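/- Let $(\xi_n)_{n\ge 0}$ be i.i.d. standard complex Gaussian random variables (real and imaginary parts independent, centered, of variance $1/2$), let $f(z)=\sum_{n\ge 0}\frac{\xi_n}{\sqrt{n!}}z^n$, and let $\mathcal X=\{z\in\mathbb C: f(\sqrt\pi\, z)=0\}$, i.e. the zero set of $f$ rescaled to have density $1$. For $u,v\in\mathbb R$ and $\operatorname{Im}\tau>0$ let $$E_{u,v}(\tau)=\sum_{(m,n)\in\mathbb Z^2\setminus\{0\}}e^{2i\pi(mu+nv)}\frac{\operatorname{Im}\tau}{|m\tau+n|^2},$$ the conditionally convergent series being understood as the limit, as $s\downarrow 1$, of the series with $\left(\frac{\operatorname{Im}\tau}{|m\tau+n|^2}\right)^s$ in place of $\frac{\operatorname{Im}\tau}{|m\tau+n|^2}$. Put $E_N(x)=E_{\operatorname{Re}(x/N),\operatorname{Im}(x/N)}(i)$ for $x\in\mathbb C$, let $\eta(i)=e^{-2\pi/24}\prod_{k\ge1}(1-e^{-2\pi k})$, and for real $N>0$ set $$\mathcal W_N=\frac{1}{2\pi N^2}\sum_{a\ne b,\ a,b\in\mathcal X\cap[0,N]^2}E_N(a-b)+\log\frac{N}{2\pi\,\eta(i)^2}.$$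 Let $$T_2(x)=1-h\left(\frac{\pi|x|^2}{2}\right),\qquad h(u)=1+\frac12\frac{d^2}{du^2}\left(u^2(\coth u-1)\right).$$ Then the following hold. 1. Almost surely the series for $f$ converges on all of $\mathbb C$ and all the zeros of $f$ are simple. $\mathcal X$ is a translation invariant random point process in the plane (an almost surely locally finite random set whose numbers of points in Borel sets are random variables), with one-point correlation function $\rho_1\equiv 1$ and two-point correlation function $\rho_2(x,y)=1-T_2(x-y)$ with respect to Lebesgue measure. 2. $\int_{\mathbb R^2}|v|^k|T_2(v)|\,dv<\infty$ for $k=1,2,3$; $T_2$ is integrable with $\int_{\mathbb R^2}T_2(v)\,dv=1$; $1-\int_{[-N,N]^2}T_2(v)\,dv=o\left((\log N)^{-1}\right)$ as $N\to\infty$; and $T_2(v)\log|v|$ is integrable over $\mathbb R^2$. 3. For every $N>0$ the random variable $\mathcal W_N$ is integrable, and $$\lim_{N\to\infty}\mathbb E\,\mathcal W_N=-\frac12\,(1+\log\pi).$$ -/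

import Mathlib

open MeasureTheory ProbabilityTheory Filter Topology Asymptotics
open scoped ENNReal NNReal Nat

noncomputable section

/-! ## Random point configurations in the plane -/

/-- Number of points of the configuration `S` in the set `B`. -/
def pointCount (S B : Set ℂ) : ℝ≥0∞ := ((S ∩ B).encard : ℝ≥0∞)

/-- `X` is a random point process: a random, almost surely locally finite, set of points,
whose counting variables are measurable. -/
structure IsPointProcess {Ω : Type*} [MeasurableSpace Ω] (P : Measure Ω) (X : Ω → Set ℂ) :
    Prop where
  locallyFinite : ∀ᵐ ω ∂P, ∀ K : Set ℂ, IsCompact K → (X ω ∩ K).Finite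
  aemeasurable_count : ∀ B : Set ℂ, MeasurableSet B → AEMeasurable (fun ω => pointCount (X ω) B) P

/-- Translation invariance: the joint laws of the counting variables (which determine the law of
a point process) do not change when the configuration is translated. -/
def IsTranslationInvariant {Ω : Type*} [MeasurableSpace Ω] (P : Measure Ω) (X : Ω → Set ℂ) :
    Prop :=
  ∀ (w : ℂ) (n : ℕ) (B : Fin n → Set ℂ), (∀ i, MeasurableSet (B i)) →
    IdentDistrib (fun ω i => pointCount (X ω) (B i))
      (fun ω i => pointCount ((fun z => z + w) '' X ω) (B i)) P P

/-- `ρ` is the `k`-point correlation function of `X` (with respect to Lebesgue measure):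
`E ∑ F(x₁, …, x_k) = ∫ F ρ`, the sum being over `k`-tuples of pairwise distinct points of `X`,
for every nonnegative Borel test function `F`. -/
def HasCorrelationFunction {Ω : Type*} [MeasurableSpace Ω] (P : Measure Ω) (X : Ω → Set ℂ)
    (k : ℕ) (ρ : (Fin k → ℂ) → ℝ) : Prop :=
  (∀ x, 0 ≤ ρ x) ∧ Measurable ρ ∧
    ∀ F : (Fin k → ℂ) → ℝ≥0∞, Measurable F →
      ∫⁻ ω, ∑' x : {x : Fin k → ℂ // Function.Injective x ∧ ∀ i, x i ∈ X ω}, F x ∂P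
        = ∫⁻ x, F x * ENNReal.ofReal (ρ x)

/-! ## The renormalized energy of a configuration in the window `[0, N]²` -/

/-- The absolutely convergent series, for `s > 1`,
`E_{u,v}(τ, s) = ∑_{(m,n) ≠ (0,0)} e^{2πi(mu+nv)} (Im τ / |mτ + n|²)^s`. -/
def eisensteinTwisted (u v : ℝ) (τ : ℂ) (s : ℝ) : ℂ :=
  ∑' p : ℤ × ℤ, if p = 0 then 0 else
    Complex.exp (2 * Real.pi * Complex.I * (p.1 * u + p.2 * v)) *
      (((τ.im / ‖(p.1 : ℂ) * τ + p.2‖ ^ 2) ^ s : ℝ) : ℂ)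

/-- The Eisenstein series `E_{u,v}(τ) = ∑_{(m,n) ≠ (0,0)} e^{2πi(mu+nv)} Im τ / |mτ + n|²`.
The series is not absolutely convergent; its value is the usual one, the limit of
`E_{u,v}(τ, s)` as `s ↓ 1`. -/
def eisensteinKronecker (u v : ℝ) (τ : ℂ) : ℂ :=
  limUnder (𝓝[>] (1 : ℝ)) (fun s => eisensteinTwisted u v τ s)

/-- `E_N(x) = E_{Re(x/N), Im(x/N)}(i)`, which is a real number. -/
def eisensteinN (N : ℝ) (x : ℂ) : ℝ :=
  (eisensteinKronecker (x / N).re (x / N).im Complex.I).re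

/-- The square `[0, N]²`. -/
def squareWindow (N : ℝ) : Set ℂ := Set.Icc 0 N ×ℂ Set.Icc 0 N

/-- The square `[-N, N]²`. -/
def centeredSquare (N : ℝ) : Set ℂ := Set.Icc (-N) N ×ℂ Set.Icc (-N) N

/-- The renormalized energy
`𝒲_N = (2πN²)⁻¹ ∑_{a ≠ b, a, b ∈ S ∩ [0,N]²} E_N(a - b) + log (N / (2π η(i)²))`,
with `η` the Dedekind eta function (`η(i)` is a positive real number). -/
def renormalizedEnergy (S : Set ℂ) (N : ℝ) : ℝ :=
  1 / (2 * Real.pi * N ^ 2) *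
      ∑' p : (S ∩ squareWindow N).offDiag, eisensteinN N (p.1.1 - p.1.2)
    + Real.log (N / (2 * Real.pi * (ModularForm.eta Complex.I).re ^ 2))

/-! ## The zeros of the planar Gaussian analytic function -/

/-- The standard complex Gaussian law: real and imaginary parts are independent, centered
Gaussians of variance `1/2`. -/
def stdComplexGaussian : Measure ℂ :=
  ((gaussianReal 0 (1 / 2)).prod (gaussianReal 0 (1 / 2))).map
    (fun p : ℝ × ℝ => (p.1 : ℂ) + p.2 * Complex.I)

/-- The random function `∑ ξ_n zⁿ / √(n!)`. -/
def gaf {Ω : Type*} (ξ : ℕ → Ω → ℂ) (ω : Ω) (z : ℂ) : ℂ :=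
  ∑' n : ℕ, ξ n ω / (Real.sqrt (n ! : ℝ) : ℂ) * z ^ n

/-- The zeros of `z ↦ f(√π z)`, `f = ∑ ξ_n zⁿ / √(n!)`, that is, the zeros of `f` divided by `√π`;
this scaling makes the density of points equal to `1`. -/
def gafZeros {Ω : Type*} (ξ : ℕ → Ω → ℂ) (ω : Ω) : Set ℂ :=
  {z | gaf ξ ω ((Real.sqrt Real.pi : ℂ) * z) = 0}

/-- `h(u) = 1 + (1/2) d²/du² (u² (coth u - 1))`; the function that is differentiated has the value
`0` at `u = 0`, which is its continuous (indeed analytic) extension there. -/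
def gafH (u : ℝ) : ℝ :=
  1 + 1 / 2 * iteratedDeriv 2 (fun t : ℝ => t ^ 2 * (Real.cosh t / Real.sinh t - 1)) u

/-- The second cluster function `T₂(x) = 1 - h(π|x|²/2)`. -/
def gafT (x : ℂ) : ℝ := 1 - gafH (Real.pi * ‖x‖ ^ 2 / 2)

end

/-! ## The area formula for entire functions -/

/-! The zeros have an explicit pair correlation, the expected energy is the integral of the
Eisenstein function against it, and the logarithmic singularity of that function turns the limit
into `∫ log|w| T₂(w) dw`, whose radial integrand has an elementary primitive.

Correlations. Given all the coefficients but the lowest, the random function is `w + h` with `w`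
Gaussian and `h` a fixed entire function. Integrating over `w` a sum over the zeros of `w + h` is
the area formula with multiplicities for `h` (`lintegral_tsum_fiber_eq`), and this is the first
Kac-Rice formula. For pairs, the constant term places a zero at `z₁`; dividing by `z - z₁` leaves an
entire function in which the next coefficient is again a free constant term, so that the area
formula applies a second time (`lintegral_pairSum_gafEntire`). The densities found in this way are
averages over the higher coefficients. To evaluate them, they are recognized as the joint density of
the values at the given points times a conditional second or fourth moment of the derivatives, taken
at the value `0`. Disintegration gives this for almost every value only, and continuity gives it at
`0` (`lintegral_eq_of_forall_lintegral_mul_eq`). Linear functionals of the coefficients are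
independent when their coefficient sequences are orthogonal, so conditioning is orthogonal
projection. With the covariance kernel `exp(π z w̄)` the results are the intensity `1`
(`lintegral_intensity`) and the pair intensity `pairIntensity (π|z₁ - z₂|²)`
(`lintegral_pairDensity`). Simplicity of the zeros is the first Kac-Rice formula for the indicator
of a vanishing derivative. Translation invariance holds because `f(z - w)` times a suitable
exponential has the same covariance kernel and, up to translation, the same zeros
(`map_shift_gafEntire`).

Cluster function. In the variable `t = π|z|²` the function `T₂ = 1 - pairIntensity` decays
exponentially, and both `T₂` and `log|z| T₂` have explicit primitives, `-clusterPrim` and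
`logClusterPrim`; their limits at `0` and at infinity give `∫ T₂ = 1` and `∫ log|v| T₂ = -(1 + log
π)/2`.

Eisenstein series. Summation by parts along the rows gives a bound that is uniform in `s` and
summable over the rows, so the limit `s ↓ 1` may be taken row by row. Each row is a Fourier series
known in closed form. Their sum (`eisensteinKronecker_eq_kron`) is a quadratic polynomial, two
logarithms of `|1 - exp(2πiz)|` and a continuous remainder. It behaves at the origin as `-2π log|z|
- 2π log(2π η(i)²)` (`tendsto_kronDiff_add_log`) and has mean zero over the torus
(`integral_tent_mul_kronDiff`).

Limit. The differences of two points of `[0,N]²` are distributed with weight `N² tent(w/N)`. The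
constant part of `ρ₂ = 1 - T₂` contributes nothing, by the mean zero property, and what remains is
`-(1/2π) ∫ T₂(w) tent(w/N) E(w/N) dw + log(N/(2π η(i)²))`, where `E` is the Eisenstein function at
scale one. Since `∫ T₂ = 1`, the last term can be moved under the integral, where it cancels the
constant and the `log N` of the singularity. The integrand tends to `log|w| T₂(w)`, and dominated
convergence ends the proof (`tendsto_expectation_formula`). -/

lemma det_restrictScalars_toSpanSingleton (a : ℂ) :
    ((ContinuousLinearMap.toSpanSingleton ℂ a).restrictScalars ℝ).det = ‖a‖ ^ 2 := by
  have h1 : ((ContinuousLinearMap.toSpanSingleton ℂ a).restrictScalars ℝ).det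
      = LinearMap.det ((LinearMap.mulLeft ℂ a).restrictScalars ℝ) := by
    rw [ContinuousLinearMap.det]
    congr 1
    ext x; simp [mul_comm]
  rw [h1, LinearMap.det_restrictScalars, Algebra.norm_complex_apply, Complex.normSq_eq_norm_sq]
  simp

lemma hasFDerivAt_real_of_differentiable {g : ℂ → ℂ} (hg : Differentiable ℂ g) (z : ℂ) :
    HasFDerivAt g ((ContinuousLinearMap.toSpanSingleton ℂ (deriv g z)).restrictScalars ℝ)
      z :=
  (hg z).hasDerivAt.hasFDerivAt.restrictScalars ℝ

/-- Injectivity leaves at most one nonzero term in each fiber, so this is the change of variables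
formula on the image of `s`. Measurability is recorded as well because countably many such pieces
are summed under the integral afterwards. -/
lemma aemeasurable_tsum_fiber_indicator_and_lintegral {g : ℂ → ℂ} (hg : Differentiable ℂ g)
    {F : ℂ → ℝ≥0∞} (hF : Measurable F) {s : Set ℂ} (hs : MeasurableSet s) (hinj : Set.InjOn g s) :
    Measurable (fun w => ∑' z : g ⁻¹' {w}, s.indicator F z) ∧
      ∫⁻ w, ∑' z : g ⁻¹' {w}, s.indicator F z = ∫⁻ z in s, F z * ‖deriv g z‖ₑ ^ 2 := by
  set G : ℂ → ℝ≥0∞ := fun w => ∑' z : g ⁻¹' {w}, s.indicator F z with hG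
  have hder : ∀ x ∈ s, HasFDerivWithinAt g ((ContinuousLinearMap.toSpanSingleton ℂ
      (deriv g x)).restrictScalars ℝ) s x :=
    fun x _ => (hasFDerivAt_real_of_differentiable hg x).hasFDerivWithinAt
  have hGs : ∀ z ∈ s, G (g z) = F z := by
    intro z hz
    rw [hG]
    dsimp only
    rw [tsum_eq_single (⟨z, rfl⟩ : g ⁻¹' {g z})]
    · simp [hz]
    · intro b hb
      by_contra hne
      have hbs : (b : ℂ) ∈ s := by
        by_contra h
        simp [h] at hne
      exact hb (Subtype.ext (hinj hbs hz b.2))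
  have hG0 : ∀ w, w ∉ g '' s → G w = 0 := by
    intro w hw
    rw [hG]
    simp only [ENNReal.tsum_eq_zero]
    intro b
    refine Set.indicator_of_notMem (fun hb => hw ⟨b, hb, b.2⟩) _
  have hemb := measurableEmbedding_of_fderivWithin hs hder hinj
  have himg : MeasurableSet (g '' s) := by
    have := hemb.measurableSet_range
    rwa [Set.range_domRestrict] at this
  refine ⟨?_, ?_⟩
  -- The fiber sum is `F` transported by the measurable embedding `g` restricted to `s`, and is zero
  -- off the image.
  · obtain ⟨g', hg', hgg'⟩ := hemb.exists_measurable_extend (hF.comp measurable_subtype_coe)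
      (fun _ => inferInstance)
    have : G = (g '' s).indicator g' := by
      funext w
      by_cases hw : w ∈ g '' s
      · obtain ⟨z, hz, rfl⟩ := hw
        rw [Set.indicator_of_mem (Set.mem_image_of_mem g hz), hGs z hz]
        exact (congrFun hgg' ⟨z, hz⟩).symm
      · rw [Set.indicator_of_notMem hw, hG0 w hw]
    rw [this]
    exact hg'.indicator himg
  · have h1 : ∫⁻ w, G w = ∫⁻ w in g '' s, G w := by
      rw [← lintegral_indicator himg]
      congr 1
      funext w
      by_cases hw : w ∈ g '' s
      · rw [Set.indicator_of_mem hw]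
      · rw [Set.indicator_of_notMem hw, hG0 w hw]
    rw [h1, lintegral_image_eq_lintegral_abs_det_fderiv_mul volume hs hder hinj]
    refine setLIntegral_congr_fun hs fun z hz => ?_
    simp only [hGs z hz, det_restrictScalars_toSpanSingleton]
    rw [abs_of_nonneg (by positivity), mul_comm, ENNReal.ofReal_pow (norm_nonneg _),
      ofReal_norm]

lemma exists_injOn_open_of_deriv_ne_zero {g : ℂ → ℂ} (hg : Differentiable ℂ g) {z : ℂ}
    (hz : deriv g z ≠ 0) : ∃ V : Set ℂ, IsOpen V ∧ Set.InjOn g V ∧ z ∈ V := by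
  have h : HasStrictDerivAt g (deriv g z) z := (hg.analyticAt z).hasStrictDerivAt
  let e := (h.hasStrictFDerivAt_equiv hz).toOpenPartialHomeomorph g
  exact ⟨e.source, e.open_source, e.injOn,
    (h.hasStrictFDerivAt_equiv hz).mem_toOpenPartialHomeomorph_source⟩

/-- The area formula, with multiplicities, for an entire function. -/
theorem lintegral_tsum_fiber_eq {g : ℂ → ℂ} (hg : Differentiable ℂ g)
    {F : ℂ → ℝ≥0∞} (hF : Measurable F) :
    ∫⁻ w, ∑' z : g ⁻¹' {w}, F z = ∫⁻ z, F z * ‖deriv g z‖ₑ ^ 2 := by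
  set C : Set ℂ := {z | deriv g z = 0} with hC
  have hdc : Continuous (deriv g) := (hg.contDiff (n := 1)).continuous_deriv le_rfl
  have hCc : IsClosed C := isClosed_eq hdc continuous_const
  have hV : ∀ z : ℂ, ∃ V : Set ℂ, IsOpen V ∧ Set.InjOn g V ∧ (z ∈ Cᶜ → z ∈ V) := by
    intro z
    by_cases hz : deriv g z = 0
    · exact ⟨∅, isOpen_empty, by simp, fun h => absurd hz h⟩
    · obtain ⟨V, h1, h2, h3⟩ := exists_injOn_open_of_deriv_ne_zero hg hz
      exact ⟨V, h1, h2, fun _ => h3⟩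
  choose V hVo hVi hVm using hV
  obtain ⟨t, -, htc, htcov⟩ := TopologicalSpace.countable_cover_nhdsWithin (s := Cᶜ) (f := V)
    (fun x hx => mem_nhdsWithin_of_mem_nhds ((hVo x).mem_nhds (hVm x hx)))
  obtain ⟨f, hf⟩ := Set.countable_iff_exists_subset_range.1 htc
  set A : ℕ → Set ℂ := disjointed (fun n => Cᶜ ∩ V (f n)) with hA
  have hAm : ∀ n, MeasurableSet (A n) := fun n =>
    MeasurableSet.disjointed (fun k => hCc.isOpen_compl.measurableSet.inter (hVo _).measurableSet) n
  have hAi : ∀ n, Set.InjOn g (A n) := fun n =>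
    (hVi (f n)).mono ((disjointed_subset _ n).trans Set.inter_subset_right)
  have hAd : Pairwise (Function.onFun Disjoint A) := disjoint_disjointed _
  have hAu : ⋃ n, A n = Cᶜ := by
    rw [hA, iUnion_disjointed]
    apply Set.Subset.antisymm
    · exact Set.iUnion_subset fun n => Set.inter_subset_left
    · intro z hz
      obtain ⟨x, hx, hzx⟩ := Set.mem_iUnion₂.1 (htcov hz)
      obtain ⟨n, rfl⟩ := hf hx
      exact Set.mem_iUnion.2 ⟨n, hz, hzx⟩
  have hsplit : ∀ z, F z = C.indicator F z + ∑' n, (A n).indicator F z := by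
    intro z
    by_cases hz : z ∈ C
    · have : ∀ n, z ∉ A n := fun n hn => by
        have : z ∈ Cᶜ := hAu ▸ Set.mem_iUnion.2 ⟨n, hn⟩
        exact this hz
      simp [hz, this]
    · have hz' : z ∈ ⋃ n, A n := by rw [hAu]; exact hz
      obtain ⟨m, hm⟩ := Set.mem_iUnion.1 hz'
      rw [Set.indicator_of_notMem hz, zero_add, tsum_eq_single m, Set.indicator_of_mem hm]
      intro n hn
      exact Set.indicator_of_notMem (fun h => Set.disjoint_left.1 (hAd hn) h hm) _
  -- Sard: the critical values form a null set, so critical points affect neither side.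
  have hCimg : volume (g '' C) = 0 :=
    addHaar_image_eq_zero_of_det_fderivWithin_eq_zero volume
      (fun x _ => (hasFDerivAt_real_of_differentiable hg x).hasFDerivWithinAt)
      (fun x hx => by
        rw [det_restrictScalars_toSpanSingleton, show deriv g x = 0 from hx]; simp)
  have hC0 : ∀ᵐ w, ∑' z : g ⁻¹' {w}, C.indicator F z = 0 := by
    filter_upwards [measure_eq_zero_iff_ae_notMem.1 hCimg] with w hw
    simp only [ENNReal.tsum_eq_zero]
    exact fun b => Set.indicator_of_notMem (fun hb => hw ⟨b, hb, b.2⟩) _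
  have hL : ∫⁻ w, ∑' z : g ⁻¹' {w}, F z
      = ∫⁻ w, ∑' n, ∑' z : g ⁻¹' {w}, (A n).indicator F z := by
    refine lintegral_congr_ae ?_
    filter_upwards [hC0] with w hw
    rw [ENNReal.tsum_comm, ← zero_add (∑' z : g ⁻¹' {w}, ∑' n, (A n).indicator F z), ← hw,
      ← ENNReal.tsum_add]
    exact tsum_congr fun z => hsplit z
  rw [hL, lintegral_tsum fun n =>
    (aemeasurable_tsum_fiber_indicator_and_lintegral hg hF (hAm n) (hAi n)).1.aemeasurable]
  simp_rw [fun n => (aemeasurable_tsum_fiber_indicator_and_lintegral hg hF (hAm n) (hAi n)).2]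
  rw [← lintegral_iUnion hAm hAd, hAu, ← lintegral_indicator hCc.isOpen_compl.measurableSet]
  congr 1
  funext z
  by_cases hz : z ∈ C
  · rw [Set.indicator_of_notMem (by simpa using hz), show deriv g z = 0 from hz]; simp
  · rw [Set.indicator_of_mem hz]

/-! ## The measurable space of entire functions and the counting measure of the zeros -/

/-- Entire functions, with the `σ`-algebra generated by the evaluations. -/
abbrev EntireFun : Type := {f : ℂ → ℂ // Differentiable ℂ f}

namespace EntireFun

lemma measurable_apply (z : ℂ) : Measurable (fun f : EntireFun => f.1 z) :=
  (measurable_pi_apply z).comp measurable_subtype_coe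

lemma measurable_eval : Measurable (fun p : EntireFun × ℂ => p.1.1 p.2) := by
  have h : Measurable (Function.uncurry fun (z : ℂ) (f : EntireFun) => f.1 z) :=
    measurable_uncurry_of_continuous_of_measurable (fun f => f.2.continuous) measurable_apply
  exact h.comp measurable_swap

/-- The derivative is the pointwise limit of difference quotients along one fixed sequence of steps,
and joint measurability passes to the limit. -/
lemma measurable_eval_deriv : Measurable (fun p : EntireFun × ℂ => deriv p.1.1 p.2) := by
  have hlim : Tendsto (fun n : ℕ => (1 / ((n : ℂ) + 1))) atTop (𝓝[≠] 0) := by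
    refine tendsto_nhdsWithin_iff.2 ⟨tendsto_one_div_add_atTop_nhds_zero_nat, ?_⟩
    filter_upwards with n
    simpa using Nat.cast_add_one_ne_zero n
  refine measurable_of_tendsto_metrizable (f := fun (n : ℕ) (p : EntireFun × ℂ) =>
    (1 / ((n : ℂ) + 1))⁻¹ • (p.1.1 (p.2 + 1 / ((n : ℂ) + 1)) - p.1.1 p.2)) (fun n => ?_) ?_
  · refine Measurable.const_smul (M := ℂ) (X := ℂ) (Measurable.sub ?_ measurable_eval) _
    exact measurable_eval.comp (measurable_fst.prodMk (measurable_snd.add_const _))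
  · refine tendsto_pi_nhds.2 fun p => ?_
    exact (hasDerivAt_iff_tendsto_slope_zero.1 (p.1.2 p.2).hasDerivAt).comp hlim

lemma measurable_of_apply {α : Type*} [MeasurableSpace α] {F : α → EntireFun}
    (h : ∀ z, Measurable fun a => (F a).1 z) : Measurable F :=
  Measurable.subtype_mk (measurable_pi_iff.2 h)

/-- The zero set of an entire function. -/
def zeros (f : EntireFun) : Set ℂ := {z | f.1 z = 0}

lemma isClosed_zeros (f : EntireFun) : IsClosed (zeros f) :=
  isClosed_eq f.2.continuous continuous_const

lemma finite_zeros_inter {f : EntireFun} (hf : f.1 ≠ 0) {K : Set ℂ} (hK : IsCompact K) :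
    (zeros f ∩ K).Finite := by
  by_contra hinf
  obtain ⟨z, -, hz⟩ := Set.Infinite.exists_accPt_of_subset_isCompact hinf hK
    Set.inter_subset_right
  have hfr : ∃ᶠ w in 𝓝[≠] z, f.1 w = 0 := by
    have := accPt_iff_frequently_nhdsNE.1 hz
    exact this.mono fun w hw => hw.1
  refine hf ?_
  have hA : AnalyticOnNhd ℂ f.1 Set.univ := fun w _ => f.2.analyticAt w
  exact hA.eq_of_frequently_eq (g := 0) (fun w _ => analyticAt_const) hfr

/-- By compactness `f` vanishes somewhere on `K` exactly when the infimum of `|f|` over a countable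
dense subset of `K` is zero, a condition on countably many evaluations. -/
lemma measurableSet_exists_zero {K : Set ℂ} (hK : IsCompact K) :
    MeasurableSet {f : EntireFun | (zeros f ∩ K).Nonempty} := by
  obtain ⟨t, htK, htc, htd⟩ := (TopologicalSpace.IsSeparable.of_separableSpace
    K).exists_countable_dense_subset
  have : {f : EntireFun | (zeros f ∩ K).Nonempty}
      = ⋂ n : ℕ, ⋃ q ∈ t, {f : EntireFun | ‖f.1 q‖ < 1 / ((n : ℝ) + 1)} := by
    ext f
    simp only [Set.mem_ofPred_eq, Set.mem_iInter, Set.mem_iUnion, exists_prop]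
    constructor
    · rintro ⟨z, hz, hzK⟩ n
      have hopen : IsOpen {w : ℂ | ‖f.1 w‖ < 1 / ((n : ℝ) + 1)} :=
        isOpen_lt f.2.continuous.norm continuous_const
      have hmem : z ∈ {w : ℂ | ‖f.1 w‖ < 1 / ((n : ℝ) + 1)} := by
        have : f.1 z = 0 := hz
        simp only [Set.mem_ofPred_eq, this, norm_zero]; positivity
      obtain ⟨q, hq1, hq2⟩ := mem_closure_iff.1 (htd hzK) _ hopen hmem
      exact ⟨q, hq2, hq1⟩
    · intro h
      have hne : K.Nonempty := by
        obtain ⟨q, hq, -⟩ := h 0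
        exact ⟨q, htK hq⟩
      obtain ⟨z, hzK, hz⟩ := hK.exists_isMinOn hne f.2.continuous.norm.continuousOn
      refine ⟨z, ?_, hzK⟩
      by_contra hne0
      have hpos : 0 < ‖f.1 z‖ := norm_pos_iff.2 hne0
      obtain ⟨n, hn⟩ := exists_nat_one_div_lt hpos
      obtain ⟨q, hq, hq2⟩ := h n
      exact absurd (hz (htK hq)) (not_le.2 (hq2.trans hn))
  rw [this]
  refine MeasurableSet.iInter fun n => MeasurableSet.biUnion htc fun q _ => ?_
  exact measurableSet_lt (measurable_apply q).norm measurable_const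

lemma measurableSet_eq_zero : MeasurableSet {f : EntireFun | f.1 = 0} := by
  obtain ⟨t, htc, htd⟩ := TopologicalSpace.exists_countable_dense ℂ
  have : {f : EntireFun | f.1 = 0} = ⋂ q ∈ t, {f : EntireFun | f.1 q = 0} := by
    ext f
    simp only [Set.mem_ofPred_eq, Set.mem_iInter]
    constructor
    · intro h q _
      rw [h]; rfl
    · intro h
      exact f.2.continuous.ext_on htd continuous_const h
  rw [this]
  exact MeasurableSet.biInter htc fun q _ =>
    measurableSet_eq_fun (measurable_apply q) measurable_const

/-- Distinct zeros can be enclosed in disjoint closed balls taken from a countable family, so having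
at least `n` zeros in `K` is a countable union of conditions, each on the existence of zeros in
compact sets. -/
lemma measurableSet_le_encard_zeros {K : Set ℂ} (hK : IsCompact K) (n : ℕ) :
    MeasurableSet {f : EntireFun | (n : ℕ∞) ≤ (zeros f ∩ K).encard} := by
  obtain ⟨D, hDc, hDd⟩ := TopologicalSpace.exists_countable_dense ℂ
  have : Countable D := hDc.to_subtype
  let ball : D × ℕ → Set ℂ := fun p => Metric.closedBall p.1 (1 / ((p.2 : ℝ) + 1))
  have hball : ∀ (z : ℂ) (U : Set ℂ), IsOpen U → z ∈ U → ∃ p, z ∈ ball p ∧ ball p ⊆ U := by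
    intro z U hU hz
    obtain ⟨ε, hε, hεU⟩ := Metric.isOpen_iff.1 hU z hz
    obtain ⟨m, hm⟩ := exists_nat_one_div_lt (half_pos hε)
    obtain ⟨q, hq, hqz⟩ := hDd.exists_dist_lt z (show (0 : ℝ) < 1 / ((m : ℝ) + 1) by positivity)
    refine ⟨(⟨q, hq⟩, m), Metric.mem_closedBall.2 hqz.le, fun w hw => hεU ?_⟩
    have := Metric.mem_closedBall.1 hw
    rw [Metric.mem_ball]
    calc dist w z ≤ dist w q + dist q z := dist_triangle _ _ _
      _ < ε := by rw [dist_comm q z]; simp only at this; linarith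
  have : {f : EntireFun | (n : ℕ∞) ≤ (zeros f ∩ K).encard}
      = ⋃ (b : Fin n → D × ℕ) (_ : Pairwise fun i j => Disjoint (ball (b i)) (ball (b j))),
        ⋂ i, {f : EntireFun | (zeros f ∩ (K ∩ ball (b i))).Nonempty} := by
    ext f
    simp only [Set.mem_ofPred_eq, Set.mem_iUnion, Set.mem_iInter, exists_prop]
    constructor
    · intro h
      obtain ⟨s, hs, hsn⟩ := Set.exists_subset_encard_eq h
      have hsf : s.Finite := Set.finite_of_encard_eq_coe hsn
      obtain ⟨U, hU, hUd⟩ := hsf.t2_separation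
      let e : Fin n ≃ s := by
        have := hsf.fintype
        refine (Fintype.equivFinOfCardEq ?_).symm
        rw [← Set.toFinset_card, ← Nat.cast_inj (R := ℕ∞), ← Set.encard_coe_eq_coe_finsetCard]
        simpa using hsn
      choose b hb1 hb2 using fun i : Fin n => hball (e i) (U (e i)) (hU _).2 (hU _).1
      refine ⟨b, fun i j hij => ?_, fun i => ⟨e i, (hs (e i).2).1, (hs (e i).2).2, hb1 i⟩⟩
      have hne : (e i : ℂ) ≠ e j := fun h => hij (e.injective (Subtype.ext h))
      exact (hUd (e i).2 (e j).2 hne).mono (hb2 i) (hb2 j)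
    · rintro ⟨b, hb, hz⟩
      choose z hz using hz
      have hinj : Function.Injective z := by
        intro i j hij
        by_contra hne
        exact Set.disjoint_left.1 (hb hne) (hz i).2.2 (hij ▸ (hz j).2.2)
      calc (n : ℕ∞) = (Set.range z).encard := by
            rw [← Set.image_univ, hinj.encard_image]; simp
        _ ≤ _ := Set.encard_le_encard (by rintro _ ⟨i, rfl⟩; exact ⟨(hz i).1, (hz i).2.1⟩)
  rw [this]
  refine MeasurableSet.iUnion fun b => MeasurableSet.iUnion fun _ => MeasurableSet.iInter fun i => ?_
  exact measurableSet_exists_zero (hK.inter (isCompact_closedBall _ _))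

open Classical in
/-- The counting measure of the zeros of an entire function (the zero measure for `f = 0`). -/
noncomputable def zeroMeasure (f : EntireFun) : Measure ℂ :=
  if f.1 = 0 then 0 else Measure.count.restrict (zeros f)

lemma zeroMeasure_apply {f : EntireFun} (hf : f.1 ≠ 0) {B : Set ℂ} (hB : MeasurableSet B) :
    zeroMeasure f B = ((zeros f ∩ B).encard : ℝ≥0∞) := by
  rw [zeroMeasure, if_neg hf, Measure.restrict_apply hB, Set.inter_comm,
    Measure.count_apply ((isClosed_zeros f).measurableSet.inter hB)]

lemma zeroMeasure_zero {f : EntireFun} (hf : f.1 = 0) : zeroMeasure f = 0 := if_pos hf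

lemma zeroMeasure_lt_top (f : EntireFun) {K : Set ℂ} (hK : IsCompact K) :
    zeroMeasure f K < ∞ := by
  by_cases hf : f.1 = 0
  · simp [zeroMeasure_zero hf]
  · rw [zeroMeasure_apply hf hK.measurableSet]
    simpa using (finite_zeros_inter hf hK)

lemma measurable_zeroMeasure_compact {K : Set ℂ} (hK : IsCompact K) :
    Measurable fun f => zeroMeasure f K := by
  have h1 : Measurable fun f : EntireFun => (zeros f ∩ K).encard := by
    refine measurable_to_countable' fun n => ?_
    induction n using ENat.recTopCoe with
    | top =>
      have : (fun f : EntireFun => (zeros f ∩ K).encard) ⁻¹' {⊤}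
          = ⋂ n : ℕ, {f : EntireFun | (n : ℕ∞) ≤ (zeros f ∩ K).encard} := by
        ext f
        simp [ENat.eq_top_iff_forall_ge]
      rw [this]
      exact MeasurableSet.iInter fun n => measurableSet_le_encard_zeros hK n
    | coe n =>
      have : (fun f : EntireFun => (zeros f ∩ K).encard) ⁻¹' {(n : ℕ∞)}
          = {f : EntireFun | (n : ℕ∞) ≤ (zeros f ∩ K).encard}
            \ {f : EntireFun | ((n + 1 : ℕ) : ℕ∞) ≤ (zeros f ∩ K).encard} := by
        ext f
        simp only [Set.mem_preimage, Set.mem_singleton_iff, Set.mem_sdiff, Set.mem_ofPred_eq, not_le]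
        push_cast
        rw [ENat.lt_add_one_iff (ENat.natCast_ne_top n), le_antisymm_iff, and_comm]
      rw [this]
      exact (measurableSet_le_encard_zeros hK n).diff (measurableSet_le_encard_zeros hK _)
  have h2 : Measurable fun f : EntireFun => (((zeros f ∩ K).encard : ℕ∞) : ℝ≥0∞) :=
    (Measurable.of_discrete (f := fun n : ℕ∞ => (n : ℝ≥0∞))).comp h1
  have : (fun f => zeroMeasure f K)
      = fun f => {f : EntireFun | f.1 = 0}ᶜ.indicator
        (fun f : EntireFun => (((zeros f ∩ K).encard : ℕ∞) : ℝ≥0∞)) f := by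
    funext f
    by_cases hf : f.1 = 0
    · simp [zeroMeasure_zero hf, hf]
    · simp [zeroMeasure_apply hf hK.measurableSet, hf]
  rw [this]
  exact h2.indicator measurableSet_eq_zero.compl

/-- The π-system argument needs finite measures, which the counting measure of the zeros is only on
bounded sets; hence the restriction to balls and the exhaustion at the end. -/
lemma measurable_zeroMeasure : Measurable zeroMeasure := by
  have hfin : ∀ (R : ℕ) (f : EntireFun),
      IsFiniteMeasure ((zeroMeasure f).restrict (Metric.closedBall 0 R)) := fun R f =>
    ⟨by rw [Measure.restrict_apply_univ]; exact zeroMeasure_lt_top f (isCompact_closedBall _ _)⟩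
  have hR : ∀ R : ℕ, Measurable fun f => (zeroMeasure f).restrict (Metric.closedBall 0 R) := by
    intro R
    refine Measurable.measure_of_isPiSystem (S := {s | IsClosed s}) ?_ isPiSystem_isClosed ?_ ?_
    · rw [← borel_eq_generateFrom_isClosed]
      exact BorelSpace.measurable_eq
    · intro s hs
      have : IsCompact (s ∩ Metric.closedBall (0 : ℂ) R) :=
        (isCompact_closedBall _ _).inter_left hs
      simp_rw [Measure.restrict_apply (IsClosed.measurableSet hs)]
      exact measurable_zeroMeasure_compact this
    · simp_rw [Measure.restrict_apply_univ]
      exact measurable_zeroMeasure_compact (isCompact_closedBall _ _)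
  refine Measure.measurable_of_measurable_coe _ fun B hB => ?_
  have hU : B = ⋃ R : ℕ, B ∩ Metric.closedBall (0 : ℂ) R := by
    rw [← Set.inter_iUnion, Metric.iUnion_closedBall_nat, Set.inter_univ]
  have : (fun f => zeroMeasure f B)
      = fun f => ⨆ R : ℕ, ((zeroMeasure f).restrict (Metric.closedBall 0 R)) B := by
    funext f
    simp_rw [Measure.restrict_apply hB]
    conv_lhs => rw [hU]
    refine Monotone.measure_iUnion fun i j hij => ?_
    exact Set.inter_subset_inter_right _ (Metric.closedBall_subset_closedBall (by exact_mod_cast hij))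
  rw [this]
  exact Measurable.iSup fun R => (Measure.measurable_coe hB).comp (hR R)

/-- The kernel sending an entire function to the counting measure of its zeros. -/
noncomputable def zeroKernel : Kernel EntireFun ℂ := ⟨zeroMeasure, measurable_zeroMeasure⟩

/-- A finite kernel must be bounded uniformly in `f`, which fails even on a fixed ball. The plane is
cut into annuli `A j` and the functions are sorted by their number of zeros in `A j`; the piece of
index `(j, n)` has mass at most `n`. -/
instance : IsSFiniteKernel zeroKernel := by
  classical
  let A : ℕ → Set ℂ := disjointed fun R : ℕ => Metric.closedBall (0 : ℂ) R
  have hA : ∀ j, MeasurableSet (A j) := fun j =>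
    MeasurableSet.disjointed (fun R => Metric.isClosed_closedBall.measurableSet) j
  have hAd : Pairwise (Function.onFun Disjoint A) := disjoint_disjointed _
  have hAu : ⋃ j, A j = Set.univ := by
    rw [iUnion_disjointed]; exact Metric.iUnion_closedBall_nat 0
  have hAfin : ∀ f j, zeroMeasure f (A j) < ∞ := fun f j =>
    (measure_mono (disjointed_subset _ j)).trans_lt
      (zeroMeasure_lt_top f (isCompact_closedBall 0 (j : ℝ)))
  have hnat : ∀ f j, ∃ n : ℕ, zeroMeasure f (A j) = n := by
    intro f j
    by_cases hf : f.1 = 0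
    · exact ⟨0, by simp [zeroMeasure_zero hf]⟩
    · have h := hAfin f j
      rw [zeroMeasure_apply hf (hA j)] at h ⊢
      have h' : (zeros f ∩ A j).encard ≠ ⊤ := by
        intro h'
        rw [h'] at h
        simp at h
      obtain ⟨n, hn⟩ := ENat.ne_top_iff_exists.1 h'
      exact ⟨n, by rw [← hn]; rfl⟩
  have hs : ∀ p : ℕ × ℕ, MeasurableSet {f : EntireFun | zeroMeasure f (A p.1) = p.2} := fun p =>
    ((Measure.measurable_coe (hA p.1)).comp measurable_zeroMeasure) (measurableSet_singleton _)
  let κ : ℕ × ℕ → Kernel EntireFun ℂ := fun p =>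
    Kernel.piecewise (hs p) (zeroKernel.restrict (hA p.1)) 0
  have hκ : ∀ p, IsFiniteKernel (κ p) := by
    intro p
    refine ⟨p.2, by simp, fun f => ?_⟩
    simp only [κ, Kernel.piecewise_apply]
    split_ifs with h
    · rw [Kernel.restrict_apply, Measure.restrict_apply_univ]
      exact (show zeroMeasure f (A p.1) = p.2 from h).le
    · simp
  have hsum : zeroKernel = Kernel.sum κ := by
    ext f B hB
    rw [Kernel.sum_apply' _ _ hB, ENNReal.tsum_prod']
    have h1 : ∀ j, ∑' n, (κ (j, n) f) B = zeroMeasure f (A j ∩ B) := by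
      intro j
      obtain ⟨n, hn⟩ := hnat f j
      rw [tsum_eq_single n]
      · simp only [κ, Kernel.piecewise_apply]
        rw [if_pos (show f ∈ {f | f.zeroMeasure (A j) = ↑n} from hn), Kernel.restrict_apply, Measure.restrict_apply hB, Set.inter_comm]; rfl
      · intro m hm
        simp only [κ, Kernel.piecewise_apply]
        rw [if_neg]
        · simp
        · intro h
          have h' : zeroMeasure f (A j) = m := h
          rw [hn] at h'
          exact hm (by exact_mod_cast h'.symm)
    simp_rw [h1]
    rw [← measure_iUnion (fun i j hij => (hAd hij).mono Set.inter_subset_left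
      Set.inter_subset_left) (fun j => (hA j).inter hB), ← Set.iUnion_inter, hAu, Set.univ_inter]
    rfl
  rw [hsum]
  infer_instance

lemma lintegral_zeroMeasure {f : EntireFun} (hf : f.1 ≠ 0) {F : ℂ → ℝ≥0∞} :
    ∫⁻ z, F z ∂(zeroMeasure f) = ∑' z : zeros f, F z := by
  rw [zeroMeasure, if_neg hf, ← lintegral_indicator (isClosed_zeros f).measurableSet,
    lintegral_count, tsum_subtype]

end EntireFun

/-! ## The standard complex Gaussian law -/

lemma measurable_ofReal_add_mul_I :
    Measurable (fun p : ℝ × ℝ => (p.1 : ℂ) + p.2 * Complex.I) := by fun_prop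

instance : IsProbabilityMeasure stdComplexGaussian :=
  Measure.isProbabilityMeasure_map measurable_ofReal_add_mul_I.aemeasurable

lemma lintegral_stdComplexGaussian {F : ℂ → ℝ≥0∞} (hF : Measurable F) :
    ∫⁻ w, F w ∂stdComplexGaussian
      = ∫⁻ w, ENNReal.ofReal (Real.exp (-‖w‖ ^ 2) / Real.pi) * F w := by
  have hv : (1 / 2 : ℝ≥0) ≠ 0 := by norm_num
  rw [stdComplexGaussian, lintegral_map hF measurable_ofReal_add_mul_I,
    gaussianReal_of_var_ne_zero 0 hv, prod_withDensity (by fun_prop) (by fun_prop),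
    lintegral_withDensity_eq_lintegral_mul _ (by fun_prop) (by fun_prop),
    ← Complex.volume_preserving_equiv_real_prod.symm.lintegral_comp (by fun_prop)]
  rw [Measure.volume_eq_prod]
  refine lintegral_congr fun p => ?_
  have he : Complex.measurableEquivRealProd.symm p = (p.1 : ℂ) + p.2 * Complex.I := by
    rw [Complex.measurableEquivRealProd_symm_apply]
    exact Complex.mk_eq_add_mul_I _ _
  rw [Pi.mul_apply, he, gaussianPDF, gaussianPDF,
    ← ENNReal.ofReal_mul (gaussianPDFReal_nonneg _ _ _)]
  congr 2
  rw [gaussianPDFReal, gaussianPDFReal, Complex.norm_add_mul_I, Real.sq_sqrt (by positivity)]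
  have hpi : Real.sqrt (2 * Real.pi * ((1 / 2 : ℝ≥0) : ℝ)) ^ 2 = Real.pi := by
    rw [Real.sq_sqrt (by positivity)]; push_cast; ring
  have hpi0 : Real.sqrt (2 * Real.pi * ((1 / 2 : ℝ≥0) : ℝ)) ≠ 0 := by
    intro h
    rw [h] at hpi
    have := Real.pi_pos
    simp at hpi
    linarith
  rw [show ∀ a b c : ℝ, a⁻¹ * b * (a⁻¹ * c) = b * c / a ^ 2 by intros; ring, ← Real.exp_add, hpi]
  congr 2
  push_cast
  ring

lemma stdComplexGaussian_eq_withDensity : stdComplexGaussian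
    = volume.withDensity (fun w : ℂ => ENNReal.ofReal (Real.exp (-‖w‖ ^ 2) / Real.pi)) := by
  refine Measure.ext_of_lintegral _ fun F hF => ?_
  rw [lintegral_stdComplexGaussian hF,
    lintegral_withDensity_eq_lintegral_mul _ (by fun_prop) hF]
  rfl

lemma integral_stdComplexGaussian (F : ℂ → ℝ) :
    ∫ w, F w ∂stdComplexGaussian = ∫ w, Real.exp (-‖w‖ ^ 2) / Real.pi * F w := by
  rw [stdComplexGaussian_eq_withDensity, integral_withDensity_eq_integral_toReal_smul
    (by fun_prop) (ae_of_all _ fun _ => ENNReal.ofReal_lt_top)]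
  refine integral_congr_ae (ae_of_all _ fun w => ?_)
  simp only [smul_eq_mul]
  rw [ENNReal.toReal_ofReal (by positivity)]

lemma integral_norm_pow_stdComplexGaussian (q : ℕ) :
    ∫ w : ℂ, ‖w‖ ^ q ∂stdComplexGaussian = Real.Gamma ((q + 2) / 2) := by
  rw [integral_stdComplexGaussian]
  have h := Complex.integral_rpow_mul_exp_neg_rpow (p := 2) (q := q) (by norm_num)
    (by have : (0 : ℝ) ≤ q := by positivity
        linarith)
  have h2 : ∀ w : ℂ, Real.exp (-‖w‖ ^ 2) / Real.pi * ‖w‖ ^ q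
      = Real.pi⁻¹ * (‖w‖ ^ (q : ℝ) * Real.exp (-‖w‖ ^ (2 : ℝ))) := by
    intro w
    rw [Real.rpow_natCast, Real.rpow_ofNat]; ring
  simp_rw [h2]
  rw [integral_const_mul, h]
  have := Real.pi_ne_zero
  field_simp

/-- The integral of a nonintegrable function is `0` by convention, while the value computed above is
positive. -/
lemma integrable_norm_pow_stdComplexGaussian (q : ℕ) :
    Integrable (fun w : ℂ => ‖w‖ ^ q) stdComplexGaussian := by
  by_contra h
  have h1 := integral_norm_pow_stdComplexGaussian q
  rw [integral_undef h] at h1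
  have : 0 < Real.Gamma (((q : ℝ) + 2) / 2) := Real.Gamma_pos_of_pos (by positivity)
  linarith

lemma integral_exp_re_stdComplexGaussian (a : ℂ) :
    ∫ w, Complex.exp (((a * w).re : ℝ) * Complex.I) ∂stdComplexGaussian
      = Complex.exp (-(‖a‖ ^ 2 / 4 : ℝ)) := by
  rw [stdComplexGaussian, integral_map measurable_ofReal_add_mul_I.aemeasurable
    (by fun_prop)]
  have h1 : ∀ p : ℝ × ℝ, Complex.exp (((a * ((p.1 : ℂ) + p.2 * Complex.I)).re : ℝ) * Complex.I)
      = Complex.exp (((a.re : ℝ) : ℂ) * p.1 * Complex.I)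
        * Complex.exp (((-a.im : ℝ) : ℂ) * p.2 * Complex.I) := by
    intro p
    rw [← Complex.exp_add]
    congr 1
    simp
    ring
  simp_rw [h1]
  rw [integral_prod_mul (fun x : ℝ => Complex.exp (((a.re : ℝ) : ℂ) * x * Complex.I))
    (fun y : ℝ => Complex.exp (((-a.im : ℝ) : ℂ) * y * Complex.I)),
    ← charFun_apply_real, ← charFun_apply_real, charFun_gaussianReal, charFun_gaussianReal,
    ← Complex.exp_add]
  congr 1
  rw [← Complex.normSq_eq_norm_sq, Complex.normSq_apply]
  push_cast
  ring

/-! ## Linear functionals of a sequence of independent complex Gaussian variables -/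

/-- The law of a sequence of independent standard complex Gaussian variables. -/
noncomputable def gaussSeq : Measure (ℕ → ℂ) := Measure.infinitePi fun _ => stdComplexGaussian

instance : IsProbabilityMeasure gaussSeq := by unfold gaussSeq; infer_instance

/-- Absolutely summable complex sequences. -/
def l1 : Submodule ℂ (ℕ → ℂ) where
  carrier := {c | Summable fun n => ‖c n‖}
  add_mem' {a b} ha hb := by
    refine Summable.of_nonneg_of_le (fun n => norm_nonneg _) (fun n => norm_add_le (a n) (b n)) ?_
    exact Summable.add ha hb
  zero_mem' := by simp
  smul_mem' r a ha := by
    simp only [Set.mem_ofPred_eq, Pi.smul_apply, smul_eq_mul, norm_mul]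
    exact Summable.mul_left _ ha

namespace l1

lemma summable_norm (c : l1) : Summable fun n => ‖c.1 n‖ := c.2

/-- The `ℓ²` inner product, linear in the first variable. -/
noncomputable def gram (c d : l1) : ℂ := ∑' n, c.1 n * starRingEnd ℂ (d.1 n)

lemma summable_gram (c d : l1) : Summable fun n => c.1 n * starRingEnd ℂ (d.1 n) := by
  refine Summable.of_norm_bounded ((summable_norm c).mul_right (∑' n, ‖d.1 n‖)) fun n => ?_
  rw [norm_mul, RCLike.norm_conj]
  gcongr
  exact (summable_norm d).le_tsum n fun _ _ => norm_nonneg _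

lemma gram_add_left (c c' d : l1) : gram (c + c') d = gram c d + gram c' d := by
  rw [gram, gram, gram, ← (summable_gram c d).tsum_add (summable_gram c' d)]
  exact tsum_congr fun n => by simp [add_mul]

lemma gram_smul_left (a : ℂ) (c d : l1) : gram (a • c) d = a * gram c d := by
  rw [gram, gram, ← tsum_mul_left]
  exact tsum_congr fun n => by simp [mul_assoc]

lemma conj_gram (c d : l1) : starRingEnd ℂ (gram c d) = gram d c := by
  rw [gram, gram, Complex.conj_tsum]
  exact tsum_congr fun n => by simp [mul_comm]

lemma gram_add_right (c d d' : l1) : gram c (d + d') = gram c d + gram c d' := by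
  rw [← conj_gram, gram_add_left, map_add, conj_gram, conj_gram]

lemma gram_smul_right (a : ℂ) (c d : l1) : gram c (a • d) = starRingEnd ℂ a * gram c d := by
  rw [← conj_gram, gram_smul_left, map_mul, conj_gram]

lemma gram_neg_left (c d : l1) : gram (-c) d = -gram c d := by
  rw [← neg_one_smul ℂ, gram_smul_left]; ring

lemma gram_neg_right (c d : l1) : gram c (-d) = -gram c d := by
  rw [← neg_one_smul ℂ, gram_smul_right]; simp

lemma gram_sub_left (c c' d : l1) : gram (c - c') d = gram c d - gram c' d := by
  rw [sub_eq_add_neg, gram_add_left, gram_neg_left]; ring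

lemma gram_sub_right (c d d' : l1) : gram c (d - d') = gram c d - gram c d' := by
  rw [sub_eq_add_neg, gram_add_right, gram_neg_right]; ring

lemma gram_sum_sum {ι : Type*} [Fintype ι] (a b : ι → ℂ) (c d : ι → l1) :
    gram (∑ i, a i • c i) (∑ j, b j • d j)
      = ∑ i, ∑ j, a i * starRingEnd ℂ (b j) * gram (c i) (d j) := by
  let Φ : l1 →+ l1 →+ ℂ := AddMonoidHom.mk' (fun c => AddMonoidHom.mk' (gram c) (gram_add_right c))
    (fun c c' => by ext d; exact gram_add_left c c' d)
  have h : ∀ c d, gram c d = Φ c d := fun _ _ => rfl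
  rw [h, map_sum Φ, AddMonoidHom.finsetSum_apply]
  refine Finset.sum_congr rfl fun i _ => ?_
  rw [map_sum]
  refine Finset.sum_congr rfl fun j _ => ?_
  rw [← h, gram_smul_left, gram_smul_right]
  ring

lemma gram_self_eq (c : l1) : gram c c = ((∑' n, ‖c.1 n‖ ^ 2 : ℝ) : ℂ) := by
  rw [gram, Complex.ofReal_tsum]
  refine tsum_congr fun n => ?_
  rw [Complex.mul_conj, Complex.normSq_eq_norm_sq]

lemma gram_self_im (c : l1) : (gram c c).im = 0 := by rw [gram_self_eq]; simp

lemma gram_self_re_nonneg (c : l1) : 0 ≤ (gram c c).re := by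
  rw [gram_self_eq, Complex.ofReal_re]
  exact tsum_nonneg fun n => by positivity

lemma hasSum_norm_sq (c : l1) : HasSum (fun n => ‖c.1 n‖ ^ 2) (gram c c).re := by
  have h : Summable fun n => ‖c.1 n‖ ^ 2 := by
    refine (summable_gram c c).norm.congr fun n => ?_
    rw [norm_mul, RCLike.norm_conj]; ring
  rw [gram_self_eq, Complex.ofReal_re]
  exact h.hasSum

/-- The linear functional `x ↦ ∑ c_n x_n`. -/
noncomputable def lin (c : l1) (x : ℕ → ℂ) : ℂ := ∑' n, c.1 n * x n

/-- All the coordinates have the same finite first absolute moment, so `ℓ¹` coefficients give a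
finite expectation of the sum of the absolute values. Absolute convergence is what makes `lin`
additive almost surely; `ℓ¹` is enough since evaluations and derivatives have such coefficients. -/
lemma ae_summable (c : l1) : ∀ᵐ x ∂gaussSeq, Summable fun n => ‖c.1 n * x n‖ := by
  have hM : ∫⁻ w, ‖w‖ₑ ∂stdComplexGaussian < ∞ := by
    have := (integrable_norm_pow_stdComplexGaussian 1).2
    simpa [HasFiniteIntegral] using this
  have hn : ∀ n, ∫⁻ x : ℕ → ℂ, ‖x n‖ₑ ∂gaussSeq = ∫⁻ w, ‖w‖ₑ ∂stdComplexGaussian := fun n =>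
    (measurePreserving_eval_infinitePi (fun _ : ℕ => stdComplexGaussian) n).lintegral_comp
      measurable_enorm
  have hm : ∀ n, Measurable fun x : ℕ → ℂ => c.1 n * x n := fun n =>
    (measurable_pi_apply n).const_mul _
  have hfin : ∫⁻ x : ℕ → ℂ, ∑' n, ‖c.1 n * x n‖ₑ ∂gaussSeq ≠ ∞ := by
    rw [lintegral_tsum fun n => (hm n).enorm.aemeasurable]
    have : ∀ n, ∫⁻ x : ℕ → ℂ, ‖c.1 n * x n‖ₑ ∂gaussSeq
        = ‖c.1 n‖ₑ * ∫⁻ w, ‖w‖ₑ ∂stdComplexGaussian := by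
      intro n
      simp_rw [enorm_mul]
      rw [lintegral_const_mul _ (by fun_prop), hn]
    simp_rw [this]
    rw [ENNReal.tsum_mul_right]
    refine ENNReal.mul_ne_top ?_ hM.ne
    simp_rw [← ofReal_norm]
    exact (summable_norm c).tsum_ofReal_ne_top
  filter_upwards [ae_lt_top (Measurable.tsum fun n => (hm n).enorm) hfin] with x hx
  have h2 : Summable fun n => ‖c.1 n * x n‖₊ := by
    rw [← ENNReal.tsum_coe_ne_top_iff_summable]
    exact hx.ne
  exact NNReal.summable_coe.2 h2

lemma ae_hasSum (c : l1) : ∀ᵐ x ∂gaussSeq, HasSum (fun n => c.1 n * x n) (lin c x) := by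
  filter_upwards [ae_summable c] with x hx
  exact hx.of_norm.hasSum

lemma lin_add_ae (c d : l1) : ∀ᵐ x ∂gaussSeq, lin (c + d) x = lin c x + lin d x := by
  filter_upwards [ae_hasSum c, ae_hasSum d, ae_hasSum (c + d)] with x h1 h2 h3
  refine h3.unique ((h1.add h2).congr_fun fun n => ?_)
  simp [add_mul]

lemma lin_smul (a : ℂ) (c : l1) (x : ℕ → ℂ) : lin (a • c) x = a * lin c x := by
  rw [lin, lin, ← tsum_mul_left]
  exact tsum_congr fun n => by simp [mul_assoc]

lemma lin_sub_ae (c d : l1) : ∀ᵐ x ∂gaussSeq, lin (c - d) x = lin c x - lin d x := by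
  filter_upwards [lin_add_ae c (-d)] with x h1
  rw [sub_eq_add_neg, h1, ← neg_one_smul ℂ d, lin_smul]; ring

lemma lin_sum_ae {ι : Type*} [Fintype ι] (a : ι → ℂ) (c : ι → l1) :
    ∀ᵐ x ∂gaussSeq, lin (∑ i, a i • c i) x = ∑ i, a i * lin (c i) x := by
  have h : ∀ᵐ x ∂gaussSeq, ∀ i, HasSum (fun n => (c i).1 n * x n) (lin (c i) x) :=
    ae_all_iff.2 fun i => ae_hasSum (c i)
  filter_upwards [h, ae_hasSum (∑ i, a i • c i)] with x h1 h3
  refine h3.unique ?_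
  have := hasSum_sum (s := Finset.univ) fun i _ => (h1 i).mul_left (a i)
  refine this.congr_fun fun n => ?_
  simp [Finset.sum_mul, mul_assoc]

lemma aemeasurable_lin (c : l1) : AEMeasurable (lin c) gaussSeq := by
  refine aemeasurable_of_tendsto_metrizable_ae atTop
    (f := fun (N : ℕ) x => ∑ n ∈ Finset.range N, c.1 n * x n) (fun N =>
      (Finset.measurable_fun_sum _ fun n _ => (measurable_pi_apply n).const_mul _).aemeasurable) ?_
  filter_upwards [ae_hasSum c] with x hx
  exact hx.tendsto_sum_nat

/-- Independence turns the characteristic function of a partial sum into a product of Gaussian ones,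
and bounded convergence passes to the whole series. All later statements on laws and independence
come from this formula. -/
lemma integral_exp_re_lin (c : l1) :
    ∫ x, Complex.exp (((lin c x).re : ℝ) * Complex.I) ∂gaussSeq
      = Complex.exp (-((gram c c).re / 4 : ℝ)) := by
  have h1 : Tendsto (fun N : ℕ => ∫ x : ℕ → ℂ, Complex.exp
      (((∑ n ∈ Finset.range N, c.1 n * x n).re : ℝ) * Complex.I) ∂gaussSeq) atTop
      (𝓝 (∫ x, Complex.exp (((lin c x).re : ℝ) * Complex.I) ∂gaussSeq)) := by
    refine tendsto_integral_of_dominated_convergence (fun _ => 1) (fun N => ?_)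
      (integrable_const _) (fun N => ?_) ?_
    · exact Measurable.aestronglyMeasurable (by fun_prop)
    · exact ae_of_all _ fun x => (Complex.norm_exp_ofReal_mul_I _).le
    · filter_upwards [ae_hasSum c] with x hx
      have hc : Continuous fun w : ℂ => Complex.exp ((w.re : ℝ) * Complex.I) := by fun_prop
      exact (hc.tendsto _).comp hx.tendsto_sum_nat
  have h2 : ∀ N : ℕ, ∫ x : ℕ → ℂ, Complex.exp
      (((∑ n ∈ Finset.range N, c.1 n * x n).re : ℝ) * Complex.I) ∂gaussSeq
      = Complex.exp (-((∑ n ∈ Finset.range N, ‖c.1 n‖ ^ 2) / 4 : ℝ)) := by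
    intro N
    have hind : iIndepFun (fun (i : Fin N) (x : ℕ → ℂ) => x i) gaussSeq := by
      have := iIndepFun_infinitePi (P := fun _ : ℕ => stdComplexGaussian) (X := fun _ w => w)
        (fun _ => measurable_id)
      exact this.precomp Fin.val_injective
    have h3 := hind.integral_fun_prod_comp (𝕜 := ℂ)
      (f := fun (i : Fin N) w => Complex.exp (((c.1 i * w).re : ℝ) * Complex.I))
      (fun i => (measurable_pi_apply _).aemeasurable)
      (fun i => Measurable.aestronglyMeasurable (by fun_prop))
    have h4 : ∀ x : ℕ → ℂ, Complex.exp
        (((∑ n ∈ Finset.range N, c.1 n * x n).re : ℝ) * Complex.I)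
        = ∏ i : Fin N, Complex.exp (((c.1 i * x i).re : ℝ) * Complex.I) := by
      intro x
      rw [← Complex.exp_sum, Finset.sum_range, Complex.re_sum, Complex.ofReal_sum, Finset.sum_mul]
    simp_rw [h4]
    rw [h3]
    have h5 : ∀ i : Fin N, ∫ x : ℕ → ℂ, Complex.exp (((c.1 i * x i).re : ℝ) * Complex.I) ∂gaussSeq
        = Complex.exp (-(‖c.1 i‖ ^ 2 / 4 : ℝ)) := by
      intro i
      have hmap : gaussSeq.map (fun x => x i) = stdComplexGaussian :=
        Measure.infinitePi_map_eval (fun _ : ℕ => stdComplexGaussian) i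
      rw [← integral_exp_re_stdComplexGaussian, ← hmap,
        integral_map (measurable_pi_apply _).aemeasurable
          (Measurable.aestronglyMeasurable (by fun_prop))]
    simp_rw [h5]
    rw [← Complex.exp_sum, Finset.sum_range]
    congr 1
    push_cast
    rw [Finset.sum_neg_distrib, Finset.sum_div]
  refine tendsto_nhds_unique h1 ?_
  simp_rw [h2]
  have hc : Continuous fun r : ℝ => Complex.exp (-(r / 4 : ℝ)) := by fun_prop
  exact (hc.tendsto _).comp (hasSum_norm_sq c).tendsto_sum_nat

end l1

/-- Through this representation, a characteristic function of a vector of linear functionals is that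
of a single linear functional. -/
lemma exists_re_sum_eq_strongDual {ι : Type*} [Fintype ι] (L : StrongDual ℝ (ι → ℂ)) :
    ∃ a : ι → ℂ, ∀ v, L v = (∑ i, a i * v i).re := by
  classical
  refine ⟨fun i => L (Pi.single i 1) - L (Pi.single i Complex.I) * Complex.I, fun v => ?_⟩
  have hv : v = ∑ i, ((v i).re • (Pi.single i (1 : ℂ) : ι → ℂ)
      + (v i).im • (Pi.single i Complex.I : ι → ℂ)) := by
    ext j
    rw [Finset.sum_apply, Finset.sum_eq_single j]
    · simp
    · intro b _ hb
      simp [hb.symm]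
    · simp
  conv_lhs => rw [hv]
  rw [map_sum, Complex.re_sum]
  refine Finset.sum_congr rfl fun i _ => ?_
  rw [map_add, map_smul, map_smul]
  simp
  ring

namespace l1

variable {ι κ : Type*} [Fintype ι] [Fintype κ]

lemma aemeasurable_lin_pi (c : ι → l1) : AEMeasurable (fun x i => lin (c i) x) gaussSeq :=
  aemeasurable_pi_iff.2 fun i => aemeasurable_lin (c i)

lemma integral_exp_re_sum_lin (a : ι → ℂ) (c : ι → l1) :
    ∫ x, Complex.exp (((∑ i, a i * lin (c i) x).re : ℝ) * Complex.I) ∂gaussSeq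
      = Complex.exp (-((∑ i, ∑ j, a i * starRingEnd ℂ (a j) * gram (c i) (c j)).re / 4 : ℝ)) := by
  rw [← gram_sum_sum, ← integral_exp_re_lin]
  refine integral_congr_ae ?_
  filter_upwards [lin_sum_ae a c] with x hx
  rw [hx]

/-- The Gram matrix determines the joint law of linear functionals. -/
theorem map_lin_eq_of_gram_eq (c d : ι → l1)
    (h : ∀ i j, gram (c i) (c j) = gram (d i) (d j)) :
    gaussSeq.map (fun x i => lin (c i) x) = gaussSeq.map (fun x i => lin (d i) x) := by
  have := Measure.isProbabilityMeasure_map (aemeasurable_lin_pi c)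
  have := Measure.isProbabilityMeasure_map (aemeasurable_lin_pi d)
  refine Measure.ext_of_charFunDual (funext fun L => ?_)
  obtain ⟨a, ha⟩ := exists_re_sum_eq_strongDual L
  rw [charFunDual_apply, charFunDual_apply,
    integral_map (aemeasurable_lin_pi c) (Continuous.aestronglyMeasurable (by fun_prop)),
    integral_map (aemeasurable_lin_pi d) (Continuous.aestronglyMeasurable (by fun_prop))]
  simp_rw [ha]
  rw [integral_exp_re_sum_lin, integral_exp_re_sum_lin]
  simp_rw [h]

/-- Orthogonal families of linear functionals are independent. -/
theorem indepFun_lin_of_gram_eq_zero (c : ι → l1) (d : κ → l1)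
    (h : ∀ i j, gram (c i) (d j) = 0) :
    IndepFun (fun x i => lin (c i) x) (fun x j => lin (d j) x) gaussSeq := by
  rw [indepFun_iff_charFunDual_prod (aemeasurable_lin_pi c) (aemeasurable_lin_pi d)]
  intro L
  obtain ⟨a, ha⟩ := exists_re_sum_eq_strongDual (L ∘SL ContinuousLinearMap.inl ℝ (ι → ℂ) (κ → ℂ))
  obtain ⟨b, hb⟩ := exists_re_sum_eq_strongDual (L ∘SL ContinuousLinearMap.inr ℝ (ι → ℂ) (κ → ℂ))
  have hL : ∀ v w, L (v, w) = (∑ i, a i * v i).re + (∑ j, b j * w j).re := by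
    intro v w
    rw [← ha, ← hb, ContinuousLinearMap.comp_apply, ContinuousLinearMap.comp_apply, ← map_add]
    simp
  have h' : ∀ i j, gram (d j) (c i) = 0 := fun i j => by rw [← conj_gram, h, map_zero]
  rw [charFunDual_apply, charFunDual_apply, charFunDual_apply,
    integral_map (aemeasurable_lin_pi c) (Continuous.aestronglyMeasurable (by fun_prop)),
    integral_map (aemeasurable_lin_pi d) (Continuous.aestronglyMeasurable (by fun_prop)),
    integral_map ((aemeasurable_lin_pi c).prodMk (aemeasurable_lin_pi d))
      (Continuous.aestronglyMeasurable (by fun_prop))]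
  simp_rw [ha, hb, hL]
  rw [integral_exp_re_sum_lin, integral_exp_re_sum_lin, ← Complex.exp_add]
  have h1 : ∀ x : ℕ → ℂ, (∑ i, a i * lin (c i) x).re + (∑ j, b j * lin (d j) x).re
      = (∑ s : ι ⊕ κ, Sum.elim a b s * lin (Sum.elim c d s) x).re := by
    intro x
    simp [Fintype.sum_sum_type]
  simp_rw [h1]
  rw [integral_exp_re_sum_lin]
  congr 1
  simp only [Fintype.sum_sum_type, Sum.elim_inl, Sum.elim_inr, h, h', mul_zero,
    Finset.sum_const_zero, add_zero, zero_add, Complex.add_re]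
  push_cast
  ring

/-! ### One-dimensional laws and moments of linear functionals. -/

/-- The sequence with `a` at the place `k` and zeros elsewhere. -/
noncomputable def single (k : ℕ) (a : ℂ) : l1 := ⟨Pi.single k a, by
  refine summable_of_ne_finset_zero (s := {k}) fun n hn => ?_
  simp at hn
  simp [hn]⟩

lemma lin_single (k : ℕ) (a : ℂ) (x : ℕ → ℂ) : lin (single k a) x = a * x k := by
  rw [lin, tsum_eq_single k]
  · simp [single]
  · intro n hn
    simp [single, hn]

lemma gram_single_right (c : l1) (k : ℕ) (a : ℂ) :
    gram c (single k a) = c.1 k * starRingEnd ℂ a := by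
  rw [gram, tsum_eq_single k]
  · simp [single]
  · intro n hn
    simp [single, hn]

/-- The functional has the same Gram matrix as a multiple of a single coordinate, hence the same
law. -/
lemma map_lin (c : l1) : gaussSeq.map (lin c)
    = stdComplexGaussian.map (fun w => (Real.sqrt (gram c c).re : ℂ) * w) := by
  have h := map_lin_eq_of_gram_eq (fun _ : Unit => c)
    (fun _ => single 0 (Real.sqrt (gram c c).re : ℂ)) (fun _ _ => by
      rw [gram_single_right]
      simp only [single, Pi.single_eq_same, Complex.conj_ofReal]
      rw [← Complex.ofReal_mul, Real.mul_self_sqrt (gram_self_re_nonneg c)]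
      exact Complex.ext rfl (by simp [gram_self_im]))
  have h2 := congrArg (Measure.map (fun v : Unit → ℂ => v ())) h
  rw [AEMeasurable.map_map_of_aemeasurable (measurable_pi_apply _).aemeasurable
    (aemeasurable_lin_pi _), AEMeasurable.map_map_of_aemeasurable
    (measurable_pi_apply _).aemeasurable (aemeasurable_lin_pi _)] at h2
  refine Eq.trans h2 ?_
  have hmap : gaussSeq.map (fun x => x 0) = stdComplexGaussian :=
    Measure.infinitePi_map_eval (fun _ : ℕ => stdComplexGaussian) 0
  rw [← hmap, Measure.map_map (by fun_prop) (measurable_pi_apply (X := fun _ : ℕ => ℂ) 0)]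
  congr 1
  funext x
  simp [lin_single]

lemma integrable_norm_pow_lin (c : l1) (q : ℕ) :
    Integrable (fun x => ‖lin c x‖ ^ q) gaussSeq := by
  have h : Integrable (fun w : ℂ => ‖w‖ ^ q) (gaussSeq.map (lin c)) := by
    rw [map_lin, integrable_map_measure (Continuous.aestronglyMeasurable (by fun_prop))
      (by fun_prop)]
    have : ((fun w : ℂ => ‖w‖ ^ q) ∘ fun w => (Real.sqrt (gram c c).re : ℂ) * w)
        = fun w => Real.sqrt (gram c c).re ^ q * ‖w‖ ^ q := by
      funext w
      simp [mul_pow, abs_of_nonneg (Real.sqrt_nonneg _)]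
    rw [this]
    exact (integrable_norm_pow_stdComplexGaussian q).const_mul _
  exact (integrable_map_measure (Continuous.aestronglyMeasurable (by fun_prop))
    (aemeasurable_lin c)).1 h

lemma integral_norm_pow_four_lin (c : l1) :
    ∫ x, ‖lin c x‖ ^ 4 ∂gaussSeq = 2 * (gram c c).re ^ 2 := by
  rw [← integral_map (f := fun w : ℂ => ‖w‖ ^ 4) (aemeasurable_lin c)
    (Continuous.aestronglyMeasurable (by fun_prop)), map_lin,
    integral_map (by fun_prop) (Continuous.aestronglyMeasurable (by fun_prop))]
  simp only [norm_mul, mul_pow, Complex.norm_real, Real.norm_eq_abs,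
    abs_of_nonneg (Real.sqrt_nonneg _)]
  rw [integral_const_mul, integral_norm_pow_stdComplexGaussian,
    show Real.sqrt (gram c c).re ^ 4 = (Real.sqrt (gram c c).re ^ 2) ^ 2 by ring,
    Real.sq_sqrt (gram_self_re_nonneg c),
    show (((4 : ℕ) : ℝ) + 2) / 2 = (2 : ℕ) + 1 by norm_num, Real.Gamma_nat_eq_factorial]
  norm_num [Nat.factorial]
  ring

/-- This expresses a mixed moment by pure fourth moments of linear combinations, which are known
from the one-dimensional law; no general Wick formula is needed. -/
lemma norm_four_polarization (X Y : ℂ) :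
    ‖X + Y‖ ^ 4 + ‖X - Y‖ ^ 4 + ‖X + Complex.I * Y‖ ^ 4 + ‖X - Complex.I * Y‖ ^ 4
      = 4 * ‖X‖ ^ 4 + 4 * ‖Y‖ ^ 4 + 16 * (‖X‖ ^ 2 * ‖Y‖ ^ 2) := by
  have h : ∀ z : ℂ, ‖z‖ ^ 4 = (z.re * z.re + z.im * z.im) ^ 2 := fun z => by
    rw [← Complex.normSq_apply, Complex.normSq_eq_norm_sq]; ring
  have h2 : ∀ z : ℂ, ‖z‖ ^ 2 = (z.re * z.re + z.im * z.im) := fun z => by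
    rw [← Complex.normSq_apply, Complex.normSq_eq_norm_sq]
  simp only [h, h2, Complex.add_re, Complex.add_im, Complex.sub_re, Complex.sub_im,
    Complex.mul_re, Complex.mul_im, Complex.I_re, Complex.I_im]
  ring

lemma integrable_norm_sq_mul_norm_sq_lin (c d : l1) :
    Integrable (fun x => ‖lin c x‖ ^ 2 * ‖lin d x‖ ^ 2) gaussSeq := by
  refine Integrable.mono' ((integrable_norm_pow_lin c 4).add (integrable_norm_pow_lin d 4))
    (by have := aemeasurable_lin c
        have := aemeasurable_lin d
        exact AEMeasurable.aestronglyMeasurable (by fun_prop)) (ae_of_all _ fun x => ?_)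
  rw [Real.norm_eq_abs, abs_of_nonneg (by positivity)]
  simp only [Pi.add_apply]
  nlinarith [sq_nonneg (‖lin c x‖ ^ 2 - ‖lin d x‖ ^ 2), sq_nonneg (‖lin c x‖ ^ 2),
    sq_nonneg (‖lin d x‖ ^ 2)]

lemma integral_norm_sq_mul_norm_sq_lin (c d : l1) :
    ∫ x, ‖lin c x‖ ^ 2 * ‖lin d x‖ ^ 2 ∂gaussSeq
      = (gram c c).re * (gram d d).re + ‖gram c d‖ ^ 2 := by
  have hpol : ∀ᵐ x ∂gaussSeq, ‖lin (c + d) x‖ ^ 4 + ‖lin (c - d) x‖ ^ 4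
      + ‖lin (c + Complex.I • d) x‖ ^ 4 + ‖lin (c - Complex.I • d) x‖ ^ 4
      = 4 * ‖lin c x‖ ^ 4 + 4 * ‖lin d x‖ ^ 4 + 16 * (‖lin c x‖ ^ 2 * ‖lin d x‖ ^ 2) := by
    filter_upwards [lin_add_ae c d, lin_sub_ae c d, lin_add_ae c (Complex.I • d),
      lin_sub_ae c (Complex.I • d)] with x h1 h2 h3 h4
    rw [h1, h2, h3, h4, lin_smul, norm_four_polarization]
  have h := integral_congr_ae hpol
  have i4 := fun c => integrable_norm_pow_lin c 4
  have e1 : ∀ {f g : (ℕ → ℂ) → ℝ}, Integrable f gaussSeq → Integrable g gaussSeq →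
      Integrable (fun x => f x + g x) gaussSeq := fun hf hg => hf.add hg
  rw [integral_add (e1 (e1 (i4 _) (i4 _)) (i4 _)) (i4 _),
    integral_add (e1 (i4 _) (i4 _)) (i4 _), integral_add (i4 _) (i4 _),
    integral_add (e1 ((i4 _).const_mul _) ((i4 _).const_mul _))
      ((integrable_norm_sq_mul_norm_sq_lin c d).const_mul _),
    integral_add ((i4 _).const_mul _) ((i4 _).const_mul _), integral_const_mul,
    integral_const_mul, integral_const_mul] at h
  simp only [integral_norm_pow_four_lin] at h
  have hdc : gram d c = starRingEnd ℂ (gram c d) := (conj_gram c d).symm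
  simp only [gram_add_left, gram_add_right, gram_sub_left, gram_sub_right, gram_smul_left,
    gram_smul_right, hdc, Complex.add_re, Complex.sub_re, Complex.mul_re,
    Complex.conj_re, Complex.conj_im, Complex.I_re, Complex.I_im, Complex.conj_I,
    Complex.neg_re, Complex.neg_im, Complex.add_im, Complex.sub_im, Complex.mul_im,
    gram_self_im] at h
  rw [← Complex.normSq_eq_norm_sq, Complex.normSq_apply]
  linarith

end l1

/-! ## Integrating sums over zeros with respect to the lowest coefficients -/

namespace EntireFun

/-- The entire function `z ↦ a + b z + f z`. -/
def addAffine (f : EntireFun) (a b : ℂ) : EntireFun :=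
  ⟨fun z => a + b * z + f.1 z, by have := f.2; fun_prop⟩

lemma addAffine_apply (f : EntireFun) (a b z : ℂ) : (addAffine f a b).1 z = a + b * z + f.1 z := rfl

lemma deriv_addAffine (f : EntireFun) (a b z : ℂ) :
    deriv (addAffine f a b).1 z = b + deriv f.1 z := by
  have h : HasDerivAt (addAffine f a b).1 (0 + b * 1 + deriv f.1 z) z :=
    ((hasDerivAt_const z a).add ((hasDerivAt_id z).const_mul b)).add (f.2 z).hasDerivAt
  rw [h.deriv]; ring

lemma measurable_addAffine :
    Measurable fun p : EntireFun × ℂ × ℂ => addAffine p.1 p.2.1 p.2.2 := by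
  refine measurable_of_apply fun z => ?_
  simp only [addAffine_apply]
  have h' : Measurable fun p : EntireFun × ℂ × ℂ => p.1.1 z :=
    (measurable_apply z).comp measurable_fst
  fun_prop

lemma measurable_lintegral_zeroMeasure {α : Type*} [MeasurableSpace α] {Θ : α → EntireFun}
    (hΘ : Measurable Θ) {F : α → ℂ → ℝ≥0∞} (hF : Measurable (Function.uncurry F)) :
    Measurable fun a => ∫⁻ z, F a z ∂(zeroMeasure (Θ a)) :=
  Measurable.lintegral_kernel_prod_right (κ := zeroKernel.comap Θ hΘ) hF

/-- Integration over the constant term of the sum over the zeros. -/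
theorem lintegral_lintegral_zeroMeasure_addAffine (h : EntireFun) {F : ℂ → ℂ → ℝ≥0∞}
    (hF : Measurable fun z => F (-h.1 z) z) :
    ∫⁻ w, ∫⁻ z, F w z ∂(zeroMeasure (addAffine h w 0))
      = ∫⁻ z, F (-h.1 z) z * ‖deriv h.1 z‖ₑ ^ 2 := by
  rw [← lintegral_tsum_fiber_eq h.2 hF, ← lintegral_neg_eq_self]
  refine lintegral_congr_ae ?_
  -- One value is discarded so that `h - w` is not identically zero: the zero function is given the
  -- zero measure, whereas its fiber would be the whole plane.
  have hne : ∀ᵐ w : ℂ, w ≠ h.1 0 := by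
    rw [ae_iff]
    simp
  filter_upwards [hne] with w hw
  have hf : (addAffine h (-w) 0).1 ≠ 0 := by
    intro h0
    have := congrFun h0 0
    simp [addAffine_apply] at this
    exact hw (by linear_combination -this)
  rw [lintegral_zeroMeasure hf]
  have hz : zeros (addAffine h (-w) 0) = h.1 ⁻¹' {w} := by
    ext z
    simp only [zeros, addAffine_apply, Set.mem_ofPred_eq, Set.mem_preimage, Set.mem_singleton_iff]
    constructor <;> intro hz
    · linear_combination hz
    · rw [hz]; ring
  rw [hz]
  refine tsum_congr fun z => ?_
  have : h.1 z = w := z.2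
  rw [this]

/-- The divided difference `z ↦ (f z - f c) / (z - c)` as an entire function. -/
noncomputable def slopeFun (f : EntireFun) (c : ℂ) : EntireFun :=
  ⟨dslope f.1 c, by
    rw [← differentiableOn_univ, Complex.differentiableOn_dslope Filter.univ_mem]
    exact f.2.differentiableOn⟩

lemma slopeFun_of_ne (f : EntireFun) {c z : ℂ} (h : z ≠ c) :
    (slopeFun f c).1 z = (f.1 z - f.1 c) / (z - c) := by
  change dslope f.1 c z = _
  rw [dslope_of_ne _ h, slope_def_field]

lemma deriv_slopeFun_of_ne (f : EntireFun) {c z : ℂ} (h : z ≠ c) :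
    deriv (slopeFun f c).1 z = (deriv f.1 z - (f.1 z - f.1 c) / (z - c)) / (z - c) := by
  have hne : z - c ≠ 0 := sub_ne_zero.2 h
  have h1 : HasDerivAt (fun z => (f.1 z - f.1 c) / (z - c))
      ((deriv f.1 z * (z - c) - (f.1 z - f.1 c) * 1) / (z - c) ^ 2) z :=
    ((f.2 z).hasDerivAt.sub_const _).div ((hasDerivAt_id z).sub_const c) hne
  have h2 : (slopeFun f c).1 =ᶠ[𝓝 z] fun z => (f.1 z - f.1 c) / (z - c) := by
    filter_upwards [isOpen_ne.mem_nhds h] with w hw using slopeFun_of_ne f hw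
  rw [h2.deriv_eq, h1.deriv]
  field_simp

/-- The sum over ordered pairs of distinct zeros. -/
noncomputable def pairSum (f : EntireFun) (F : ℂ → ℂ → ℝ≥0∞) : ℝ≥0∞ :=
  ∫⁻ z₁, ∫⁻ z₂, ({z₁}ᶜ : Set ℂ).indicator (F z₁) z₂ ∂(zeroMeasure f) ∂(zeroMeasure f)

lemma measurable_offDiag_indicator {α : Type*} [MeasurableSpace α] {u v : α → ℂ} {G : α → ℝ≥0∞}
    (hu : Measurable u) (hv : Measurable v) (hG : Measurable G) :
    Measurable fun a => ({u a}ᶜ : Set ℂ).indicator (fun _ => G a) (v a) := by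
  have : (fun a => ({u a}ᶜ : Set ℂ).indicator (fun _ => G a) (v a))
      = {a | v a = u a}ᶜ.indicator G := by
    funext a
    by_cases h : v a = u a <;> simp [h]
  rw [this]
  exact hG.indicator (measurableSet_eq_fun hv hu).compl

lemma measurable_pairSum {F : ℂ → ℂ → ℝ≥0∞} (hF : Measurable (Function.uncurry F)) :
    Measurable fun f => pairSum f F := by
  refine measurable_lintegral_zeroMeasure measurable_id ?_
  refine measurable_lintegral_zeroMeasure (Θ := fun p : EntireFun × ℂ => p.1)
    (F := fun p z₂ => ({p.2}ᶜ : Set ℂ).indicator (F p.2) z₂) measurable_fst ?_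
  exact measurable_offDiag_indicator (u := fun q : (EntireFun × ℂ) × ℂ => q.1.2)
    (v := fun q => q.2) (G := fun q => F q.1.2 q.2) (by fun_prop) (by fun_prop)
    (hF.comp ((measurable_snd.comp measurable_fst).prodMk measurable_snd))

/-- Integration over the constant term of the sum over pairs of zeros. -/
theorem lintegral_pairSum_addAffine (h : EntireFun) {ψ : ℂ → ℝ≥0∞} (hψ : Measurable ψ)
    {F : ℂ → ℂ → ℝ≥0∞} (hF : Measurable (Function.uncurry F)) :
    ∫⁻ w, ψ w * pairSum (addAffine h w 0) F
      = ∫⁻ z₁, ψ (-h.1 z₁) * (∫⁻ z₂, ({z₁}ᶜ : Set ℂ).indicator (F z₁) z₂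
          ∂(zeroMeasure (addAffine h (-h.1 z₁) 0))) * ‖deriv h.1 z₁‖ₑ ^ 2 := by
  have hm : ∀ w : ℂ, Measurable fun z₁ => ∫⁻ z₂, ({z₁}ᶜ : Set ℂ).indicator (F z₁) z₂
          ∂(zeroMeasure (addAffine h w 0)) := by
    intro w
    refine measurable_lintegral_zeroMeasure measurable_const ?_
    exact measurable_offDiag_indicator (u := fun q : ℂ × ℂ => q.1) (v := fun q => q.2)
      (G := fun q => F q.1 q.2) measurable_fst measurable_snd hF
  have hm2 : Measurable fun z₁ => ∫⁻ z₂, ({z₁}ᶜ : Set ℂ).indicator (F z₁) z₂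
          ∂(zeroMeasure (addAffine h (-h.1 z₁) 0)) := by
    refine measurable_lintegral_zeroMeasure ?_ ?_
    · have := h.2.continuous.measurable
      exact measurable_addAffine.comp (measurable_const.prodMk
        (this.neg.prodMk measurable_const))
    · exact measurable_offDiag_indicator (u := fun q : ℂ × ℂ => q.1) (v := fun q => q.2)
        (G := fun q => F q.1 q.2) measurable_fst measurable_snd hF
  rw [← lintegral_lintegral_zeroMeasure_addAffine h (F := fun w z₁ => ψ w *
    ∫⁻ z₂, ({z₁}ᶜ : Set ℂ).indicator (F z₁) z₂ ∂(zeroMeasure (addAffine h w 0)))]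
  · refine lintegral_congr fun w => ?_
    rw [lintegral_const_mul _ (hm w)]
    rfl
  · have := h.2.continuous.measurable
    exact (hψ.comp this.neg).mul hm2

/-- Integration over the linear coefficient of the sum over the zeros of `h - h(c)` other than `c`,
where `h(z) = r w z + g(z)`. -/
theorem lintegral_lintegral_zeroMeasure_linear (g : EntireFun) {r : ℂ} (hr : r ≠ 0) (c : ℂ)
    {ψ : ℂ → ℝ≥0∞} (hψ : Measurable ψ) {F : ℂ → ℝ≥0∞} (hF : Measurable F) :
    ∫⁻ w, ψ w * ∫⁻ z, ({c}ᶜ : Set ℂ).indicator F z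
        ∂(zeroMeasure (addAffine g (-(r * w * c + g.1 c)) (r * w)))
      = ∫⁻ z, ({c}ᶜ : Set ℂ).indicator
          (fun z => ψ (-((g.1 z - g.1 c) / (z - c) / r)) * F z
            * ‖(deriv g.1 z - (g.1 z - g.1 c) / (z - c)) / (z - c) / r‖ₑ ^ 2) z := by
  let k : EntireFun := ⟨fun z => r⁻¹ * (slopeFun g c).1 z, by have := (slopeFun g c).2; fun_prop⟩
  have hk : ∀ z, k.1 z = r⁻¹ * (slopeFun g c).1 z := fun _ => rfl
  have hdk : ∀ z, deriv k.1 z = r⁻¹ * deriv (slopeFun g c).1 z := fun z =>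
    deriv_const_mul _ ((slopeFun g c).2 z)
  have hFc : Measurable (({c}ᶜ : Set ℂ).indicator F) :=
    hF.indicator (measurableSet_singleton c).compl
  -- The factorization behind the two-point formula: once the zero at `c` is divided out, `w` is the
  -- constant term of what remains, and the one-point formula applies to `k`.
  have hfac : ∀ w z, (addAffine g (-(r * w * c + g.1 c)) (r * w)).1 z
      = r * ((z - c) * (addAffine k w 0).1 z) := by
    intro w z
    rw [addAffine_apply, addAffine_apply, hk]
    by_cases hz : z = c
    · subst hz; ring
    · rw [slopeFun_of_ne g hz]
      have : z - c ≠ 0 := sub_ne_zero.2 hz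
      field_simp
      ring
  have hmeas : ∀ w, ∫⁻ z, ({c}ᶜ : Set ℂ).indicator F z
        ∂(zeroMeasure (addAffine g (-(r * w * c + g.1 c)) (r * w)))
      = ∫⁻ z, ({c}ᶜ : Set ℂ).indicator F z ∂(zeroMeasure (addAffine k w 0)) := by
    intro w
    by_cases h0 : (addAffine k w 0).1 = 0
    · have h1 : (addAffine g (-(r * w * c + g.1 c)) (r * w)).1 = 0 := by
        funext z
        rw [hfac, h0]; simp
      rw [zeroMeasure_zero h0, zeroMeasure_zero h1]
    -- The functions can only be compared off `c`, where `z - c` is invertible; density of the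
    -- complement of `c` transfers the vanishing.
    · have h1 : (addAffine g (-(r * w * c + g.1 c)) (r * w)).1 ≠ 0 := by
        intro h1
        refine h0 ?_
        refine Continuous.ext_on (dense_compl_singleton c) (addAffine k w 0).2.continuous
          continuous_const fun z hz => ?_
        have h2 := congrFun h1 z
        rw [hfac] at h2
        simpa [hr, sub_ne_zero.2 hz] using h2
      rw [lintegral_zeroMeasure h0, lintegral_zeroMeasure h1,
        tsum_subtype (zeros (addAffine k w 0)) (({c}ᶜ : Set ℂ).indicator F),
        tsum_subtype (zeros (addAffine g _ _)) (({c}ᶜ : Set ℂ).indicator F)]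
      refine tsum_congr fun z => ?_
      rw [Set.indicator_indicator, Set.indicator_indicator]
      congr 1
      ext z
      simp only [Set.mem_inter_iff, Set.mem_compl_iff, Set.mem_singleton_iff, zeros,
        Set.mem_ofPred_eq, hfac]
      refine and_congr_left fun hz => ?_
      simp [hr, sub_ne_zero.2 hz]
  simp_rw [hmeas]
  have hkm := k.2.continuous.measurable
  have := lintegral_lintegral_zeroMeasure_addAffine k (F := fun w z => ψ w *
    ({c}ᶜ : Set ℂ).indicator F z) ((hψ.comp hkm.neg).mul hFc)
  simp_rw [lintegral_const_mul _ hFc] at this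
  rw [this]
  refine lintegral_congr fun z => ?_
  by_cases hz : z = c
  · simp [hz]
  · have hz' : z ∈ ({c}ᶜ : Set ℂ) := hz
    rw [Set.indicator_of_mem hz', Set.indicator_of_mem hz', hk, hdk, slopeFun_of_ne g hz,
      deriv_slopeFun_of_ne g hz]
    simp only [div_eq_mul_inv, mul_comm r⁻¹]

end EntireFun

/-! ## The planar Gaussian analytic function as a random entire function -/

/-- Write the term as `(2R)ⁿ/√(n!)` times `2⁻ⁿ` and bound the product by the sum of the squares, an
exponential series plus a geometric one. -/
lemma summable_pow_div_sqrt_factorial (R : ℝ) :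
    Summable fun n : ℕ => ‖R ^ n / Real.sqrt (n ! : ℝ)‖ := by
  have h1 : Summable fun n : ℕ => ((4 * R ^ 2) ^ n / (n ! : ℝ) + (1 / 4 : ℝ) ^ n) :=
    (Real.summable_pow_div_factorial _).add (summable_geometric_of_lt_one (by norm_num) (by norm_num))
  refine Summable.of_nonneg_of_le (fun _ => norm_nonneg _) (fun n => ?_) h1
  have hs : Real.sqrt (n ! : ℝ) ^ 2 = n ! := Real.sq_sqrt (by positivity)
  have ha : (2 ^ n * (R ^ n / Real.sqrt (n ! : ℝ))) ^ 2 = (4 * R ^ 2) ^ n / (n ! : ℝ) := by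
    rw [mul_pow, div_pow, hs, mul_pow, ← pow_mul, ← pow_mul, mul_comm n 2, pow_mul 2 2 n,
      pow_mul R 2 n]
    norm_num
    ring
  have hb : ((1 / 2 : ℝ) ^ n) ^ 2 = (1 / 4 : ℝ) ^ n := by
    rw [← pow_mul, mul_comm, pow_mul]; norm_num
  have hab : R ^ n / Real.sqrt (n ! : ℝ)
      = (2 ^ n * (R ^ n / Real.sqrt (n ! : ℝ))) * (1 / 2 : ℝ) ^ n := by
    rw [mul_right_comm, ← mul_pow]; norm_num
  rw [hab, norm_mul, ← ha, ← hb, ← sq_abs (2 ^ n * (R ^ n / Real.sqrt (n ! : ℝ))),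
    ← sq_abs ((1 / 2 : ℝ) ^ n), Real.norm_eq_abs, Real.norm_eq_abs]
  nlinarith [sq_nonneg (|2 ^ n * (R ^ n / Real.sqrt (n ! : ℝ))| - |(1 / 2 : ℝ) ^ n|),
    abs_nonneg (2 ^ n * (R ^ n / Real.sqrt (n ! : ℝ))), abs_nonneg ((1 / 2 : ℝ) ^ n)]

/-! ### Values and derivatives as linear functionals, and the covariance kernel. -/

namespace l1

/-- The coefficients of the evaluation at `√π z`. -/
noncomputable def evalCoef (z : ℂ) : l1 :=
  ⟨fun n => ((Real.sqrt Real.pi : ℂ) * z) ^ n / (Real.sqrt (n ! : ℝ) : ℂ), by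
    refine (summable_pow_div_sqrt_factorial ‖(Real.sqrt Real.pi : ℂ) * z‖).congr fun n => ?_
    simp⟩

/-- The coefficients of the derivative, at `z`, of the rescaled Gaussian analytic function. -/
noncomputable def derivCoef (z : ℂ) : l1 :=
  ⟨fun n => (Real.sqrt Real.pi : ℂ) * (n * ((Real.sqrt Real.pi : ℂ) * z) ^ (n - 1))
      / (Real.sqrt (n ! : ℝ) : ℂ), by
    set w := (Real.sqrt Real.pi : ℂ) * z
    refine Summable.of_nonneg_of_le (fun _ => norm_nonneg _) (fun n => ?_)
      ((summable_pow_div_sqrt_factorial (2 * (‖w‖ + 1))).mul_left (Real.sqrt Real.pi))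
    rw [norm_div, norm_div, norm_mul, norm_mul, norm_pow, Complex.norm_natCast, mul_div_assoc,
      Complex.norm_real, Complex.norm_real, Real.norm_eq_abs, abs_of_nonneg (Real.sqrt_nonneg _)]
    have h1 : (n : ℝ) ≤ 2 ^ n := by exact_mod_cast Nat.lt_two_pow_self.le
    have h2 : ‖w‖ ^ (n - 1) ≤ (‖w‖ + 1) ^ n :=
      (pow_le_pow_left₀ (norm_nonneg _) (by linarith) _).trans
        (pow_le_pow_right₀ (by linarith [norm_nonneg w]) (Nat.sub_le _ _))
    have h3 : ‖(2 * (‖w‖ + 1)) ^ n‖ = 2 ^ n * (‖w‖ + 1) ^ n := by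
      rw [Real.norm_eq_abs, abs_of_nonneg (by positivity), mul_pow]
    rw [h3, Real.norm_eq_abs]
    gcongr⟩

lemma sqrt_pi_mul_self : (Real.sqrt Real.pi : ℂ) * (Real.sqrt Real.pi : ℂ) = Real.pi := by
  rw [← Complex.ofReal_mul, Real.mul_self_sqrt Real.pi_pos.le]

lemma sqrt_factorial_mul_self (n : ℕ) :
    (Real.sqrt (n ! : ℝ) : ℂ) * (Real.sqrt (n ! : ℝ) : ℂ) = (n ! : ℂ) := by
  rw [← Complex.ofReal_mul, Real.mul_self_sqrt (by positivity)]; simp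

lemma hasSum_exp (u : ℂ) : HasSum (fun n : ℕ => u ^ n / (n ! : ℂ)) (Complex.exp u) := by
  rw [Complex.exp_eq_exp_ℂ]
  exact NormedSpace.expSeries_div_hasSum_exp u

lemma gram_evalCoef (z w : ℂ) :
    gram (evalCoef z) (evalCoef w) = Complex.exp (Real.pi * z * starRingEnd ℂ w) := by
  rw [gram, ← (hasSum_exp _).tsum_eq]
  refine tsum_congr fun n => ?_
  simp only [evalCoef, map_div₀, map_pow, map_mul, Complex.conj_ofReal]
  rw [div_mul_div_comm, sqrt_factorial_mul_self, ← mul_pow, ← sqrt_pi_mul_self]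
  ring

lemma factorial_succ_div (n : ℕ) : ((n + 1 : ℕ) : ℂ) / ((n + 1) ! : ℂ) = 1 / (n ! : ℂ) := by
  have h1 : ((n + 1 : ℕ) : ℂ) ≠ 0 := Nat.cast_ne_zero.2 n.succ_ne_zero
  have h2 : (n ! : ℂ) ≠ 0 := Nat.cast_ne_zero.2 n.factorial_ne_zero
  rw [Nat.factorial_succ, Nat.cast_mul]
  field_simp

lemma gram_derivCoef_evalCoef (z w : ℂ) : gram (derivCoef z) (evalCoef w)
    = Real.pi * starRingEnd ℂ w * Complex.exp (Real.pi * z * starRingEnd ℂ w) := by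
  have hs := (summable_gram (derivCoef z) (evalCoef w))
  rw [gram, hs.tsum_eq_zero_add, ← (hasSum_exp _).tsum_eq, ← tsum_mul_left]
  have h0 : (derivCoef z).1 0 = 0 := by simp [derivCoef]
  rw [h0, zero_mul, zero_add]
  refine tsum_congr fun n => ?_
  simp only [derivCoef, evalCoef, map_div₀, map_pow, map_mul, Complex.conj_ofReal,
    Nat.add_sub_cancel]
  rw [div_mul_div_comm, sqrt_factorial_mul_self]
  have := factorial_succ_div n
  calc _ = (Real.sqrt Real.pi * Real.sqrt Real.pi) * starRingEnd ℂ w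
        * ((Real.sqrt Real.pi * Real.sqrt Real.pi) * z * starRingEnd ℂ w) ^ n
        * (((n + 1 : ℕ) : ℂ) / ((n + 1) ! : ℂ)) := by ring
    _ = _ := by rw [this, sqrt_pi_mul_self]; ring

lemma gram_derivCoef (z w : ℂ) : gram (derivCoef z) (derivCoef w)
    = Real.pi * (1 + Real.pi * z * starRingEnd ℂ w)
      * Complex.exp (Real.pi * z * starRingEnd ℂ w) := by
  set u := Real.pi * z * starRingEnd ℂ w with hu
  have hs := (summable_gram (derivCoef z) (derivCoef w))
  have h0 : (derivCoef z).1 0 = 0 := by simp [derivCoef]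
  have h1 : HasSum (fun n : ℕ => (n : ℂ) * (u ^ n / (n ! : ℂ))) (u * Complex.exp u) := by
    rw [← hasSum_nat_add_iff' 1]
    simp only [Finset.range_one, Finset.sum_singleton, Nat.cast_zero, zero_mul, sub_zero]
    refine ((hasSum_exp u).mul_left u).congr_fun fun n => ?_
    have := factorial_succ_div n
    calc _ = u ^ (n + 1) * (((n + 1 : ℕ) : ℂ) / ((n + 1) ! : ℂ)) := by ring
      _ = _ := by rw [this]; ring
  have h2 := ((hasSum_exp u).add h1).mul_left (Real.pi : ℂ)
  rw [gram, hs.tsum_eq_zero_add, h0, zero_mul, zero_add,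
    show Real.pi * (1 + u) * Complex.exp u = Real.pi * (Complex.exp u + u * Complex.exp u) by ring,
    ← h2.tsum_eq]
  refine tsum_congr fun n => ?_
  simp only [derivCoef, map_div₀, map_pow, map_mul, Complex.conj_ofReal, Nat.add_sub_cancel,
    Complex.conj_natCast]
  rw [div_mul_div_comm, sqrt_factorial_mul_self]
  have := factorial_succ_div n
  calc _ = (Real.sqrt Real.pi * Real.sqrt Real.pi) * ((n + 1 : ℕ) : ℂ)
        * ((Real.sqrt Real.pi * Real.sqrt Real.pi) * z * starRingEnd ℂ w) ^ n
        * (((n + 1 : ℕ) : ℂ) / ((n + 1) ! : ℂ)) := by ring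
    _ = _ := by rw [this, sqrt_pi_mul_self, ← hu]; push_cast; ring

end l1

/-! ### Almost sure convergence and the random entire function. -/

/-- The coefficient sequences of everywhere convergent series `∑ x_n zⁿ / √(n!)`. -/
def gafGood : Set (ℕ → ℂ) :=
  {x | ∀ R : ℕ, Summable fun n => ‖x n / (Real.sqrt (n ! : ℝ) : ℂ) * (R : ℂ) ^ n‖}

lemma ae_mem_gafGood : ∀ᵐ x ∂gaussSeq, x ∈ gafGood := by
  refine ae_all_iff.2 fun R => ?_
  let c : l1 := ⟨fun n => (R : ℂ) ^ n / (Real.sqrt (n ! : ℝ) : ℂ), by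
    refine (summable_pow_div_sqrt_factorial R).congr fun n => ?_
    simp⟩
  filter_upwards [l1.ae_summable c] with x hx
  refine hx.congr fun n => ?_
  congr 1
  simp only [c]
  ring

lemma norm_term_le_of_le (x : ℕ → ℂ) {w : ℂ} {R : ℕ} (h : ‖w‖ ≤ R) (n : ℕ) :
    ‖x n / (Real.sqrt (n ! : ℝ) : ℂ) * w ^ n‖
      ≤ ‖x n / (Real.sqrt (n ! : ℝ) : ℂ) * (R : ℂ) ^ n‖ := by
  rw [norm_mul, norm_mul, norm_pow, norm_pow, Complex.norm_natCast]
  gcongr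

lemma summable_of_mem_gafGood {x : ℕ → ℂ} (hx : x ∈ gafGood) (w : ℂ) :
    Summable fun n => x n / (Real.sqrt (n ! : ℝ) : ℂ) * w ^ n := by
  obtain ⟨R, hR⟩ := exists_nat_ge ‖w‖
  exact Summable.of_norm_bounded (hx R) (norm_term_le_of_le x hR)

/-- The sum of the series, at the point `√π z`. -/
noncomputable def gafSum (x : ℕ → ℂ) (z : ℂ) : ℂ :=
  ∑' n, x n / (Real.sqrt (n ! : ℝ) : ℂ) * ((Real.sqrt Real.pi : ℂ) * z) ^ n

lemma hasDerivAt_gafTerm (x : ℕ → ℂ) (n : ℕ) (z : ℂ) :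
    HasDerivAt (fun z => x n / (Real.sqrt (n ! : ℝ) : ℂ) * ((Real.sqrt Real.pi : ℂ) * z) ^ n)
      ((l1.derivCoef z).1 n * x n) z := by
  have h := ((((hasDerivAt_id z).const_mul (Real.sqrt Real.pi : ℂ)).pow n).const_mul
    (x n / (Real.sqrt (n ! : ℝ) : ℂ)))
  refine h.congr_deriv ?_
  simp only [l1.derivCoef, id]
  ring

lemma norm_gafTerm_le (x : ℕ → ℂ) (r : ℝ) : ∃ R : ℕ, ∀ n, ∀ w ∈ Metric.ball (0 : ℂ) r,
    ‖x n / (Real.sqrt (n ! : ℝ) : ℂ) * ((Real.sqrt Real.pi : ℂ) * w) ^ n‖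
      ≤ ‖x n / (Real.sqrt (n ! : ℝ) : ℂ) * (R : ℂ) ^ n‖ := by
  obtain ⟨R, hR⟩ := exists_nat_ge (Real.sqrt Real.pi * r)
  refine ⟨R, fun n w hw => norm_term_le_of_le x ?_ n⟩
  rw [mem_ball_zero_iff] at hw
  rw [norm_mul, Complex.norm_real, Real.norm_eq_abs, abs_of_nonneg (Real.sqrt_nonneg _)]
  exact (mul_le_mul_of_nonneg_left hw.le (Real.sqrt_nonneg _)).trans hR

lemma differentiable_gafSum {x : ℕ → ℂ} (hx : x ∈ gafGood) : Differentiable ℂ (gafSum x) := by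
  intro z
  obtain ⟨R, hR⟩ := norm_gafTerm_le x (‖z‖ + 1)
  have h := Complex.differentiableOn_tsum_of_summable_norm (hx R)
    (fun n w _ => (hasDerivAt_gafTerm x n w).differentiableAt.differentiableWithinAt)
    Metric.isOpen_ball hR
  exact (h z (by simp)).differentiableAt (Metric.isOpen_ball.mem_nhds (by simp))

lemma deriv_gafSum {x : ℕ → ℂ} (hx : x ∈ gafGood) (z : ℂ) :
    deriv (gafSum x) z = l1.lin (l1.derivCoef z) x := by
  obtain ⟨R, hR⟩ := norm_gafTerm_le x (‖z‖ + 1)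
  have h := Complex.hasSum_deriv_of_summable_norm (z := z) (hx R)
    (fun n w _ => (hasDerivAt_gafTerm x n w).differentiableAt.differentiableWithinAt)
    Metric.isOpen_ball hR (by simp)
  simp_rw [fun n => (hasDerivAt_gafTerm x n z).deriv] at h
  exact h.tsum_eq.symm

lemma gafSum_eq_lin (x : ℕ → ℂ) (z : ℂ) : gafSum x z = l1.lin (l1.evalCoef z) x :=
  tsum_congr fun n => by simp only [l1.evalCoef]; ring

open Classical in
/-- The rescaled Gaussian analytic function, as a random element of the space of entire
functions. -/
noncomputable def gafEntire (x : ℕ → ℂ) : EntireFun :=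
  if h : x ∈ gafGood then ⟨gafSum x, differentiable_gafSum h⟩
  else ⟨0, differentiable_const _⟩

lemma gafEntire_of_mem {x : ℕ → ℂ} (h : x ∈ gafGood) : (gafEntire x).1 = gafSum x := by
  rw [gafEntire, dif_pos h]

lemma gafEntire_of_notMem {x : ℕ → ℂ} (h : x ∉ gafGood) : (gafEntire x).1 = 0 := by
  rw [gafEntire, dif_neg h]

lemma measurableSet_gafGood : MeasurableSet gafGood := by
  have : gafGood = ⋂ R : ℕ, {x : ℕ → ℂ |
      ∑' n, ‖x n / (Real.sqrt (n ! : ℝ) : ℂ) * (R : ℂ) ^ n‖ₑ ≠ ∞} := by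
    ext x
    simp only [gafGood, Set.mem_ofPred_eq, Set.mem_iInter]
    refine forall_congr' fun R => ?_
    exact ((ENNReal.tsum_coe_ne_top_iff_summable (f := fun n =>
      ‖x n / (Real.sqrt (n ! : ℝ) : ℂ) * (R : ℂ) ^ n‖₊)).trans NNReal.summable_coe.symm).symm
  rw [this]
  refine MeasurableSet.iInter fun R => ?_
  have hm : Measurable fun x : ℕ → ℂ =>
      ∑' n, ‖x n / (Real.sqrt (n ! : ℝ) : ℂ) * (R : ℂ) ^ n‖ₑ :=
    Measurable.tsum fun n => (((measurable_pi_apply n).div_const _).mul_const _).enorm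
  exact (hm (measurableSet_singleton _)).compl

lemma measurable_gafEntire : Measurable gafEntire := by
  refine EntireFun.measurable_of_apply fun z => ?_
  refine measurable_of_tendsto_metrizable (f := fun N => gafGood.indicator fun x =>
    ∑ n ∈ Finset.range N, x n / (Real.sqrt (n ! : ℝ) : ℂ) * ((Real.sqrt Real.pi : ℂ) * z) ^ n)
    (fun N => ?_) (tendsto_pi_nhds.2 fun x => ?_)
  · refine Measurable.indicator (Finset.measurable_fun_sum _ fun n _ => ?_) measurableSet_gafGood
    exact ((measurable_pi_apply n).div_const _).mul_const _
  · by_cases hx : x ∈ gafGood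
    · simp only [Set.indicator_of_mem hx, gafEntire_of_mem hx]
      exact (summable_of_mem_gafGood hx _).hasSum.tendsto_sum_nat
    · simp only [Set.indicator_of_notMem hx, gafEntire_of_notMem hx]
      exact tendsto_const_nhds

/-! ### Splitting off the lowest coefficients. -/

/-- The sequence with first term `w` followed by the sequence `y`. -/
def consSeq (w : ℂ) (y : ℕ → ℂ) : ℕ → ℂ
  | 0 => w
  | n + 1 => y n

lemma measurable_consSeq : Measurable fun p : (ℕ → ℂ) × ℂ => consSeq p.2 p.1 := by
  refine measurable_pi_iff.2 fun n => ?_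
  cases n with
  | zero => exact measurable_snd
  | succ n => exact (measurable_pi_apply n).comp measurable_fst

-- Prepending an independent coordinate to an i.i.d. sequence reproduces its law; it suffices to
-- check this on finite boxes.
open Classical in
lemma map_consSeq :
    (gaussSeq.prod stdComplexGaussian).map (fun p => consSeq p.2 p.1) = gaussSeq := by
  refine Measure.eq_infinitePi _ fun s t ht => ?_
  rw [Measure.map_apply measurable_consSeq (MeasurableSet.pi s.countable_toSet fun i _ => ht i)]
  have hpre : (fun p : (ℕ → ℂ) × ℂ => consSeq p.2 p.1) ⁻¹' Set.pi s t
      = (Set.pi (s.preimage Nat.succ (Nat.succ_injective.injOn)) fun n => t (n + 1))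
        ×ˢ (if 0 ∈ s then t 0 else Set.univ) := by
    ext ⟨y, w⟩
    simp only [Set.mem_preimage, Set.mem_pi, Set.mem_prod, Finset.coe_preimage, Finset.mem_coe]
    constructor
    · intro h
      refine ⟨fun n hn => h (n + 1) hn, ?_⟩
      split_ifs with h0
      · exact h 0 h0
      · trivial
    · rintro ⟨h1, h2⟩ n hn
      cases n with
      | zero => rw [if_pos hn] at h2; exact h2
      | succ n => exact h1 n hn
  rw [hpre, Measure.prod_prod, gaussSeq, Measure.infinitePi_pi _ (fun i _ => ht _),
    Finset.prod_preimage' Nat.succ s Nat.succ_injective.injOn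
      (fun n => stdComplexGaussian (t n))]
  by_cases h0 : 0 ∈ s
  · rw [if_pos h0, ← Finset.prod_erase_mul s _ h0]
    congr 1
    refine Finset.prod_congr ?_ fun _ _ => rfl
    ext n
    cases n <;> simp
  · rw [if_neg h0, measure_univ, mul_one]
    refine Finset.prod_congr ?_ fun _ _ => rfl
    ext n
    cases n <;> simp [h0]

/-- The density of the standard complex Gaussian law. -/
noncomputable def gaussDensity (w : ℂ) : ℝ≥0∞ := ENNReal.ofReal (Real.exp (-‖w‖ ^ 2) / Real.pi)

lemma measurable_gaussDensity : Measurable gaussDensity := by unfold gaussDensity; fun_prop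

lemma gaussDensity_neg (w : ℂ) : gaussDensity (-w) = gaussDensity w := by simp [gaussDensity]

lemma lintegral_gaussSeq_consSeq {S : (ℕ → ℂ) → ℝ≥0∞} (hS : Measurable S) :
    ∫⁻ x, S x ∂gaussSeq = ∫⁻ y, (∫⁻ w, gaussDensity w * S (consSeq w y)) ∂gaussSeq := by
  conv_lhs => rw [← map_consSeq]
  rw [lintegral_map hS measurable_consSeq, lintegral_prod (fun p => S (consSeq p.2 p.1))
    (hS.comp measurable_consSeq).aemeasurable]
  refine lintegral_congr fun y => ?_
  rw [lintegral_stdComplexGaussian]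
  · rfl
  · exact hS.comp (measurable_consSeq.comp (measurable_const.prodMk measurable_id))

lemma consSeq_mem_gafGood {w w' : ℂ} {y : ℕ → ℂ} (h : consSeq w y ∈ gafGood) :
    consSeq w' y ∈ gafGood := by
  intro R
  have := h R
  rw [← summable_nat_add_iff 1] at this ⊢
  exact this

lemma gafSum_consSeq {w : ℂ} {y : ℕ → ℂ} (h : consSeq w y ∈ gafGood) (z : ℂ) :
    gafSum (consSeq w y) z = w + gafSum (consSeq 0 y) z := by
  rw [gafSum, (summable_of_mem_gafGood h _).tsum_eq_zero_add, gafSum,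
    (summable_of_mem_gafGood (consSeq_mem_gafGood h) _).tsum_eq_zero_add]
  simp [consSeq]

lemma consSeq_consSeq_mem_gafGood {v w w' : ℂ} {y : ℕ → ℂ}
    (h : consSeq v (consSeq w y) ∈ gafGood) : consSeq v (consSeq w' y) ∈ gafGood := by
  intro R
  have := h R
  rw [← summable_nat_add_iff 2] at this ⊢
  exact this

lemma gafSum_consSeq_consSeq {w : ℂ} {y : ℕ → ℂ} (h : consSeq 0 (consSeq w y) ∈ gafGood) (z : ℂ) :
    gafSum (consSeq 0 (consSeq w y)) z
      = Real.sqrt Real.pi * w * z + gafSum (consSeq 0 (consSeq 0 y)) z := by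
  have h1 := summable_of_mem_gafGood h (Real.sqrt Real.pi * z)
  have h2 := summable_of_mem_gafGood (consSeq_consSeq_mem_gafGood (w' := 0) h)
    (Real.sqrt Real.pi * z)
  rw [gafSum, ← h1.sum_add_tsum_nat_add 2, gafSum, ← h2.sum_add_tsum_nat_add 2]
  simp [consSeq, Finset.sum_range_succ]
  ring

lemma gafEntire_consSeq {w : ℂ} {y : ℕ → ℂ} (h : consSeq w y ∈ gafGood) :
    gafEntire (consSeq w y) = EntireFun.addAffine (gafEntire (consSeq 0 y)) w 0 := by
  ext z
  rw [EntireFun.addAffine_apply, gafEntire_of_mem h, gafEntire_of_mem (consSeq_mem_gafGood h),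
    gafSum_consSeq h]
  ring

lemma gafEntire_consSeq_consSeq {w : ℂ} {y : ℕ → ℂ} (h : consSeq 0 (consSeq w y) ∈ gafGood) :
    gafEntire (consSeq 0 (consSeq w y))
      = EntireFun.addAffine (gafEntire (consSeq 0 (consSeq 0 y))) 0 (Real.sqrt Real.pi * w) := by
  ext z
  rw [EntireFun.addAffine_apply, gafEntire_of_mem h,
    gafEntire_of_mem (consSeq_consSeq_mem_gafGood h), gafSum_consSeq_consSeq h]
  ring

/-- Fubini provides at least one good value of the new coordinate. This is enough for properties
such as convergence, which do not depend on that coordinate. -/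
lemma ae_of_ae_consSeq {p : (ℕ → ℂ) → Prop} (h : ∀ᵐ x ∂gaussSeq, p x) :
    ∀ᵐ y ∂gaussSeq, ∃ w, p (consSeq w y) := by
  rw [← map_consSeq] at h
  have h2 := Measure.ae_ae_of_ae_prod (ae_of_ae_map measurable_consSeq.aemeasurable h)
  filter_upwards [h2] with y hy
  exact hy.exists

lemma ae_consSeq_mem_gafGood : ∀ᵐ y ∂gaussSeq, ∀ w, consSeq w y ∈ gafGood := by
  filter_upwards [ae_of_ae_consSeq ae_mem_gafGood] with y hy w
  obtain ⟨v, hv⟩ := hy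
  exact consSeq_mem_gafGood hv

lemma ae_consSeq_consSeq_mem_gafGood :
    ∀ᵐ y ∂gaussSeq, ∀ v w, consSeq v (consSeq w y) ∈ gafGood := by
  filter_upwards [ae_of_ae_consSeq ae_consSeq_mem_gafGood] with y hy v w
  obtain ⟨w', hw'⟩ := hy
  exact consSeq_consSeq_mem_gafGood (hw' v)

/-! ## Kac-Rice formulas -/

open EntireFun

lemma measurable_gafEntire_consSeq : Measurable fun y => gafEntire (consSeq 0 y) :=
  measurable_gafEntire.comp (measurable_consSeq.comp (measurable_id.prodMk measurable_const))

lemma measurable_gafEntire_consSeq_consSeq :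
    Measurable fun y => gafEntire (consSeq 0 (consSeq 0 y)) :=
  measurable_gafEntire_consSeq.comp (measurable_consSeq.comp (measurable_id.prodMk measurable_const))

/-- The first Kac-Rice formula. -/
theorem lintegral_lintegral_zeroMeasure_gafEntire {F : ℂ → ℂ → ℝ≥0∞}
    (hF : Measurable (Function.uncurry F)) :
    ∫⁻ x, (∫⁻ z, F z (deriv (gafEntire x).1 z) ∂(zeroMeasure (gafEntire x))) ∂gaussSeq
      = ∫⁻ z, (∫⁻ y, gaussDensity ((gafEntire (consSeq 0 y)).1 z)
          * F z (deriv (gafEntire (consSeq 0 y)).1 z)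
          * ‖deriv (gafEntire (consSeq 0 y)).1 z‖ₑ ^ 2 ∂gaussSeq) := by
  have hS : Measurable fun f : EntireFun => ∫⁻ z, F z (deriv f.1 z) ∂(zeroMeasure f) :=
    measurable_lintegral_zeroMeasure measurable_id
      (hF.comp (measurable_snd.prodMk measurable_eval_deriv))
  rw [lintegral_gaussSeq_consSeq (S := fun x => ∫⁻ z, F z (deriv (gafEntire x).1 z)
    ∂(zeroMeasure (gafEntire x))) (hS.comp measurable_gafEntire)]
  have hyz : Measurable fun p : (ℕ → ℂ) × ℂ => (gafEntire (consSeq 0 p.1), p.2) :=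
    (measurable_gafEntire_consSeq.comp measurable_fst).prodMk measurable_snd
  have h1 : ∀ᵐ y ∂gaussSeq, (∫⁻ w, gaussDensity w * ∫⁻ z, F z (deriv (gafEntire (consSeq w y)).1 z)
        ∂(zeroMeasure (gafEntire (consSeq w y))))
      = ∫⁻ z, gaussDensity ((gafEntire (consSeq 0 y)).1 z)
          * F z (deriv (gafEntire (consSeq 0 y)).1 z)
          * ‖deriv (gafEntire (consSeq 0 y)).1 z‖ₑ ^ 2 := by
    filter_upwards [ae_consSeq_mem_gafGood] with y hy
    set g := gafEntire (consSeq 0 y) with hg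
    have hm : Measurable fun z => F z (deriv g.1 z) :=
      hF.comp (measurable_id.prodMk (measurable_deriv _))
    have h2 := lintegral_lintegral_zeroMeasure_addAffine g
      (F := fun w z => gaussDensity w * F z (deriv g.1 z))
      ((measurable_gaussDensity.comp g.2.continuous.measurable.neg).mul hm)
    simp only [gaussDensity_neg] at h2
    rw [← h2]
    refine lintegral_congr fun w => ?_
    rw [lintegral_const_mul _ hm, gafEntire_consSeq (hy w)]
    simp only [deriv_addAffine, zero_add, ← hg]
  rw [lintegral_congr_ae h1, lintegral_lintegral_swap]
  refine Measurable.aemeasurable ?_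
  have hd := measurable_eval_deriv.comp hyz
  exact ((measurable_gaussDensity.comp (measurable_eval.comp hyz)).mul
    (hF.comp (measurable_snd.prodMk hd))).mul (hd.enorm.pow_const 2)

/-- The linear coefficient of an entire function vanishing at `z₁` and `z₂`, up to the terms of
higher order, which are given by `g`. -/
noncomputable def slopeCoef (g : EntireFun) (z₁ z₂ : ℂ) : ℂ :=
  -((g.1 z₂ - g.1 z₁) / (z₂ - z₁) / (Real.sqrt Real.pi : ℂ))

/-- The density of pairs of zeros, given the terms of order at least two. -/
noncomputable def pairDensity (g : EntireFun) (z₁ z₂ : ℂ) : ℝ≥0∞ :=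
  gaussDensity (slopeCoef g z₁ z₂)
    * gaussDensity (Real.sqrt Real.pi * slopeCoef g z₁ z₂ * z₁ + g.1 z₁)
    * ‖Real.sqrt Real.pi * slopeCoef g z₁ z₂ + deriv g.1 z₁‖ₑ ^ 2
    * ‖(Real.sqrt Real.pi * slopeCoef g z₁ z₂ + deriv g.1 z₂)
        / (z₂ - z₁) / (Real.sqrt Real.pi : ℂ)‖ₑ ^ 2

lemma sqrt_pi_ne_zero : (Real.sqrt Real.pi : ℂ) ≠ 0 := by
  rw [Complex.ofReal_ne_zero]
  exact (Real.sqrt_pos.2 Real.pi_pos).ne'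

lemma measurable_pairDensity {α : Type*} [MeasurableSpace α] {g : α → EntireFun} {u v : α → ℂ}
    (hg : Measurable g) (hu : Measurable u) (hv : Measurable v) :
    Measurable fun a => pairDensity (g a) (u a) (v a) := by
  have h1 : Measurable fun a => (g a).1 (u a) := measurable_eval.comp (hg.prodMk hu)
  have h2 : Measurable fun a => (g a).1 (v a) := measurable_eval.comp (hg.prodMk hv)
  have h3 : Measurable fun a => deriv (g a).1 (u a) := measurable_eval_deriv.comp (hg.prodMk hu)
  have h4 : Measurable fun a => deriv (g a).1 (v a) := measurable_eval_deriv.comp (hg.prodMk hv)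
  have h5 : Measurable fun a => slopeCoef (g a) (u a) (v a) := by
    unfold slopeCoef
    exact (((h2.sub h1).div (hv.sub hu)).div_const _).neg
  unfold pairDensity
  refine ((((measurable_gaussDensity.comp h5).mul (measurable_gaussDensity.comp
    (((h5.const_mul _).mul hu).add h1))).mul
    (((h5.const_mul _).add h3).enorm.pow_const 2))).mul ?_
  exact ((((h5.const_mul _).add h4).div (hv.sub hu)).div_const _).enorm.pow_const 2

/-- The integral over `w₀` forces `w₀ = -(r w₁ z₁ + g(z₁))`, which puts a zero at `z₁`, at the cost
of a factor `|f'(z₁)|²`. The integral over `w₁` then forces `w₁ = slopeCoef g z₁ z₂`, which puts one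
at `z₂`. -/
lemma lintegral_lintegral_pairSum_linear (g : EntireFun) {F : ℂ → ℂ → ℝ≥0∞}
    (hF : Measurable (Function.uncurry F)) :
    ∫⁻ w₁, gaussDensity w₁ * ∫⁻ w₀, gaussDensity w₀
        * pairSum (addAffine (addAffine g 0 (Real.sqrt Real.pi * w₁)) w₀ 0) F
      = ∫⁻ z₁, ∫⁻ z₂, ({z₁}ᶜ : Set ℂ).indicator
          (fun z₂ => F z₁ z₂ * pairDensity g z₁ z₂) z₂ := by
  set r : ℂ := (Real.sqrt Real.pi : ℂ) with hr
  have hadd : ∀ w₁ z₁ : ℂ,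
      addAffine (addAffine g 0 (r * w₁)) (-(addAffine g 0 (r * w₁)).1 z₁) 0
        = addAffine g (-(r * w₁ * z₁ + g.1 z₁)) (r * w₁) := by
    intro w₁ z₁
    ext z
    simp only [addAffine_apply]
    ring
  simp_rw [fun w₁ => lintegral_pairSum_addAffine (addAffine g 0 (r * w₁)) measurable_gaussDensity
    hF, hadd]
  have hg : Measurable fun z => g.1 z := g.2.continuous.measurable
  have hΘ : Measurable fun p : ℂ × ℂ => addAffine g (-(r * p.1 * p.2 + g.1 p.2)) (r * p.1) := by
    have h' : Measurable fun p : ℂ × ℂ => g.1 p.2 := hg.comp measurable_snd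
    exact measurable_addAffine.comp (measurable_const.prodMk
      (Measurable.prodMk (by fun_prop) (by fun_prop)))
  have hI : Measurable fun p : ℂ × ℂ => ∫⁻ z₂, ({p.2}ᶜ : Set ℂ).indicator (F p.2) z₂
      ∂(zeroMeasure (addAffine g (-(r * p.1 * p.2 + g.1 p.2)) (r * p.1))) := by
    refine measurable_lintegral_zeroMeasure hΘ ?_
    exact measurable_offDiag_indicator (u := fun q : (ℂ × ℂ) × ℂ => q.1.2) (v := fun q => q.2)
      (G := fun q => F q.1.2 q.2) (by fun_prop) (by fun_prop)
      (hF.comp ((measurable_snd.comp measurable_fst).prodMk measurable_snd))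
  have hψ : Measurable fun p : ℂ × ℂ => gaussDensity p.1
      * gaussDensity (r * p.1 * p.2 + g.1 p.2) * ‖r * p.1 + deriv g.1 p.2‖ₑ ^ 2 := by
    have h1 : Measurable fun p : ℂ × ℂ => g.1 p.2 := hg.comp measurable_snd
    have h2 : Measurable fun p : ℂ × ℂ => deriv g.1 p.2 := (measurable_deriv _).comp measurable_snd
    refine ((measurable_gaussDensity.comp measurable_fst).mul
      (measurable_gaussDensity.comp ?_)).mul (Measurable.pow_const (Measurable.enorm ?_) 2)
    · fun_prop
    · fun_prop
  have hpt : ∀ w₁ z₁ : ℂ, gaussDensity w₁ * (gaussDensity (-(addAffine g 0 (r * w₁)).1 z₁)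
      * (∫⁻ z₂, ({z₁}ᶜ : Set ℂ).indicator (F z₁) z₂
          ∂(zeroMeasure (addAffine g (-(r * w₁ * z₁ + g.1 z₁)) (r * w₁))))
      * ‖deriv (addAffine g 0 (r * w₁)).1 z₁‖ₑ ^ 2)
      = (gaussDensity w₁ * gaussDensity (r * w₁ * z₁ + g.1 z₁) * ‖r * w₁ + deriv g.1 z₁‖ₑ ^ 2)
        * ∫⁻ z₂, ({z₁}ᶜ : Set ℂ).indicator (F z₁) z₂
          ∂(zeroMeasure (addAffine g (-(r * w₁ * z₁ + g.1 z₁)) (r * w₁))) := by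
    intro w₁ z₁
    rw [gaussDensity_neg, deriv_addAffine, addAffine_apply, zero_add]
    ring
  have hpull : ∀ w₁ : ℂ, gaussDensity w₁ * ∫⁻ z₁, (gaussDensity (-(addAffine g 0 (r * w₁)).1 z₁)
      * (∫⁻ z₂, ({z₁}ᶜ : Set ℂ).indicator (F z₁) z₂
          ∂(zeroMeasure (addAffine g (-(r * w₁ * z₁ + g.1 z₁)) (r * w₁))))
      * ‖deriv (addAffine g 0 (r * w₁)).1 z₁‖ₑ ^ 2)
      = ∫⁻ z₁, (gaussDensity w₁ * gaussDensity (r * w₁ * z₁ + g.1 z₁)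
          * ‖r * w₁ + deriv g.1 z₁‖ₑ ^ 2)
        * ∫⁻ z₂, ({z₁}ᶜ : Set ℂ).indicator (F z₁) z₂
          ∂(zeroMeasure (addAffine g (-(r * w₁ * z₁ + g.1 z₁)) (r * w₁))) := by
    intro w₁
    rw [← lintegral_const_mul' (gaussDensity w₁) _ ENNReal.ofReal_ne_top]
    exact lintegral_congr fun z₁ => hpt w₁ z₁
  simp_rw [hpull]
  rw [lintegral_lintegral_swap (hψ.mul hI).aemeasurable]
  refine lintegral_congr fun z₁ => ?_
  have hsec : Measurable fun w : ℂ => gaussDensity w * gaussDensity (r * w * z₁ + g.1 z₁)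
      * ‖r * w + deriv g.1 z₁‖ₑ ^ 2 := by
    refine (measurable_gaussDensity.mul (measurable_gaussDensity.comp ?_)).mul
      (Measurable.pow_const (Measurable.enorm ?_) 2)
    · fun_prop
    · fun_prop
  have hFz : Measurable (F z₁) := hF.comp (measurable_prodMk_left (x := z₁))
  have hr0 : r ≠ 0 := sqrt_pi_ne_zero
  refine Eq.trans (lintegral_lintegral_zeroMeasure_linear g hr0 z₁ hsec hFz) ?_
  refine lintegral_congr fun z₂ => ?_
  by_cases hz : z₂ = z₁
  · simp [hz]
  have hz' : z₂ ∈ ({z₁}ᶜ : Set ℂ) := hz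
  rw [Set.indicator_of_mem hz', Set.indicator_of_mem hz', pairDensity, ← hr]
  have hs : -((g.1 z₂ - g.1 z₁) / (z₂ - z₁) / r) = slopeCoef g z₁ z₂ := rfl
  -- Since `r` times `slopeCoef` is minus the difference quotient of `g`, the Jacobian of the second
  -- step is the derivative at `z₂` of the function that vanishes at both points.
  have hs2 : deriv g.1 z₂ - (g.1 z₂ - g.1 z₁) / (z₂ - z₁)
      = r * slopeCoef g z₁ z₂ + deriv g.1 z₂ := by
    rw [slopeCoef, ← hr]
    field_simp
    ring
  rw [hs, hs2]
  ring

/-- The second Kac-Rice formula. -/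
theorem lintegral_pairSum_gafEntire {F : ℂ → ℂ → ℝ≥0∞} (hF : Measurable (Function.uncurry F)) :
    ∫⁻ x, pairSum (gafEntire x) F ∂gaussSeq
      = ∫⁻ z₁, ∫⁻ z₂, ({z₁}ᶜ : Set ℂ).indicator (fun z₂ => F z₁ z₂
          * ∫⁻ y, pairDensity (gafEntire (consSeq 0 (consSeq 0 y))) z₁ z₂ ∂gaussSeq) z₂ := by
  have hS : Measurable fun f => pairSum f F := measurable_pairSum hF
  let T : EntireFun → ℝ≥0∞ := fun h => ∫⁻ w₀, gaussDensity w₀ * pairSum (addAffine h w₀ 0) F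
  have hT : Measurable T := by
    have h1 : Measurable fun p : EntireFun × ℂ => addAffine p.1 p.2 0 :=
      measurable_addAffine.comp (measurable_fst.prodMk (measurable_snd.prodMk measurable_const))
    exact ((measurable_gaussDensity.comp measurable_snd).mul
      (hS.comp h1)).lintegral_prod_right'
  have e1 : ∫⁻ x, pairSum (gafEntire x) F ∂gaussSeq
      = ∫⁻ y, T (gafEntire (consSeq 0 y)) ∂gaussSeq := by
    rw [lintegral_gaussSeq_consSeq (S := fun x => pairSum (gafEntire x) F)
      (hS.comp measurable_gafEntire)]
    refine lintegral_congr_ae ?_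
    filter_upwards [ae_consSeq_mem_gafGood] with y hy
    refine lintegral_congr fun w => ?_
    rw [gafEntire_consSeq (hy w)]
  have e2 : ∫⁻ y, T (gafEntire (consSeq 0 y)) ∂gaussSeq
      = ∫⁻ y, (∫⁻ z₁, ∫⁻ z₂, ({z₁}ᶜ : Set ℂ).indicator (fun z₂ => F z₁ z₂
          * pairDensity (gafEntire (consSeq 0 (consSeq 0 y))) z₁ z₂) z₂) ∂gaussSeq := by
    rw [lintegral_gaussSeq_consSeq (S := fun y => T (gafEntire (consSeq 0 y)))
      (hT.comp measurable_gafEntire_consSeq)]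
    refine lintegral_congr_ae ?_
    filter_upwards [ae_consSeq_consSeq_mem_gafGood] with y hy
    rw [← lintegral_lintegral_pairSum_linear _ hF]
    refine lintegral_congr fun w => ?_
    rw [gafEntire_consSeq_consSeq (hy 0 w)]
  have hm : Measurable fun p : ((ℕ → ℂ) × ℂ) × ℂ => ({p.1.2}ᶜ : Set ℂ).indicator (fun z₂ =>
      F p.1.2 z₂ * pairDensity (gafEntire (consSeq 0 (consSeq 0 p.1.1))) p.1.2 z₂) p.2 := by
    refine measurable_offDiag_indicator (u := fun p : ((ℕ → ℂ) × ℂ) × ℂ => p.1.2)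
      (v := fun p => p.2)
      (G := fun p => F p.1.2 p.2 * pairDensity (gafEntire (consSeq 0 (consSeq 0 p.1.1))) p.1.2 p.2)
      (by fun_prop) (by fun_prop) (Measurable.mul ?_ ?_)
    · exact hF.comp ((measurable_snd.comp measurable_fst).prodMk measurable_snd)
    · exact measurable_pairDensity (measurable_gafEntire_consSeq_consSeq.comp
        (measurable_fst.comp measurable_fst)) (by fun_prop) (by fun_prop)
  have hswap : ∀ z₁, ∫⁻ y, (∫⁻ z₂, ({z₁}ᶜ : Set ℂ).indicator (fun z₂ =>
      F z₁ z₂ * pairDensity (gafEntire (consSeq 0 (consSeq 0 y))) z₁ z₂) z₂) ∂gaussSeq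
      = ∫⁻ z₂, ({z₁}ᶜ : Set ℂ).indicator (fun z₂ => F z₁ z₂
          * ∫⁻ y, pairDensity (gafEntire (consSeq 0 (consSeq 0 y))) z₁ z₂ ∂gaussSeq) z₂ := by
    intro z₁
    rw [lintegral_lintegral_swap]
    · refine lintegral_congr fun z₂ => ?_
      by_cases hz : z₂ = z₁
      · simp [hz]
      · have hz' : z₂ ∈ ({z₁}ᶜ : Set ℂ) := hz
        simp only [Set.indicator_of_mem hz']
        rw [lintegral_const_mul]
        exact measurable_pairDensity measurable_gafEntire_consSeq_consSeq measurable_const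
          measurable_const
    · exact (hm.comp ((measurable_fst.prodMk measurable_const).prodMk measurable_snd)).aemeasurable
  rw [e1, e2, lintegral_lintegral_swap]
  · exact lintegral_congr hswap
  · exact hm.lintegral_prod_right'.aemeasurable

/-! ## Conditional densities -/

/-- Testing against all `ψ` identifies the two densities almost everywhere only, whereas Kac-Rice
needs them at the single point `0`. The bound `C` makes the left side continuous in `u` by dominated
convergence, and two continuous functions that agree almost everywhere agree everywhere. -/
lemma lintegral_eq_of_forall_lintegral_mul_eq {E Y : Type*} [MeasureSpace E] [TopologicalSpace E]
    [FirstCountableTopology E] [BorelSpace E]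
    [(volume : Measure E).IsOpenPosMeasure] [SigmaFinite (volume : Measure E)]
    [MeasurableSpace Y] {ν : Measure Y} [IsFiniteMeasure ν] {k : E → Y → ℝ} {C : ℝ}
    (hk : ∀ y, Continuous fun u => k u y) (hkm : Measurable (Function.uncurry k))
    (hk0 : ∀ u y, 0 ≤ k u y) (hkC : ∀ u y, k u y ≤ C) {p : E → ℝ} (hp : Continuous p)
    (h : ∀ ψ : E → ℝ≥0∞, Measurable ψ →
      ∫⁻ u, ψ u * ∫⁻ y, ENNReal.ofReal (k u y) ∂ν = ∫⁻ u, ψ u * ENNReal.ofReal (p u)) (u : E) :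
    ∫⁻ y, ENNReal.ofReal (k u y) ∂ν = ENNReal.ofReal (p u) := by
  have hkmu : ∀ u, Measurable (k u) := fun u => hkm.of_uncurry_left
  have hint : ∀ u, Integrable (k u) ν := fun u =>
    Integrable.mono' (integrable_const C) (hkmu u).aestronglyMeasurable
      (ae_of_all _ fun y => by rw [Real.norm_eq_abs, abs_of_nonneg (hk0 u y)]; exact hkC u y)
  have hK : ∀ u, ∫⁻ y, ENNReal.ofReal (k u y) ∂ν = ENNReal.ofReal (∫ y, k u y ∂ν) := fun u =>
    (ofReal_integral_eq_lintegral_ofReal (hint u) (ae_of_all _ fun y => hk0 u y)).symm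
  have hKc : Continuous fun u => ∫ y, k u y ∂ν :=
    continuous_of_dominated (fun u => (hkmu u).aestronglyMeasurable)
      (fun u => ae_of_all _ fun y => by
        rw [Real.norm_eq_abs, abs_of_nonneg (hk0 u y)]; exact hkC u y)
      (integrable_const C) (ae_of_all _ hk)
  have hae : (fun u => ENNReal.ofReal (∫ y, k u y ∂ν)) =ᵐ[volume] fun u => ENNReal.ofReal (p u) := by
    refine ae_eq_of_forall_setLIntegral_eq_of_sigmaFinite
      (ENNReal.measurable_ofReal.comp hKc.measurable) (by fun_prop)
      fun s hs _ => ?_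
    have h1 := h (s.indicator 1) (measurable_one.indicator hs)
    have h2 : ∀ g : E → ℝ≥0∞, ∫⁻ u, s.indicator 1 u * g u = ∫⁻ u in s, g u := by
      intro g
      rw [← lintegral_indicator hs]
      refine lintegral_congr fun u => ?_
      by_cases hu : u ∈ s <;> simp [hu]
    rw [h2, h2] at h1
    simp_rw [hK] at h1
    exact h1
  rw [hK]
  exact congrFun ((Continuous.ae_eq_iff_eq volume (ENNReal.continuous_ofReal.comp hKc)
    (ENNReal.continuous_ofReal.comp hp)).1 hae) u

/-- The area formula for an affine map, whose fibers are single points. -/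
lemma lintegral_comp_affine {F : ℂ → ℝ≥0∞} (hF : Measurable F) {a : ℂ} (ha : a ≠ 0) (b : ℂ) :
    ∫⁻ w, F w = ‖a‖ₑ⁻¹ ^ 2 * ∫⁻ u, F ((u - b) / a) := by
  have hg : Differentiable ℂ fun z : ℂ => a * z + b := by fun_prop
  have h := lintegral_tsum_fiber_eq hg hF
  have hd : ∀ z, deriv (fun z : ℂ => a * z + b) z = a := fun z => by
    have : HasDerivAt (fun z : ℂ => a * z + b) (a * 1) z :=
      ((hasDerivAt_id z).const_mul a).add_const b
    rw [this.deriv, mul_one]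
  have hfib : ∀ u, ∑' z : (fun z : ℂ => a * z + b) ⁻¹' {u}, F z = F ((u - b) / a) := by
    intro u
    have : (fun z : ℂ => a * z + b) ⁻¹' {u} = {(u - b) / a} := by
      ext z
      simp only [Set.mem_preimage, Set.mem_singleton_iff]
      rw [eq_div_iff ha]
      constructor <;> intro h
      · linear_combination h
      · linear_combination h
    rw [this, tsum_singleton]
  simp_rw [hfib, hd] at h
  have ha' : ‖a‖ₑ ≠ 0 := by simpa using ha
  have hat : ‖a‖ₑ ≠ ∞ := enorm_ne_top
  rw [h, lintegral_mul_const' _ _ (ENNReal.pow_ne_top hat), mul_comm (∫⁻ z, F z), ← mul_assoc,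
    ← mul_pow, ENNReal.inv_mul_cancel ha' hat, one_pow, one_mul]

/-- The density of the standard complex Gaussian law, as a real function. -/
noncomputable def gaussPdf (w : ℂ) : ℝ := Real.exp (-‖w‖ ^ 2) / Real.pi

lemma gaussPdf_nonneg (w : ℂ) : 0 ≤ gaussPdf w := by
  unfold gaussPdf; have := Real.pi_pos; positivity

lemma gaussPdf_le_one (w : ℂ) : gaussPdf w ≤ 1 := by
  unfold gaussPdf
  rw [div_le_one Real.pi_pos]
  have h1 : Real.exp (-‖w‖ ^ 2) ≤ 1 := Real.exp_le_one_iff.2 (by nlinarith [norm_nonneg w])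
  linarith [Real.pi_gt_three]

lemma continuous_gaussPdf : Continuous gaussPdf := by unfold gaussPdf; fun_prop

lemma gaussDensity_eq (w : ℂ) : gaussDensity w = ENNReal.ofReal (gaussPdf w) := rfl

lemma gaussPdf_zero : gaussPdf 0 = 1 / Real.pi := by simp [gaussPdf]

lemma iSup_ofReal_min (a : ℝ) : ⨆ M : ℕ, ENNReal.ofReal (min a M) = ENNReal.ofReal a := by
  refine le_antisymm (iSup_le fun M => ENNReal.ofReal_le_ofReal (min_le_left _ _)) ?_
  obtain ⟨M, hM⟩ := exists_nat_ge a
  exact le_iSup_of_le M (by rw [min_eq_left hM])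

/-- Squared derivatives are unbounded, so the continuity argument is applied to their truncations;
monotone convergence removes the truncation. -/
lemma lintegral_ofReal_mul_eq_iSup {Y : Type*} [MeasurableSpace Y] {ν : Measure Y}
    {f g : Y → ℝ} (hf : AEMeasurable f ν) (hg : AEMeasurable g ν) (hf0 : ∀ y, 0 ≤ f y) :
    ∫⁻ y, ENNReal.ofReal (f y) * ENNReal.ofReal (g y) ∂ν
      = ⨆ M : ℕ, ∫⁻ y, ENNReal.ofReal (f y * min (g y) M) ∂ν := by
  rw [← lintegral_iSup']
  · refine lintegral_congr fun y => ?_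
    simp_rw [ENNReal.ofReal_mul (hf0 y)]
    rw [← ENNReal.mul_iSup, iSup_ofReal_min]
  · intro M
    exact (hf.mul (hg.min aemeasurable_const)).ennreal_ofReal
  · refine ae_of_all _ fun y M N hMN => ?_
    refine ENNReal.ofReal_le_ofReal (mul_le_mul_of_nonneg_left ?_ (hf0 y))
    exact min_le_min_left _ (by exact_mod_cast hMN)

/-- The density of a nondegenerate linear functional. -/
lemma lintegral_comp_lin {c : l1} {s : ℝ} (hs : 0 < s) (hc : l1.gram c c = ((s ^ 2 : ℝ) : ℂ))
    {ψ : ℂ → ℝ≥0∞} (hψ : Measurable ψ) :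
    ∫⁻ x, ψ (l1.lin c x) ∂gaussSeq
      = ∫⁻ u, ψ u * ENNReal.ofReal (gaussPdf (u / s) / s ^ 2) := by
  have hs' : (s : ℂ) ≠ 0 := Complex.ofReal_ne_zero.2 hs.ne'
  have hsq : Real.sqrt (l1.gram c c).re = s := by
    rw [hc, Complex.ofReal_re, Real.sqrt_sq hs.le]
  have hψs : Measurable fun w : ℂ => ψ (s * w) := hψ.comp (by fun_prop)
  rw [← lintegral_map' hψ.aemeasurable (l1.aemeasurable_lin c), l1.map_lin, hsq,
    lintegral_map hψ (by fun_prop),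
    lintegral_stdComplexGaussian hψs,
    lintegral_comp_affine (F := fun w => ENNReal.ofReal (Real.exp (-‖w‖ ^ 2) / Real.pi)
      * ψ (s * w)) (by fun_prop) hs' 0, ← lintegral_const_mul']
  · refine lintegral_congr fun u => ?_
    simp only [sub_zero]
    rw [mul_div_cancel₀ _ hs', div_eq_mul_inv (gaussPdf _),
      ENNReal.ofReal_mul (gaussPdf_nonneg _)]
    have : ‖(s : ℂ)‖ₑ⁻¹ ^ 2 = ENNReal.ofReal (s ^ 2)⁻¹ := by
      rw [← ofReal_norm, Complex.norm_real, Real.norm_eq_abs, abs_of_pos hs,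
        ← ENNReal.ofReal_inv_of_pos hs, ← ENNReal.ofReal_pow (by positivity), inv_pow]
    rw [this, gaussPdf]
    ring
  · simp [hs']

/-! ## The intensity of the zeros -/

lemma gafEntire_apply {x : ℕ → ℂ} (hx : x ∈ gafGood) (z : ℂ) :
    (gafEntire x).1 z = l1.lin (l1.evalCoef z) x := by
  rw [gafEntire_of_mem hx, gafSum_eq_lin]

lemma deriv_gafEntire {x : ℕ → ℂ} (hx : x ∈ gafGood) (z : ℂ) :
    deriv (gafEntire x).1 z = l1.lin (l1.derivCoef z) x := by
  rw [gafEntire_of_mem hx, deriv_gafSum hx]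

lemma lintegral_mul_comp_lin {ι κ : Type*} [Fintype ι] [Fintype κ] {c : ι → l1} {d : κ → l1}
    (h : ∀ i j, l1.gram (c i) (d j) = 0) {f : (ι → ℂ) → ℝ≥0∞} {g : (κ → ℂ) → ℝ≥0∞}
    (hf : Measurable f) (hg : Measurable g) :
    ∫⁻ x, f (fun i => l1.lin (c i) x) * g (fun j => l1.lin (d j) x) ∂gaussSeq
      = (∫⁻ x, f (fun i => l1.lin (c i) x) ∂gaussSeq)
        * ∫⁻ x, g (fun j => l1.lin (d j) x) ∂gaussSeq := by
  have hi := (l1.indepFun_lin_of_gram_eq_zero c d h).comp hf hg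
  exact lintegral_mul_eq_lintegral_mul_lintegral_of_indepFun''
    (hf.comp_aemeasurable (l1.aemeasurable_lin_pi c))
    (hg.comp_aemeasurable (l1.aemeasurable_lin_pi d)) hi

/-- The coefficients of the covariant derivative. -/
noncomputable def covCoef (z : ℂ) : l1 :=
  l1.derivCoef z - (Real.pi * starRingEnd ℂ z) • l1.evalCoef z

lemma lin_covCoef_ae (z : ℂ) : ∀ᵐ x ∂gaussSeq, l1.lin (covCoef z) x
    = deriv (gafEntire x).1 z - Real.pi * starRingEnd ℂ z * (gafEntire x).1 z := by
  filter_upwards [l1.lin_sub_ae (l1.derivCoef z) ((Real.pi * starRingEnd ℂ z) • l1.evalCoef z),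
    ae_mem_gafGood] with x hx hg
  rw [covCoef, hx, l1.lin_smul, gafEntire_apply hg, deriv_gafEntire hg]

/-- At `w = z` this vanishes, so `f'(z) - π z̄ f(z)` is independent of `f(z)`. At a zero of `f` it
coincides with `f'(z)`. -/
lemma gram_covCoef_evalCoef (z w : ℂ) : l1.gram (covCoef z) (l1.evalCoef w)
    = Real.pi * (starRingEnd ℂ w - starRingEnd ℂ z) * Complex.exp (Real.pi * z * starRingEnd ℂ w) := by
  rw [covCoef, l1.gram_sub_left, l1.gram_smul_left, l1.gram_derivCoef_evalCoef, l1.gram_evalCoef]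
  ring

lemma gram_evalCoef_covCoef (z w : ℂ) : l1.gram (l1.evalCoef z) (covCoef w)
    = Real.pi * (z - w) * Complex.exp (Real.pi * z * starRingEnd ℂ w) := by
  rw [← l1.conj_gram, gram_covCoef_evalCoef, map_mul, ← Complex.exp_conj]
  simp only [map_mul, map_sub, Complex.conj_conj, Complex.conj_ofReal]
  ring_nf

lemma gram_covCoef (z w : ℂ) : l1.gram (covCoef z) (covCoef w)
    = (Real.pi - Real.pi ^ 2 * ((z - w) * (starRingEnd ℂ z - starRingEnd ℂ w)))
      * Complex.exp (Real.pi * z * starRingEnd ℂ w) := by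
  rw [covCoef, l1.gram_sub_left, l1.gram_smul_left, gram_evalCoef_covCoef, covCoef,
    l1.gram_sub_right, l1.gram_smul_right, l1.gram_derivCoef, l1.gram_derivCoef_evalCoef]
  simp only [map_mul, Complex.conj_conj, Complex.conj_ofReal]
  ring

lemma gram_evalCoef_self (z : ℂ) : l1.gram (l1.evalCoef z) (l1.evalCoef z)
    = ((Real.exp (Real.pi * ‖z‖ ^ 2) : ℝ) : ℂ) := by
  rw [l1.gram_evalCoef, mul_assoc, Complex.mul_conj, Complex.normSq_eq_norm_sq]
  push_cast
  rfl

lemma gram_covCoef_self (z : ℂ) : l1.gram (covCoef z) (covCoef z)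
    = ((Real.pi * Real.exp (Real.pi * ‖z‖ ^ 2) : ℝ) : ℂ) := by
  rw [gram_covCoef, Complex.ofReal_mul, ← gram_evalCoef_self, l1.gram_evalCoef]
  ring

lemma lintegral_norm_sq_lin (c : l1) :
    ∫⁻ x, ENNReal.ofReal (‖l1.lin c x‖ ^ 2) ∂gaussSeq = ENNReal.ofReal (l1.gram c c).re := by
  rw [← ofReal_integral_eq_lintegral_ofReal (l1.integrable_norm_pow_lin c 2)
    (ae_of_all _ fun x => by positivity)]
  congr 1
  rw [← integral_map (f := fun w : ℂ => ‖w‖ ^ 2) (l1.aemeasurable_lin c)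
    (Continuous.aestronglyMeasurable (by fun_prop)), l1.map_lin,
    integral_map (by fun_prop) (Continuous.aestronglyMeasurable (by fun_prop))]
  simp only [norm_mul, mul_pow, Complex.norm_real, Real.norm_eq_abs,
    abs_of_nonneg (Real.sqrt_nonneg _)]
  rw [integral_const_mul, integral_norm_pow_stdComplexGaussian,
    Real.sq_sqrt (l1.gram_self_re_nonneg c),
    show (((2 : ℕ) : ℝ) + 2) / 2 = (1 : ℕ) + 1 by norm_num, Real.Gamma_nat_eq_factorial]
  simp

lemma measurable_gafEntire_consSeq_apply (z : ℂ) :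
    Measurable fun y => (gafEntire (consSeq 0 y)).1 z :=
  (EntireFun.measurable_apply z).comp measurable_gafEntire_consSeq

lemma measurable_deriv_gafEntire_consSeq (z : ℂ) :
    Measurable fun y => deriv (gafEntire (consSeq 0 y)).1 z :=
  EntireFun.measurable_eval_deriv.comp (measurable_gafEntire_consSeq.prodMk measurable_const)

/-- The joint law of the value and of the derivative, in terms of the higher coefficients. -/
lemma lintegral_apply_deriv_gafEntire (z : ℂ) {Ψ : ℂ → ℂ → ℝ≥0∞}
    (hΨ : Measurable (Function.uncurry Ψ)) :
    ∫⁻ x, Ψ ((gafEntire x).1 z) (deriv (gafEntire x).1 z) ∂gaussSeq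
      = ∫⁻ u, ∫⁻ y, gaussDensity (u - (gafEntire (consSeq 0 y)).1 z)
        * Ψ u (deriv (gafEntire (consSeq 0 y)).1 z) ∂gaussSeq := by
  have hg := measurable_gafEntire_consSeq_apply z
  have hd := measurable_deriv_gafEntire_consSeq z
  rw [lintegral_gaussSeq_consSeq
    (S := fun x => Ψ ((gafEntire x).1 z) (deriv (gafEntire x).1 z))
    (hΨ.comp (((EntireFun.measurable_apply z).comp measurable_gafEntire).prodMk
      (EntireFun.measurable_eval_deriv.comp (measurable_gafEntire.prodMk measurable_const))))]
  symm
  rw [lintegral_lintegral_swap]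
  symm
  · refine lintegral_congr_ae ?_
    filter_upwards [ae_consSeq_mem_gafGood] with y hy
    rw [← lintegral_add_right_eq_self (μ := volume)
      (fun u => gaussDensity (u - (gafEntire (consSeq 0 y)).1 z)
        * Ψ u (deriv (gafEntire (consSeq 0 y)).1 z)) ((gafEntire (consSeq 0 y)).1 z)]
    refine lintegral_congr fun w => ?_
    rw [gafEntire_consSeq (hy w), EntireFun.addAffine_apply, EntireFun.deriv_addAffine]
    simp
  · refine Measurable.aemeasurable (Measurable.mul ?_ ?_)
    · exact measurable_gaussDensity.comp (measurable_fst.sub (hg.comp measurable_snd))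
    · exact hΨ.comp (measurable_fst.prodMk (hd.comp measurable_snd))

/-- The left side is the density of `f(z)` at `0`, which is `1/(π s²)`, times the conditional mean
of `|f'(z)|²` given `f(z) = 0`. By independence that mean is the unconditional variance `π s²` of
the covariant derivative, and the factors cancel. -/
theorem lintegral_intensity (z : ℂ) :
    ∫⁻ y, gaussDensity ((gafEntire (consSeq 0 y)).1 z)
      * ‖deriv (gafEntire (consSeq 0 y)).1 z‖ₑ ^ 2 ∂gaussSeq = 1 := by
  set s : ℝ := Real.exp (Real.pi * ‖z‖ ^ 2 / 2) with hs
  have hs0 : 0 < s := Real.exp_pos _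
  have hs2 : s ^ 2 = Real.exp (Real.pi * ‖z‖ ^ 2) := by
    rw [hs, ← Real.exp_nat_mul]; congr 1; push_cast; ring
  have hg := measurable_gafEntire_consSeq_apply z
  have hd := measurable_deriv_gafEntire_consSeq z
  set W : ℂ → (ℕ → ℂ) → ℂ := fun u y =>
    deriv (gafEntire (consSeq 0 y)).1 z - Real.pi * starRingEnd ℂ z * u with hW
  have hWm : Measurable (Function.uncurry W) := by
    have : Measurable fun p : ℂ × (ℕ → ℂ) => deriv (gafEntire (consSeq 0 p.2)).1 z :=
      hd.comp measurable_snd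
    exact this.sub (measurable_fst.const_mul _)
  -- The value `u` of `f(z)` is kept as a variable, because the disintegration identity only tests
  -- against functions of `u`; the case `u = 0` is used afterwards.
  have hM : ∀ M : ℕ, ∀ u, ∫⁻ y, ENNReal.ofReal (gaussPdf (u - (gafEntire (consSeq 0 y)).1 z)
      * min (‖W u y‖ ^ 2) M) ∂gaussSeq = ENNReal.ofReal (gaussPdf (u / s) / s ^ 2
        * (∫⁻ x, ENNReal.ofReal (min (‖l1.lin (covCoef z) x‖ ^ 2) M) ∂gaussSeq).toReal) := by
    intro M u
    have hfin : ∫⁻ x, ENNReal.ofReal (min (‖l1.lin (covCoef z) x‖ ^ 2) M) ∂gaussSeq ≠ ∞ := by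
      refine ne_top_of_le_ne_top (lintegral_norm_sq_lin (covCoef z) ▸ ENNReal.ofReal_ne_top)
        (lintegral_mono fun x => ENNReal.ofReal_le_ofReal (min_le_left _ _))
    refine lintegral_eq_of_forall_lintegral_mul_eq (ν := gaussSeq) (C := M)
      (k := fun u y => gaussPdf (u - (gafEntire (consSeq 0 y)).1 z) * min (‖W u y‖ ^ 2) M)
      (p := fun u => gaussPdf (u / s) / s ^ 2
        * (∫⁻ x, ENNReal.ofReal (min (‖l1.lin (covCoef z) x‖ ^ 2) M) ∂gaussSeq).toReal)
      (fun y => ?_) ?_ (fun u y => ?_) (fun u y => ?_) ?_ (fun ψ hψ => ?_) u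
    · have := continuous_gaussPdf
      simp only [hW]
      fun_prop
    · refine Measurable.mul (continuous_gaussPdf.measurable.comp
        (measurable_fst.sub (hg.comp measurable_snd))) ?_
      exact (hWm.norm.pow_const 2).min measurable_const
    · exact mul_nonneg (gaussPdf_nonneg _) (le_min (by positivity) (by positivity))
    · calc _ ≤ 1 * (M : ℝ) := mul_le_mul (gaussPdf_le_one _) (min_le_right _ _)
            (le_min (by positivity) (by positivity)) zero_le_one
        _ = M := one_mul _
    · have := continuous_gaussPdf
      fun_prop
    · have h1 := lintegral_apply_deriv_gafEntire z (Ψ := fun u d => ψ u *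
        ENNReal.ofReal (min (‖d - Real.pi * starRingEnd ℂ z * u‖ ^ 2) M)) (by
          refine (hψ.comp measurable_fst).mul ?_
          fun_prop)
      have h2 : ∫⁻ x, ψ ((gafEntire x).1 z) * ENNReal.ofReal (min (‖deriv (gafEntire x).1 z
          - Real.pi * starRingEnd ℂ z * (gafEntire x).1 z‖ ^ 2) M) ∂gaussSeq
          = (∫⁻ u, ψ u * ENNReal.ofReal (gaussPdf (u / s) / s ^ 2))
            * ∫⁻ x, ENNReal.ofReal (min (‖l1.lin (covCoef z) x‖ ^ 2) M) ∂gaussSeq := by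
        rw [← lintegral_comp_lin hs0 (c := l1.evalCoef z) (by rw [gram_evalCoef_self, hs2]) hψ]
        have h3 := lintegral_mul_comp_lin (c := fun _ : Unit => l1.evalCoef z)
          (d := fun _ : Unit => covCoef z)
          (fun _ _ => by rw [gram_evalCoef_covCoef]; simp)
          (f := fun v => ψ (v ())) (g := fun v => ENNReal.ofReal (min (‖v ()‖ ^ 2) M))
          (hψ.comp (measurable_pi_apply ())) (by fun_prop)
        rw [← h3]
        refine lintegral_congr_ae ?_
        filter_upwards [ae_mem_gafGood, lin_covCoef_ae z] with x hx hx2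
        rw [hx2, gafEntire_apply hx]
      calc ∫⁻ u, ψ u * ∫⁻ y, ENNReal.ofReal (gaussPdf (u - (gafEntire (consSeq 0 y)).1 z)
              * min (‖W u y‖ ^ 2) M) ∂gaussSeq
          = ∫⁻ u, ∫⁻ y, gaussDensity (u - (gafEntire (consSeq 0 y)).1 z) * (ψ u *
            ENNReal.ofReal (min (‖W u y‖ ^ 2) M)) ∂gaussSeq := by
            refine lintegral_congr fun u => ?_
            rw [← lintegral_const_mul]
            · refine lintegral_congr fun y => ?_
              rw [gaussDensity_eq, ENNReal.ofReal_mul (gaussPdf_nonneg _)]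
              ring
            · refine ENNReal.measurable_ofReal.comp (Measurable.mul
                (continuous_gaussPdf.measurable.comp (measurable_const.sub hg)) ?_)
              exact ((hWm.comp (measurable_prodMk_left (x := u))).norm.pow_const 2).min
                measurable_const
        _ = _ := h1.symm
        _ = _ := h2
        _ = _ := by
            rw [← lintegral_mul_const' _ _ hfin]
            refine lintegral_congr fun u => ?_
            rw [ENNReal.ofReal_mul (div_nonneg (gaussPdf_nonneg _) (by positivity)),
              ENNReal.ofReal_toReal hfin, mul_assoc]
  have hcov : ∫⁻ x, ENNReal.ofReal (‖l1.lin (covCoef z) x‖ ^ 2) ∂gaussSeq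
      = ENNReal.ofReal (Real.pi * s ^ 2) := by
    rw [lintegral_norm_sq_lin, gram_covCoef_self, hs2, Complex.ofReal_re]
  have hL : AEMeasurable (fun x => ‖l1.lin (covCoef z) x‖ ^ 2) gaussSeq :=
    (l1.aemeasurable_lin _).norm.pow_const 2
  calc ∫⁻ y, gaussDensity ((gafEntire (consSeq 0 y)).1 z)
      * ‖deriv (gafEntire (consSeq 0 y)).1 z‖ₑ ^ 2 ∂gaussSeq
      = ∫⁻ y, ENNReal.ofReal (gaussPdf (0 - (gafEntire (consSeq 0 y)).1 z))
        * ENNReal.ofReal (‖W 0 y‖ ^ 2) ∂gaussSeq := by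
        refine lintegral_congr fun y => ?_
        rw [ENNReal.ofReal_pow (norm_nonneg _), ofReal_norm]
        simp [hW, gaussDensity_eq, gaussPdf]
    _ = ⨆ M : ℕ, ∫⁻ x, ENNReal.ofReal ((gaussPdf 0 / s ^ 2)
          * min (‖l1.lin (covCoef z) x‖ ^ 2) M) ∂gaussSeq := by
        rw [lintegral_ofReal_mul_eq_iSup
          (f := fun y => gaussPdf (0 - (gafEntire (consSeq 0 y)).1 z)) (g := fun y => ‖W 0 y‖ ^ 2)
          (continuous_gaussPdf.measurable.comp (measurable_const.sub hg)).aemeasurable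
          ((hWm.comp (measurable_prodMk_left (x := 0))).norm.pow_const 2).aemeasurable
          fun y => gaussPdf_nonneg _]
        refine iSup_congr fun M => ?_
        rw [hM M 0, zero_div, ENNReal.ofReal_mul (div_nonneg (gaussPdf_nonneg _) (by positivity)),
          ENNReal.ofReal_toReal (ne_top_of_le_ne_top (hcov ▸ ENNReal.ofReal_ne_top)
            (lintegral_mono fun x => ENNReal.ofReal_le_ofReal (min_le_left _ _))),
          ← lintegral_const_mul'' _ (hL.min aemeasurable_const).ennreal_ofReal]
        refine lintegral_congr fun x => ?_
        rw [ENNReal.ofReal_mul (div_nonneg (gaussPdf_nonneg _) (by positivity))]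
    _ = ENNReal.ofReal (gaussPdf 0 / s ^ 2) * ENNReal.ofReal (Real.pi * s ^ 2) := by
        rw [← lintegral_ofReal_mul_eq_iSup (f := fun _ => gaussPdf 0 / s ^ 2) aemeasurable_const hL
          fun _ => div_nonneg (gaussPdf_nonneg _) (by positivity),
          lintegral_const_mul'' _ hL.ennreal_ofReal, hcov]
    _ = 1 := by
        rw [← ENNReal.ofReal_mul (div_nonneg (gaussPdf_nonneg _) (by positivity)), gaussPdf_zero,
          ← ENNReal.ofReal_one]
        congr 1
        have := Real.pi_pos
        field_simp

/-! ## The two-point intensity of the zeros -/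

/-- The density of a pair of linear functionals, written through an orthogonal decomposition. -/
noncomputable def pairPdf (γ : ℂ) (s₁ s₂ : ℝ) (u : ℂ × ℂ) : ℝ :=
  gaussPdf (u.1 / s₁) / s₁ ^ 2 * (gaussPdf ((u.2 - γ * u.1) / s₂) / s₂ ^ 2)

lemma continuous_pairPdf (γ : ℂ) (s₁ s₂ : ℝ) : Continuous (pairPdf γ s₁ s₂) := by
  have := continuous_gaussPdf
  unfold pairPdf
  fun_prop

lemma pairPdf_nonneg (γ : ℂ) (s₁ s₂ : ℝ) (u : ℂ × ℂ) : 0 ≤ pairPdf γ s₁ s₂ u :=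
  mul_nonneg (div_nonneg (gaussPdf_nonneg _) (by positivity))
    (div_nonneg (gaussPdf_nonneg _) (by positivity))

lemma lintegral_comp_lin_pair {a b : l1} {γ : ℂ} {s₁ s₂ : ℝ} (hs₁ : 0 < s₁) (hs₂ : 0 < s₂)
    (ha : l1.gram a a = ((s₁ ^ 2 : ℝ) : ℂ))
    (hb : l1.gram (b - γ • a) (b - γ • a) = ((s₂ ^ 2 : ℝ) : ℂ))
    (hab : l1.gram a (b - γ • a) = 0) {ψ : ℂ × ℂ → ℝ≥0∞} (hψ : Measurable ψ) :
    ∫⁻ x, ψ (l1.lin a x, l1.lin b x) ∂gaussSeq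
      = ∫⁻ u, ψ u * ENNReal.ofReal (pairPdf γ s₁ s₂ u) := by
  have hi : IndepFun (l1.lin a) (l1.lin (b - γ • a)) gaussSeq :=
    (l1.indepFun_lin_of_gram_eq_zero (fun _ : Unit => a) (fun _ : Unit => b - γ • a)
      fun _ _ => hab).comp (measurable_pi_apply ()) (measurable_pi_apply ())
  have ham := l1.aemeasurable_lin a
  have hbm := l1.aemeasurable_lin (b - γ • a)
  have hpa := Measure.isProbabilityMeasure_map ham
  have hpb := Measure.isProbabilityMeasure_map hbm
  have hmap := (indepFun_iff_map_prod_eq_prod_map_map ham hbm).1 hi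
  have hψ' : Measurable fun p : ℂ × ℂ => ψ (p.1, p.2 + γ * p.1) :=
    hψ.comp (measurable_fst.prodMk (measurable_snd.add (measurable_fst.const_mul γ)))
  have hG := continuous_gaussPdf.measurable
  have e1 : ∫⁻ x, ψ (l1.lin a x, l1.lin b x) ∂gaussSeq
      = ∫⁻ x, ψ (l1.lin a x, l1.lin (b - γ • a) x + γ * l1.lin a x) ∂gaussSeq := by
    refine lintegral_congr_ae ?_
    filter_upwards [l1.lin_sub_ae b (γ • a)] with x hx
    rw [hx, l1.lin_smul, sub_add_cancel]
  have e2 : ∀ α : ℂ, ∫⁻ β, ψ (α, β + γ * α) ∂(gaussSeq.map (l1.lin (b - γ • a)))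
      = ∫⁻ v, ψ (α, v) * ENNReal.ofReal (gaussPdf ((v - γ * α) / s₂) / s₂ ^ 2) := by
    intro α
    have hm : Measurable fun β => ψ (α, β + γ * α) :=
      hψ.comp (measurable_const.prodMk (measurable_id.add_const _))
    rw [lintegral_map' hm.aemeasurable hbm, lintegral_comp_lin hs₂ hb hm,
      ← lintegral_add_right_eq_self (μ := volume)
        (fun v => ψ (α, v) * ENNReal.ofReal (gaussPdf ((v - γ * α) / s₂) / s₂ ^ 2)) (γ * α)]
    simp
  have hm2 : Measurable fun q : ℂ × ℂ =>
      ψ (q.1, q.2) * ENNReal.ofReal (gaussPdf ((q.2 - γ * q.1) / s₂) / s₂ ^ 2) :=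
    hψ.mul (ENNReal.measurable_ofReal.comp ((hG.comp (by fun_prop)).div_const _))
  have hm3 : Measurable fun α : ℂ => ∫⁻ v, ψ (α, v)
      * ENNReal.ofReal (gaussPdf ((v - γ * α) / s₂) / s₂ ^ 2) := hm2.lintegral_prod_right'
  rw [e1, ← lintegral_map' (f := fun p : ℂ × ℂ => ψ (p.1, p.2 + γ * p.1))
    (g := fun x => (l1.lin a x, l1.lin (b - γ • a) x)) hψ'.aemeasurable (ham.prodMk hbm), hmap,
    lintegral_prod _ hψ'.aemeasurable]
  simp_rw [e2]
  rw [lintegral_map' hm3.aemeasurable ham, lintegral_comp_lin hs₁ ha hm3,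
    Measure.volume_eq_prod, lintegral_prod]
  · refine lintegral_congr fun α => ?_
    rw [← lintegral_mul_const' _ _ ENNReal.ofReal_ne_top]
    refine lintegral_congr fun v => ?_
    rw [pairPdf, ENNReal.ofReal_mul (div_nonneg (gaussPdf_nonneg _) (by positivity))]
    ring
  · exact (hψ.mul (ENNReal.measurable_ofReal.comp (continuous_pairPdf γ s₁ s₂).measurable)).aemeasurable

/-- A conditional second moment computed from a disintegration. -/
lemma lintegral_kernel_eq_of_disintegration {a b w₁ w₂ : l1} {γ : ℂ} {s₁ s₂ : ℝ}
    (hs₁ : 0 < s₁) (hs₂ : 0 < s₂)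
    (ha : l1.gram a a = ((s₁ ^ 2 : ℝ) : ℂ))
    (hb : l1.gram (b - γ • a) (b - γ • a) = ((s₂ ^ 2 : ℝ) : ℂ))
    (hab : l1.gram a (b - γ • a) = 0)
    (h1 : l1.gram a w₁ = 0) (h2 : l1.gram a w₂ = 0) (h3 : l1.gram b w₁ = 0)
    (h4 : l1.gram b w₂ = 0)
    {k : ℂ × ℂ → (ℕ → ℂ) → ℝ} {W₁ W₂ : ℂ × ℂ → (ℕ → ℂ) → ℂ} {C : ℝ}
    (hk : ∀ y, Continuous fun u => k u y) (hkm : Measurable (Function.uncurry k))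
    (hk0 : ∀ u y, 0 ≤ k u y) (hkC : ∀ u y, k u y ≤ C)
    (hW₁ : ∀ y, Continuous fun u => W₁ u y) (hW₁m : Measurable (Function.uncurry W₁))
    (hW₂ : ∀ y, Continuous fun u => W₂ u y) (hW₂m : Measurable (Function.uncurry W₂))
    (h : ∀ (ψ : ℂ × ℂ → ℝ≥0∞) (H : ℂ → ℂ → ℝ≥0∞), Measurable ψ → Measurable (Function.uncurry H) →
      ∫⁻ x, ψ (l1.lin a x, l1.lin b x) * H (l1.lin w₁ x) (l1.lin w₂ x) ∂gaussSeq
        = ∫⁻ u, ψ u * ∫⁻ y, ENNReal.ofReal (k u y) * H (W₁ u y) (W₂ u y) ∂gaussSeq) :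
    ∫⁻ y, ENNReal.ofReal (k 0 y) * ENNReal.ofReal (‖W₁ 0 y‖ ^ 2 * ‖W₂ 0 y‖ ^ 2) ∂gaussSeq
      = ENNReal.ofReal (1 / (Real.pi ^ 2 * (s₁ ^ 2 * s₂ ^ 2))
        * ((l1.gram w₁ w₁).re * (l1.gram w₂ w₂).re + ‖l1.gram w₁ w₂‖ ^ 2)) := by
  have hL : AEMeasurable (fun x => ‖l1.lin w₁ x‖ ^ 2 * ‖l1.lin w₂ x‖ ^ 2) gaussSeq :=
    ((l1.aemeasurable_lin _).norm.pow_const 2).mul ((l1.aemeasurable_lin _).norm.pow_const 2)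
  have hLI : ∫⁻ x, ENNReal.ofReal (‖l1.lin w₁ x‖ ^ 2 * ‖l1.lin w₂ x‖ ^ 2) ∂gaussSeq
      = ENNReal.ofReal ((l1.gram w₁ w₁).re * (l1.gram w₂ w₂).re + ‖l1.gram w₁ w₂‖ ^ 2) := by
    rw [← ofReal_integral_eq_lintegral_ofReal (l1.integrable_norm_sq_mul_norm_sq_lin w₁ w₂)
      (ae_of_all _ fun x => by positivity), l1.integral_norm_sq_mul_norm_sq_lin]
  have hp := pairPdf_nonneg γ s₁ s₂
  have hfin : ∀ M : ℕ, ∫⁻ x, ENNReal.ofReal (min (‖l1.lin w₁ x‖ ^ 2 * ‖l1.lin w₂ x‖ ^ 2) M)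
      ∂gaussSeq ≠ ∞ := fun M =>
    ne_top_of_le_ne_top (hLI ▸ ENNReal.ofReal_ne_top)
      (lintegral_mono fun x => ENNReal.ofReal_le_ofReal (min_le_left _ _))
  have hN : ∀ u : ℂ × ℂ, Measurable fun y => ‖W₁ u y‖ ^ 2 * ‖W₂ u y‖ ^ 2 := fun u =>
    ((hW₁m.comp (measurable_prodMk_left (x := u))).norm.pow_const 2).mul
      ((hW₂m.comp (measurable_prodMk_left (x := u))).norm.pow_const 2)
  have hku : ∀ u, Measurable (k u) := fun u => hkm.of_uncurry_left
  -- Truncation at `M` makes the integrand bounded, as the passage from almost every `u` to every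
  -- `u` demands. The two functionals `w₁`, `w₂` are orthogonal to `a` and `b`, so their moment
  -- factors out.
  have hM : ∀ (M : ℕ) (u : ℂ × ℂ),
      ∫⁻ y, ENNReal.ofReal (k u y * min (‖W₁ u y‖ ^ 2 * ‖W₂ u y‖ ^ 2) M) ∂gaussSeq
      = ENNReal.ofReal (pairPdf γ s₁ s₂ u
        * (∫⁻ x, ENNReal.ofReal (min (‖l1.lin w₁ x‖ ^ 2 * ‖l1.lin w₂ x‖ ^ 2) M)
          ∂gaussSeq).toReal) := by
    intro M u
    refine lintegral_eq_of_forall_lintegral_mul_eq (ν := gaussSeq) (C := C * M)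
      (k := fun u y => k u y * min (‖W₁ u y‖ ^ 2 * ‖W₂ u y‖ ^ 2) M)
      (p := fun u => pairPdf γ s₁ s₂ u
        * (∫⁻ x, ENNReal.ofReal (min (‖l1.lin w₁ x‖ ^ 2 * ‖l1.lin w₂ x‖ ^ 2) M)
          ∂gaussSeq).toReal)
      (fun y => ?_) ?_ (fun u y => ?_) (fun u y => ?_) ?_ (fun ψ hψ => ?_) u
    · have := hk y
      have := hW₁ y
      have := hW₂ y
      fun_prop
    · exact hkm.mul (((hW₁m.norm.pow_const 2).mul (hW₂m.norm.pow_const 2)).min measurable_const)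
    · exact mul_nonneg (hk0 u y) (le_min (by positivity) (by positivity))
    · exact mul_le_mul (hkC u y) (min_le_right _ _) (le_min (by positivity) (by positivity))
        ((hk0 u y).trans (hkC u y))
    · exact (continuous_pairPdf γ s₁ s₂).mul_const _
    · have e1 := h ψ (fun α β => ENNReal.ofReal (min (‖α‖ ^ 2 * ‖β‖ ^ 2) M)) hψ (by fun_prop)
      have e2 := lintegral_mul_comp_lin (c := ![a, b]) (d := ![w₁, w₂])
        (fun i j => by fin_cases i <;> fin_cases j <;> simpa)
        (f := fun v => ψ (v 0, v 1))
        (g := fun v => ENNReal.ofReal (min (‖v 0‖ ^ 2 * ‖v 1‖ ^ 2) M))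
        (hψ.comp (by fun_prop)) (by fun_prop)
      simp only [Matrix.cons_val_zero, Matrix.cons_val_one] at e2
      rw [lintegral_comp_lin_pair hs₁ hs₂ ha hb hab hψ] at e2
      calc _ = ∫⁻ u, ψ u * ∫⁻ y, ENNReal.ofReal (k u y)
            * ENNReal.ofReal (min (‖W₁ u y‖ ^ 2 * ‖W₂ u y‖ ^ 2) M) ∂gaussSeq := by
            refine lintegral_congr fun u => ?_
            congr 1
            exact lintegral_congr fun y => ENNReal.ofReal_mul (hk0 u y)
        _ = _ := e1.symm.trans e2
        _ = _ := by
            rw [← lintegral_mul_const' _ _ (hfin M)]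
            refine lintegral_congr fun u => ?_
            rw [ENNReal.ofReal_mul (hp u), ENNReal.ofReal_toReal (hfin M), mul_assoc]
  have hp0 : pairPdf γ s₁ s₂ 0 = 1 / (Real.pi ^ 2 * (s₁ ^ 2 * s₂ ^ 2)) := by
    have := Real.pi_pos
    simp only [pairPdf, Prod.fst_zero, Prod.snd_zero, zero_div, mul_zero, sub_zero, gaussPdf_zero]
    field_simp
  rw [lintegral_ofReal_mul_eq_iSup (hku 0).aemeasurable (hN 0).aemeasurable (hk0 0)]
  simp_rw [hM _ 0, ENNReal.ofReal_mul (hp 0), ENNReal.ofReal_toReal (hfin _),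
    ← lintegral_const_mul'' _ (hL.min aemeasurable_const).ennreal_ofReal,
    ← ENNReal.ofReal_mul (hp 0)]
  rw [← lintegral_ofReal_mul_eq_iSup (f := fun _ => pairPdf γ s₁ s₂ 0) aemeasurable_const hL
    fun _ => hp 0, lintegral_const_mul'' _ hL.ennreal_ofReal, hLI, hp0,
    ← ENNReal.ofReal_mul (by positivity)]

/-- The coefficient of `z` in the random function, in terms of its values at two points. -/
noncomputable def slopeAt (g : EntireFun) (z₁ z₂ : ℂ) (u : ℂ × ℂ) : ℂ :=
  (u.2 - u.1 - (g.1 z₂ - g.1 z₁)) / (z₂ - z₁) / (Real.sqrt Real.pi : ℂ)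

lemma slopeAt_zero (g : EntireFun) (z₁ z₂ : ℂ) : slopeAt g z₁ z₂ 0 = slopeCoef g z₁ z₂ := by
  simp only [slopeAt, slopeCoef, Prod.fst_zero, Prod.snd_zero]
  ring

lemma enorm_inv_sq_sqrt_pi_mul (d : ℂ) (hd : d ≠ 0) :
    ‖(Real.sqrt Real.pi : ℂ) * d‖ₑ⁻¹ ^ 2 = ENNReal.ofReal (1 / (Real.pi * ‖d‖ ^ 2)) := by
  have h0 : 0 < ‖(Real.sqrt Real.pi : ℂ) * d‖ := norm_pos_iff.2 (mul_ne_zero sqrt_pi_ne_zero hd)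
  rw [← ofReal_norm, ← ENNReal.ofReal_inv_of_pos h0, ← ENNReal.ofReal_pow (by positivity)]
  congr 1
  rw [norm_mul, Complex.norm_real, Real.norm_eq_abs, abs_of_nonneg (Real.sqrt_nonneg _), inv_pow,
    mul_pow, Real.sq_sqrt Real.pi_pos.le, one_div]

/-- The joint law of the values and the derivatives at two points, in terms of the higher
coefficients. -/
lemma lintegral_apply_deriv_gafEntire_pair {z₁ z₂ : ℂ} (hz : z₂ - z₁ ≠ 0)
    {Ψ : ℂ × ℂ → ℂ → ℂ → ℝ≥0∞} (hΨ : Measurable fun p : (ℂ × ℂ) × ℂ × ℂ => Ψ p.1 p.2.1 p.2.2) :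
    ∫⁻ x, Ψ ((gafEntire x).1 z₁, (gafEntire x).1 z₂) (deriv (gafEntire x).1 z₁)
        (deriv (gafEntire x).1 z₂) ∂gaussSeq
      = ∫⁻ u, ∫⁻ y, ENNReal.ofReal (1 / (Real.pi * ‖z₂ - z₁‖ ^ 2))
        * (gaussDensity (slopeAt (gafEntire (consSeq 0 (consSeq 0 y))) z₁ z₂ u)
          * gaussDensity (u.1 - (Real.sqrt Real.pi
              * slopeAt (gafEntire (consSeq 0 (consSeq 0 y))) z₁ z₂ u * z₁
              + (gafEntire (consSeq 0 (consSeq 0 y))).1 z₁))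
        * Ψ u (Real.sqrt Real.pi * slopeAt (gafEntire (consSeq 0 (consSeq 0 y))) z₁ z₂ u
            + deriv (gafEntire (consSeq 0 (consSeq 0 y))).1 z₁)
          (Real.sqrt Real.pi * slopeAt (gafEntire (consSeq 0 (consSeq 0 y))) z₁ z₂ u
            + deriv (gafEntire (consSeq 0 (consSeq 0 y))).1 z₂)) ∂gaussSeq := by
  set r : ℂ := (Real.sqrt Real.pi : ℂ) with hr
  have hr0 : r ≠ 0 := sqrt_pi_ne_zero
  set G : (ℕ → ℂ) → EntireFun := fun y => gafEntire (consSeq 0 (consSeq 0 y)) with hG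
  have hGm : Measurable G := measurable_gafEntire_consSeq_consSeq
  let S : EntireFun → ℝ≥0∞ := fun f => Ψ (f.1 z₁, f.1 z₂) (deriv f.1 z₁) (deriv f.1 z₂)
  have hS : Measurable S := by
    refine hΨ.comp (Measurable.prodMk ((measurable_apply z₁).prodMk (measurable_apply z₂))
      (Measurable.prodMk ?_ ?_)) <;>
    exact measurable_eval_deriv.comp (measurable_id.prodMk measurable_const)
  let T : EntireFun → ℝ≥0∞ := fun h => ∫⁻ w₀, gaussDensity w₀ * S (addAffine h w₀ 0)
  have hT : Measurable T := by
    have h1 : Measurable fun p : EntireFun × ℂ => addAffine p.1 p.2 0 :=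
      measurable_addAffine.comp (measurable_fst.prodMk (measurable_snd.prodMk measurable_const))
    exact ((measurable_gaussDensity.comp measurable_snd).mul
      (hS.comp h1)).lintegral_prod_right'
  have e1 : ∫⁻ x, S (gafEntire x) ∂gaussSeq = ∫⁻ y, T (gafEntire (consSeq 0 y)) ∂gaussSeq := by
    rw [lintegral_gaussSeq_consSeq (S := fun x => S (gafEntire x)) (hS.comp measurable_gafEntire)]
    refine lintegral_congr_ae ?_
    filter_upwards [ae_consSeq_mem_gafGood] with y hy
    refine lintegral_congr fun w => ?_
    rw [gafEntire_consSeq (hy w)]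
  have e2 : ∫⁻ y, T (gafEntire (consSeq 0 y)) ∂gaussSeq
      = ∫⁻ y, (∫⁻ w₁, gaussDensity w₁ * T (addAffine (G y) 0 (r * w₁))) ∂gaussSeq := by
    rw [lintegral_gaussSeq_consSeq (S := fun y => T (gafEntire (consSeq 0 y)))
      (hT.comp measurable_gafEntire_consSeq)]
    refine lintegral_congr_ae ?_
    filter_upwards [ae_consSeq_consSeq_mem_gafGood] with y hy
    refine lintegral_congr fun w => ?_
    rw [gafEntire_consSeq_consSeq (hy 0 w)]
  let Q : EntireFun → ℂ × ℂ → ℝ≥0∞ := fun g u => gaussDensity (slopeAt g z₁ z₂ u)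
    * gaussDensity (u.1 - (r * slopeAt g z₁ z₂ u * z₁ + g.1 z₁))
    * Ψ u (r * slopeAt g z₁ z₂ u + deriv g.1 z₁) (r * slopeAt g z₁ z₂ u + deriv g.1 z₂)
  have hQ : Measurable (Function.uncurry Q) := by
    have m1 : Measurable fun p : EntireFun × ℂ × ℂ => p.1.1 z₁ :=
      (measurable_apply z₁).comp measurable_fst
    have m2 : Measurable fun p : EntireFun × ℂ × ℂ => p.1.1 z₂ :=
      (measurable_apply z₂).comp measurable_fst
    have m3 : Measurable fun p : EntireFun × ℂ × ℂ => deriv p.1.1 z₁ :=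
      measurable_eval_deriv.comp (measurable_fst.prodMk measurable_const)
    have m4 : Measurable fun p : EntireFun × ℂ × ℂ => deriv p.1.1 z₂ :=
      measurable_eval_deriv.comp (measurable_fst.prodMk measurable_const)
    have m5 : Measurable fun p : EntireFun × ℂ × ℂ => slopeAt p.1 z₁ z₂ p.2 := by
      unfold slopeAt
      fun_prop
    have m6 : Measurable fun p : EntireFun × ℂ × ℂ =>
        p.2.1 - (r * slopeAt p.1 z₁ z₂ p.2 * z₁ + p.1.1 z₁) := by fun_prop
    refine ((measurable_gaussDensity.comp m5).mul (measurable_gaussDensity.comp m6)).mul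
      (hΨ.comp (measurable_snd.prodMk (Measurable.prodMk ?_ ?_))) <;> fun_prop
  have key : ∀ g : EntireFun, ∫⁻ w₁, gaussDensity w₁ * T (addAffine g 0 (r * w₁))
      = ∫⁻ u, ENNReal.ofReal (1 / (Real.pi * ‖z₂ - z₁‖ ^ 2)) * Q g u := by
    intro g
    have hQg : Measurable (Q g) := hQ.of_uncurry_left
    -- Change of variables from the two lowest coefficients to the two values: the constant term is
    -- translated to give the value `u₁` at `z₁`, and for fixed `u₁` the value at `z₂` is affine in
    -- `w` with slope `r (z₂ - z₁)`, whence the Jacobian `1/(π|z₂ - z₁|²)`.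
    let R : ℂ → ℂ → ℝ≥0∞ := fun w u₁ => gaussDensity w
      * gaussDensity (u₁ - (r * w * z₁ + g.1 z₁))
      * Ψ (u₁, u₁ + r * w * (z₂ - z₁) + (g.1 z₂ - g.1 z₁)) (r * w + deriv g.1 z₁)
        (r * w + deriv g.1 z₂)
    have hR : Measurable (Function.uncurry R) := by
      refine ((measurable_gaussDensity.comp measurable_fst).mul (measurable_gaussDensity.comp
        (by fun_prop))).mul (hΨ.comp (g := fun p : (ℂ × ℂ) × ℂ × ℂ => Ψ p.1 p.2.1 p.2.2)
          (f := fun q : ℂ × ℂ => ((q.2, q.2 + r * q.1 * (z₂ - z₁) + (g.1 z₂ - g.1 z₁)),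
            (r * q.1 + deriv g.1 z₁, r * q.1 + deriv g.1 z₂))) (by fun_prop))
    have f1 : ∀ w, gaussDensity w * T (addAffine g 0 (r * w)) = ∫⁻ u₁, R w u₁ := by
      intro w
      rw [← lintegral_const_mul' (gaussDensity w) _ ENNReal.ofReal_ne_top,
        ← lintegral_add_right_eq_self (μ := volume) (R w) (r * w * z₁ + g.1 z₁)]
      refine lintegral_congr fun w₀ => ?_
      simp only [R, S, addAffine_apply, deriv_addAffine, add_sub_cancel_right]
      rw [← mul_assoc (gaussDensity w), show w₀ + 0 * z₁ + (0 + r * w * z₁ + g.1 z₁)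
        = w₀ + (r * w * z₁ + g.1 z₁) by ring, show w₀ + 0 * z₂ + (0 + r * w * z₂ + g.1 z₂)
        = w₀ + (r * w * z₁ + g.1 z₁) + r * w * (z₂ - z₁) + (g.1 z₂ - g.1 z₁) by ring, zero_add, zero_add]
    simp_rw [f1]
    rw [lintegral_lintegral_swap hR.aemeasurable, lintegral_const_mul' _ _ ENNReal.ofReal_ne_top,
      Measure.volume_eq_prod, lintegral_prod _ hQg.aemeasurable,
      ← lintegral_const_mul' _ _ ENNReal.ofReal_ne_top]
    refine lintegral_congr fun u₁ => ?_
    rw [lintegral_comp_affine (F := fun w => R w u₁) hR.of_uncurry_right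
      (mul_ne_zero hr0 hz) (u₁ + (g.1 z₂ - g.1 z₁)), enorm_inv_sq_sqrt_pi_mul _ hz]
    congr 1
    refine lintegral_congr fun u₂ => ?_
    have hs : (u₂ - (u₁ + (g.1 z₂ - g.1 z₁))) / (r * (z₂ - z₁)) = slopeAt g z₁ z₂ (u₁, u₂) := by
      rw [slopeAt, ← hr, div_div, mul_comm r, sub_add_eq_sub_sub]
    have hs2 : u₁ + r * slopeAt g z₁ z₂ (u₁, u₂) * (z₂ - z₁) + (g.1 z₂ - g.1 z₁) = u₂ := by
      rw [slopeAt, ← hr]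
      field_simp
      ring
    simp only [R, hs, hs2, Q]
  have swap : ∀ (q : EntireFun → ℂ × ℂ → ℝ≥0∞) (b : ℝ≥0∞), Measurable (Function.uncurry q) →
      ∫⁻ y, (∫⁻ u, b * q (G y) u) ∂gaussSeq = ∫⁻ u, ∫⁻ y, b * q (G y) u ∂gaussSeq := by
    intro q b hq
    have hq' : Measurable fun p : (ℕ → ℂ) × ℂ × ℂ => Function.uncurry q (G p.1, p.2) :=
      hq.comp ((hGm.comp measurable_fst).prodMk measurable_snd)
    rw [lintegral_lintegral_swap]
    exact (hq'.const_mul b).aemeasurable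
  calc _ = ∫⁻ x, S (gafEntire x) ∂gaussSeq := rfl
    _ = ∫⁻ y, (∫⁻ u, ENNReal.ofReal (1 / (Real.pi * ‖z₂ - z₁‖ ^ 2)) * Q (G y) u) ∂gaussSeq := by
        rw [e1, e2]
        exact lintegral_congr fun y => key (G y)
    _ = _ := swap Q _ hQ

/-! ### Projection on two vectors and the Gram matrix of the residuals. -/

namespace l1

/-- The residual of `p` after projection on the plane of `a` and `b`, when `p` is orthogonal
to `a`. -/
noncomputable def residual (a b p : l1) : l1 :=
  p - (gram p b * gram a a / (gram a a * gram b b - gram a b * gram b a)) •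
    (b - (gram b a / gram a a) • a)

variable {a b p : l1}

lemma gram_residual_fst (ha : gram a a ≠ 0) (hpa : gram p a = 0) :
    gram (residual a b p) a = 0 := by
  rw [residual, gram_sub_left, gram_smul_left, gram_sub_left, gram_smul_left, hpa]
  field_simp
  ring

lemma gram_residual_snd (ha : gram a a ≠ 0)
    (hD : gram a a * gram b b - gram a b * gram b a ≠ 0) :
    gram (residual a b p) b = 0 := by
  rw [residual, gram_sub_left, gram_smul_left, gram_sub_left, gram_smul_left]
  field_simp
  ring

lemma gram_fst_residual (ha : gram a a ≠ 0) (hpa : gram p a = 0) :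
    gram a (residual a b p) = 0 := by
  rw [← conj_gram, gram_residual_fst ha hpa, map_zero]

lemma gram_snd_residual (ha : gram a a ≠ 0)
    (hD : gram a a * gram b b - gram a b * gram b a ≠ 0) :
    gram b (residual a b p) = 0 := by
  rw [← conj_gram, gram_residual_snd ha hD, map_zero]

/-- Only one factor has to be expanded: the residual is already orthogonal to `a` and to `b`. The
result is the Schur complement, simplified because `p` is orthogonal to `a`. -/
lemma gram_residual_self (ha : gram a a ≠ 0) (hpa : gram p a = 0)
    (hD : gram a a * gram b b - gram a b * gram b a ≠ 0) :
    gram (residual a b p) (residual a b p) = gram p p - gram p b * gram b p * gram a a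
      / (gram a a * gram b b - gram a b * gram b a) := by
  have hap : gram a p = 0 := by rw [← conj_gram, hpa, map_zero]
  conv_lhs => enter [2]; rw [residual]
  rw [gram_sub_right, gram_smul_right, gram_sub_right, gram_smul_right, gram_residual_fst ha hpa,
    gram_residual_snd ha hD, residual, gram_sub_left, gram_smul_left, gram_sub_left,
    gram_smul_left, hap]
  field_simp
  ring

/-- The roles of `a` and `b` are exchanged in the second residual, since the covariant derivative at
each point is orthogonal to the value at that same point. -/
lemma gram_residual_residual {q : l1} (ha : gram a a ≠ 0) (hpa : gram p a = 0)
    (hqb : gram q b = 0) (hD : gram a a * gram b b - gram a b * gram b a ≠ 0) :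
    gram (residual a b p) (residual b a q) = gram p q + gram p b * gram b a * gram a q
      / (gram a a * gram b b - gram a b * gram b a) := by
  have hbq : gram b q = 0 := by rw [← conj_gram, hqb, map_zero]
  conv_lhs => enter [2]; rw [residual]
  rw [gram_sub_right, gram_smul_right, gram_sub_right, gram_smul_right, gram_residual_fst ha hpa,
    gram_residual_snd ha hD, residual, gram_sub_left, gram_smul_left, gram_sub_left,
    gram_smul_left, hbq]
  field_simp
  ring

end l1

/-- The two-point intensity, as a function of `t = π |z₁ - z₂|²`. -/
noncomputable def pairIntensity (t : ℝ) : ℝ :=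
  ((1 - t * Real.exp (-t) / (1 - Real.exp (-t))) ^ 2
    + Real.exp (-t) * (1 - t / (1 - Real.exp (-t))) ^ 2) / (1 - Real.exp (-t))

section Grams

variable {z₁ z₂ : ℂ}

/-- After division by the variances, the squared correlation depends on the distance alone; for this
reason the pair intensity is a function of `π|z₁ - z₂|²`. -/
lemma gram_evalCoef_mul_gram_evalCoef (z₁ z₂ : ℂ) :
    l1.gram (l1.evalCoef z₁) (l1.evalCoef z₂) * l1.gram (l1.evalCoef z₂) (l1.evalCoef z₁)
      = ((Real.exp (Real.pi * ‖z₁‖ ^ 2) * Real.exp (Real.pi * ‖z₂‖ ^ 2)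
        * Real.exp (-(Real.pi * ‖z₁ - z₂‖ ^ 2)) : ℝ) : ℂ) := by
  rw [l1.gram_evalCoef, l1.gram_evalCoef, ← Complex.exp_add]
  push_cast
  rw [← Complex.exp_add, ← Complex.exp_add]
  congr 1
  simp only [← Complex.mul_conj', map_sub]
  ring

lemma norm_gram_evalCoef_sq (z₁ z₂ : ℂ) :
    ‖l1.gram (l1.evalCoef z₁) (l1.evalCoef z₂)‖ ^ 2
      = Real.exp (Real.pi * ‖z₁‖ ^ 2) * Real.exp (Real.pi * ‖z₂‖ ^ 2)
        * Real.exp (-(Real.pi * ‖z₁ - z₂‖ ^ 2)) := by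
  have h := gram_evalCoef_mul_gram_evalCoef z₁ z₂
  rw [← l1.conj_gram (l1.evalCoef z₁) (l1.evalCoef z₂), Complex.mul_conj'] at h
  exact_mod_cast h

lemma gram_det_evalCoef (z₁ z₂ : ℂ) :
    l1.gram (l1.evalCoef z₁) (l1.evalCoef z₁) * l1.gram (l1.evalCoef z₂) (l1.evalCoef z₂)
      - l1.gram (l1.evalCoef z₁) (l1.evalCoef z₂) * l1.gram (l1.evalCoef z₂) (l1.evalCoef z₁)
      = ((Real.exp (Real.pi * ‖z₁‖ ^ 2) * Real.exp (Real.pi * ‖z₂‖ ^ 2)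
        * (1 - Real.exp (-(Real.pi * ‖z₁ - z₂‖ ^ 2))) : ℝ) : ℂ) := by
  rw [gram_evalCoef_mul_gram_evalCoef, gram_evalCoef_self, gram_evalCoef_self]
  push_cast
  ring

lemma one_sub_exp_neg_pos (h : z₁ ≠ z₂) : 0 < 1 - Real.exp (-(Real.pi * ‖z₁ - z₂‖ ^ 2)) := by
  have : 0 < ‖z₁ - z₂‖ := norm_pos_iff.2 (sub_ne_zero.2 h)
  have := Real.pi_pos
  rw [sub_pos, Real.exp_lt_one_iff]
  have : 0 < Real.pi * ‖z₁ - z₂‖ ^ 2 := by positivity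
  linarith

lemma gram_evalCoef_self_ne_zero (z : ℂ) : l1.gram (l1.evalCoef z) (l1.evalCoef z) ≠ 0 := by
  rw [gram_evalCoef_self]
  exact Complex.ofReal_ne_zero.2 (Real.exp_pos _).ne'

lemma gram_det_evalCoef_ne_zero (h : z₁ ≠ z₂) :
    l1.gram (l1.evalCoef z₁) (l1.evalCoef z₁) * l1.gram (l1.evalCoef z₂) (l1.evalCoef z₂)
      - l1.gram (l1.evalCoef z₁) (l1.evalCoef z₂) * l1.gram (l1.evalCoef z₂) (l1.evalCoef z₁)
      ≠ 0 := by
  rw [gram_det_evalCoef]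
  have := one_sub_exp_neg_pos h
  exact Complex.ofReal_ne_zero.2 (by positivity)

lemma gram_covCoef_evalCoef_self (z : ℂ) : l1.gram (covCoef z) (l1.evalCoef z) = 0 := by
  rw [gram_covCoef_evalCoef]; simp

/-- The part of the derivative at `z₁` that is independent of the values at `z₁` and `z₂`. -/
noncomputable def resCoef (z₁ z₂ : ℂ) : l1 :=
  l1.residual (l1.evalCoef z₁) (l1.evalCoef z₂) (covCoef z₁)

lemma gram_resCoef_self (h : z₁ ≠ z₂) : l1.gram (resCoef z₁ z₂) (resCoef z₁ z₂)
    = ((Real.pi * Real.exp (Real.pi * ‖z₁‖ ^ 2) * (1 - Real.pi * ‖z₁ - z₂‖ ^ 2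
        * Real.exp (-(Real.pi * ‖z₁ - z₂‖ ^ 2))
          / (1 - Real.exp (-(Real.pi * ‖z₁ - z₂‖ ^ 2)))) : ℝ) : ℂ) := by
  have hq : ((1 - Real.exp (-(Real.pi * ‖z₁ - z₂‖ ^ 2)) : ℝ) : ℂ) ≠ 0 :=
    Complex.ofReal_ne_zero.2 (one_sub_exp_neg_pos h).ne'
  have e : l1.gram (covCoef z₁) (l1.evalCoef z₂) * l1.gram (l1.evalCoef z₂) (covCoef z₁)
      = Real.pi ^ 2 * ((‖z₁ - z₂‖ ^ 2 : ℝ) : ℂ) * (l1.gram (l1.evalCoef z₁) (l1.evalCoef z₂)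
        * l1.gram (l1.evalCoef z₂) (l1.evalCoef z₁)) := by
    rw [gram_covCoef_evalCoef, gram_evalCoef_covCoef, l1.gram_evalCoef, l1.gram_evalCoef]
    push_cast
    rw [← Complex.mul_conj', map_sub]
    ring
  rw [resCoef, l1.gram_residual_self (gram_evalCoef_self_ne_zero _) (gram_covCoef_evalCoef_self _)
    (gram_det_evalCoef_ne_zero h), gram_det_evalCoef, e, gram_evalCoef_mul_gram_evalCoef,
    gram_covCoef_self, gram_evalCoef_self]
  have h1 := (Real.exp_pos (Real.pi * ‖z₁‖ ^ 2)).ne'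
  have h2 := (Real.exp_pos (Real.pi * ‖z₂‖ ^ 2)).ne'
  have h3 := (one_sub_exp_neg_pos h).ne'
  norm_cast
  field_simp

lemma gram_resCoef_resCoef (h : z₁ ≠ z₂) : l1.gram (resCoef z₁ z₂) (resCoef z₂ z₁)
    = ((Real.pi * (1 - Real.pi * ‖z₁ - z₂‖ ^ 2
          / (1 - Real.exp (-(Real.pi * ‖z₁ - z₂‖ ^ 2)))) : ℝ) : ℂ)
      * l1.gram (l1.evalCoef z₁) (l1.evalCoef z₂) := by
  have e : l1.gram (covCoef z₁) (l1.evalCoef z₂) * l1.gram (l1.evalCoef z₂) (l1.evalCoef z₁)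
        * l1.gram (l1.evalCoef z₁) (covCoef z₂)
      = -(Real.pi ^ 2 * ((‖z₁ - z₂‖ ^ 2 : ℝ) : ℂ) * (l1.gram (l1.evalCoef z₁) (l1.evalCoef z₂)
        * l1.gram (l1.evalCoef z₂) (l1.evalCoef z₁)))
        * l1.gram (l1.evalCoef z₁) (l1.evalCoef z₂) := by
    rw [gram_covCoef_evalCoef, gram_evalCoef_covCoef, l1.gram_evalCoef, l1.gram_evalCoef]
    push_cast
    rw [← Complex.mul_conj', map_sub]
    ring
  have e2 : l1.gram (covCoef z₁) (covCoef z₂)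
      = ((Real.pi - Real.pi ^ 2 * ‖z₁ - z₂‖ ^ 2 : ℝ) : ℂ)
        * l1.gram (l1.evalCoef z₁) (l1.evalCoef z₂) := by
    rw [gram_covCoef, l1.gram_evalCoef]
    push_cast
    rw [← Complex.mul_conj', map_sub]
  rw [resCoef, resCoef, l1.gram_residual_residual (gram_evalCoef_self_ne_zero _)
    (gram_covCoef_evalCoef_self _) (gram_covCoef_evalCoef_self _)
    (gram_det_evalCoef_ne_zero h), gram_det_evalCoef, e, gram_evalCoef_mul_gram_evalCoef, e2,
    mul_div_right_comm, ← add_mul]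
  congr 1
  have h1 := (Real.exp_pos (Real.pi * ‖z₁‖ ^ 2)).ne'
  have h2 := (Real.exp_pos (Real.pi * ‖z₂‖ ^ 2)).ne'
  have h3 := (one_sub_exp_neg_pos h).ne'
  norm_cast
  field_simp
  ring

end Grams

/-- The residual differs from the derivative by a combination of the two values, so it equals the
derivative when both points are zeros. -/
lemma lin_resCoef_ae (z₁ z₂ : ℂ) : ∃ α β : ℂ, ∀ᵐ x ∂gaussSeq, l1.lin (resCoef z₁ z₂) x
    = deriv (gafEntire x).1 z₁ + α * (gafEntire x).1 z₁ + β * (gafEntire x).1 z₂ := by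
  set B : ℂ := l1.gram (covCoef z₁) (l1.evalCoef z₂) * l1.gram (l1.evalCoef z₁) (l1.evalCoef z₁)
    / (l1.gram (l1.evalCoef z₁) (l1.evalCoef z₁) * l1.gram (l1.evalCoef z₂) (l1.evalCoef z₂)
      - l1.gram (l1.evalCoef z₁) (l1.evalCoef z₂) * l1.gram (l1.evalCoef z₂) (l1.evalCoef z₁))
    with hB
  set A : ℂ := l1.gram (l1.evalCoef z₂) (l1.evalCoef z₁)
    / l1.gram (l1.evalCoef z₁) (l1.evalCoef z₁) with hA
  refine ⟨B * A - Real.pi * starRingEnd ℂ z₁, -B, ?_⟩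
  filter_upwards [l1.lin_sub_ae (covCoef z₁) (B • (l1.evalCoef z₂ - A • l1.evalCoef z₁)),
    l1.lin_sub_ae (l1.evalCoef z₂) (A • l1.evalCoef z₁), lin_covCoef_ae z₁, ae_mem_gafGood]
    with x h1 h2 h3 h4
  rw [resCoef, l1.residual, ← hB, ← hA, h1, l1.lin_smul, h2, l1.lin_smul, h3,
    gafEntire_apply h4, gafEntire_apply h4]
  ring

/-- The pair density is the joint density of the two values at `(0, 0)`, with determinant `K₁K₂(1 -
q)`, times the mixed fourth moment of the residual derivatives. The latter is the product of the
variances plus the squared covariance; these are the two terms of `pairIntensity`, and `K₁K₂`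
cancels. -/
theorem lintegral_pairDensity {z₁ z₂ : ℂ} (h : z₁ ≠ z₂) :
    ∫⁻ y, pairDensity (gafEntire (consSeq 0 (consSeq 0 y))) z₁ z₂ ∂gaussSeq
      = ENNReal.ofReal (pairIntensity (Real.pi * ‖z₁ - z₂‖ ^ 2)) := by
  have hz : z₂ - z₁ ≠ 0 := sub_ne_zero.2 h.symm
  have hd : 0 < ‖z₂ - z₁‖ := norm_pos_iff.2 hz
  have hpi := Real.pi_pos
  set K₁ := Real.exp (Real.pi * ‖z₁‖ ^ 2) with hK₁
  set K₂ := Real.exp (Real.pi * ‖z₂‖ ^ 2) with hK₂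
  set q := Real.exp (-(Real.pi * ‖z₁ - z₂‖ ^ 2)) with hq
  have hK₁0 : 0 < K₁ := Real.exp_pos _
  have hK₂0 : 0 < K₂ := Real.exp_pos _
  have hq0 : 0 < 1 - q := one_sub_exp_neg_pos h
  set a := l1.evalCoef z₁ with ha
  set b := l1.evalCoef z₂ with hb
  set γ := l1.gram b a / l1.gram a a with hγ
  have haa : l1.gram a a = ((Real.sqrt K₁ ^ 2 : ℝ) : ℂ) := by
    rw [ha, gram_evalCoef_self, Real.sq_sqrt hK₁0.le]
  have haa0 : l1.gram a a ≠ 0 := gram_evalCoef_self_ne_zero _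
  have hab : l1.gram (b - γ • a) a = 0 := by
    rw [l1.gram_sub_left, l1.gram_smul_left, hγ]
    field_simp
    ring
  have hab' : l1.gram a (b - γ • a) = 0 := by rw [← l1.conj_gram, hab, map_zero]
  have hbb : l1.gram (b - γ • a) (b - γ • a) = ((Real.sqrt (K₂ * (1 - q)) ^ 2 : ℝ) : ℂ) := by
    rw [l1.gram_sub_right, l1.gram_smul_right, hab, mul_zero, sub_zero, l1.gram_sub_left,
      l1.gram_smul_left, hγ, Real.sq_sqrt (by positivity)]
    have h1 := gram_det_evalCoef z₁ z₂
    rw [← ha, ← hb, ← hK₁, ← hK₂, ← hq] at h1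
    have h2 : l1.gram a a = (K₁ : ℂ) := gram_evalCoef_self z₁
    have h3 : (K₁ : ℂ) ≠ 0 := Complex.ofReal_ne_zero.2 hK₁0.ne'
    rw [h2] at h1 ⊢
    push_cast at h1 ⊢
    field_simp
    linear_combination h1
  obtain ⟨α₁, β₁, hW₁⟩ := lin_resCoef_ae z₁ z₂
  obtain ⟨α₂, β₂, hW₂⟩ := lin_resCoef_ae z₂ z₁
  set G : (ℕ → ℂ) → EntireFun := fun y => gafEntire (consSeq 0 (consSeq 0 y)) with hG
  have hGm : Measurable G := measurable_gafEntire_consSeq_consSeq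
  set r : ℂ := (Real.sqrt Real.pi : ℂ) with hr
  have m1 : Measurable fun y => (G y).1 z₁ := (measurable_apply z₁).comp hGm
  have m2 : Measurable fun y => (G y).1 z₂ := (measurable_apply z₂).comp hGm
  have m3 : Measurable fun y => deriv (G y).1 z₁ :=
    measurable_eval_deriv.comp (hGm.prodMk measurable_const)
  have m4 : Measurable fun y => deriv (G y).1 z₂ :=
    measurable_eval_deriv.comp (hGm.prodMk measurable_const)
  set κ : ℂ × ℂ → (ℕ → ℂ) → ℂ := fun u y => slopeAt (G y) z₁ z₂ u with hκ
  have hκc : ∀ y, Continuous fun u => κ u y := fun y => by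
    simp only [hκ, slopeAt]
    fun_prop
  have hκm : Measurable (Function.uncurry κ) := by
    have n1 : Measurable fun p : (ℂ × ℂ) × (ℕ → ℂ) => (G p.2).1 z₁ := m1.comp measurable_snd
    have n2 : Measurable fun p : (ℂ × ℂ) × (ℕ → ℂ) => (G p.2).1 z₂ := m2.comp measurable_snd
    have : Measurable fun p : (ℂ × ℂ) × (ℕ → ℂ) => slopeAt (G p.2) z₁ z₂ p.1 := by
      unfold slopeAt
      fun_prop
    exact this
  set k : ℂ × ℂ → (ℕ → ℂ) → ℝ := fun u y => 1 / (Real.pi * ‖z₂ - z₁‖ ^ 2)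
    * (gaussPdf (κ u y) * gaussPdf (u.1 - (r * κ u y * z₁ + (G y).1 z₁))) with hk
  set W₁ : ℂ × ℂ → (ℕ → ℂ) → ℂ := fun u y => r * κ u y + deriv (G y).1 z₁ + α₁ * u.1 + β₁ * u.2
    with hW₁d
  set W₂ : ℂ × ℂ → (ℕ → ℂ) → ℂ := fun u y => r * κ u y + deriv (G y).1 z₂ + α₂ * u.2 + β₂ * u.1
    with hW₂d
  have hkm : Measurable (Function.uncurry k) := by
    have n1 : Measurable fun p : (ℂ × ℂ) × (ℕ → ℂ) => (G p.2).1 z₁ := m1.comp measurable_snd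
    have hGp := continuous_gaussPdf.measurable
    have hκm' : Measurable fun p : (ℂ × ℂ) × (ℕ → ℂ) => κ p.1 p.2 := hκm
    refine Measurable.const_mul ((hGp.comp hκm).mul (hGp.comp ?_)) _
    exact (measurable_fst.comp measurable_fst).sub (((hκm'.const_mul r).mul_const z₁).add n1)
  have hW₁m : Measurable (Function.uncurry W₁) := by
    have hκm' : Measurable fun p : (ℂ × ℂ) × (ℕ → ℂ) => κ p.1 p.2 := hκm
    have n1 : Measurable fun p : (ℂ × ℂ) × (ℕ → ℂ) => deriv (G p.2).1 z₁ := m3.comp measurable_snd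
    have : Measurable fun p : (ℂ × ℂ) × (ℕ → ℂ) => r * κ p.1 p.2 + deriv (G p.2).1 z₁
      + α₁ * p.1.1 + β₁ * p.1.2 := by fun_prop
    exact this
  have hW₂m : Measurable (Function.uncurry W₂) := by
    have hκm' : Measurable fun p : (ℂ × ℂ) × (ℕ → ℂ) => κ p.1 p.2 := hκm
    have n1 : Measurable fun p : (ℂ × ℂ) × (ℕ → ℂ) => deriv (G p.2).1 z₂ := m4.comp measurable_snd
    have : Measurable fun p : (ℂ × ℂ) × (ℕ → ℂ) => r * κ p.1 p.2 + deriv (G p.2).1 z₂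
      + α₂ * p.1.2 + β₂ * p.1.1 := by fun_prop
    exact this
  have hk0 : ∀ u y, 0 ≤ k u y := fun u y =>
    mul_nonneg (by positivity) (mul_nonneg (gaussPdf_nonneg _) (gaussPdf_nonneg _))
  have hD1 := gram_det_evalCoef_ne_zero h
  have hD2 := gram_det_evalCoef_ne_zero h.symm
  have main := lintegral_kernel_eq_of_disintegration (a := a) (b := b) (w₁ := resCoef z₁ z₂)
    (w₂ := resCoef z₂ z₁) (γ := γ) (Real.sqrt_pos.2 hK₁0)
    (Real.sqrt_pos.2 (by positivity : 0 < K₂ * (1 - q))) haa hbb hab'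
    (l1.gram_fst_residual haa0 (gram_covCoef_evalCoef_self z₁))
    (l1.gram_snd_residual (gram_evalCoef_self_ne_zero z₂) hD2)
    (l1.gram_snd_residual haa0 hD1)
    (l1.gram_fst_residual (gram_evalCoef_self_ne_zero z₂) (gram_covCoef_evalCoef_self z₂))
    (k := k) (W₁ := W₁) (W₂ := W₂) (C := 1 / (Real.pi * ‖z₂ - z₁‖ ^ 2) * (1 * 1))
    (fun y => ?_) hkm hk0 (fun u y => ?_) (fun y => ?_) hW₁m (fun y => ?_) hW₂m
    (fun ψ H hψ hH => ?_)
  · rw [Real.sq_sqrt hK₁0.le, Real.sq_sqrt (by positivity), gram_resCoef_self h,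
      gram_resCoef_self h.symm, gram_resCoef_resCoef h, norm_mul, mul_pow, norm_gram_evalCoef_sq,
      Complex.norm_real, Real.norm_eq_abs, sq_abs, norm_sub_rev z₂ z₁, ← hK₁, ← hK₂, ← hq,
      Complex.ofReal_re, Complex.ofReal_re] at main
    calc _ = ∫⁻ y, ENNReal.ofReal (k 0 y) * ENNReal.ofReal (‖W₁ 0 y‖ ^ 2 * ‖W₂ 0 y‖ ^ 2)
          ∂gaussSeq := by
          refine lintegral_congr fun y => ?_
          -- At the value `u = (0, 0)` the general slope is that of a function vanishing at both
          -- points, and the corrections by `α` and `β` disappear.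
          have e1 : κ 0 y = slopeCoef (G y) z₁ z₂ := slopeAt_zero _ _ _
          have e2 : W₁ 0 y = r * slopeCoef (G y) z₁ z₂ + deriv (G y).1 z₁ := by
            simp [hW₁d, e1]
          have e3 : W₂ 0 y = r * slopeCoef (G y) z₁ z₂ + deriv (G y).1 z₂ := by
            simp [hW₂d, e1]
          have e4 : ‖W₂ 0 y / (z₂ - z₁) / r‖ₑ ^ 2
              = ENNReal.ofReal (1 / (Real.pi * ‖z₂ - z₁‖ ^ 2)) * ENNReal.ofReal (‖W₂ 0 y‖ ^ 2) := by
            rw [← enorm_inv_sq_sqrt_pi_mul _ hz, ENNReal.ofReal_pow (norm_nonneg _), ofReal_norm,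
              ← hr, div_div, div_eq_mul_inv,
              enorm_mul, enorm_inv (mul_ne_zero hz sqrt_pi_ne_zero), mul_pow, mul_comm r,
              mul_comm (‖W₂ 0 y‖ₑ ^ 2)]
          change pairDensity (G y) z₁ z₂ = _
          rw [pairDensity, ← hr, ← e3, e4, ← e2]
          simp only [hk, e1]
          rw [ENNReal.ofReal_mul (p := 1 / (Real.pi * ‖z₂ - z₁‖ ^ 2)) (by positivity),
            ENNReal.ofReal_mul (gaussPdf_nonneg _), ENNReal.ofReal_mul (by positivity),
            ENNReal.ofReal_pow (norm_nonneg (W₁ 0 y)), ENNReal.ofReal_pow (norm_nonneg (W₂ 0 y)),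
            ofReal_norm, ofReal_norm, Prod.fst_zero, zero_sub,
            ← gaussDensity_eq, ← gaussDensity_eq, gaussDensity_neg]
          ring
      _ = _ := main
      _ = _ := by
          congr 1
          rw [pairIntensity, ← hq]
          field_simp
  · have := continuous_gaussPdf
    have := hκc y
    simp only [hk]
    fun_prop
  · exact mul_le_mul_of_nonneg_left (mul_le_mul (gaussPdf_le_one _) (gaussPdf_le_one _)
      (gaussPdf_nonneg _) zero_le_one) (by positivity)
  · have := hκc y
    simp only [hW₁d]
    fun_prop
  · have := hκc y
    simp only [hW₂d]
    fun_prop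
  · have e := lintegral_apply_deriv_gafEntire_pair hz (Ψ := fun u d₁ d₂ => ψ u
      * H (d₁ + α₁ * u.1 + β₁ * u.2) (d₂ + α₂ * u.2 + β₂ * u.1)) (by
        refine (hψ.comp measurable_fst).mul (hH.comp (Measurable.prodMk ?_ ?_)) <;> fun_prop)
    calc _ = ∫⁻ x, ψ ((gafEntire x).1 z₁, (gafEntire x).1 z₂)
          * H (deriv (gafEntire x).1 z₁ + α₁ * (gafEntire x).1 z₁ + β₁ * (gafEntire x).1 z₂)
            (deriv (gafEntire x).1 z₂ + α₂ * (gafEntire x).1 z₂ + β₂ * (gafEntire x).1 z₁)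
          ∂gaussSeq := by
          refine lintegral_congr_ae ?_
          filter_upwards [hW₁, hW₂, ae_mem_gafGood] with x h1 h2 h3
          rw [h1, h2, ha, hb, gafEntire_apply h3, gafEntire_apply h3]
      _ = _ := e
      _ = _ := by
          refine lintegral_congr fun u => ?_
          have hψu : ∀ y, ENNReal.ofReal (1 / (Real.pi * ‖z₂ - z₁‖ ^ 2))
              * (gaussDensity (κ u y) * gaussDensity (u.1 - (r * κ u y * z₁ + (G y).1 z₁))
                * (ψ u * H (W₁ u y) (W₂ u y)))
              = ψ u * (ENNReal.ofReal (k u y) * H (W₁ u y) (W₂ u y)) := fun y => by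
            simp only [hk]
            rw [ENNReal.ofReal_mul (p := 1 / (Real.pi * ‖z₂ - z₁‖ ^ 2)) (by positivity),
              ENNReal.ofReal_mul (gaussPdf_nonneg _), ← gaussDensity_eq, ← gaussDensity_eq]
            ring
          refine (lintegral_congr hψu).trans (lintegral_const_mul _ ?_)
          have n1 : Measurable fun y => k u y := hkm.of_uncurry_left
          have n2 : Measurable fun y => W₁ u y := hW₁m.of_uncurry_left
          have n3 : Measurable fun y => W₂ u y := hW₂m.of_uncurry_left
          exact n1.ennreal_ofReal.mul (hH.comp (n2.prodMk n3))

/-! ## The point process of the zeros -/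

theorem lintegral_zeroMeasure_gafEntire {F : ℂ → ℝ≥0∞} (hF : Measurable F) :
    ∫⁻ x, (∫⁻ z, F z ∂(zeroMeasure (gafEntire x))) ∂gaussSeq = ∫⁻ z, F z := by
  rw [lintegral_lintegral_zeroMeasure_gafEntire (F := fun z _ => F z) (hF.comp measurable_fst)]
  refine lintegral_congr fun z => ?_
  simp_rw [mul_comm (gaussDensity _) (F z), mul_assoc]
  rw [lintegral_const_mul, lintegral_intensity, mul_one]
  exact (measurable_gaussDensity.comp (measurable_gafEntire_consSeq_apply z)).mul
    ((measurable_deriv_gafEntire_consSeq z).enorm.pow_const 2)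

theorem lintegral_pairSum_gafEntire_eq {F : ℂ → ℂ → ℝ≥0∞} (hF : Measurable (Function.uncurry F)) :
    ∫⁻ x, pairSum (gafEntire x) F ∂gaussSeq = ∫⁻ z₁, ∫⁻ z₂, F z₁ z₂
      * ENNReal.ofReal (pairIntensity (Real.pi * ‖z₁ - z₂‖ ^ 2)) := by
  rw [lintegral_pairSum_gafEntire hF]
  refine lintegral_congr fun z₁ => lintegral_congr_ae ?_
  have h : ∀ᵐ z₂ : ℂ, z₂ ≠ z₁ := Measure.ae_ne volume z₁
  filter_upwards [h] with z₂ hz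
  have hz' : z₂ ∈ ({z₁}ᶜ : Set ℂ) := hz
  rw [Set.indicator_of_mem hz', lintegral_pairDensity (Ne.symm hz)]

/-- The value at the origin has a density, so it vanishes with probability zero. -/
lemma ae_gafEntire_ne_zero : ∀ᵐ x ∂gaussSeq, (gafEntire x).1 ≠ 0 := by
  have h := lintegral_comp_lin (c := l1.evalCoef 0) one_pos (by rw [gram_evalCoef_self]; simp)
    (ψ := ({0} : Set ℂ).indicator 1) (measurable_one.indicator (measurableSet_singleton 0))
  have h0 : ∫⁻ u : ℂ, ({0} : Set ℂ).indicator 1 u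
      * ENNReal.ofReal (gaussPdf (u / (1 : ℝ)) / 1 ^ 2) = 0 := by
    rw [← lintegral_zero (μ := (volume : Measure ℂ))]
    refine lintegral_congr_ae ?_
    filter_upwards [Measure.ae_ne volume (0 : ℂ)] with u hu
    simp [hu]
  have hm : AEMeasurable (fun x => ({0} : Set ℂ).indicator (1 : ℂ → ℝ≥0∞)
      (l1.lin (l1.evalCoef 0) x)) gaussSeq := Measurable.comp_aemeasurable
    (measurable_one.indicator (measurableSet_singleton 0)) (l1.aemeasurable_lin _)
  rw [h0, lintegral_eq_zero_iff' hm] at h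
  filter_upwards [h, ae_mem_gafGood] with x hx hg hf
  have : l1.lin (l1.evalCoef 0) x = 0 := by rw [← gafEntire_apply hg, hf]; rfl
  rw [this] at hx
  simp at hx

/-- In the first Kac-Rice formula for the indicator of a zero derivative, the Jacobian `|f'|²`
vanishes wherever the test function does not; the expected number of multiple zeros is therefore
zero. -/
lemma ae_simple_zeros : ∀ᵐ x ∂gaussSeq, ∀ z, (gafEntire x).1 z = 0 →
    deriv (gafEntire x).1 z ≠ 0 := by
  let F : ℂ → ℂ → ℝ≥0∞ := fun _ w => ({0} : Set ℂ).indicator 1 w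
  have hF : Measurable (Function.uncurry F) :=
    (measurable_one.indicator (measurableSet_singleton (0 : ℂ))).comp measurable_snd
  have h := lintegral_lintegral_zeroMeasure_gafEntire hF
  have h0 : ∀ z, ∫⁻ y, gaussDensity ((gafEntire (consSeq 0 y)).1 z)
      * F z (deriv (gafEntire (consSeq 0 y)).1 z)
      * ‖deriv (gafEntire (consSeq 0 y)).1 z‖ₑ ^ 2 ∂gaussSeq = 0 := by
    intro z
    rw [← lintegral_zero (μ := gaussSeq)]
    refine lintegral_congr fun y => ?_
    by_cases hd : deriv (gafEntire (consSeq 0 y)).1 z = 0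
    · simp [hd]
    · simp [F, hd]
  simp_rw [h0, lintegral_zero] at h
  have hm : Measurable fun f : EntireFun => ∫⁻ z, F z (deriv f.1 z) ∂(zeroMeasure f) :=
    measurable_lintegral_zeroMeasure measurable_id
      (hF.comp (measurable_snd.prodMk measurable_eval_deriv))
  have hm' : Measurable fun x => ∫⁻ z, F z (deriv (gafEntire x).1 z) ∂(zeroMeasure (gafEntire x)) :=
    hm.comp measurable_gafEntire
  rw [lintegral_eq_zero_iff hm'] at h
  filter_upwards [h, ae_gafEntire_ne_zero] with x hx hne z hz hd
  simp only [Pi.zero_apply] at hx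
  rw [lintegral_zeroMeasure hne, ENNReal.tsum_eq_zero] at hx
  have := hx ⟨z, hz⟩
  simp [F, hd] at this

lemma tsum_injective_one (S : Set ℂ) (F : (Fin 1 → ℂ) → ℝ≥0∞) :
    ∑' x : {x : Fin 1 → ℂ // Function.Injective x ∧ ∀ i, x i ∈ S}, F x
      = ∑' z : S, F fun _ => z := by
  have h1 := tsum_subtype {x : Fin 1 → ℂ | Function.Injective x ∧ ∀ i, x i ∈ S} F
  refine Eq.trans h1 ?_
  rw [tsum_subtype S fun z => F fun _ => z, ← (Equiv.funUnique (Fin 1) ℂ).symm.tsum_eq]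
  refine tsum_congr fun z => ?_
  have : ((Equiv.funUnique (Fin 1) ℂ).symm z) = fun _ => z := rfl
  rw [this]
  by_cases hz : z ∈ S
  · rw [Set.indicator_of_mem hz, Set.indicator_of_mem]
    exact ⟨Function.injective_of_subsingleton _, fun _ => hz⟩
  · rw [Set.indicator_of_notMem hz, Set.indicator_of_notMem]
    exact fun h => hz (h.2 0)

lemma tsum_injective_two (S : Set ℂ) (F : (Fin 2 → ℂ) → ℝ≥0∞) :
    ∑' x : {x : Fin 2 → ℂ // Function.Injective x ∧ ∀ i, x i ∈ S}, F x
      = ∑' a : S, ∑' b : S, ({(a : ℂ)}ᶜ : Set ℂ).indicator (fun b => F ![a, b]) b := by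
  have h1 := tsum_subtype {x : Fin 2 → ℂ | Function.Injective x ∧ ∀ i, x i ∈ S} F
  refine Eq.trans h1 ?_
  have h2 : ∀ a : ℂ, ∑' b : S, ({(a : ℂ)}ᶜ : Set ℂ).indicator (fun b => F ![a, b]) b
      = ∑' b, S.indicator (({(a : ℂ)}ᶜ : Set ℂ).indicator fun b => F ![a, b]) b := fun a =>
    tsum_subtype S _
  simp_rw [h2]
  rw [tsum_subtype S fun a => ∑' b, S.indicator (({(a : ℂ)}ᶜ : Set ℂ).indicator
    fun b => F ![a, b]) b, ← (finTwoArrowEquiv ℂ).symm.tsum_eq, ENNReal.tsum_prod']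
  refine tsum_congr fun a => ?_
  by_cases ha : a ∈ S
  · rw [Set.indicator_of_mem ha]
    refine tsum_congr fun b => ?_
    have : (finTwoArrowEquiv ℂ).symm (a, b) = ![a, b] := rfl
    rw [this]
    by_cases hb : b ∈ S
    · by_cases hab : b = a
      · rw [Set.indicator_of_mem hb, Set.indicator_of_notMem, Set.indicator_of_notMem]
        · simp [hab]
        · rintro ⟨h, -⟩
          have := @h 0 1 (by simp [hab])
          simp at this
      · rw [Set.indicator_of_mem hb, Set.indicator_of_mem, Set.indicator_of_mem]
        · exact hab
        · refine ⟨fun i j hij => ?_, fun i => ?_⟩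
          · fin_cases i <;> fin_cases j <;> simp_all
          · fin_cases i <;> simpa
    · rw [Set.indicator_of_notMem hb, Set.indicator_of_notMem]
      exact fun h => hb (h.2 1)
  · rw [Set.indicator_of_notMem ha, ENNReal.tsum_eq_zero]
    intro b
    rw [Set.indicator_of_notMem]
    exact fun h => ha (h.2 0)

/-! ### Invariance of the law under translations. -/

namespace EntireFun

/-- The action of the translations of the plane on the entire functions that preserves the law of
the random function `gafEntire`. -/
noncomputable def shift (w : ℂ) (f : EntireFun) : EntireFun :=
  ⟨fun z => Complex.exp (Real.pi * z * starRingEnd ℂ w - Real.pi * ‖w‖ ^ 2 / 2) * f.1 (z - w), by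
    have := f.2
    fun_prop⟩

lemma shift_apply (w : ℂ) (f : EntireFun) (z : ℂ) : (shift w f).1 z
    = Complex.exp (Real.pi * z * starRingEnd ℂ w - Real.pi * ‖w‖ ^ 2 / 2) * f.1 (z - w) := rfl

lemma measurable_shift (w : ℂ) : Measurable (shift w) :=
  measurable_of_apply fun z => (measurable_apply (z - w)).const_mul _

lemma zeros_shift (w : ℂ) (f : EntireFun) : zeros (shift w f) = (fun z => z + w) '' zeros f := by
  ext z
  simp only [zeros, Set.mem_image, shift_apply, Set.mem_ofPred_eq, mul_eq_zero, Complex.exp_ne_zero,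
    false_or]
  constructor
  · intro h
    exact ⟨z - w, h, sub_add_cancel _ _⟩
  · rintro ⟨v, hv, rfl⟩
    rwa [add_sub_cancel_right]

lemma shift_ne_zero (w : ℂ) {f : EntireFun} (hf : f.1 ≠ 0) : (shift w f).1 ≠ 0 := by
  obtain ⟨z, hz⟩ := Function.ne_iff.1 hf
  refine Function.ne_iff.2 ⟨z + w, ?_⟩
  rw [shift_apply, add_sub_cancel_right]
  exact mul_ne_zero (Complex.exp_ne_zero _) hz

/-- The σ-algebra of the evaluations is the trace of the product one, so finite-dimensional laws
determine a measure. -/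
lemma measure_ext_of_finite {μ ν : Measure EntireFun} [IsFiniteMeasure μ] [IsFiniteMeasure ν]
    (h : ∀ I : Finset ℂ, μ.map (fun f (i : I) => f.1 i) = ν.map (fun f (i : I) => f.1 i)) :
    μ = ν := by
  have hval : Measurable (Subtype.val : EntireFun → ℂ → ℂ) := measurable_subtype_coe
  have hI : ∀ I : Finset ℂ, Measurable fun f : EntireFun => fun i : I => f.1 i := fun I =>
    measurable_pi_iff.2 fun i => measurable_apply _
  have hmap : μ.map Subtype.val = ν.map Subtype.val := by
    have : ∀ I : Finset ℂ, IsFiniteMeasure (ν.map fun f (i : I) => f.1 i) := fun I =>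
      Measure.isFiniteMeasure_map _ _
    refine IsProjectiveLimit.unique (P := fun I : Finset ℂ => ν.map fun f (i : I) => f.1 i)
      (fun I => ?_) (fun I => ?_)
    · rw [Measure.map_map (Finset.measurable_restrict I) hval]
      exact h I
    · rw [Measure.map_map (Finset.measurable_restrict I) hval]
      rfl
  ext s hs
  obtain ⟨t, ht, rfl⟩ := hs
  rw [← Measure.map_apply hval ht, ← Measure.map_apply hval ht, hmap]

end EntireFun

/-- The multipliers at `z` and `z'` combine with `exp(π (z - w)(z' - w)‾)` to give back `exp(π z
z̄')`, so all finite Gram matrices agree. -/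
theorem map_shift_gafEntire (w : ℂ) :
    gaussSeq.map (fun x => shift w (gafEntire x)) = gaussSeq.map gafEntire := by
  have hs : Measurable fun x => shift w (gafEntire x) :=
    (measurable_shift w).comp measurable_gafEntire
  have : IsProbabilityMeasure (gaussSeq.map (fun x => shift w (gafEntire x))) :=
    Measure.isProbabilityMeasure_map hs.aemeasurable
  have : IsProbabilityMeasure (gaussSeq.map gafEntire) :=
    Measure.isProbabilityMeasure_map measurable_gafEntire.aemeasurable
  refine EntireFun.measure_ext_of_finite fun I => ?_
  have hI : Measurable fun f : EntireFun => fun i : I => f.1 i :=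
    measurable_pi_iff.2 fun i => measurable_apply _
  rw [Measure.map_map hI hs, Measure.map_map hI measurable_gafEntire]
  let c : I → l1 := fun i => Complex.exp (Real.pi * i * starRingEnd ℂ w - Real.pi * ‖w‖ ^ 2 / 2)
    • l1.evalCoef (i - w)
  have h1 : ((fun f : EntireFun => fun i : I => f.1 i) ∘ fun x => shift w (gafEntire x))
      =ᵐ[gaussSeq] fun x i => l1.lin (c i) x := by
    filter_upwards [ae_mem_gafGood] with x hx
    funext i
    simp only [Function.comp, shift_apply, gafEntire_apply hx, c, l1.lin_smul]
  have h2 : ((fun f : EntireFun => fun i : I => f.1 i) ∘ gafEntire)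
      =ᵐ[gaussSeq] fun x i => l1.lin (l1.evalCoef i) x := by
    filter_upwards [ae_mem_gafGood] with x hx
    funext i
    simp only [Function.comp, gafEntire_apply hx]
  rw [Measure.map_congr h1, Measure.map_congr h2]
  refine l1.map_lin_eq_of_gram_eq _ _ fun i j => ?_
  simp only [c]
  rw [l1.gram_smul_left, l1.gram_smul_right, l1.gram_evalCoef, l1.gram_evalCoef,
    ← Complex.exp_conj, ← Complex.exp_add, ← Complex.exp_add]
  congr 1
  simp only [map_sub, map_mul, map_div₀, map_pow, Complex.conj_ofReal, Complex.conj_conj,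
    map_ofNat]
  rw [← Complex.mul_conj']
  ring

/-! ## Transfer to an arbitrary probability space -/

lemma pointCount_zeros {f : EntireFun} (hf : f.1 ≠ 0) {B : Set ℂ} (hB : MeasurableSet B) :
    pointCount (zeros f) B = zeroMeasure f B := by
  rw [zeroMeasure_apply hf hB, pointCount]

lemma gaf_eq_gafSum {Ω : Type*} (ξ : ℕ → Ω → ℂ) (ω : Ω) (z : ℂ) :
    gaf ξ ω ((Real.sqrt Real.pi : ℂ) * z) = gafSum (fun n => ξ n ω) z := rfl

lemma gafZeros_eq {Ω : Type*} {ξ : ℕ → Ω → ℂ} {ω : Ω} (h : (fun n => ξ n ω) ∈ gafGood) :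
    gafZeros ξ ω = zeros (gafEntire fun n => ξ n ω) := by
  ext z
  simp only [gafZeros, zeros, Set.mem_ofPred_eq, gaf_eq_gafSum, gafEntire_of_mem h]

lemma deriv_gaf {Ω : Type*} {ξ : ℕ → Ω → ℂ} {ω : Ω} (h : (fun n => ξ n ω) ∈ gafGood) (z : ℂ) :
    deriv (gafEntire fun n => ξ n ω).1 z
      = Real.sqrt Real.pi * deriv (gaf ξ ω) ((Real.sqrt Real.pi : ℂ) * z) := by
  rw [gafEntire_of_mem h]
  have : gafSum (fun n => ξ n ω) = fun z => gaf ξ ω ((Real.sqrt Real.pi : ℂ) * z) := rfl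
  rw [this, deriv_comp_mul_left (f := gaf ξ ω), smul_eq_mul]

lemma aemeasurable_seq {Ω : Type*} [MeasurableSpace Ω] {P : Measure Ω} {ξ : ℕ → Ω → ℂ}
    (hlaw : ∀ n, HasLaw (ξ n) stdComplexGaussian P) :
    AEMeasurable (fun ω n => ξ n ω) P :=
  aemeasurable_pi_iff.2 fun n => (hlaw n).aemeasurable

lemma map_gaussian_seq {Ω : Type*} [MeasurableSpace Ω] {P : Measure Ω} [IsProbabilityMeasure P]
    {ξ : ℕ → Ω → ℂ} (hlaw : ∀ n, HasLaw (ξ n) stdComplexGaussian P) (hind : iIndepFun ξ P) :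
    P.map (fun ω n => ξ n ω) = gaussSeq := by
  rw [hind.map_fun_eq_infinitePi_map₀' fun n => (hlaw n).aemeasurable, gaussSeq]
  congr 1
  funext n
  exact (hlaw n).map_eq

lemma ae_seq {Ω : Type*} [MeasurableSpace Ω] {P : Measure Ω} [IsProbabilityMeasure P]
    {ξ : ℕ → Ω → ℂ} (hlaw : ∀ n, HasLaw (ξ n) stdComplexGaussian P) (hind : iIndepFun ξ P)
    {p : (ℕ → ℂ) → Prop} (h : ∀ᵐ x ∂gaussSeq, p x) : ∀ᵐ ω ∂P, p fun n => ξ n ω := by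
  rw [← map_gaussian_seq hlaw hind] at h
  exact ae_of_ae_map (aemeasurable_seq hlaw) h

lemma lintegral_seq {Ω : Type*} [MeasurableSpace Ω] {P : Measure Ω} [IsProbabilityMeasure P]
    {ξ : ℕ → Ω → ℂ} (hlaw : ∀ n, HasLaw (ξ n) stdComplexGaussian P) (hind : iIndepFun ξ P)
    {S : EntireFun → ℝ≥0∞} (hS : Measurable S) :
    ∫⁻ ω, S (gafEntire fun n => ξ n ω) ∂P = ∫⁻ x, S (gafEntire x) ∂gaussSeq := by
  have hS' : Measurable fun x => S (gafEntire x) := hS.comp measurable_gafEntire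
  rw [← map_gaussian_seq hlaw hind, lintegral_map' hS'.aemeasurable (aemeasurable_seq hlaw)]

lemma aemeasurable_gafEntire_seq {Ω : Type*} [MeasurableSpace Ω] {P : Measure Ω} {ξ : ℕ → Ω → ℂ}
    (hlaw : ∀ n, HasLaw (ξ n) stdComplexGaussian P) :
    AEMeasurable (fun ω => gafEntire fun n => ξ n ω) P :=
  measurable_gafEntire.comp_aemeasurable (aemeasurable_seq hlaw)

lemma ae_gafZeros_eq {Ω : Type*} [MeasurableSpace Ω] {P : Measure Ω} [IsProbabilityMeasure P]
    {ξ : ℕ → Ω → ℂ} (hlaw : ∀ n, HasLaw (ξ n) stdComplexGaussian P) (hind : iIndepFun ξ P)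
    : ∀ᵐ ω ∂P, gafZeros ξ ω = zeros (gafEntire fun n => ξ n ω)
    ∧ (gafEntire fun n => ξ n ω).1 ≠ 0 := by
  filter_upwards [ae_seq hlaw hind ae_mem_gafGood, ae_seq hlaw hind ae_gafEntire_ne_zero]
    with ω h1 h2
  exact ⟨gafZeros_eq h1, h2⟩

theorem ae_summable_and_simple {Ω : Type*} [MeasurableSpace Ω] {P : Measure Ω} [IsProbabilityMeasure P]
    {ξ : ℕ → Ω → ℂ} (hlaw : ∀ n, HasLaw (ξ n) stdComplexGaussian P) (hind : iIndepFun ξ P)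
    : ∀ᵐ ω ∂P,
    (∀ z : ℂ, Summable fun n : ℕ => ξ n ω / (Real.sqrt (n ! : ℝ) : ℂ) * z ^ n) ∧
      ∀ z : ℂ, gaf ξ ω z = 0 → deriv (gaf ξ ω) z ≠ 0 := by
  filter_upwards [ae_seq hlaw hind ae_mem_gafGood, ae_seq hlaw hind ae_simple_zeros] with ω h1 h2
  refine ⟨fun z => summable_of_mem_gafGood h1 z, fun z hz hd => ?_⟩
  have hz' : (Real.sqrt Real.pi : ℂ) * (z / (Real.sqrt Real.pi : ℂ)) = z :=
    mul_div_cancel₀ _ sqrt_pi_ne_zero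
  refine h2 (z / (Real.sqrt Real.pi : ℂ)) ?_ ?_
  · rw [gafEntire_of_mem h1, ← gaf_eq_gafSum, hz', hz]
  · rw [deriv_gaf h1, hz', hd, mul_zero]

theorem isPointProcess_gafZeros {Ω : Type*} [MeasurableSpace Ω] {P : Measure Ω} [IsProbabilityMeasure P]
    {ξ : ℕ → Ω → ℂ} (hlaw : ∀ n, HasLaw (ξ n) stdComplexGaussian P) (hind : iIndepFun ξ P)
    : IsPointProcess P (gafZeros ξ) where
  locallyFinite := by
    filter_upwards [ae_gafZeros_eq hlaw hind] with ω ⟨h1, h2⟩ K hK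
    rw [h1]
    exact finite_zeros_inter h2 hK
  aemeasurable_count B hB := by
    have hm : Measurable fun f => zeroMeasure f B := (Measure.measurable_coe hB).comp
      measurable_zeroMeasure
    refine (hm.comp_aemeasurable (aemeasurable_gafEntire_seq hlaw)).congr ?_
    filter_upwards [ae_gafZeros_eq hlaw hind] with ω ⟨h1, h2⟩
    rw [h1, pointCount_zeros h2 hB]
    rfl

theorem isTranslationInvariant_gafZeros {Ω : Type*} [MeasurableSpace Ω] {P : Measure Ω} [IsProbabilityMeasure P]
    {ξ : ℕ → Ω → ℂ} (hlaw : ∀ n, HasLaw (ξ n) stdComplexGaussian P) (hind : iIndepFun ξ P)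
    : IsTranslationInvariant P (gafZeros ξ) := by
  intro w n B hB
  have hm : Measurable fun f (i : Fin n) => zeroMeasure f (B i) := measurable_pi_iff.2 fun i =>
    (Measure.measurable_coe (hB i)).comp measurable_zeroMeasure
  have hX := aemeasurable_gafEntire_seq hlaw
  have hY : AEMeasurable (fun ω => shift w (gafEntire fun n => ξ n ω)) P :=
    (measurable_shift w).comp_aemeasurable hX
  have e1 : (fun ω i => pointCount (gafZeros ξ ω) (B i))
      =ᵐ[P] (fun f (i : Fin n) => zeroMeasure f (B i)) ∘ fun ω => gafEntire fun n => ξ n ω := by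
    filter_upwards [ae_gafZeros_eq hlaw hind] with ω ⟨h1, h2⟩
    funext i
    rw [h1, pointCount_zeros h2 (hB i)]
    rfl
  have e2 : (fun ω i => pointCount ((fun z => z + w) '' gafZeros ξ ω) (B i))
      =ᵐ[P] (fun f (i : Fin n) => zeroMeasure f (B i))
        ∘ fun ω => shift w (gafEntire fun n => ξ n ω) := by
    filter_upwards [ae_gafZeros_eq hlaw hind] with ω ⟨h1, h2⟩
    funext i
    rw [h1, ← zeros_shift, pointCount_zeros (shift_ne_zero w h2) (hB i)]
    rfl
  refine ⟨(hm.comp_aemeasurable hX).congr e1.symm, (hm.comp_aemeasurable hY).congr e2.symm, ?_⟩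
  rw [Measure.map_congr e1, Measure.map_congr e2, ← AEMeasurable.map_map_of_aemeasurable
    hm.aemeasurable hX, ← AEMeasurable.map_map_of_aemeasurable hm.aemeasurable hY]
  congr 1
  have h1 : P.map (fun ω => gafEntire fun n => ξ n ω) = gaussSeq.map gafEntire := by
    rw [← map_gaussian_seq hlaw hind, AEMeasurable.map_map_of_aemeasurable measurable_gafEntire.aemeasurable
      (aemeasurable_seq hlaw)]
    rfl
  have h2 : P.map (fun ω => shift w (gafEntire fun n => ξ n ω))
      = gaussSeq.map fun x => shift w (gafEntire x) := by
    have hg : Measurable fun x => shift w (gafEntire x) :=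
      (measurable_shift w).comp measurable_gafEntire
    rw [← map_gaussian_seq hlaw hind, AEMeasurable.map_map_of_aemeasurable hg.aemeasurable
      (aemeasurable_seq hlaw)]
    rfl
  rw [h1, h2, map_shift_gafEntire]

theorem hasCorrelationFunction_one {Ω : Type*} [MeasurableSpace Ω] {P : Measure Ω} [IsProbabilityMeasure P]
    {ξ : ℕ → Ω → ℂ} (hlaw : ∀ n, HasLaw (ξ n) stdComplexGaussian P) (hind : iIndepFun ξ P)
    : HasCorrelationFunction P (gafZeros ξ) 1 fun _ => 1 := by
  refine ⟨fun _ => zero_le_one, measurable_const, fun F hF => ?_⟩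
  have hF' : Measurable fun z : ℂ => F fun _ => z :=
    hF.comp (measurable_pi_iff.2 fun _ => measurable_id)
  have hm : Measurable fun f : EntireFun => ∫⁻ z, F (fun _ => z) ∂(zeroMeasure f) :=
    (Measure.measurable_lintegral hF').comp measurable_zeroMeasure
  calc _ = ∫⁻ ω, (∫⁻ z, F (fun _ => z) ∂(zeroMeasure (gafEntire fun n => ξ n ω))) ∂P := by
        refine lintegral_congr_ae ?_
        filter_upwards [ae_gafZeros_eq hlaw hind] with ω ⟨h1, h2⟩
        rw [tsum_injective_one, h1, lintegral_zeroMeasure h2]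
    _ = ∫⁻ z, F fun _ => z := by
        rw [lintegral_seq hlaw hind hm, lintegral_zeroMeasure_gafEntire hF']
    _ = ∫⁻ x, F x * ENNReal.ofReal 1 := by
        simp only [ENNReal.ofReal_one, mul_one]
        have hp := (volume_preserving_funUnique (Fin 1) ℂ).symm
        exact hp.lintegral_comp hF

lemma lintegral_pairSum_gafZeros {Ω : Type*} [MeasurableSpace Ω] {P : Measure Ω} [IsProbabilityMeasure P]
    {ξ : ℕ → Ω → ℂ} (hlaw : ∀ n, HasLaw (ξ n) stdComplexGaussian P) (hind : iIndepFun ξ P)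
    {ρ : ℂ → ℝ}
    (hρ : ∀ z, z ≠ 0 → ρ z = pairIntensity (Real.pi * ‖z‖ ^ 2)) {F : ℂ → ℂ → ℝ≥0∞}
    (hF : Measurable (Function.uncurry F)) :
    ∫⁻ ω, pairSum (gafEntire fun n => ξ n ω) F ∂P
      = ∫⁻ z₁, ∫⁻ z₂, F z₁ z₂ * ENNReal.ofReal (ρ (z₁ - z₂)) := by
  rw [lintegral_seq hlaw hind (S := fun f => pairSum f F) (measurable_pairSum hF),
    lintegral_pairSum_gafEntire_eq hF]
  refine lintegral_congr fun z₁ => lintegral_congr_ae ?_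
  filter_upwards [Measure.ae_ne volume z₁] with z₂ hz
  rw [hρ _ (sub_ne_zero.2 hz.symm)]

/-- The value of `ρ` at `0` is constrained only by its sign, since the diagonal is a null set. -/
theorem hasCorrelationFunction_two {Ω : Type*} [MeasurableSpace Ω] {P : Measure Ω} [IsProbabilityMeasure P]
    {ξ : ℕ → Ω → ℂ} (hlaw : ∀ n, HasLaw (ξ n) stdComplexGaussian P) (hind : iIndepFun ξ P)
    {ρ : ℂ → ℝ} (hρm : Measurable ρ) (hρ0 : ∀ z, 0 ≤ ρ z)
    (hρ : ∀ z, z ≠ 0 → ρ z = pairIntensity (Real.pi * ‖z‖ ^ 2)) :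
    HasCorrelationFunction P (gafZeros ξ) 2 fun x => ρ (x 0 - x 1) := by
  have hρ2 : Measurable fun x : Fin 2 → ℂ => ρ (x 0 - x 1) :=
    hρm.comp ((measurable_pi_apply 0).sub (measurable_pi_apply 1))
  refine ⟨fun _ => hρ0 _, hρ2, fun F hF => ?_⟩
  have hF' : Measurable (Function.uncurry fun a b : ℂ => F ![a, b]) := by
    refine hF.comp (measurable_pi_iff.2 fun i => ?_)
    fin_cases i
    · exact measurable_fst
    · exact measurable_snd
  calc _ = ∫⁻ ω, pairSum (gafEntire fun n => ξ n ω) (fun a b => F ![a, b]) ∂P := by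
        refine lintegral_congr_ae ?_
        filter_upwards [ae_gafZeros_eq hlaw hind] with ω ⟨h1, h2⟩
        rw [tsum_injective_two, h1, pairSum, lintegral_zeroMeasure h2]
        refine tsum_congr fun a => ?_
        rw [lintegral_zeroMeasure h2]
    _ = ∫⁻ a, ∫⁻ b, F ![a, b] * ENNReal.ofReal (ρ (a - b)) :=
        lintegral_pairSum_gafZeros hlaw hind hρ hF'
    _ = _ := by
        have hG : Measurable fun x : Fin 2 → ℂ => F x * ENNReal.ofReal (ρ (x 0 - x 1)) :=
          hF.mul hρ2.ennreal_ofReal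
        rw [← (volume_preserving_finTwoArrow ℂ).symm.lintegral_comp hG, Measure.volume_eq_prod,
          lintegral_prod]
        · rfl
        · exact (hG.comp (MeasurableEquiv.finTwoArrow.symm.measurable)).aemeasurable

/-! ## The cluster function -/

section PairIntensity

variable {t : ℝ}

lemma one_sub_exp_neg_pos' (ht : 0 < t) : 0 < 1 - Real.exp (-t) := by
  rw [sub_pos, Real.exp_lt_one_iff]; linarith

lemma one_add_mul_exp_neg_le (t : ℝ) : (1 + t) * Real.exp (-t) ≤ 1 := by
  rw [Real.exp_neg, ← div_eq_mul_inv, div_le_one (Real.exp_pos t), add_comm]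
  exact Real.add_one_le_exp t

/-- The function `t / (e^t - 1)`. -/
noncomputable def boseFun (t : ℝ) : ℝ := t * Real.exp (-t) / (1 - Real.exp (-t))

/-- The function `t / (1 - e^{-t})`. -/
noncomputable def boseFun' (t : ℝ) : ℝ := t / (1 - Real.exp (-t))

lemma boseFun_eq (ht : 0 < t) : boseFun t = boseFun' t - t := by
  have := one_sub_exp_neg_pos' ht
  rw [boseFun, boseFun']
  field_simp
  ring

lemma boseFun_pos (ht : 0 < t) : 0 < boseFun t := by
  have := one_sub_exp_neg_pos' ht
  have := Real.exp_pos (-t)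
  rw [boseFun]; positivity

lemma boseFun_le_one (ht : 0 < t) : boseFun t ≤ 1 := by
  have := one_sub_exp_neg_pos' ht
  rw [boseFun, div_le_one this]
  linarith [one_add_mul_exp_neg_le t]

lemma one_le_boseFun' (ht : 0 < t) : 1 ≤ boseFun' t := by
  have := one_sub_exp_neg_pos' ht
  rw [boseFun', one_le_div this]
  linarith [Real.add_one_le_exp (-t)]

lemma boseFun'_le (ht : 0 < t) : boseFun' t ≤ 1 + t := by
  linarith [boseFun_eq ht, boseFun_le_one ht]

lemma one_sub_boseFun_le (ht : 0 < t) : 1 - boseFun t ≤ t := by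
  linarith [boseFun_eq ht, one_le_boseFun' ht]

lemma pairIntensity_eq (t : ℝ) : pairIntensity t
    = ((1 - boseFun t) ^ 2 + Real.exp (-t) * (1 - boseFun' t) ^ 2) / (1 - Real.exp (-t)) := rfl

lemma pairIntensity_nonneg (ht : 0 < t) : 0 ≤ pairIntensity t := by
  have := one_sub_exp_neg_pos' ht
  have := Real.exp_pos (-t)
  rw [pairIntensity_eq]
  positivity

lemma pairIntensity_le_four (ht : 0 < t) (h1 : t ≤ 1) : pairIntensity t ≤ 4 := by
  have hq1 := one_sub_exp_neg_pos' ht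
  have hx1 := boseFun_le_one ht
  have hx2 := one_sub_boseFun_le ht
  have hy1 := one_le_boseFun' ht
  have hy2 := boseFun'_le ht
  have hq2 := one_add_mul_exp_neg_le t
  have hq0 := Real.exp_pos (-t)
  rw [pairIntensity_eq, div_le_iff₀ hq1]
  have e1 : (1 - boseFun t) ^ 2 ≤ t ^ 2 := pow_le_pow_left₀ (by linarith) hx2 2
  have e2 : (1 - boseFun' t) ^ 2 ≤ t ^ 2 := by
    rw [← neg_sub, neg_sq]
    exact pow_le_pow_left₀ (by linarith) (by linarith) 2
  have e3 : Real.exp (-t) * (1 - boseFun' t) ^ 2 ≤ 1 * t ^ 2 :=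
    mul_le_mul (by linarith) e2 (sq_nonneg _) zero_le_one
  -- From `(1 + t) e^{-t} ≤ 1` one gets `1 - e^{-t} ≥ t/(1 + t) ≥ t/2`. The numerator is at most
  -- `2t²`, which beats this denominator.
  have e5 : t ≤ 2 * (1 - Real.exp (-t)) := by nlinarith
  nlinarith

lemma abs_one_sub_pairIntensity_le_of_one_le (h1 : 1 ≤ t) :
    |1 - pairIntensity t| ≤ 2 * (Real.exp (-t) * (1 + 4 * t + t ^ 2)) := by
  have ht : 0 < t := by linarith
  have hq1 := one_sub_exp_neg_pos' ht
  have hx0 := boseFun_pos ht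
  have hx1 := boseFun_le_one ht
  have hy1 := one_le_boseFun' ht
  have hy2 := boseFun'_le ht
  have hq2 := one_add_mul_exp_neg_le t
  have hq0 := Real.exp_pos (-t)
  have hqh : Real.exp (-t) ≤ 1 / 2 := by nlinarith
  have hx' : boseFun t ≤ 2 * (t * Real.exp (-t)) := by
    rw [boseFun, div_le_iff₀ hq1]
    nlinarith [mul_pos ht hq0]
  have e2 : (1 - boseFun' t) ^ 2 ≤ t ^ 2 := by
    rw [← neg_sub, neg_sq]
    exact pow_le_pow_left₀ (by linarith) (by linarith) 2
  have e3 : Real.exp (-t) * (1 - boseFun' t) ^ 2 ≤ Real.exp (-t) * t ^ 2 := by gcongr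
  have e4 : 0 ≤ Real.exp (-t) * (1 - boseFun' t) ^ 2 := by positivity
  have e5 : boseFun t ^ 2 ≤ boseFun t := by nlinarith
  have e7 : 0 ≤ Real.exp (-t) * (1 + 4 * t + t ^ 2) := by positivity
  have e8 : Real.exp (-t) * (1 + 4 * t + t ^ 2)
      = Real.exp (-t) + 4 * (t * Real.exp (-t)) + Real.exp (-t) * t ^ 2 := by ring
  have e9 : 0 < t * Real.exp (-t) := by positivity
  have : 1 - pairIntensity t = (2 * boseFun t - boseFun t ^ 2
      - Real.exp (-t) * (1 - boseFun' t) ^ 2 - Real.exp (-t)) / (1 - Real.exp (-t)) := by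
    rw [pairIntensity_eq]
    field_simp
    ring
  rw [this, abs_div, abs_of_pos hq1, div_le_iff₀ hq1]
  have e6 : |2 * boseFun t - boseFun t ^ 2 - Real.exp (-t) * (1 - boseFun' t) ^ 2 - Real.exp (-t)|
      ≤ Real.exp (-t) * (1 + 4 * t + t ^ 2) := by
    rw [abs_le, e8]
    constructor
    · linarith
    · linarith [sq_nonneg (boseFun t)]
  nlinarith

/-- For `t ≤ 1` the difference is at most `3` and the exponential at least `1/2`. For `t ≥ 1` half
of `e^{-t}` absorbs the polynomial: `(1 + 4t + t²) e^{-t/2} ≤ 1 + 8 + 8`. The constant is generous.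
-/
lemma abs_one_sub_pairIntensity_le (ht : 0 < t) :
    |1 - pairIntensity t| ≤ 100 * Real.exp (-t / 2) := by
  rcases le_total t 1 with h1 | h1
  · have hle := pairIntensity_le_four ht h1
    have hD := pairIntensity_nonneg ht
    have he : Real.exp (-t / 2) ≥ 1 / 2 := by
      have := Real.add_one_le_exp (-t / 2)
      linarith
    rw [abs_le]
    constructor <;> linarith
  · refine (abs_one_sub_pairIntensity_le_of_one_le h1).trans ?_
    have hE : Real.exp (t / 2) * Real.exp (-t / 2) = 1 := by
      rw [← Real.exp_add]; simp [neg_div]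
    have hqe : Real.exp (-t) = Real.exp (-t / 2) * Real.exp (-t / 2) := by
      rw [← Real.exp_add]; congr 1; ring
    have he0 : 0 < Real.exp (-t / 2) := Real.exp_pos _
    have he1 : Real.exp (-t / 2) ≤ 1 := by rw [Real.exp_le_one_iff]; linarith
    have hte : t * Real.exp (-t / 2) ≤ 2 := by
      have := Real.add_one_le_exp (t / 2)
      calc t * Real.exp (-t / 2) ≤ (2 * Real.exp (t / 2)) * Real.exp (-t / 2) := by
            gcongr; linarith
        _ = 2 := by rw [mul_assoc, hE, mul_one]
    have hte2 : t ^ 2 * Real.exp (-t / 2) ≤ 8 := by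
      have := Real.quadratic_le_exp_of_nonneg (x := t / 2) (by linarith)
      calc t ^ 2 * Real.exp (-t / 2) ≤ (8 * Real.exp (t / 2)) * Real.exp (-t / 2) := by
            gcongr; nlinarith
        _ = 8 := by rw [mul_assoc, hE, mul_one]
    have h17 : Real.exp (-t / 2) * (1 + 4 * t + t ^ 2) ≤ 17 := by linarith
    rw [hqe]
    calc 2 * (Real.exp (-t / 2) * Real.exp (-t / 2) * (1 + 4 * t + t ^ 2))
        = 2 * (Real.exp (-t / 2) * (Real.exp (-t / 2) * (1 + 4 * t + t ^ 2))) := by ring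
      _ ≤ 2 * (Real.exp (-t / 2) * 17) := by gcongr
      _ ≤ 100 * Real.exp (-t / 2) := by linarith

/-! ### Primitives of the cluster function and of its logarithmic moment. -/

/-- A primitive of `pairIntensity - 1`. -/
noncomputable def clusterPrim (t : ℝ) : ℝ := boseFun t * (2 - boseFun' t)

lemma hasDerivAt_boseFun' (ht : 0 < t) : HasDerivAt boseFun'
    (1 / (1 - Real.exp (-t)) - t * Real.exp (-t) / (1 - Real.exp (-t)) ^ 2) t := by
  have hq1 := one_sub_exp_neg_pos' ht
  have h1 : HasDerivAt (fun t => 1 - Real.exp (-t)) (Real.exp (-t)) t := by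
    have := ((hasDerivAt_id t).neg.exp).const_sub 1
    simpa using this
  refine ((hasDerivAt_id t).div h1 hq1.ne').congr_deriv ?_
  simp only [id]
  field_simp

lemma hasDerivAt_boseFun (ht : 0 < t) : HasDerivAt boseFun
    (Real.exp (-t) / (1 - Real.exp (-t)) - t * Real.exp (-t) / (1 - Real.exp (-t)) ^ 2) t := by
  have hq1 := one_sub_exp_neg_pos' ht
  have h := (hasDerivAt_boseFun' ht).sub (hasDerivAt_id t)
  refine (h.congr_of_eventuallyEq ?_).congr_deriv ?_
  · filter_upwards [lt_mem_nhds ht] with s hs using boseFun_eq hs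
  · field_simp
    ring

lemma hasDerivAt_clusterPrim (ht : 0 < t) :
    HasDerivAt clusterPrim (pairIntensity t - 1) t := by
  have hq1 := one_sub_exp_neg_pos' ht
  refine ((hasDerivAt_boseFun ht).mul ((hasDerivAt_boseFun' ht).const_sub 2)).congr_deriv ?_
  rw [pairIntensity_eq, boseFun, boseFun']
  field_simp
  ring

lemma abs_clusterPrim_sub_one_le (ht : 0 < t) : |clusterPrim t - 1| ≤ 2 * t := by
  have hx0 := boseFun_pos ht
  have hx1 := boseFun_le_one ht
  have hx2 := one_sub_boseFun_le ht
  have hy1 := one_le_boseFun' ht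
  have hy2 := boseFun'_le ht
  rw [clusterPrim, abs_le]
  constructor <;> nlinarith

lemma tendsto_mul_exp_neg : Tendsto (fun t : ℝ => t * Real.exp (-t)) atTop (𝓝 0) := by
  simpa using Real.tendsto_pow_mul_exp_neg_atTop_nhds_zero 1

lemma tendsto_one_sub_exp_neg : Tendsto (fun t : ℝ => 1 - Real.exp (-t)) atTop (𝓝 1) := by
  simpa using (Real.tendsto_exp_neg_atTop_nhds_zero).const_sub 1

lemma tendsto_boseFun_atTop : Tendsto boseFun atTop (𝓝 0) := by
  have h := tendsto_mul_exp_neg.div tendsto_one_sub_exp_neg one_ne_zero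
  rw [zero_div] at h
  exact h

lemma abs_clusterPrim_le (ht : 1 ≤ t) : |clusterPrim t| ≤ 4 * (t ^ 2 * Real.exp (-t))  := by
  have ht0 : 0 < t := by linarith
  have hq1 := one_sub_exp_neg_pos' ht0
  have hx0 := boseFun_pos ht0
  have hy1 := one_le_boseFun' ht0
  have hy2 := boseFun'_le ht0
  have hq2 := one_add_mul_exp_neg_le t
  have hq0 := Real.exp_pos (-t)
  have hx' : boseFun t ≤ 2 * (t * Real.exp (-t)) := by
    rw [boseFun, div_le_iff₀ hq1]
    have : Real.exp (-t) ≤ 1 / 2 := by nlinarith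
    nlinarith [mul_pos ht0 hq0]
  rw [clusterPrim, abs_mul, abs_of_pos hx0]
  have h2 : |2 - boseFun' t| ≤ 2 * t := by
    rw [abs_le]; constructor <;> linarith
  calc _ ≤ (2 * (t * Real.exp (-t))) * (2 * t) := mul_le_mul hx' h2 (abs_nonneg _) (by positivity)
    _ = _ := by ring

lemma tendsto_clusterPrim_atTop : Tendsto clusterPrim atTop (𝓝 0) := by
  have h := (Real.tendsto_pow_mul_exp_neg_atTop_nhds_zero 2).const_mul 4
  rw [mul_zero] at h
  refine squeeze_zero_norm' ?_ h
  filter_upwards [eventually_ge_atTop 1] with t ht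
  exact abs_clusterPrim_le ht

lemma tendsto_clusterPrim_zero : Tendsto clusterPrim (𝓝[>] 0) (𝓝 1) := by
  rw [tendsto_iff_norm_sub_tendsto_zero]
  have h : Tendsto (fun t : ℝ => 2 * t) (𝓝[>] 0) (𝓝 0) := by
    have : Tendsto (fun t : ℝ => 2 * t) (𝓝 0) (𝓝 (2 * 0)) := tendsto_id.const_mul 2
    rw [mul_zero] at this
    exact this.mono_left nhdsWithin_le_nhds
  refine squeeze_zero' (Eventually.of_forall fun _ => norm_nonneg _) ?_ h
  filter_upwards [self_mem_nhdsWithin] with t ht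
  exact abs_clusterPrim_sub_one_le ht

/-- A primitive of `log (t / π) (1 - pairIntensity t) / 2`. -/
noncomputable def logClusterPrim (t : ℝ) : ℝ :=
  -(1 / 2) * (clusterPrim t * Real.log (t / Real.pi) - Real.log (1 - Real.exp (-t)) - boseFun t)

/-- Integration by parts against `clusterPrim`; it closes because `clusterPrim t / t` is the
derivative of `log(1 - e^{-t}) + boseFun t`. -/
lemma hasDerivAt_logClusterPrim (ht : 0 < t) : HasDerivAt logClusterPrim
    (1 / 2 * Real.log (t / Real.pi) * (1 - pairIntensity t)) t := by
  have hq1 := one_sub_exp_neg_pos' ht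
  have hpi := Real.pi_pos
  have h1 : HasDerivAt (fun t => 1 - Real.exp (-t)) (Real.exp (-t)) t := by
    have := ((hasDerivAt_id t).neg.exp).const_sub 1
    simpa using this
  have h2 : HasDerivAt (fun t => Real.log (t / Real.pi)) (1 / t) t := by
    have := ((hasDerivAt_id t).div_const Real.pi).log (by simp only [id]; positivity)
    refine this.congr_deriv ?_
    simp only [id]
    field_simp
  refine (((((hasDerivAt_clusterPrim ht).mul h2).sub (h1.log hq1.ne')).sub
    (hasDerivAt_boseFun ht)).const_mul (-(1 / 2))).congr_deriv ?_
  rw [clusterPrim, boseFun, boseFun']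
  field_simp
  ring

lemma tendsto_logClusterPrim_atTop : Tendsto logClusterPrim atTop (𝓝 0) := by
  have h1 : Tendsto (fun t => clusterPrim t * Real.log (t / Real.pi)) atTop (𝓝 0) := by
    have h := (Real.tendsto_pow_mul_exp_neg_atTop_nhds_zero 3).const_mul 4
    rw [mul_zero] at h
    refine squeeze_zero_norm' ?_ h
    filter_upwards [eventually_ge_atTop 4] with t ht
    have hpi := Real.pi_pos
    have h0 : 0 ≤ Real.log (t / Real.pi) := Real.log_nonneg (by
      rw [one_le_div hpi]; linarith [Real.pi_lt_four])
    have h2 : Real.log (t / Real.pi) ≤ t := by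
      refine (Real.log_le_self (by positivity)).trans (div_le_self (by linarith) ?_)
      linarith [Real.pi_gt_three]
    rw [norm_mul, Real.norm_eq_abs, Real.norm_eq_abs, abs_of_nonneg h0]
    calc _ ≤ 4 * (t ^ 2 * Real.exp (-t)) * t :=
          mul_le_mul (abs_clusterPrim_le (by linarith)) h2 h0 (by positivity)
      _ = _ := by ring
  have h2 : Tendsto (fun t => Real.log (1 - Real.exp (-t))) atTop (𝓝 0) := by
    have := tendsto_one_sub_exp_neg.log one_ne_zero
    rwa [Real.log_one] at this
  have h := ((h1.sub h2).sub tendsto_boseFun_atTop).const_mul (-(1 / 2))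
  rw [sub_zero, sub_zero, mul_zero] at h
  exact h

lemma tendsto_boseFun'_zero : Tendsto boseFun' (𝓝[>] 0) (𝓝 1) := by
  have h : Tendsto (fun t : ℝ => 1 + t) (𝓝[>] 0) (𝓝 1) := by
    have : Tendsto (fun t : ℝ => 1 + t) (𝓝 0) (𝓝 (1 + 0)) := tendsto_id.const_add 1
    rw [add_zero] at this
    exact this.mono_left nhdsWithin_le_nhds
  refine tendsto_of_tendsto_of_tendsto_of_le_of_le' tendsto_const_nhds h ?_ ?_ <;>
  filter_upwards [self_mem_nhdsWithin] with t ht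
  · exact one_le_boseFun' ht
  · exact boseFun'_le ht

/-- The two logarithmic divergences cancel: they combine into `(clusterPrim t - 1) log t`, which is
`O(t log t)`, and `log boseFun'`. There remain `log π` and the limit `1` of `boseFun`, the two terms
of the final constant. -/
lemma tendsto_logClusterPrim_zero :
    Tendsto logClusterPrim (𝓝[>] 0) (𝓝 (1 / 2 * (1 + Real.log Real.pi))) := by
  have hpi := Real.pi_pos
  have hid : Tendsto (fun t : ℝ => t) (𝓝[>] 0) (𝓝 0) := tendsto_id.mono_left nhdsWithin_le_nhds
  have h1 : Tendsto (fun t => (clusterPrim t - 1) * Real.log t) (𝓝[>] 0) (𝓝 0) := by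
    have h := (tendsto_log_mul_rpow_nhdsGT_zero one_pos).norm.const_mul 2
    simp only [norm_zero, mul_zero, Real.rpow_one] at h
    refine squeeze_zero_norm' ?_ h
    filter_upwards [self_mem_nhdsWithin] with t ht
    have ht' : 0 < t := ht
    rw [norm_mul, norm_mul, Real.norm_eq_abs t, abs_of_pos ht', ← mul_assoc, mul_right_comm]
    exact mul_le_mul_of_nonneg_right (abs_clusterPrim_sub_one_le ht') (norm_nonneg _)
  have h2 : Tendsto (fun t => Real.log (boseFun' t)) (𝓝[>] 0) (𝓝 0) := by
    have := tendsto_boseFun'_zero.log one_ne_zero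
    rwa [Real.log_one] at this
  have h3 : Tendsto (fun t => boseFun' t - t) (𝓝[>] 0) (𝓝 1) := by
    simpa using tendsto_boseFun'_zero.sub hid
  have h := (((h1.add h2).sub (tendsto_clusterPrim_zero.mul_const (Real.log Real.pi))).sub
    h3).const_mul (-(1 / 2))
  have e : -(1 / 2) * (0 + 0 - 1 * Real.log Real.pi - 1) = 1 / 2 * (1 + Real.log Real.pi) := by ring
  rw [e] at h
  refine h.congr' ?_
  filter_upwards [self_mem_nhdsWithin] with t ht
  have ht' : 0 < t := ht
  rw [logClusterPrim, boseFun_eq ht', Real.log_div ht'.ne' hpi.ne', boseFun',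
    Real.log_div ht'.ne' (one_sub_exp_neg_pos' ht').ne']
  ring

end PairIntensity

/-! ### Identification with the hyperbolic formula -/

lemma hasDerivAt_coth {t : ℝ} (ht : t ≠ 0) :
    HasDerivAt (fun t => Real.cosh t / Real.sinh t) (-1 / Real.sinh t ^ 2) t := by
  have hs : Real.sinh t ≠ 0 := by simpa using ht
  refine ((Real.hasDerivAt_cosh t).div (Real.hasDerivAt_sinh t) hs).congr_deriv ?_
  rw [← Real.cosh_sq_sub_sinh_sq t]
  ring

lemma hasDerivAt_deriv_sq_mul_coth_sub_one {u : ℝ} (hu : u ≠ 0) :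
    HasDerivAt (deriv fun t : ℝ => t ^ 2 * (Real.cosh t / Real.sinh t - 1))
      (2 * (Real.cosh u / Real.sinh u - 1)
        - 4 * u / Real.sinh u ^ 2 + 2 * u ^ 2 * Real.cosh u / Real.sinh u ^ 3) u := by
  have hs : Real.sinh u ≠ 0 := by simpa using hu
  have h1 : ∀ t : ℝ, t ≠ 0 → HasDerivAt (fun t : ℝ => t ^ 2 * (Real.cosh t / Real.sinh t - 1))
      (2 * t * (Real.cosh t / Real.sinh t - 1) - t ^ 2 / Real.sinh t ^ 2) t := by
    intro t ht
    refine ((hasDerivAt_pow 2 t).mul ((hasDerivAt_coth ht).sub_const 1)).congr_deriv ?_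
    push_cast
    ring
  have h2 : HasDerivAt (fun t => 2 * t * (Real.cosh t / Real.sinh t - 1)
      - t ^ 2 / Real.sinh t ^ 2) (2 * (Real.cosh u / Real.sinh u - 1)
      - 4 * u / Real.sinh u ^ 2 + 2 * u ^ 2 * Real.cosh u / Real.sinh u ^ 3) u := by
    have e1 := ((hasDerivAt_id u).const_mul 2).mul ((hasDerivAt_coth hu).sub_const 1)
    have e2 := (hasDerivAt_pow 2 u).div ((Real.hasDerivAt_sinh u).pow 2) (pow_ne_zero 2 hs)
    refine (e1.sub e2).congr_deriv ?_
    simp only [id, Pi.pow_apply]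
    field_simp
    push_cast
    ring
  refine h2.congr_of_eventuallyEq ?_
  filter_upwards [isOpen_ne.mem_nhds hu] with t ht using (h1 t ht).deriv

lemma gafH_eq_deriv (u : ℝ) : gafH u = 1 + 1 / 2 * deriv
    (deriv fun t : ℝ => t ^ 2 * (Real.cosh t / Real.sinh t - 1)) u := by
  rw [gafH, show (2 : ℕ) = 1 + 1 from rfl, iteratedDeriv_succ, iteratedDeriv_one]

lemma gafH_eq {u : ℝ} (hu : u ≠ 0) : gafH u
    = (Real.sinh u ^ 2 * Real.cosh u - 2 * u * Real.sinh u + u ^ 2 * Real.cosh u)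
      / Real.sinh u ^ 3 := by
  have hs : Real.sinh u ≠ 0 := by simpa using hu
  rw [gafH_eq_deriv, (hasDerivAt_deriv_sq_mul_coth_sub_one hu).deriv]
  field_simp
  ring

/-- Both sides are rational in `u` and `e^{-u}`; the argument doubles because `t = π|z|²` while
`gafT` uses half of it. -/
lemma gafH_eq_pairIntensity {u : ℝ} (hu : 0 < u) : gafH u = pairIntensity (2 * u) := by
  have he : Real.exp (-(2 * u)) = Real.exp (-u) ^ 2 := by
    rw [← Real.exp_nat_mul]; congr 1; push_cast; ring
  have hm : Real.exp u * Real.exp (-u) = 1 := by rw [← Real.exp_add]; simp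
  have hs : 0 < Real.sinh u := Real.sinh_pos_iff.2 hu
  have hc : Real.cosh u = (Real.exp u + Real.exp (-u)) / 2 := Real.cosh_eq u
  have hs2 : Real.sinh u = (Real.exp u - Real.exp (-u)) / 2 := Real.sinh_eq u
  have hE : Real.exp u = (Real.exp (-u))⁻¹ := eq_inv_of_mul_eq_one_left hm
  have hq : 0 < 1 - Real.exp (-(2 * u)) := one_sub_exp_neg_pos' (by linarith)
  rw [he] at hq
  rw [gafH_eq hu.ne', pairIntensity, he, hs2, hc, hE]
  have hb := Real.exp_pos (-u)
  set b := Real.exp (-u)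
  have h1 : (b⁻¹ - b) = (1 - b ^ 2) / b := by field_simp
  have h2 : (b⁻¹ + b) = (1 + b ^ 2) / b := by field_simp
  rw [h1, h2]
  field_simp
  ring

/-- The value at the origin need not be computed. If the first derivative is not differentiable
there, the second derivative is `0` by convention and the value is `1`. Otherwise `g' + 2t` is
nondecreasing on `[0, ∞)`, as its derivative is twice a nonnegative function on the interior, so its
derivative at `0` is nonnegative. -/
lemma gafH_zero_nonneg : 0 ≤ gafH 0 := by
  set g : ℝ → ℝ := fun t : ℝ => t ^ 2 * (Real.cosh t / Real.sinh t - 1) with hg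
  rw [gafH_eq_deriv]
  by_cases hd : DifferentiableAt ℝ (deriv g) 0
  · have hdd : ∀ u, 0 ≤ u → DifferentiableAt ℝ (deriv g) u := by
      intro u hu
      rcases hu.eq_or_lt with rfl | hu
      · exact hd
      · exact (hasDerivAt_deriv_sq_mul_coth_sub_one hu.ne').differentiableAt
    have hder : ∀ u, 0 ≤ u → HasDerivAt (fun t => deriv g t + 2 * t) (deriv (deriv g) u + 2) u := by
      intro u hu
      exact ((hdd u hu).hasDerivAt.add ((hasDerivAt_id u).const_mul 2)).congr_deriv (by simp)
    have hmono : MonotoneOn (fun t => deriv g t + 2 * t) (Set.Ici 0) := by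
      refine monotoneOn_of_deriv_nonneg (convex_Ici 0)
        (fun u hu => (hder u hu).continuousAt.continuousWithinAt)
        (fun u hu => (hder u (interior_subset hu)).differentiableAt.differentiableWithinAt)
        fun u hu => ?_
      rw [interior_Ici] at hu
      have hu' : 0 < u := hu
      have h1 : 0 ≤ gafH u := by
        rw [gafH_eq_pairIntensity hu']; exact pairIntensity_nonneg (by linarith)
      rw [gafH_eq_deriv] at h1
      rw [(hder u hu'.le).deriv]
      linarith
    have h0 := hmono.derivWithin_nonneg (x := 0)
    rw [(hder 0 le_rfl).hasDerivWithinAt.derivWithin (uniqueDiffWithinAt_Ici 0)] at h0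
    linarith
  · rw [deriv_zero_of_not_differentiableAt hd]
    norm_num

lemma gafH_nonneg {u : ℝ} (hu : 0 ≤ u) : 0 ≤ gafH u := by
  rcases hu.eq_or_lt with rfl | hu
  · exact gafH_zero_nonneg
  · rw [gafH_eq_pairIntensity hu]
    exact pairIntensity_nonneg (by linarith)

lemma measurable_gafH : Measurable gafH := by
  have h : gafH = fun u => if u = 0 then gafH 0 else
      (Real.sinh u ^ 2 * Real.cosh u - 2 * u * Real.sinh u + u ^ 2 * Real.cosh u)
      / Real.sinh u ^ 3 := by
    funext u
    split_ifs with h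
    · rw [h]
    · exact gafH_eq h
  rw [h]
  refine Measurable.ite (measurableSet_singleton (0 : ℝ)) measurable_const ?_
  have h1 := Real.continuous_sinh.measurable
  have h2 := Real.continuous_cosh.measurable
  exact ((((h1.pow_const 2).mul h2).sub ((measurable_id.const_mul 2).mul h1)).add
    ((measurable_id.pow_const 2).mul h2)).div (h1.pow_const 3)

/-! ### Integrals of the cluster function -/

lemma gafT_eq {z : ℂ} (hz : z ≠ 0) : gafT z = 1 - pairIntensity (Real.pi * ‖z‖ ^ 2) := by
  have : 0 < ‖z‖ := norm_pos_iff.2 hz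
  have := Real.pi_pos
  rw [gafT, gafH_eq_pairIntensity (by positivity)]
  congr 2
  ring

lemma one_sub_gafT_nonneg (z : ℂ) : 0 ≤ 1 - gafT z := by
  have := Real.pi_pos
  rw [gafT, sub_sub_cancel]
  exact gafH_nonneg (by positivity)

lemma measurable_gafT : Measurable gafT := by
  unfold gafT
  have := measurable_gafH
  fun_prop

lemma abs_gafT_le {z : ℂ} (hz : z ≠ 0) : |gafT z| ≤ 100 * Real.exp (-(Real.pi / 2) * ‖z‖ ^ 2) := by
  have : 0 < ‖z‖ := norm_pos_iff.2 hz
  have := Real.pi_pos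
  rw [gafT_eq hz]
  refine (abs_one_sub_pairIntensity_le (by positivity)).trans_eq ?_
  congr 2
  ring

lemma integrable_radial {f : ℝ → ℝ} : Integrable (fun z : ℂ => f ‖z‖)
    ↔ IntegrableOn (fun r => r * f r) (Set.Ioi 0) := by
  rw [integrable_fun_norm_addHaar (volume : Measure ℂ), Complex.finrank_real_complex]
  simp

lemma integral_radial (f : ℝ → ℝ) :
    ∫ z : ℂ, f ‖z‖ = 2 * Real.pi * ∫ r in Set.Ioi (0 : ℝ), r * f r := by
  rw [integral_fun_norm_addHaar (volume : Measure ℂ), Complex.finrank_real_complex]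
  simp [Measure.real, Complex.volume_ball, mul_assoc]

lemma integrableOn_pow_mul_exp (k : ℕ) :
    IntegrableOn (fun r : ℝ => r ^ k * Real.exp (-(Real.pi / 2) * r ^ 2)) (Set.Ioi 0) := by
  have h := integrableOn_rpow_mul_exp_neg_mul_sq (b := Real.pi / 2) (by positivity)
    (s := k) (by linarith [(Nat.cast_nonneg k : (0 : ℝ) ≤ k)])
  simpa using h

lemma integrable_norm_pow_mul_exp (k : ℕ) :
    Integrable fun z : ℂ => ‖z‖ ^ k * Real.exp (-(Real.pi / 2) * ‖z‖ ^ 2) := by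
  refine (integrable_radial (f := fun r => r ^ k * Real.exp (-(Real.pi / 2) * r ^ 2))).2 ?_
  refine (integrableOn_pow_mul_exp (k + 1)).congr_fun (fun r _ => ?_) measurableSet_Ioi
  ring

lemma integrable_norm_pow_mul_abs_gafT (k : ℕ) : Integrable fun z : ℂ => ‖z‖ ^ k * |gafT z| := by
  refine ((integrable_norm_pow_mul_exp k).const_mul 100).mono'
    ((measurable_norm.pow_const k).mul (_root_.measurable_abs.comp measurable_gafT)).aestronglyMeasurable
    ?_
  filter_upwards [Measure.ae_ne volume (0 : ℂ)] with z hz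
  rw [norm_mul, norm_pow, norm_norm, Real.norm_eq_abs, abs_abs]
  calc _ ≤ ‖z‖ ^ k * (100 * Real.exp (-(Real.pi / 2) * ‖z‖ ^ 2)) := by
        gcongr
        exact abs_gafT_le hz
    _ = _ := by ring

lemma integrable_gafT : Integrable gafT := by
  have h := integrable_norm_pow_mul_abs_gafT 0
  simp only [pow_zero, one_mul] at h
  exact (integrable_norm_iff measurable_gafT.aestronglyMeasurable).1 h

lemma abs_log_le {r : ℝ} (hr : 0 < r) : |Real.log r| ≤ r + r⁻¹ := by
  have h1 := Real.log_le_self hr.le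
  have h2 := Real.log_le_self (inv_pos.2 hr).le
  rw [Real.log_inv] at h2
  have := inv_pos.2 hr
  rw [abs_le]
  constructor <;> linarith

lemma integrable_log_mul_exp :
    Integrable fun z : ℂ => |Real.log ‖z‖| * Real.exp (-(Real.pi / 2) * ‖z‖ ^ 2) := by
  refine (integrable_radial (f := fun r => |Real.log r| * Real.exp (-(Real.pi / 2) * r ^ 2))).2 ?_
  refine ((integrableOn_pow_mul_exp 2).add (integrableOn_pow_mul_exp 0)).mono' ?_ ?_
  · exact (measurable_id.mul ((_root_.measurable_abs.comp Real.measurable_log).mul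
      (Real.measurable_exp.comp (by fun_prop)))).aestronglyMeasurable
  · filter_upwards [ae_restrict_mem measurableSet_Ioi] with r hr
    have hr' : 0 < r := hr
    rw [norm_mul, norm_mul, Real.norm_eq_abs, Real.norm_eq_abs, Real.norm_eq_abs, abs_abs,
      abs_of_pos hr', abs_of_pos (Real.exp_pos _), ← mul_assoc]
    simp only [Pi.add_apply]
    rw [← add_mul]
    gcongr
    calc r * |Real.log r| ≤ r * (r + r⁻¹) := by gcongr; exact abs_log_le hr'
      _ = r ^ 2 + r ^ 0 := by field_simp

lemma integrable_log_mul_gafT : Integrable fun z : ℂ => Real.log ‖z‖ * gafT z := by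
  refine (integrable_log_mul_exp.const_mul 100).mono'
    ((Real.measurable_log.comp measurable_norm).mul measurable_gafT).aestronglyMeasurable ?_
  filter_upwards [Measure.ae_ne volume (0 : ℂ)] with z hz
  rw [norm_mul, Real.norm_eq_abs, Real.norm_eq_abs]
  calc _ ≤ |Real.log ‖z‖| * (100 * Real.exp (-(Real.pi / 2) * ‖z‖ ^ 2)) := by
        gcongr
        exact abs_gafT_le hz
    _ = _ := by ring

/-- The primitives have a limit at `0`, but their formulas divide by zero there; the value at `0` is
replaced by that limit. -/
lemma integral_Ioi_zero_of_hasDerivAt_of_tendsto {f f' : ℝ → ℝ} {l m : ℝ}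
    (hderiv : ∀ x, 0 < x → HasDerivAt f (f' x) x) (hint : IntegrableOn f' (Set.Ioi 0))
    (h0 : Tendsto f (𝓝[>] 0) (𝓝 l)) (hf : Tendsto f atTop (𝓝 m)) :
    ∫ x in Set.Ioi 0, f' x = m - l := by
  have hne : ∀ x : ℝ, 0 < x → Function.update f 0 l =ᶠ[𝓝 x] f := fun x hx => by
    filter_upwards [lt_mem_nhds hx] with y hy
    exact Function.update_of_ne hy.ne' _ _
  have h := integral_Ioi_of_hasDerivAt_of_tendsto (f := Function.update f 0 l) (f' := f') (a := 0)
    (m := m) ?_ (fun x hx => (hderiv x hx).congr_of_eventuallyEq (hne x hx)) hint ?_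
  · rwa [Function.update_self] at h
  · rw [continuousWithinAt_update_same, Set.Ici_sdiff_left]
    exact h0
  · refine hf.congr' ?_
    filter_upwards [eventually_gt_atTop 0] with y hy
    exact (Function.update_of_ne hy.ne' _ _).symm

lemma hasDerivAt_comp_pi_mul_sq {f : ℝ → ℝ} {f' r : ℝ} (h : HasDerivAt f f' (Real.pi * r ^ 2)) :
    HasDerivAt (fun r => f (Real.pi * r ^ 2)) (2 * Real.pi * (r * f')) r := by
  refine (h.comp r ((hasDerivAt_pow 2 r).const_mul Real.pi)).congr_deriv ?_
  push_cast
  ring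

lemma tendsto_pi_mul_sq_zero : Tendsto (fun r : ℝ => Real.pi * r ^ 2) (𝓝[>] 0) (𝓝[>] 0) := by
  have hpi := Real.pi_pos
  refine tendsto_nhdsWithin_iff.2 ⟨?_, ?_⟩
  · have : Tendsto (fun r : ℝ => Real.pi * r ^ 2) (𝓝 0) (𝓝 (Real.pi * 0 ^ 2)) :=
      Continuous.tendsto (by fun_prop) 0
    simp only [ne_eq, OfNat.ofNat_ne_zero, not_false_eq_true, zero_pow, mul_zero] at this
    exact this.mono_left nhdsWithin_le_nhds
  · filter_upwards [self_mem_nhdsWithin] with r hr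
    have hr' : 0 < r := hr
    exact Set.mem_Ioi.2 (by positivity)

lemma tendsto_pi_mul_sq_atTop : Tendsto (fun r : ℝ => Real.pi * r ^ 2) atTop atTop :=
  (tendsto_pow_atTop two_ne_zero).const_mul_atTop Real.pi_pos

/-- In polar coordinates `2π r dr` is the differential of `π r²`, so a primitive in `t = π|z|²` is
all that is needed. -/
lemma integral_radial_of_primitive {f F : ℝ → ℝ} {l m : ℝ}
    (hF : ∀ t, 0 < t → HasDerivAt F (f t) t)
    (hint : Integrable fun z : ℂ => f (Real.pi * ‖z‖ ^ 2)) (h0 : Tendsto F (𝓝[>] 0) (𝓝 l))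
    (h1 : Tendsto F atTop (𝓝 m)) : ∫ z : ℂ, f (Real.pi * ‖z‖ ^ 2) = m - l := by
  have hpi := Real.pi_pos
  rw [integral_radial fun r => f (Real.pi * r ^ 2), ← integral_const_mul]
  refine integral_Ioi_zero_of_hasDerivAt_of_tendsto (f := fun r => F (Real.pi * r ^ 2))
    (fun r hr => hasDerivAt_comp_pi_mul_sq (hF _ (by positivity)))
    ((integrable_radial (f := fun r => f (Real.pi * r ^ 2)).1 hint).const_mul _)
    (h0.comp tendsto_pi_mul_sq_zero) (h1.comp tendsto_pi_mul_sq_atTop)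

lemma integral_gafT : ∫ z : ℂ, gafT z = 1 := by
  have hae : gafT =ᵐ[volume] fun z : ℂ => 1 - pairIntensity (Real.pi * ‖z‖ ^ 2) := by
    filter_upwards [Measure.ae_ne volume (0 : ℂ)] with z hz using gafT_eq hz
  rw [integral_congr_ae hae]
  have h := integral_radial_of_primitive (f := fun t => 1 - pairIntensity t)
    (F := fun t => -clusterPrim t) (fun t ht => (hasDerivAt_clusterPrim ht).neg.congr_deriv (by ring))
    (integrable_gafT.congr hae) tendsto_clusterPrim_zero.neg tendsto_clusterPrim_atTop.neg
  rw [h]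
  norm_num

lemma integral_log_mul_gafT :
    ∫ z : ℂ, Real.log ‖z‖ * gafT z = -(1 / 2) * (1 + Real.log Real.pi) := by
  have hpi := Real.pi_pos
  have hae : (fun z : ℂ => Real.log ‖z‖ * gafT z) =ᵐ[volume] fun z : ℂ =>
      1 / 2 * Real.log (Real.pi * ‖z‖ ^ 2 / Real.pi) * (1 - pairIntensity (Real.pi * ‖z‖ ^ 2)) := by
    filter_upwards [Measure.ae_ne volume (0 : ℂ)] with z hz
    rw [gafT_eq hz, mul_div_cancel_left₀ _ hpi.ne', Real.log_pow]
    push_cast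
    ring
  rw [integral_congr_ae hae, integral_radial_of_primitive
    (f := fun t => 1 / 2 * Real.log (t / Real.pi) * (1 - pairIntensity t))
    (fun t ht => hasDerivAt_logClusterPrim ht) (integrable_log_mul_gafT.congr hae)
    tendsto_logClusterPrim_zero tendsto_logClusterPrim_atTop]
  ring

/-! ### Truncation of the integral to squares. -/

lemma measurableSet_centeredSquare (N : ℝ) : MeasurableSet (centeredSquare N) :=
  (measurableSet_Icc.preimage Complex.measurable_re).inter
    (measurableSet_Icc.preimage Complex.measurable_im)

lemma le_norm_of_notMem_centeredSquare {N : ℝ} {z : ℂ} (h : z ∉ centeredSquare N) : N ≤ ‖z‖ := by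
  by_contra hlt
  push Not at hlt
  refine h (Complex.mem_reProdIm.2 ⟨abs_le.1 ?_, abs_le.1 ?_⟩)
  · exact (Complex.abs_re_le_norm z).trans hlt.le
  · exact (Complex.abs_im_le_norm z).trans hlt.le

/-- Off the square `|v| ≥ N`, so the finite first moment bounds the tail by a multiple of `1/N`,
which is negligible against `1/log N`. -/
lemma one_sub_integral_gafT_isLittleO :
    (fun N : ℝ => 1 - ∫ v in centeredSquare N, gafT v) =o[atTop] fun N : ℝ => (Real.log N)⁻¹ := by
  have hI := integrable_norm_pow_mul_abs_gafT 1
  simp only [pow_one] at hI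
  have hO : (fun N : ℝ => 1 - ∫ v in centeredSquare N, gafT v) =O[atTop] fun N : ℝ => N⁻¹ := by
    refine IsBigO.of_bound (∫ z : ℂ, ‖z‖ * |gafT z|) ?_
    filter_upwards [eventually_gt_atTop 0] with N hN
    have h1 : 1 - ∫ v in centeredSquare N, gafT v = ∫ v in (centeredSquare N)ᶜ, gafT v := by
      rw [← integral_gafT, ← integral_add_compl (measurableSet_centeredSquare N) integrable_gafT]
      ring
    rw [h1, norm_inv, Real.norm_eq_abs N, abs_of_pos hN, ← div_eq_mul_inv, le_div_iff₀ hN]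
    calc ‖∫ v in (centeredSquare N)ᶜ, gafT v‖ * N
        ≤ (∫ v in (centeredSquare N)ᶜ, |gafT v|) * N := by
          gcongr
          exact norm_integral_le_integral_norm _
      _ = ∫ v in (centeredSquare N)ᶜ, |gafT v| * N := (integral_mul_const _ _).symm
      _ ≤ ∫ v in (centeredSquare N)ᶜ, ‖v‖ * |gafT v| := by
          refine setIntegral_mono_on (integrable_gafT.abs.mul_const N).integrableOn hI.integrableOn
            (measurableSet_centeredSquare N).compl fun v hv => ?_
          rw [mul_comm]
          gcongr
          exact le_norm_of_notMem_centeredSquare hv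
      _ ≤ ∫ v : ℂ, ‖v‖ * |gafT v| :=
          setIntegral_le_integral hI (ae_of_all _ fun v => by positivity)
  refine hO.trans_isLittleO ?_
  refine Real.isLittleO_log_id_atTop.inv_rev ?_
  filter_upwards [eventually_gt_atTop 1] with N hN h
  exact absurd h (Real.log_pos hN).ne'

/-! ## The twisted Eisenstein series at `s = 1` -/

/-- The function `e^{2πix}`. -/
noncomputable def unitExp (x : ℝ) : ℂ := Complex.exp (2 * Real.pi * Complex.I * x)

lemma norm_unitExp (x : ℝ) : ‖unitExp x‖ = 1 := by
  rw [unitExp, show 2 * (Real.pi : ℂ) * Complex.I * x = ((2 * Real.pi * x : ℝ) : ℂ) * Complex.I by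
    push_cast; ring, Complex.norm_exp_ofReal_mul_I]

lemma unitExp_add (x y : ℝ) : unitExp (x + y) = unitExp x * unitExp y := by
  rw [unitExp, unitExp, unitExp, ← Complex.exp_add]
  congr 1
  push_cast
  ring

lemma unitExp_eq_one_iff {x : ℝ} : unitExp x = 1 ↔ ∃ n : ℤ, x = n := by
  rw [unitExp, Complex.exp_eq_one_iff]
  refine exists_congr fun n => ?_
  have h : 2 * (Real.pi : ℂ) * Complex.I ≠ 0 := Complex.two_pi_I_ne_zero
  rw [mul_comm (n : ℂ), mul_right_inj' h]
  norm_cast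

lemma unitExp_add_unitExp_neg (x : ℝ) :
    unitExp x + unitExp (-x) = ((2 * Real.cos (2 * Real.pi * x) : ℝ) : ℂ) := by
  push_cast
  rw [Complex.two_cos, unitExp, unitExp]
  push_cast
  ring_nf

lemma hasSum_sub_succ {a : ℕ → ℝ} (ha : ∀ n, a (n + 1) ≤ a n) (h0 : Tendsto a atTop (𝓝 0)) :
    HasSum (fun n => a n - a (n + 1)) (a 0) := by
  rw [hasSum_iff_tendsto_nat_of_nonneg fun n => sub_nonneg.2 (ha n)]
  simp_rw [Finset.sum_range_sub']
  simpa using h0.const_sub (a 0)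

/-- Summation by parts. -/
lemma norm_tsum_unitExp_mul_le {a : ℤ → ℝ} (hs : Summable a) (heven : ∀ n, a (-n) = a n)
    (ha : ∀ n : ℕ, a (n + 1) ≤ a n) (v : ℝ) :
    ‖1 - unitExp v‖ * ‖∑' n : ℤ, unitExp (n * v) * a n‖ ≤ 2 * a 0 := by
  have h0 : Tendsto (fun n : ℕ => a n) atTop (𝓝 0) :=
    (hs.comp_injective (i := fun n : ℕ => (n : ℤ)) Nat.cast_injective).tendsto_atTop_zero
  have hsum : ∀ b : ℤ → ℝ, Summable b → Summable fun n : ℤ => unitExp (n * v) * b n := fun b hb => by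
    refine Summable.of_norm ?_
    simp only [norm_mul, norm_unitExp, one_mul, Complex.norm_real]
    exact hb.norm
  have hs1 : Summable fun n : ℤ => a (n + 1) := (Equiv.addRight (1 : ℤ)).summable_iff.2 hs
  -- For an even sequence decreasing on the nonnegative integers, the total variation telescopes on
  -- each half line to `a 0`.
  have hvar : HasSum (fun n : ℤ => |a (n + 1) - a n|) (a 0 + a 0) := by
    refine HasSum.of_nat_of_neg_add_one ?_ ?_
    · refine (hasSum_sub_succ ha h0).congr_fun fun n => ?_
      rw [abs_of_nonpos (sub_nonpos.2 (ha n)), neg_sub]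
      push_cast
      rfl
    · refine (hasSum_sub_succ ha h0).congr_fun fun n => ?_
      have e1 : (-((n : ℤ) + 1) + 1) = -(n : ℤ) := by ring
      rw [e1, heven, heven, abs_of_nonneg (sub_nonneg.2 (ha n))]
      push_cast
      rfl
  have hshift : ∑' n : ℤ, unitExp (n * v) * a n
      = unitExp v * ∑' n : ℤ, unitExp (n * v) * a (n + 1) := by
    rw [← (Equiv.addRight (1 : ℤ)).tsum_eq, ← tsum_mul_left]
    refine tsum_congr fun n => ?_
    simp only [Equiv.coe_addRight]
    rw [show ((n + 1 : ℤ) : ℝ) * v = v + n * v by push_cast; ring, unitExp_add]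
    ring
  -- Multiplication by `1 - e^{2πiv}` moves the difference onto `a`; after this the phases are
  -- bounded by `1`.
  have key : (1 - unitExp v) * ∑' n : ℤ, unitExp (n * v) * a n
      = unitExp v * ∑' n : ℤ, unitExp (n * v) * ((a (n + 1) - a n : ℝ) : ℂ) := by
    have : ∑' n : ℤ, unitExp (n * v) * ((a (n + 1) - a n : ℝ) : ℂ)
        = ∑' n : ℤ, unitExp (n * v) * a (n + 1) - ∑' n : ℤ, unitExp (n * v) * a n := by
      rw [← (hsum _ hs1).tsum_sub (hsum a hs)]
      refine tsum_congr fun n => ?_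
      push_cast
      ring
    rw [this, mul_sub, ← hshift]
    ring
  rw [← norm_mul, key, norm_mul, norm_unitExp, one_mul]
  calc ‖∑' n : ℤ, unitExp (n * v) * ((a (n + 1) - a n : ℝ) : ℂ)‖
      ≤ ∑' n : ℤ, |a (n + 1) - a n| := by
        refine tsum_of_norm_bounded hvar.summable.hasSum fun n => ?_
        rw [norm_mul, norm_unitExp, one_mul, Complex.norm_real, Real.norm_eq_abs]
    _ = 2 * a 0 := by rw [hvar.tsum_eq]; ring

/-! ### The rows of the series and their uniform bounds. -/

/-- The terms `|mi + n|^{-2s}` of the Eisenstein series. -/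
noncomputable def latticeTerm (m : ℤ) (s : ℝ) (n : ℤ) : ℝ := ((m : ℝ) ^ 2 + (n : ℝ) ^ 2) ^ (-s)

lemma latticeTerm_nonneg (m : ℤ) (s : ℝ) (n : ℤ) : 0 ≤ latticeTerm m s n :=
  Real.rpow_nonneg (by positivity) _

lemma one_le_int_sq {n : ℤ} (hn : n ≠ 0) : (1 : ℝ) ≤ (n : ℝ) ^ 2 := by
  have : 0 < n ^ 2 := by positivity
  exact_mod_cast this

/-- A summable bound of the terms of a row. -/
noncomputable def intBound (n : ℤ) : ℝ := if n = 0 then 1 else ((n : ℝ) ^ 2)⁻¹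

lemma summable_intBound : Summable intBound := by
  have h : Summable fun n : ℤ => 1 / (n : ℝ) ^ 2 := Real.summable_one_div_int_pow.2 one_lt_two
  refine (summable_congr_cofinite ?_).2 h
  rw [Filter.EventuallyEq, Filter.eventually_cofinite]
  refine (Set.finite_singleton (0 : ℤ)).subset fun n hn => ?_
  by_contra h0
  refine hn ?_
  have h0' : n ≠ 0 := h0
  simp [intBound, h0']

/-- The bound is uniform in `m` and in `s ≥ 1`. At `m = n = 0` the power of zero with a nonzero
exponent is `0`, so the excluded lattice point needs no separate treatment in the rows. -/
lemma latticeTerm_le_intBound {s : ℝ} (hs : 1 ≤ s) (m n : ℤ) :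
    latticeTerm m s n ≤ intBound n := by
  rw [latticeTerm, intBound]
  split_ifs with h
  · subst h
    by_cases hm : m = 0
    · subst hm
      simp [Real.zero_rpow (by linarith : -s ≠ 0)]
    · refine Real.rpow_le_one_of_one_le_of_nonpos ?_ (by linarith)
      have := one_le_int_sq hm
      simpa
  · have h1 := one_le_int_sq h
    calc ((m : ℝ) ^ 2 + (n : ℝ) ^ 2) ^ (-s) ≤ ((n : ℝ) ^ 2) ^ (-s) :=
          Real.rpow_le_rpow_of_nonpos (by linarith) (by nlinarith [sq_nonneg (m : ℝ)]) (by linarith)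
      _ ≤ ((n : ℝ) ^ 2) ^ (-1 : ℝ) := Real.rpow_le_rpow_of_exponent_le h1 (by linarith)
      _ = _ := Real.rpow_neg_one _

lemma summable_latticeTerm {s : ℝ} (hs : 1 ≤ s) (m : ℤ) : Summable (latticeTerm m s) :=
  Summable.of_nonneg_of_le (latticeTerm_nonneg m s) (latticeTerm_le_intBound hs m)
    summable_intBound

lemma summable_latticeTerm_prod {s : ℝ} (hs : 1 < s) :
    Summable fun p : ℤ × ℤ => latticeTerm p.1 s p.2 := by
  have h := EisensteinSeries.summable_one_div_norm_rpow (k := 2 * s) (by linarith)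
  rw [← (finTwoArrowEquiv ℤ).symm.summable_iff] at h
  refine Summable.of_nonneg_of_le (fun p => latticeTerm_nonneg _ _ _) (fun p => ?_) h
  obtain ⟨m, n⟩ := p
  simp only [Function.comp, finTwoArrowEquiv_symm_apply, latticeTerm]
  by_cases h0 : ![m, n] = 0
  · have hm : m = 0 := congrFun h0 0
    have hn : n = 0 := congrFun h0 1
    subst hm hn
    rw [h0]
    simp [Real.zero_rpow (by linarith : -s ≠ 0), Real.zero_rpow (by linarith : -(2 * s) ≠ 0)]
  · have hpos : 0 < ‖![m, n]‖ := norm_pos_iff.2 h0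
    have hle : ‖![m, n]‖ ^ 2 ≤ (m : ℝ) ^ 2 + (n : ℝ) ^ 2 := by
      have : ‖![m, n]‖ ≤ Real.sqrt ((m : ℝ) ^ 2 + (n : ℝ) ^ 2) := by
        refine (pi_norm_le_iff_of_nonneg (Real.sqrt_nonneg _)).2 fun i => ?_
        fin_cases i
        · refine Real.le_sqrt_of_sq_le ?_
          simp only [Fin.zero_eta, Matrix.cons_val_zero, Int.norm_eq_abs, sq_abs]
          nlinarith [sq_nonneg (n : ℝ)]
        · refine Real.le_sqrt_of_sq_le ?_
          simp only [Fin.mk_one, Matrix.cons_val_one, Matrix.cons_val_zero, Int.norm_eq_abs, sq_abs]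
          nlinarith [sq_nonneg (m : ℝ)]
      calc ‖![m, n]‖ ^ 2 ≤ Real.sqrt ((m : ℝ) ^ 2 + (n : ℝ) ^ 2) ^ 2 := by gcongr
        _ = _ := Real.sq_sqrt (by positivity)
    calc ((m : ℝ) ^ 2 + (n : ℝ) ^ 2) ^ (-s) ≤ (‖![m, n]‖ ^ 2) ^ (-s) :=
          Real.rpow_le_rpow_of_nonpos (by positivity) hle (by linarith)
      _ = ‖![m, n]‖ ^ (-(2 * s)) := by
          rw [← Real.rpow_natCast, ← Real.rpow_mul hpos.le]
          congr 1
          push_cast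
          ring

/-- The sum of a row of the twisted Eisenstein series. -/
noncomputable def rowSum (v : ℝ) (m : ℤ) (s : ℝ) : ℂ :=
  ∑' n : ℤ, unitExp (n * v) * latticeTerm m s n

lemma eisensteinTwisted_eq {s : ℝ} (hs : 1 < s) (u v : ℝ) :
    eisensteinTwisted u v Complex.I s = ∑' m : ℤ, unitExp (m * u) * rowSum v m s := by
  have hterm : ∀ p : ℤ × ℤ, (if p = 0 then 0 else
      Complex.exp (2 * Real.pi * Complex.I * (p.1 * u + p.2 * v)) *
      (((Complex.I.im / ‖(p.1 : ℂ) * Complex.I + p.2‖ ^ 2) ^ s : ℝ) : ℂ))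
      = unitExp (p.1 * u) * (unitExp (p.2 * v) * latticeTerm p.1 s p.2) := by
    rintro ⟨m, n⟩
    split_ifs with h
    · obtain ⟨rfl, rfl⟩ := Prod.mk_eq_zero.1 h
      simp [latticeTerm, Real.zero_rpow (by linarith : -s ≠ 0)]
    · rw [← mul_assoc, ← unitExp_add]
      congr 1
      · rw [unitExp]
        push_cast
        rfl
      · congr 1
        rw [← Complex.normSq_eq_norm_sq, Complex.normSq_apply, latticeTerm,
          Real.rpow_neg (by positivity), ← Real.inv_rpow (by positivity)]
        congr 1
        simp
        ring
  rw [eisensteinTwisted, tsum_congr hterm]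
  have hsum : Summable fun p : ℤ × ℤ => unitExp (p.1 * u) * (unitExp (p.2 * v)
      * (latticeTerm p.1 s p.2 : ℂ)) := by
    refine Summable.of_norm ((summable_latticeTerm_prod hs).congr fun p => ?_)
    simp only [norm_mul, norm_unitExp, one_mul, Complex.norm_real, Real.norm_eq_abs,
      abs_of_nonneg (latticeTerm_nonneg _ _ _)]
  rw [hsum.tsum_prod]
  refine tsum_congr fun m => ?_
  rw [rowSum, ← tsum_mul_left]

/-- Without the oscillation a row is only of order `1/|m|` at `s = 1`, which is not summable.
Summation by parts improves this to the largest term `|m|^{-2s} ≤ m⁻²`, uniformly in `s`, when `v`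
is not an integer. -/
lemma norm_rowSum_le (v : ℝ) {m : ℤ} (hm : m ≠ 0) {s : ℝ} (hs : 1 ≤ s) :
    ‖1 - unitExp v‖ * ‖rowSum v m s‖ ≤ 2 * intBound m := by
  have hm1 := one_le_int_sq hm
  refine (norm_tsum_unitExp_mul_le (summable_latticeTerm hs m) (fun n => by simp [latticeTerm])
    (fun n => ?_) v).trans ?_
  · refine Real.rpow_le_rpow_of_nonpos (by nlinarith [sq_nonneg ((n : ℤ) : ℝ)]) ?_ (by linarith)
    have hn : (0 : ℝ) ≤ ((n : ℤ) : ℝ) := by positivity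
    push_cast at hn ⊢
    nlinarith
  · gcongr
    have := latticeTerm_le_intBound hs 0 m
    simpa [latticeTerm] using this

lemma norm_rowSum_zero_le (v : ℝ) {s : ℝ} (hs : 1 ≤ s) :
    ‖rowSum v 0 s‖ ≤ ∑' n, intBound n :=
  tsum_of_norm_bounded summable_intBound.hasSum fun n => by
    rw [norm_mul, norm_unitExp, one_mul, Complex.norm_real, Real.norm_eq_abs,
      abs_of_nonneg (latticeTerm_nonneg _ _ _)]
    exact latticeTerm_le_intBound hs 0 n

lemma tendsto_rowSum (v : ℝ) (m : ℤ) :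
    Tendsto (rowSum v m) (𝓝[>] 1) (𝓝 (rowSum v m 1)) := by
  refine tendsto_tsum_of_dominated_convergence summable_intBound (fun n => ?_) ?_
  · refine Tendsto.const_mul _ ((Complex.continuous_ofReal.tendsto _).comp ?_)
    refine Tendsto.mono_left ?_ nhdsWithin_le_nhds
    by_cases h : (m : ℝ) ^ 2 + (n : ℝ) ^ 2 = 0
    · have e1 : latticeTerm m 1 n = 0 := by
        rw [latticeTerm, h, Real.zero_rpow (by norm_num)]
      rw [e1]
      refine tendsto_const_nhds.congr' ?_
      filter_upwards [lt_mem_nhds (zero_lt_one : (0 : ℝ) < 1)] with s hs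
      rw [latticeTerm, h, Real.zero_rpow (by linarith)]
    · exact ((Real.continuousAt_const_rpow h).comp continuousAt_neg).tendsto
  · filter_upwards [self_mem_nhdsWithin] with s hs n
    have hs' : 1 < s := hs
    rw [norm_mul, norm_unitExp, one_mul, Complex.norm_real, Real.norm_eq_abs,
      abs_of_nonneg (latticeTerm_nonneg _ _ _)]
    exact latticeTerm_le_intBound hs'.le m n

/-- The value at `s = 1` is obtained by summing the rows first. -/
theorem eisensteinKronecker_eq_tsum {u v : ℝ} (hv : unitExp v ≠ 1) :
    eisensteinKronecker u v Complex.I = ∑' m : ℤ, unitExp (m * u) * rowSum v m 1 := by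
  have hc : 0 < ‖1 - unitExp v‖ := norm_pos_iff.2 (sub_ne_zero.2 hv.symm)
  set C := ∑' n, intBound n
  set c := ‖1 - unitExp v‖
  have hC : 0 ≤ C := tsum_nonneg fun n => by
    rw [intBound]; split_ifs <;> positivity
  have hib : ∀ m, 0 ≤ intBound m := fun m => by rw [intBound]; split_ifs <;> positivity
  refine Tendsto.limUnder_eq ?_
  have h : Tendsto (fun s => ∑' m : ℤ, unitExp (m * u) * rowSum v m s) (𝓝[>] 1)
      (𝓝 (∑' m : ℤ, unitExp (m * u) * rowSum v m 1)) := by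
    refine tendsto_tsum_of_dominated_convergence
      (bound := fun m => (C + 2 / c) * intBound m) (summable_intBound.mul_left _)
      (fun m => (tendsto_rowSum v m).const_mul _) ?_
    filter_upwards [self_mem_nhdsWithin] with s hs m
    have hs' : 1 ≤ s := le_of_lt hs
    rw [norm_mul, norm_unitExp, one_mul]
    by_cases hm : m = 0
    · subst hm
      refine (norm_rowSum_zero_le v hs').trans ?_
      have h0 : intBound 0 = 1 := if_pos rfl
      have : 0 ≤ 2 / c := by positivity
      rw [h0, mul_one]
      linarith
    · have h1 := norm_rowSum_le v hm hs'
      have h2 : ‖rowSum v m s‖ ≤ 2 / c * intBound m := by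
        rw [div_mul_eq_mul_div, le_div_iff₀ hc, mul_comm]
        exact h1
      have := mul_nonneg hC (hib m)
      linarith
  refine h.congr' ?_
  filter_upwards [self_mem_nhdsWithin] with s hs
  exact (eisensteinTwisted_eq hs u v).symm

lemma eisensteinTwisted_neg_right (u v s : ℝ) :
    eisensteinTwisted u (-v) Complex.I s = eisensteinTwisted u v Complex.I s := by
  rw [eisensteinTwisted, eisensteinTwisted,
    ← ((Equiv.refl ℤ).prodCongr (Equiv.neg ℤ)).tsum_eq]
  refine tsum_congr fun p => ?_
  obtain ⟨m, n⟩ := p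
  simp only [Equiv.prodCongr_apply, Prod.map, Equiv.refl_apply, Equiv.neg_apply, Prod.mk_eq_zero,
    neg_eq_zero]
  split_ifs
  · rfl
  · congr 2
    · push_cast; ring_nf
    · congr 3
      refine (sq_eq_sq₀ (norm_nonneg _) (norm_nonneg _)).1 ?_
      rw [← Complex.normSq_eq_norm_sq, ← Complex.normSq_eq_norm_sq, Complex.normSq_apply,
        Complex.normSq_apply]
      simp

lemma eisensteinKronecker_neg_right (u v : ℝ) :
    eisensteinKronecker u (-v) Complex.I = eisensteinKronecker u v Complex.I := by
  simp only [eisensteinKronecker, eisensteinTwisted_neg_right u v]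

/-! ## The rows in closed form -/

/-- The function whose Fourier coefficients are proportional to `1 / (a² + n²)`. -/
noncomputable def rowFun (a v : ℝ) : ℝ :=
  Real.exp (-(2 * Real.pi * a * v)) + Real.exp (-(2 * Real.pi * a * (1 - v)))

lemma continuous_rowFun (a : ℝ) : Continuous (rowFun a) := by unfold rowFun; fun_prop

/-- The symmetry gives equal values at `0` and `1`, so the periodic extension is continuous and its
Fourier series, having summable coefficients, converges to it pointwise. -/
lemma rowFun_one_sub (a v : ℝ) : rowFun a (1 - v) = rowFun a v := by
  rw [rowFun, rowFun, sub_sub_cancel, add_comm]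

lemma one_sub_exp_neg_two_pi_pos {a : ℝ} (ha : 0 < a) : 0 < 1 - Real.exp (-(2 * Real.pi * a)) := by
  have := Real.pi_pos
  rw [sub_pos, Real.exp_lt_one_iff]
  have : 0 < 2 * Real.pi * a := by positivity
  linarith

lemma fourierCoeffOn_rowFun {a : ℝ} (ha : 0 < a) (n : ℤ) (h01 : (0 : ℝ) < 0 + 1) :
    fourierCoeffOn h01 (fun v => (rowFun a v : ℂ)) n
      = (a * (1 - Real.exp (-(2 * Real.pi * a))) / (Real.pi * (a ^ 2 + n ^ 2)) : ℝ) := by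
  have hpi : (Real.pi : ℂ) ≠ 0 := Complex.ofReal_ne_zero.2 Real.pi_ne_zero
  set c₁ : ℂ := -(2 * Real.pi * (a + n * Complex.I)) with hc₁
  set c₂ : ℂ := 2 * Real.pi * (a - n * Complex.I) with hc₂
  have h1 : (a : ℂ) + n * Complex.I ≠ 0 := fun h => by
    have := congrArg Complex.re h
    simp at this
    exact ha.ne' this
  have h2 : (a : ℂ) - n * Complex.I ≠ 0 := fun h => by
    have := congrArg Complex.re h
    simp at this
    exact ha.ne' this
  have hc₁0 : c₁ ≠ 0 := neg_ne_zero.2 (mul_ne_zero (mul_ne_zero two_ne_zero hpi) h1)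
  have hc₂0 : c₂ ≠ 0 := mul_ne_zero (mul_ne_zero two_ne_zero hpi) h2
  set Q : ℂ := Complex.exp (-(2 * Real.pi * a)) with hQ
  have hper : Complex.exp (-(n * (2 * Real.pi * Complex.I))) = 1 := by
    rw [Complex.exp_neg, Complex.exp_int_mul_two_pi_mul_I, inv_one]
  have e1 : Complex.exp c₁ = Q := by
    rw [hc₁, hQ, show -(2 * (Real.pi : ℂ) * (a + n * Complex.I))
      = -(2 * Real.pi * a) + -(n * (2 * Real.pi * Complex.I)) by ring, Complex.exp_add, hper, mul_one]
  have e2 : Q * Complex.exp c₂ = 1 := by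
    rw [hQ, ← Complex.exp_add, hc₂, show -(2 * (Real.pi : ℂ) * a)
      + 2 * Real.pi * (a - n * Complex.I) = -(n * (2 * Real.pi * Complex.I)) by ring, hper]
  have hint : ∀ x : ℝ, (fourier (-n) (x : AddCircle (0 + 1 - 0 : ℝ)) • (rowFun a x : ℂ))
      = Complex.exp (c₁ * x) + Q * Complex.exp (c₂ * x) := by
    intro x
    rw [fourier_coe_apply, smul_eq_mul, rowFun, hQ, ← Complex.exp_add]
    push_cast
    rw [mul_add, ← Complex.exp_add, ← Complex.exp_add]
    congr 1
    · congr 1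
      rw [hc₁]
      ring
    · congr 1
      rw [hc₂]
      ring
  rw [fourierCoeffOn_eq_integral]
  simp_rw [hint]
  rw [intervalIntegral.integral_add (Continuous.intervalIntegrable (by fun_prop) _ _)
    (Continuous.intervalIntegrable (by fun_prop) _ _), intervalIntegral.integral_const_mul,
    integral_exp_mul_complex hc₁0, integral_exp_mul_complex hc₂0]
  simp only [zero_add, Complex.ofReal_one, mul_one, Complex.ofReal_zero, mul_zero, Complex.exp_zero,
    sub_zero, div_one, one_smul]
  rw [e1, ← mul_div_assoc, mul_sub, e2, mul_one, hc₁, hc₂]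
  -- The two exponentials of `rowFun` contribute the conjugate denominators `a ± in`, whose product
  -- is `a² + n²`.
  have h3 : (a : ℂ) ^ 2 + n ^ 2 ≠ 0 := by
    have : (a : ℂ) ^ 2 + n ^ 2 = (a + n * Complex.I) * (a - n * Complex.I) := by
      linear_combination ((n : ℂ) ^ 2) * Complex.I_sq
    rw [this]
    exact mul_ne_zero h1 h2
  push_cast
  rw [← hQ]
  field_simp
  linear_combination (2 * (n : ℂ) ^ 2 * a * (1 - Q)) * Complex.I_sq

/-- The Fourier series of `rowFun`. -/
lemma hasSum_rowFun {a : ℝ} (ha : 0 < a) {v : ℝ} (hv : v ∈ Set.Ico (0 : ℝ) 1) :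
    HasSum (fun n : ℤ => unitExp (n * v) * (((a ^ 2 + (n : ℝ) ^ 2)⁻¹ : ℝ) : ℂ))
      ((Real.pi / a * (rowFun a v / (1 - Real.exp (-(2 * Real.pi * a)))) : ℝ) : ℂ) := by
  have hpi := Real.pi_pos
  have hQ := one_sub_exp_neg_two_pi_pos ha
  have : Fact ((0 : ℝ) < 1) := ⟨one_pos⟩
  have hcont : Continuous (AddCircle.liftIco (1 : ℝ) 0 fun v => (rowFun a v : ℂ)) := by
    refine AddCircle.liftIco_continuous ?_ ?_
    · rw [zero_add, ← rowFun_one_sub a 0, sub_zero]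
    · have := continuous_rowFun a
      exact Continuous.continuousOn (by fun_prop)
  set f : C(AddCircle (1 : ℝ), ℂ) := ⟨_, hcont⟩ with hf
  have hcoef : ∀ n, fourierCoeff f n
      = ((a * (1 - Real.exp (-(2 * Real.pi * a))) / (Real.pi * (a ^ 2 + n ^ 2)) : ℝ) : ℂ) :=
    fun n => by
      rw [hf, ContinuousMap.coe_mk, fourierCoeff_liftIco_eq]
      exact fourierCoeffOn_rowFun ha n _
  have hsum : Summable (fourierCoeff f) := by
    have hs : Summable fun n : ℤ => (a ^ 2 + (n : ℝ) ^ 2)⁻¹ := by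
      refine (summable_intBound.mul_left (1 + (a ^ 2)⁻¹)).of_nonneg_of_le (fun n => by positivity)
        fun n => ?_
      rw [intBound]
      have ha2 : 0 < (a ^ 2)⁻¹ := by positivity
      split_ifs with h
      · subst h
        simp only [Int.cast_zero, ne_eq, OfNat.ofNat_ne_zero, not_false_eq_true, zero_pow, add_zero]
        linarith
      · have h1 := one_le_int_sq h
        have h2 : (a ^ 2 + (n : ℝ) ^ 2)⁻¹ ≤ ((n : ℝ) ^ 2)⁻¹ :=
          inv_anti₀ (by linarith) (by nlinarith)
        have h3 : 0 < ((n : ℝ) ^ 2)⁻¹ := by positivity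
        nlinarith
    refine (Complex.hasSum_ofReal.2
      (hs.mul_left (a * (1 - Real.exp (-(2 * Real.pi * a))) / Real.pi)).hasSum).summable.congr
      fun n => ?_
    rw [hcoef]
    congr 1
    rw [div_mul_eq_div_div, div_eq_mul_inv _ (a ^ 2 + (n : ℝ) ^ 2)]
  have h := has_pointwise_sum_fourier_series_of_summable hsum (v : AddCircle (1 : ℝ))
  have hfv : f (v : AddCircle (1 : ℝ)) = (rowFun a v : ℂ) := by
    rw [hf, ContinuousMap.coe_mk, AddCircle.liftIco_coe_apply (by simpa using hv)]
  rw [hfv] at h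
  have h' := h.mul_left ((Real.pi / (a * (1 - Real.exp (-(2 * Real.pi * a)))) : ℝ) : ℂ)
  have hterm : ∀ n : ℤ, unitExp (n * v) * (((a ^ 2 + (n : ℝ) ^ 2)⁻¹ : ℝ) : ℂ)
      = ((Real.pi / (a * (1 - Real.exp (-(2 * Real.pi * a)))) : ℝ) : ℂ)
        * (fourierCoeff f n • fourier n (v : AddCircle (1 : ℝ))) := by
    intro n
    rw [hcoef, smul_eq_mul, ← mul_assoc, ← Complex.ofReal_mul, mul_comm (unitExp _),
      fourier_coe_apply, unitExp]
    congr 1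
    · congr 1
      have : a ^ 2 + (n : ℝ) ^ 2 ≠ 0 := by positivity
      generalize 1 - Real.exp (-(2 * Real.pi * a)) = q at hQ
      field_simp
    · congr 1
      push_cast
      ring
  rw [funext hterm]
  rw [← Complex.ofReal_mul] at h'
  have e : Real.pi / a * (rowFun a v / (1 - Real.exp (-(2 * Real.pi * a))))
      = Real.pi / (a * (1 - Real.exp (-(2 * Real.pi * a)))) * rowFun a v := by
    rw [div_mul_div_comm, div_mul_eq_mul_div]
  rwa [e]

lemma rowSum_natCast {m : ℕ} (hm : m ≠ 0) {v : ℝ} (hv : v ∈ Set.Ico (0 : ℝ) 1) : rowSum v m 1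
    = ((Real.pi / m * (rowFun m v / (1 - Real.exp (-(2 * Real.pi * m)))) : ℝ) : ℂ) := by
  rw [← (hasSum_rowFun (by positivity : (0 : ℝ) < m) hv).tsum_eq, rowSum]
  refine tsum_congr fun n => ?_
  rw [latticeTerm, Real.rpow_neg_one]
  simp

lemma rowSum_neg (v : ℝ) (m : ℤ) (s : ℝ) : rowSum v (-m) s = rowSum v m s := by
  simp [rowSum, latticeTerm]

/-- The Fourier series of the second Bernoulli polynomial; the term `n = 0` is `0` on both sides by
the convention for division by zero. -/
lemma rowSum_zero {v : ℝ} (hv : v ∈ Set.Ico (0 : ℝ) 1) :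
    rowSum v 0 1 = ((2 * Real.pi ^ 2 * (v ^ 2 - v + 1 / 6) : ℝ) : ℂ) := by
  have h := hasSum_one_div_pow_mul_fourier_mul_bernoulliFun (k := 2) le_rfl
    (Set.Ico_subset_Icc_self hv)
  rw [rowSum]
  have e : ∀ n : ℤ, unitExp (n * v) * (latticeTerm 0 1 n : ℂ)
      = 1 / (n : ℂ) ^ 2 * fourier n (v : UnitAddCircle) := by
    intro n
    rw [latticeTerm, Real.rpow_neg_one, fourier_coe_apply, unitExp]
    push_cast
    simp only [ne_eq, OfNat.ofNat_ne_zero, not_false_eq_true, zero_pow, zero_add, div_one, one_div]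
    rw [mul_comm, mul_assoc (2 * (Real.pi : ℂ) * Complex.I)]
  rw [tsum_congr e, h.tsum_eq, bernoulliFun_two]
  push_cast [Nat.factorial]
  rw [mul_pow, Complex.I_sq]
  ring

/-! ## The Kronecker limit formula on the square lattice -/

/-- The function `e^{2πiz}`. -/
noncomputable def nome (z : ℂ) : ℂ := Complex.exp (2 * Real.pi * Complex.I * z)

lemma norm_nome (z : ℂ) : ‖nome z‖ = Real.exp (-(2 * Real.pi * z.im)) := by
  rw [nome, Complex.norm_exp]
  simp

lemma nome_pow_re (z : ℂ) (n : ℕ) : (nome z ^ n).re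
    = Real.exp (-(2 * Real.pi * n * z.im)) * Real.cos (2 * Real.pi * n * z.re) := by
  rw [nome, ← Complex.exp_nat_mul, Complex.exp_re]
  congr 2
  · simp
    ring
  · simp
    ring

lemma norm_nome_lt_one {z : ℂ} (hz : 0 < z.im) : ‖nome z‖ < 1 := by
  rw [norm_nome, Real.exp_lt_one_iff]
  have := Real.pi_pos
  have : 0 < 2 * Real.pi * z.im := by positivity
  linarith

/-- The real part of the Taylor series of `-log(1 - w)` at `w = e^{2πiz}`; the term `n = 0` vanishes
since division by zero gives zero. -/
lemma hasSum_neg_log_norm_one_sub_nome {z : ℂ} (hz : 0 < z.im) :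
    HasSum (fun n : ℕ => Real.exp (-(2 * Real.pi * n * z.im)) * Real.cos (2 * Real.pi * n * z.re) / n)
      (-Real.log ‖1 - nome z‖) := by
  have h := Complex.hasSum_re (Complex.hasSum_taylorSeries_neg_log (norm_nome_lt_one hz))
  rw [Complex.neg_re, Complex.log_re] at h
  refine h.congr_fun fun n => ?_
  rw [← nome_pow_re, Complex.div_natCast_re]

/-- The terms of the continuous part of the Kronecker limit formula. -/
noncomputable def corrTerm (n : ℕ) (u a : ℝ) : ℝ :=
  2 * Real.pi / n * Real.cos (2 * Real.pi * n * u)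
    * (rowFun n a * (Real.exp (-(2 * Real.pi * n)) / (1 - Real.exp (-(2 * Real.pi * n)))))

lemma exp_neg_two_pi_mul_nat (n : ℕ) :
    Real.exp (-(2 * Real.pi * n)) = Real.exp (-(2 * Real.pi)) ^ n := by
  rw [← Real.exp_nat_mul]
  congr 1
  ring

lemma exp_neg_two_pi_lt_one : Real.exp (-(2 * Real.pi)) < 1 := by
  have := one_sub_exp_neg_two_pi_pos one_pos
  rw [mul_one] at this
  linarith

lemma rowFun_nonneg (b a : ℝ) : 0 ≤ rowFun b a := by unfold rowFun; positivity

lemma rowFun_le_two {b a : ℝ} (hb : 0 ≤ b) (ha : a ∈ Set.Icc (0 : ℝ) 1) : rowFun b a ≤ 2 := by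
  have hpi := Real.pi_pos
  have h1 : Real.exp (-(2 * Real.pi * b * a)) ≤ 1 := by
    rw [Real.exp_le_one_iff]
    have := ha.1
    have : 0 ≤ 2 * Real.pi * b * a := by positivity
    linarith
  have h2 : Real.exp (-(2 * Real.pi * b * (1 - a))) ≤ 1 := by
    rw [Real.exp_le_one_iff]
    have := sub_nonneg.2 ha.2
    have : 0 ≤ 2 * Real.pi * b * (1 - a) := by positivity
    linarith
  rw [rowFun]
  linarith

/-- The constant in the bound of the correction terms. -/
noncomputable def corrBound : ℝ := 4 * Real.pi / (1 - Real.exp (-(2 * Real.pi)))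

lemma one_sub_exp_le {n : ℕ} (hn : n ≠ 0) :
    1 - Real.exp (-(2 * Real.pi)) ≤ 1 - Real.exp (-(2 * Real.pi * n)) := by
  rw [exp_neg_two_pi_mul_nat]
  have := pow_le_of_le_one (Real.exp_pos _).le exp_neg_two_pi_lt_one.le hn
  linarith

lemma abs_corrTerm_le (n : ℕ) (u : ℝ) {a : ℝ} (ha : a ∈ Set.Icc (0 : ℝ) 1) :
    |corrTerm n u a| ≤ corrBound * Real.exp (-(2 * Real.pi)) ^ n := by
  have hpi := Real.pi_pos
  have hq := sub_pos.2 exp_neg_two_pi_lt_one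
  have hB : 0 < corrBound := by unfold corrBound; positivity
  rcases eq_or_ne n 0 with rfl | hn
  · simp only [corrTerm, CharP.cast_eq_zero, div_zero, zero_mul, abs_zero, pow_zero, mul_one]
    exact hB.le
  have hn1 : (1 : ℝ) ≤ n := Nat.one_le_cast.2 (Nat.one_le_iff_ne_zero.2 hn)
  have hqn := one_sub_exp_le hn
  have hqn0 := hq.trans_le hqn
  rw [corrTerm, abs_mul, abs_mul, abs_of_nonneg (by positivity : 0 ≤ 2 * Real.pi / n),
    abs_mul, abs_of_nonneg (rowFun_nonneg _ _), abs_of_nonneg (by positivity : 0 ≤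
      Real.exp (-(2 * Real.pi * n)) / (1 - Real.exp (-(2 * Real.pi * n)))), ← exp_neg_two_pi_mul_nat]
  calc _ ≤ 2 * Real.pi * 1 * (2 * (Real.exp (-(2 * Real.pi * n)) / (1 - Real.exp (-(2 * Real.pi))))) := by
        gcongr
        · have := rowFun_nonneg n a
          positivity
        · exact div_le_self (by positivity) hn1
        · exact Real.abs_cos_le_one _
        · exact rowFun_le_two (by positivity) ha
    _ = _ := by rw [corrBound]; ring

lemma summable_corrBound : Summable fun n : ℕ => corrBound * Real.exp (-(2 * Real.pi)) ^ n :=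
  (summable_geometric_of_lt_one (Real.exp_pos _).le exp_neg_two_pi_lt_one).mul_left _

/-- The continuous part of the Kronecker limit formula. -/
noncomputable def corr (u a : ℝ) : ℝ := ∑' n, corrTerm n u a

lemma summable_corrTerm (u : ℝ) {a : ℝ} (ha : a ∈ Set.Icc (0 : ℝ) 1) :
    Summable fun n => corrTerm n u a :=
  Summable.of_norm_bounded summable_corrBound fun n => abs_corrTerm_le n u ha

/-- A bound of `corr`. -/
noncomputable def corrTotal : ℝ := ∑' n : ℕ, corrBound * Real.exp (-(2 * Real.pi)) ^ n

lemma abs_corr_le (u : ℝ) {a : ℝ} (ha : a ∈ Set.Icc (0 : ℝ) 1) : |corr u a| ≤ corrTotal := by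
  unfold corr corrTotal
  exact tsum_of_norm_bounded (f := fun n => corrTerm n u a) summable_corrBound.hasSum
    fun n => abs_corrTerm_le n u ha

lemma continuous_corrTerm (n : ℕ) : Continuous fun p : ℝ × ℝ => corrTerm n p.1 p.2 := by
  have := continuous_rowFun n
  unfold corrTerm
  fun_prop

lemma continuousOn_corr :
    ContinuousOn (fun p : ℝ × ℝ => corr p.1 p.2) {p | p.2 ∈ Set.Icc (0 : ℝ) 1} :=
  continuousOn_tsum (fun n => (continuous_corrTerm n).continuousOn) summable_corrBound
    fun n p hp => abs_corrTerm_le n p.1 hp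

/-- The value of the twisted Eisenstein series at the point `(u, a)`, `0 < a < 1`. -/
noncomputable def kron (u a : ℝ) : ℝ :=
  2 * Real.pi ^ 2 * (a ^ 2 - a + 1 / 6)
    - 2 * Real.pi * (Real.log ‖1 - nome ⟨u, a⟩‖ + Real.log ‖1 - nome ⟨u, 1 - a⟩‖) + corr u a

/-- The sum of the rows of index `n` and `-n`. -/
noncomputable def rowTerm (n : ℕ) (u a : ℝ) : ℝ :=
  2 * Real.cos (2 * Real.pi * n * u)
    * (Real.pi / n * (rowFun n a / (1 - Real.exp (-(2 * Real.pi * n)))))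

/-- With `q = e^{-2πn}`, write `1/(1 - q) = 1 + q/(1 - q)`. The first part, with the two
exponentials of `rowFun`, sums to the two logarithms; the second part decays geometrically up to the
boundary `a = 0, 1` and sums to `corr`. -/
lemma hasSum_rowTerm (u : ℝ) {a : ℝ} (ha : a ∈ Set.Ioo (0 : ℝ) 1) :
    HasSum (fun n => rowTerm n u a) (-(2 * Real.pi * (Real.log ‖1 - nome ⟨u, a⟩‖
      + Real.log ‖1 - nome ⟨u, 1 - a⟩‖)) + corr u a) := by
  have h1 := (hasSum_neg_log_norm_one_sub_nome (z := ⟨u, a⟩) ha.1).mul_left (2 * Real.pi)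
  have h2 := (hasSum_neg_log_norm_one_sub_nome (z := ⟨u, 1 - a⟩)
    (sub_pos.2 ha.2)).mul_left (2 * Real.pi)
  have h3 := (summable_corrTerm u (Set.Ioo_subset_Icc_self ha)).hasSum
  have e : -(2 * Real.pi * (Real.log ‖1 - nome ⟨u, a⟩‖ + Real.log ‖1 - nome ⟨u, 1 - a⟩‖)) + corr u a
      = 2 * Real.pi * -Real.log ‖1 - nome ⟨u, a⟩‖ + 2 * Real.pi * -Real.log ‖1 - nome ⟨u, 1 - a⟩‖
        + ∑' n, corrTerm n u a := by
    unfold corr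
    ring
  rw [e]
  refine ((h1.add h2).add h3).congr_fun fun n => ?_
  · rcases eq_or_ne n 0 with rfl | hn
    · simp [rowTerm, corrTerm]
    have hq : 1 - Real.exp (-(2 * Real.pi * n)) ≠ 0 :=
      ((sub_pos.2 exp_neg_two_pi_lt_one).trans_le (one_sub_exp_le hn)).ne'
    have hn' : (n : ℝ) ≠ 0 := Nat.cast_ne_zero.2 hn
    rw [rowTerm, corrTerm, rowFun]
    generalize Real.exp (-(2 * Real.pi * n)) = q at hq
    dsimp only
    generalize Real.exp (-(2 * Real.pi * n * a)) = A
    generalize Real.exp (-(2 * Real.pi * n * (1 - a))) = B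
    field_simp
    ring

/-- Apart from the cosine all factors are nonnegative, so the terms at `u = 0` dominate and their
sum is already known to converge. -/
lemma summable_norm_rowTerm {a : ℝ} (ha : a ∈ Set.Ioo (0 : ℝ) 1) :
    ∃ b : ℕ → ℝ, Summable b ∧ ∀ n u, |rowTerm n u a| ≤ b n := by
  refine ⟨fun n => rowTerm n 0 a, (hasSum_rowTerm 0 ha).summable, fun n u => ?_⟩
  have hpi := Real.pi_pos
  rcases eq_or_ne n 0 with rfl | hn
  · simp [rowTerm]
  have hq := (sub_pos.2 exp_neg_two_pi_lt_one).trans_le (one_sub_exp_le hn)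
  have h0 : 0 ≤ Real.pi / n * (rowFun n a / (1 - Real.exp (-(2 * Real.pi * n)))) := by
    have := rowFun_nonneg n a
    positivity
  dsimp only [rowTerm]
  rw [abs_mul, abs_of_nonneg h0, mul_zero, Real.cos_zero, abs_mul,
    abs_of_pos two_pos]
  gcongr
  exact Real.abs_cos_le_one _

/-- The row `m = 0` gives the quadratic polynomial. The rows `m` and `-m` have equal sums, and their
phases combine into a cosine. -/
theorem eisensteinKronecker_eq_kron (u : ℝ) {a : ℝ} (ha : a ∈ Set.Ioo (0 : ℝ) 1) :
    eisensteinKronecker u a Complex.I = (kron u a : ℂ) := by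
  have hne : unitExp a ≠ 1 := fun h => by
    obtain ⟨n, hn⟩ := unitExp_eq_one_iff.1 h
    have h1 : (0 : ℝ) < n := hn ▸ ha.1
    have h2 : (n : ℝ) < 1 := hn ▸ ha.2
    have h3 : 0 < n := by exact_mod_cast h1
    have h4 : n < 1 := by exact_mod_cast h2
    omega
  have ha' : a ∈ Set.Ico (0 : ℝ) 1 := Set.Ioo_subset_Ico_self ha
  rw [eisensteinKronecker_eq_tsum hne]
  set g : ℕ → ℝ := fun n => Real.pi / n * (rowFun n a / (1 - Real.exp (-(2 * Real.pi * n)))) with hg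
  have hg0 : g 0 = 0 := by simp [hg]
  have hgs : Summable g := by
    refine ((hasSum_rowTerm 0 ha).summable.mul_left (1 / 2)).congr fun n => ?_
    rw [rowTerm, mul_zero, Real.cos_zero]
    ring
  set G : ℤ → ℂ := fun m => unitExp (m * u) * (g m.natAbs : ℂ) with hG
  have hexp : ∀ f : ℕ → ℝ, Summable fun n => unitExp (f n) * (g n : ℂ) := fun f =>
    Summable.of_norm (by
      simp only [norm_mul, norm_unitExp, one_mul, Complex.norm_real]
      exact hgs.norm)
  have s1 := (hexp fun n => n * u).hasSum
  have s2 := (hexp fun n => -(n * u)).hasSum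
  -- Splitting the integers into two half lines counts the index `0` twice, whence the subtraction.
  have hGsum : HasSum G ((∑' n : ℕ, unitExp (n * u) * (g n : ℂ))
      + (∑' n : ℕ, unitExp (-(n * u)) * (g n : ℂ)) - G 0) := by
    refine HasSum.of_nat_of_neg (s1.congr_fun fun n => ?_) (s2.congr_fun fun n => ?_)
    · simp [hG]
    · simp [hG]
  have hG0 : G 0 = 0 := by simp [hG, hg0]
  have hS := s1.add s2
  have hK : HasSum (fun n : ℕ => unitExp (n * u) * (g n : ℂ) + unitExp (-(n * u)) * (g n : ℂ))
      ((-(2 * Real.pi * (Real.log ‖1 - nome ⟨u, a⟩‖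
      + Real.log ‖1 - nome ⟨u, 1 - a⟩‖)) + corr u a : ℝ) : ℂ) := by
    refine (Complex.hasSum_ofReal.2 (hasSum_rowTerm u ha)).congr_fun fun n => ?_
    rw [← add_mul, unitExp_add_unitExp_neg, ← Complex.ofReal_mul, rowTerm, mul_assoc (2 * Real.pi)]
  rw [hG0, sub_zero, hS.unique hK] at hGsum
  have h0 := hasSum_ite_eq (0 : ℤ) (rowSum a 0 1)
  have htot := h0.add hGsum
  have hterm : ∀ m : ℤ, unitExp (m * u) * rowSum a m 1
      = (if m = 0 then rowSum a 0 1 else 0) + G m := by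
    intro m
    split_ifs with hm
    · subst hm
      rw [hG0]
      simp [unitExp]
    · rw [zero_add, hG]
      dsimp only
      rw [hg]
      dsimp only
      rw [← rowSum_natCast (Int.natAbs_ne_zero.2 hm) ha']
      congr 1
      rcases Int.natAbs_eq m with h | h
      · rw [← h]
      · rw [← rowSum_neg a m, show -m = (m.natAbs : ℤ) by omega]
  rw [tsum_congr hterm, htot.tsum_eq, rowSum_zero ha', ← Complex.ofReal_add, kron]
  congr 1
  ring

/-! ## Bounds of the Eisenstein series and its behaviour at the origin -/

/-- The function `max (1 - |x|) 0`. -/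
noncomputable def tentR (x : ℝ) : ℝ := max (1 - |x|) 0

/-- The area of the intersection of the unit square with its translate by `z`. -/
noncomputable def tent (z : ℂ) : ℝ := tentR z.re * tentR z.im

/-- The Eisenstein series as a function of the difference of two points of the unit square. -/
noncomputable def kronDiff (z : ℂ) : ℝ := kron z.re (min |z.im| 1)

lemma continuous_tentR : Continuous tentR := by unfold tentR; fun_prop

lemma continuous_tent : Continuous tent :=
  (continuous_tentR.comp Complex.continuous_re).mul (continuous_tentR.comp Complex.continuous_im)

lemma tentR_nonneg (x : ℝ) : 0 ≤ tentR x := le_max_right _ _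

lemma tentR_le_one (x : ℝ) : tentR x ≤ 1 :=
  max_le (by linarith [abs_nonneg x]) zero_le_one

lemma one_sub_tentR_le (x : ℝ) : 1 - tentR x ≤ |x| := by
  have := le_max_left (1 - |x|) 0
  rw [tentR]
  linarith

lemma tent_nonneg (z : ℂ) : 0 ≤ tent z := mul_nonneg (tentR_nonneg _) (tentR_nonneg _)

lemma tent_le_one (z : ℂ) : tent z ≤ 1 := mul_le_one₀ (tentR_le_one _) (tentR_nonneg _)
  (tentR_le_one _)

lemma one_sub_tent_le (z : ℂ) : 1 - tent z ≤ 2 * ‖z‖ := by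
  have h1 := (one_sub_tentR_le z.re).trans (Complex.abs_re_le_norm z)
  have h2 := (one_sub_tentR_le z.im).trans (Complex.abs_im_le_norm z)
  have h3 := tentR_nonneg z.re
  have h4 := tentR_nonneg z.im
  have h5 := tentR_le_one z.re
  have h6 := tentR_le_one z.im
  rw [tent]
  nlinarith

lemma tentR_eq_zero {x : ℝ} (hx : 1 ≤ |x|) : tentR x = 0 := max_eq_right (by linarith)

lemma tentR_of_le {x : ℝ} (hx : |x| ≤ 1) : tentR x = 1 - |x| := max_eq_left (by linarith)

lemma continuous_nome : Continuous nome := by unfold nome; fun_prop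

lemma measurable_kronDiff : Measurable kronDiff := by
  have hc : Continuous fun z : ℂ => min |z.im| 1 := by fun_prop
  have h1 : Continuous fun z : ℂ => corr z.re (min |z.im| 1) :=
    continuousOn_univ.1 (continuousOn_corr.comp (f := fun z : ℂ => (z.re, min |z.im| 1))
      (Complex.continuous_re.prodMk hc).continuousOn
      fun z _ => ⟨le_min (abs_nonneg _) zero_le_one, min_le_right _ _⟩)
  have hmk : Continuous fun p : ℝ × ℝ => (⟨p.1, p.2⟩ : ℂ) :=
    Complex.equivRealProdCLM.symm.continuous
  have h2 : Continuous fun z : ℂ => ‖1 - nome ⟨z.re, min |z.im| 1⟩‖ :=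
    (continuous_const.sub (continuous_nome.comp (hmk.comp (Complex.continuous_re.prodMk hc)))).norm
  have h3 : Continuous fun z : ℂ => ‖1 - nome ⟨z.re, 1 - min |z.im| 1⟩‖ :=
    (continuous_const.sub (continuous_nome.comp (hmk.comp (Complex.continuous_re.prodMk
      (continuous_const.sub hc))))).norm
  have h4 : Continuous fun z : ℂ =>
      2 * Real.pi ^ 2 * ((min |z.im| 1) ^ 2 - min |z.im| 1 + 1 / 6) := by fun_prop
  exact (h4.measurable.sub (((Real.measurable_log.comp h2.measurable).add
    (Real.measurable_log.comp h3.measurable)).const_mul _)).add h1.measurable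

lemma half_le_one_sub_exp {t : ℝ} (ht : t ∈ Set.Icc (0 : ℝ) 1) :
    t / 2 ≤ 1 - Real.exp (-(2 * Real.pi * t)) := by
  have h1 : Real.exp (-(2 * Real.pi * t)) ≤ Real.exp (-t) := by
    gcongr
    have := Real.pi_gt_three
    nlinarith [ht.1]
  have h2 := one_add_mul_exp_neg_le t
  nlinarith [ht.1, ht.2, Real.exp_pos (-t)]

lemma le_norm_one_sub_nome {z : ℂ} (hz : z.im ∈ Set.Icc (0 : ℝ) 1) :
    z.im / 2 ≤ ‖1 - nome z‖ := by
  have h := norm_sub_norm_le 1 (nome z)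
  rw [norm_one, norm_nome] at h
  exact (half_le_one_sub_exp hz).trans h

lemma norm_one_sub_nome_le_two {z : ℂ} (hz : 0 ≤ z.im) : ‖1 - nome z‖ ≤ 2 := by
  have h := norm_sub_le 1 (nome z)
  have h2 : ‖nome z‖ ≤ 1 := by
    rw [norm_nome, Real.exp_le_one_iff]
    have : 0 ≤ 2 * Real.pi * z.im := by positivity
    linarith
  rw [norm_one] at h
  linarith

lemma norm_one_sub_nome_le {z : ℂ} (hz : 0 ≤ z.im) : ‖1 - nome z‖ ≤ 4 * Real.pi * ‖z‖ := by
  have hpi := Real.pi_pos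
  have hn : ‖2 * Real.pi * Complex.I * z‖ = 2 * Real.pi * ‖z‖ := by
    simp [abs_of_pos hpi]
  by_cases h : 2 * Real.pi * ‖z‖ ≤ 1
  · have := Complex.norm_exp_sub_one_le (hn.le.trans h)
    rw [norm_sub_rev]
    rw [hn] at this
    calc _ ≤ _ := this
      _ = _ := by ring
  · have := norm_one_sub_nome_le_two hz
    linarith

/-- Jordan's inequality at `π|x|` or at `π(1 - |x|)`, whichever is below `π/2`. -/
lemma abs_mul_le_sin {x : ℝ} (hx : |x| ≤ 1) : 2 * (|x| * (1 - |x|)) ≤ |Real.sin (Real.pi * x)| := by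
  have hpi := Real.pi_pos
  have hx0 := abs_nonneg x
  have e : |Real.sin (Real.pi * x)| = |Real.sin (Real.pi * |x|)| := by
    rcases abs_choice x with h | h
    · rw [h]
    · rw [h, mul_neg, Real.sin_neg, abs_neg]
  rw [e]
  refine le_trans ?_ (le_abs_self _)
  rcases le_total (|x|) (1 / 2) with h | h
  · have := Real.mul_le_sin (x := Real.pi * |x|) (by positivity) (by nlinarith)
    rw [← mul_assoc, div_mul_cancel₀ _ hpi.ne'] at this
    nlinarith
  · have := Real.mul_le_sin (x := Real.pi * (1 - |x|)) (mul_nonneg hpi.le (by linarith))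
      (by nlinarith)
    rw [← mul_assoc, div_mul_cancel₀ _ hpi.ne', show Real.pi * (1 - |x|) = Real.pi - Real.pi * |x| by
      ring, Real.sin_pi_sub] at this
    nlinarith

/-- With `ρ = |e^{2πiz}|` one has `|1 - e^{2πiz}|² = (1 - ρ)² + 4ρ sin²(π Re z)`, and `ρ ≥ e^{-2π}`
when `Im z ≤ 1`. -/
lemma le_norm_one_sub_nome_of_re {z : ℂ} (hz : z.im ≤ 1) (hre : |z.re| ≤ 1) :
    4 * Real.exp (-Real.pi) * (|z.re| * (1 - |z.re|)) ≤ ‖1 - nome z‖ := by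
  have hpi := Real.pi_pos
  have hs := abs_mul_le_sin hre
  have hn := norm_nome z
  have hre' : (nome z).re = ‖nome z‖ * Real.cos (2 * (Real.pi * z.re)) := by
    have := nome_pow_re z 1
    rw [pow_one] at this
    rw [this, hn]
    simp only [Nat.cast_one, mul_one]
    ring_nf
  have hsq : ‖1 - nome z‖ ^ 2 = 1 - 2 * (nome z).re + ‖nome z‖ ^ 2 := by
    rw [← Complex.normSq_eq_norm_sq, ← Complex.normSq_eq_norm_sq, Complex.normSq_sub]
    simp
    ring
  rw [hre', Real.cos_two_mul, Real.cos_sq'] at hsq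
  have hρ : Real.exp (-Real.pi) ^ 2 ≤ ‖nome z‖ := by
    rw [hn, ← Real.exp_nat_mul]
    gcongr
    push_cast
    nlinarith
  have h0 : 0 ≤ |z.re| * (1 - |z.re|) := mul_nonneg (abs_nonneg _) (by linarith)
  refine abs_le_of_sq_le_sq' ?_ (norm_nonneg _) |>.2
  rw [hsq]
  have h1 : (2 * (|z.re| * (1 - |z.re|))) ^ 2 ≤ Real.sin (Real.pi * z.re) ^ 2 := by
    rw [← sq_abs (Real.sin _)]
    gcongr
  have h2 : 0 ≤ (1 - ‖nome z‖) ^ 2 := sq_nonneg _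
  have h3 : Real.exp (-Real.pi) ^ 2 * (2 * (|z.re| * (1 - |z.re|))) ^ 2
      ≤ ‖nome z‖ * Real.sin (Real.pi * z.re) ^ 2 := by gcongr
  nlinarith

/-- The bound of the logarithmic singularity at the origin. -/
noncomputable def logBound : ℝ := 4 * Real.pi + (Real.exp Real.pi / 4 + 2)

/-- Use `|log r| ≤ r + 1/r` for the ratio `r = |1 - e^{2πiz}|/|z|`, which is at most `4π`. Its
inverse is unbounded near `z = ±1`, the other zeros of the numerator; the weight compensates this,
as the two lower bounds in terms of `|Re z|(1 - |Re z|)` and of `Im z` cover the weighted `|z|`. -/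
lemma abs_log_norm_one_sub_nome_sub_log_le {z : ℂ} (hz : z.im ∈ Set.Ioo (0 : ℝ) 1)
    (hre : |z.re| ≤ 1) :
    (1 - |z.re|) * (1 - z.im) * |Real.log ‖1 - nome z‖ - Real.log ‖z‖| ≤ logBound := by
  have hpi := Real.pi_pos
  have hz0 : 0 < ‖z‖ := norm_pos_iff.2 fun h => by
    rw [h] at hz
    exact lt_irrefl _ hz.1
  have h1 := le_norm_one_sub_nome (Set.Ioo_subset_Icc_self hz)
  have h2 := le_norm_one_sub_nome_of_re hz.2.le hre
  have h3 := norm_one_sub_nome_le hz.1.le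
  have hr0 : 0 < ‖1 - nome z‖ := lt_of_lt_of_le (by linarith [hz.1]) h1
  have hlog := abs_log_le (div_pos hr0 hz0)
  rw [Real.log_div hr0.ne' hz0.ne', inv_div] at hlog
  set x := |z.re| with hx
  set a := z.im with ha
  have hx0 : 0 ≤ x := abs_nonneg _
  have ha1 : 0 ≤ 1 - a := by linarith [hz.2]
  have hx1 : 0 ≤ 1 - x := by linarith
  have hzn : ‖z‖ ≤ x + a := (Complex.norm_le_abs_re_add_abs_im z).trans (by
    rw [abs_of_pos hz.1])
  have hc1 : (1 - x) * (1 - a) ≤ 1 := by nlinarith [hz.1]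
  have hup : ‖1 - nome z‖ / ‖z‖ ≤ 4 * Real.pi := (div_le_iff₀ hz0).2 h3
  have hE : Real.exp Real.pi * Real.exp (-Real.pi) = 1 := by rw [← Real.exp_add]; simp
  have hlow : (1 - x) * (1 - a) * (‖z‖ / ‖1 - nome z‖) ≤ Real.exp Real.pi / 4 + 2 := by
    rw [← mul_div_assoc, div_le_iff₀ hr0]
    have e1 : x * (1 - x) ≤ Real.exp Real.pi / 4 * ‖1 - nome z‖ := by
      have := mul_le_mul_of_nonneg_left h2 (Real.exp_pos Real.pi).le
      have e : Real.exp Real.pi * (4 * Real.exp (-Real.pi) * (x * (1 - x)))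
          = 4 * (x * (1 - x)) := by linear_combination 4 * (x * (1 - x)) * hE
      rw [e] at this
      linarith
    have e2 : (1 - x) * (1 - a) * ‖z‖ ≤ x * (1 - x) + a := by
      calc _ ≤ (1 - x) * (1 - a) * (x + a) := by gcongr
        _ ≤ _ := by
          have b1 : (1 - x) * (1 - a) * x ≤ x * (1 - x) := by
            have : 0 ≤ (1 - x) * a * x := mul_nonneg (mul_nonneg hx1 hz.1.le) hx0
            nlinarith
          have b2 : (1 - x) * (1 - a) * a ≤ a := by nlinarith [hz.1]
          nlinarith
    linarith
  calc _ ≤ (1 - x) * (1 - a) * (‖1 - nome z‖ / ‖z‖ + ‖z‖ / ‖1 - nome z‖) := by gcongr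
    _ = (1 - x) * (1 - a) * (‖1 - nome z‖ / ‖z‖) + (1 - x) * (1 - a) * (‖z‖ / ‖1 - nome z‖) := by ring
    _ ≤ 1 * (4 * Real.pi) + (Real.exp Real.pi / 4 + 2) := by gcongr
    _ = logBound := by rw [logBound]; ring

lemma abs_log_norm_one_sub_nome_le {z : ℂ} (hz : z.im ∈ Set.Ioc (0 : ℝ) 1) :
    z.im * |Real.log ‖1 - nome z‖| ≤ 4 := by
  have h1 := le_norm_one_sub_nome (Set.Ioc_subset_Icc_self hz)
  have h2 := norm_one_sub_nome_le_two hz.1.le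
  have h0 := hz.1
  have hr0 : 0 < ‖1 - nome z‖ := lt_of_lt_of_le (by linarith [hz.1]) h1
  have h3 : ‖1 - nome z‖⁻¹ ≤ 2 / z.im := by
    rw [← inv_div]
    exact inv_anti₀ (by linarith) h1
  calc _ ≤ z.im * (2 + 2 / z.im) := by
        gcongr
        exact (abs_log_le hr0).trans (by linarith)
    _ = 2 * z.im + 2 := by field_simp
    _ ≤ 4 := by linarith [hz.2]

/-- The bound of the Eisenstein series without its singularity. -/
noncomputable def kronBound : ℝ :=
  2 * Real.pi ^ 2 + 2 * Real.pi * (logBound + 4) + corrTotal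

/-- Besides the origin, the singularities on the support are at lattice points of its boundary. The
factor `1 - |Re z|` controls those of the first logarithm, `1 - |Im z|` those of the second, and the
logarithm at the origin is the one added back. -/
lemma abs_tent_mul_kronDiff_add_log_le {z : ℂ} (hz : z.im ≠ 0) :
    |tent z * (kronDiff z + 2 * Real.pi * Real.log ‖z‖)| ≤ kronBound := by
  have hpi := Real.pi_pos
  have hC : 0 ≤ corrTotal := (abs_nonneg _).trans (abs_corr_le 0 (a := 0) (by simp))
  have hL : 0 ≤ logBound := by
    have := Real.exp_pos Real.pi
    unfold logBound
    positivity
  have hK : 0 ≤ kronBound := by unfold kronBound; positivity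
  rcases le_or_gt 1 |z.re| with h | hre
  · rw [tent, tentR_eq_zero h, zero_mul, zero_mul, abs_zero]
    exact hK
  rcases le_or_gt 1 |z.im| with h | him
  · rw [tent, tentR_eq_zero h, mul_zero, zero_mul, abs_zero]
    exact hK
  have ha0 : 0 < |z.im| := abs_pos.2 hz
  rw [kronDiff, min_eq_left him.le, tent, tentR_of_le hre.le, tentR_of_le him.le]
  set a := |z.im| with ha
  set w : ℂ := ⟨z.re, a⟩ with hw
  have hwn : ‖w‖ = ‖z‖ := by
    refine (sq_eq_sq₀ (norm_nonneg _) (norm_nonneg _)).1 ?_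
    rw [← Complex.normSq_eq_norm_sq, ← Complex.normSq_eq_norm_sq, Complex.normSq_apply,
      Complex.normSq_apply]
    simp [hw, ha]
  have h1 := abs_log_norm_one_sub_nome_sub_log_le (z := w) ⟨ha0, him⟩ hre.le
  have h2 := abs_log_norm_one_sub_nome_le (z := ⟨z.re, 1 - a⟩)
    ⟨by simpa using him, by simpa using ha0.le⟩
  have h3 := abs_corr_le z.re (a := a) ⟨ha0.le, him.le⟩
  rw [hwn] at h1
  change (1 - |z.re|) * (1 - a) * _ ≤ _ at h1
  change (1 - a) * _ ≤ _ at h2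
  have hc0 : 0 ≤ 1 - |z.re| := by linarith
  have hc1 : 1 - |z.re| ≤ 1 := by linarith [abs_nonneg z.re]
  have ha1 : 0 ≤ 1 - a := by linarith
  have hpoly : |a ^ 2 - a + 1 / 6| ≤ 1 := by
    rw [abs_le]
    constructor <;> nlinarith
  set l₁ := Real.log ‖1 - nome w‖
  set l₂ := Real.log ‖1 - nome ⟨z.re, 1 - a⟩‖
  have e : (1 - |z.re|) * (1 - a) * (kron z.re a + 2 * Real.pi * Real.log ‖z‖)
      = (1 - |z.re|) * (1 - a) * (2 * Real.pi ^ 2 * (a ^ 2 - a + 1 / 6))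
        + -(2 * Real.pi * ((1 - |z.re|) * (1 - a) * (l₁ - Real.log ‖z‖)))
        + -(2 * Real.pi * ((1 - |z.re|) * ((1 - a) * l₂)))
        + (1 - |z.re|) * (1 - a) * corr z.re a := by
    rw [kron]
    ring
  have hcc : 0 ≤ (1 - |z.re|) * (1 - a) := mul_nonneg hc0 ha1
  have hcc1 : (1 - |z.re|) * (1 - a) ≤ 1 := mul_le_one₀ hc1 ha1 (by linarith)
  rw [e]
  refine (abs_add_le _ _).trans ?_
  have b1 : |(1 - |z.re|) * (1 - a) * (2 * Real.pi ^ 2 * (a ^ 2 - a + 1 / 6))| ≤ 2 * Real.pi ^ 2 := by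
    rw [abs_mul, abs_of_nonneg hcc, abs_mul, abs_of_pos (by positivity : 0 < 2 * Real.pi ^ 2)]
    calc _ ≤ 1 * (2 * Real.pi ^ 2 * 1) := by gcongr
      _ = _ := by ring
  have b2 : |-(2 * Real.pi * ((1 - |z.re|) * (1 - a) * (l₁ - Real.log ‖z‖)))|
      ≤ 2 * Real.pi * logBound := by
    rw [abs_neg, abs_mul (2 * Real.pi), abs_mul ((1 - |z.re|) * (1 - a)), abs_of_nonneg hcc,
      abs_of_pos (by positivity : 0 < 2 * Real.pi)]
    gcongr
  have b3 : |-(2 * Real.pi * ((1 - |z.re|) * ((1 - a) * l₂)))| ≤ 2 * Real.pi * 4 := by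
    rw [abs_neg, abs_mul (2 * Real.pi), abs_mul (1 - |z.re|), abs_mul (1 - a), abs_of_nonneg hc0,
      abs_of_nonneg ha1,
      abs_of_pos (by positivity : 0 < 2 * Real.pi)]
    have : (1 - |z.re|) * ((1 - a) * |l₂|) ≤ 1 * 4 := by gcongr
    gcongr
    linarith
  have b4 : |(1 - |z.re|) * (1 - a) * corr z.re a| ≤ corrTotal := by
    rw [abs_mul, abs_of_nonneg hcc]
    calc _ ≤ 1 * corrTotal := by gcongr
      _ = _ := one_mul _
  have := abs_add_three ((1 - |z.re|) * (1 - a) * (2 * Real.pi ^ 2 * (a ^ 2 - a + 1 / 6)))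
    (-(2 * Real.pi * ((1 - |z.re|) * (1 - a) * (l₁ - Real.log ‖z‖))))
    (-(2 * Real.pi * ((1 - |z.re|) * ((1 - a) * l₂))))
  rw [kronBound]
  linarith

lemma ae_im_ne (c : ℝ) : ∀ᵐ z : ℂ, z.im ≠ c := by
  have h : ∀ᵐ p : ℝ × ℝ, p.2 ≠ c := by
    rw [Measure.volume_eq_prod]
    exact Measure.quasiMeasurePreserving_snd.ae (Measure.ae_ne volume c)
  exact Complex.volume_preserving_equiv_real_prod.quasiMeasurePreserving.ae h

lemma integrable_tent_mul_kronDiff : Integrable fun z => tent z * kronDiff z := by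
  have hpi := Real.pi_pos
  have h1 := integrable_norm_pow_mul_exp 0
  have h2 := integrable_log_mul_exp
  refine (((h1.const_mul kronBound).add (h2.const_mul (2 * Real.pi))).const_mul
    (Real.exp Real.pi)).mono' (continuous_tent.measurable.mul measurable_kronDiff).aestronglyMeasurable
    ?_
  filter_upwards [ae_im_ne 0] with z hz
  simp only [Pi.add_apply, pow_zero, one_mul, Real.norm_eq_abs]
  have hb := abs_tent_mul_kronDiff_add_log_le hz
  have hB : 0 ≤ kronBound := (abs_nonneg _).trans hb
  by_cases hzero : tent z = 0
  · rw [hzero, zero_mul, abs_zero]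
    positivity
  have hre : |z.re| < 1 := by
    by_contra h
    exact hzero (by rw [tent, tentR_eq_zero (not_lt.1 h), zero_mul])
  have him : |z.im| < 1 := by
    by_contra h
    exact hzero (by rw [tent, tentR_eq_zero (not_lt.1 h), mul_zero])
  have hn : ‖z‖ ^ 2 ≤ 2 := by
    rw [← Complex.normSq_eq_norm_sq, Complex.normSq_apply, ← sq, ← sq, ← sq_abs z.re, ← sq_abs z.im]
    nlinarith [abs_nonneg z.re, abs_nonneg z.im]
  -- On the support `|z|² ≤ 2`, so a multiple of the Gaussian exceeds `1` there; the integrable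
  -- Gaussian functions already at hand serve as majorants.
  have hexp : 1 ≤ Real.exp Real.pi * Real.exp (-(Real.pi / 2) * ‖z‖ ^ 2) := by
    rw [← Real.exp_add, Real.one_le_exp_iff]
    nlinarith
  have e : tent z * kronDiff z = tent z * (kronDiff z + 2 * Real.pi * Real.log ‖z‖)
      - tent z * (2 * Real.pi * Real.log ‖z‖) := by ring
  have h3 : |tent z * (2 * Real.pi * Real.log ‖z‖)| ≤ 2 * Real.pi * |Real.log ‖z‖| := by
    rw [abs_mul, abs_of_nonneg (tent_nonneg z), abs_mul, abs_of_pos (by positivity : 0 < 2 * Real.pi)]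
    exact mul_le_of_le_one_left (by positivity) (tent_le_one z)
  calc |tent z * kronDiff z| ≤ kronBound + 2 * Real.pi * |Real.log ‖z‖| := by
        rw [e]
        exact (abs_sub _ _).trans (add_le_add hb h3)
    _ ≤ (kronBound + 2 * Real.pi * |Real.log ‖z‖|)
        * (Real.exp Real.pi * Real.exp (-(Real.pi / 2) * ‖z‖ ^ 2)) :=
        le_mul_of_one_le_right (by positivity) hexp
    _ = _ := by ring

/-! ## The Dedekind eta function at `i` and the constant term -/

/-- The number `e^{-2π}`. -/
noncomputable def nomeI : ℝ := Real.exp (-(2 * Real.pi))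

lemma nomeI_pos : 0 < nomeI := Real.exp_pos _

lemma nomeI_lt_one : nomeI < 1 := exp_neg_two_pi_lt_one

lemma nomeI_pow_lt_one (k : ℕ) : nomeI ^ (k + 1) < 1 :=
  pow_lt_one₀ nomeI_pos.le nomeI_lt_one k.succ_ne_zero

/-- The terms of the double series for `-∑ log (1 - q^k)`. -/
noncomputable def etaTerm (n k : ℕ) : ℝ := (nomeI ^ (n + 1)) ^ (k + 1) / (n + 1)

lemma etaTerm_nonneg (n k : ℕ) : 0 ≤ etaTerm n k := by
  have := nomeI_pos
  unfold etaTerm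
  positivity

lemma hasSum_etaTerm_right (n : ℕ) :
    HasSum (fun k => etaTerm n k) (nomeI ^ (n + 1) / (1 - nomeI ^ (n + 1)) / (n + 1)) := by
  have h := ((hasSum_geometric_of_lt_one (pow_nonneg nomeI_pos.le (n + 1))
    (nomeI_pow_lt_one n)).mul_left (nomeI ^ (n + 1))).div_const ((n : ℝ) + 1)
  rw [← div_eq_mul_inv] at h
  refine h.congr_fun fun k => ?_
  rw [etaTerm, pow_succ' (nomeI ^ (n + 1))]

lemma hasSum_etaTerm_left (k : ℕ) :
    HasSum (fun n => etaTerm n k) (-Real.log (1 - nomeI ^ (k + 1))) := by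
  have h := Real.hasSum_pow_div_log_of_abs_lt_one (x := nomeI ^ (k + 1)) (by
    rw [abs_of_nonneg (pow_nonneg nomeI_pos.le _)]
    exact nomeI_pow_lt_one k)
  refine h.congr_fun fun n => ?_
  rw [etaTerm, pow_right_comm]

lemma summable_etaTerm : Summable (Function.uncurry etaTerm) := by
  refine (summable_prod_of_nonneg fun p => etaTerm_nonneg _ _).2
    ⟨fun n => (hasSum_etaTerm_right n).summable, ?_⟩
  simp only [(hasSum_etaTerm_right _).tsum_eq]
  have hq := sub_pos.2 nomeI_lt_one
  have hs : Summable fun n : ℕ => nomeI ^ n * (nomeI / (1 - nomeI)) :=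
    (summable_geometric_of_lt_one nomeI_pos.le nomeI_lt_one).mul_right _
  refine hs.of_nonneg_of_le (fun n => ?_) fun n => ?_
  · have := sub_pos.2 (nomeI_pow_lt_one n)
    have := nomeI_pos
    positivity
  · have h1 := sub_pos.2 (nomeI_pow_lt_one n)
    have h2 : nomeI ^ (n + 1) ≤ nomeI := pow_le_of_le_one nomeI_pos.le nomeI_lt_one.le n.succ_ne_zero
    have h3 := nomeI_pos
    refine (div_le_self (by positivity) (by linarith [(Nat.cast_nonneg n : (0 : ℝ) ≤ n)])).trans ?_
    calc _ ≤ nomeI ^ (n + 1) / (1 - nomeI) := by gcongr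
      _ = _ := by rw [pow_succ, mul_div_assoc]

/-- The logarithm of `∏ (1 - e^{-2πk})`. -/
noncomputable def etaLog : ℝ := ∑' k : ℕ, Real.log (1 - nomeI ^ (k + 1))

lemma hasSum_etaLog : HasSum (fun k : ℕ => Real.log (1 - nomeI ^ (k + 1))) etaLog := by
  have h := summable_etaTerm.prod_symm.prod
  simp only [Function.uncurry, Prod.swap, (hasSum_etaTerm_left _).tsum_eq] at h
  have h' := h.neg
  simp only [neg_neg] at h'
  exact h'.hasSum

/-- Summing the nonnegative double series `q^{nk}/n` in both orders: over `k` it gives Lambert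
terms, over `n` logarithms of the factors of the product. -/
lemma hasSum_neg_etaLog :
    HasSum (fun n : ℕ => nomeI ^ (n + 1) / (1 - nomeI ^ (n + 1)) / (n + 1)) (-etaLog) := by
  have h := summable_etaTerm.prod
  simp only [Function.uncurry, (hasSum_etaTerm_right _).tsum_eq] at h
  have h2 := summable_etaTerm.tsum_comm
  simp only [(hasSum_etaTerm_right _).tsum_eq, (hasSum_etaTerm_left _).tsum_eq] at h2
  rw [tsum_neg] at h2
  rw [etaLog, h2]
  exact h.hasSum

lemma eta_I : ModularForm.eta Complex.I = (Real.exp (-(Real.pi / 12) + etaLog) : ℝ) := by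
  have hp := (Real.hasProd_of_hasSum_log (fun k => sub_pos.2 (nomeI_pow_lt_one k))
    hasSum_etaLog).map Complex.ofRealHom Complex.continuous_ofReal
  have hterm : ∀ k : ℕ, 1 - ModularForm.eta_q k Complex.I
      = (Complex.ofRealHom ∘ fun k : ℕ => 1 - nomeI ^ (k + 1)) k := by
    intro k
    rw [ModularForm.eta_q_eq_pow]
    simp only [Function.comp, Complex.ofRealHom_eq_coe, nomeI]
    push_cast
    congr 3
    linear_combination 2 * (Real.pi : ℂ) * Complex.I_sq
  rw [ModularForm.eta, tprod_congr hterm, hp.tprod_eq, Complex.ofRealHom_eq_coe, Real.exp_add,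
    Complex.ofReal_mul]
  congr 1
  rw [Function.Periodic.qParam]
  push_cast
  congr 1
  linear_combination ((Real.pi : ℂ) / 12) * Complex.I_sq

lemma log_two_pi_mul_eta_sq : Real.log (2 * Real.pi * (ModularForm.eta Complex.I).re ^ 2)
    = Real.log (2 * Real.pi) + 2 * (-(Real.pi / 12) + etaLog) := by
  have hpi := Real.pi_pos
  rw [eta_I, Complex.ofReal_re, Real.log_mul (by positivity) (by positivity), Real.log_pow,
    Real.log_exp]
  push_cast
  ring

/-- With `q = e^{-2πn}` one has `rowFun n 0 = 1 + q`, and adding the logarithmic term `2πq/n` gives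
`(1 + q) + (1 - q) = 2` in the numerator. The sum is thus `4π` times the Lambert series. -/
lemma corr_zero : corr 0 0 - 2 * Real.pi * Real.log (1 - nomeI) = -(4 * Real.pi * etaLog) := by
  have h1 : HasSum (fun n : ℕ => corrTerm (n + 1) 0 0) (corr 0 0) := by
    have h := (summable_corrTerm 0 (a := 0) (by simp)).hasSum
    rw [← hasSum_nat_add_iff' 1] at h
    have h0 : corrTerm 0 0 0 = 0 := by simp [corrTerm]
    rw [Finset.sum_range_one, h0, sub_zero] at h
    exact h
  have h2 := (Real.hasSum_pow_div_log_of_abs_lt_one (x := nomeI) (by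
    rw [abs_of_pos nomeI_pos]; exact nomeI_lt_one)).mul_left (2 * Real.pi)
  have h3 := hasSum_neg_etaLog.mul_left (4 * Real.pi)
  have h4 := h1.add h2
  have e := h4.unique (h3.congr_fun fun n => ?_)
  · linarith
  have hq := (sub_pos.2 (nomeI_pow_lt_one n)).ne'
  have hexp : Real.exp (-(2 * Real.pi * (n + 1 : ℕ))) = nomeI ^ (n + 1) := exp_neg_two_pi_mul_nat _
  simp only [corrTerm, rowFun, mul_zero, Real.cos_zero, neg_zero, Real.exp_zero, sub_zero, mul_one]
  rw [hexp]
  have hn : ((n : ℝ) + 1) ≠ 0 := by positivity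
  push_cast
  generalize nomeI ^ (n + 1) = q at hq
  field_simp
  ring

lemma hasDerivAt_nome_zero : HasDerivAt nome (2 * Real.pi * Complex.I) 0 := by
  have h := ((hasDerivAt_id (0 : ℂ)).const_mul (2 * Real.pi * Complex.I)).cexp
  simp only [id, mul_zero, Complex.exp_zero, one_mul, mul_one] at h
  exact h

lemma tendsto_log_norm_one_sub_nome_sub_log :
    Tendsto (fun z => Real.log ‖1 - nome z‖ - Real.log ‖z‖) (𝓝[≠] 0) (𝓝 (Real.log (2 * Real.pi))) := by
  have hpi := Real.pi_pos
  have h := (hasDerivAt_iff_tendsto_slope.1 hasDerivAt_nome_zero).norm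
  have hn : ‖2 * (Real.pi : ℂ) * Complex.I‖ = 2 * Real.pi := by simp [abs_of_pos hpi]
  rw [hn] at h
  have h2 := h.log (by positivity)
  refine h2.congr' ?_
  have hne : ∀ᶠ z in 𝓝[≠] (0 : ℂ), ‖slope nome 0 z‖ ≠ 0 :=
    h.eventually_ne (by positivity)
  filter_upwards [self_mem_nhdsWithin, hne] with z hz hs
  have hz0 : ‖z‖ ≠ 0 := norm_ne_zero_iff.2 hz
  have e : ‖slope nome 0 z‖ = ‖1 - nome z‖ / ‖z‖ := by
    rw [slope_def_field, norm_div, sub_zero, norm_sub_rev]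
    simp [nome]
  rw [e] at hs ⊢
  rw [Real.log_div (fun h => hs (by rw [h, zero_div])) hz0]

/-- The Kronecker limit formula at the origin. -/
theorem tendsto_kronDiff_add_log :
    Tendsto (fun z => kronDiff z + 2 * Real.pi * Real.log ‖z‖) (𝓝[{z | z.im ≠ 0}] 0)
      (𝓝 (-(2 * Real.pi * Real.log (2 * Real.pi * (ModularForm.eta Complex.I).re ^ 2)))) := by
  have hc : Continuous fun z : ℂ => min |z.im| 1 := by fun_prop
  have hmk : Continuous fun p : ℝ × ℝ => (⟨p.1, p.2⟩ : ℂ) :=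
    Complex.equivRealProdCLM.symm.continuous
  have h1 : Continuous fun z : ℂ => corr z.re (min |z.im| 1) :=
    continuousOn_univ.1 (continuousOn_corr.comp (f := fun z : ℂ => (z.re, min |z.im| 1))
      (Complex.continuous_re.prodMk hc).continuousOn
      fun z _ => ⟨le_min (abs_nonneg _) zero_le_one, min_le_right _ _⟩)
  have h2 : Continuous fun z : ℂ => 2 * Real.pi ^ 2 * ((min |z.im| 1) ^ 2 - min |z.im| 1 + 1 / 6) := by
    fun_prop
  have h3 : Continuous fun z : ℂ => ‖1 - nome ⟨z.re, 1 - min |z.im| 1⟩‖ :=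
    (continuous_const.sub (continuous_nome.comp (hmk.comp (Complex.continuous_re.prodMk
      (continuous_const.sub hc))))).norm
  have hI : ‖1 - nome ⟨(0 : ℂ).re, 1 - min |(0 : ℂ).im| 1⟩‖ = 1 - nomeI := by
    have : nome ⟨(0 : ℂ).re, 1 - min |(0 : ℂ).im| 1⟩ = (nomeI : ℂ) := by
      have e : (⟨(0 : ℂ).re, 1 - min |(0 : ℂ).im| 1⟩ : ℂ) = Complex.I := by
        apply Complex.ext <;> simp
      rw [e, nome, nomeI]
      push_cast
      congr 1
      linear_combination 2 * (Real.pi : ℂ) * Complex.I_sq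
    rw [this, ← Complex.ofReal_one, ← Complex.ofReal_sub, Complex.norm_real, Real.norm_eq_abs,
      abs_of_pos (sub_pos.2 nomeI_lt_one)]
  have t3 := (h3.tendsto 0).log (by rw [hI]; exact (sub_pos.2 nomeI_lt_one).ne')
  rw [hI] at t3
  have h4 : Continuous fun z : ℂ => (⟨z.re, min |z.im| 1⟩ : ℂ) :=
    hmk.comp (Complex.continuous_re.prodMk hc)
  -- Folding `Im z` to `|Im z|` stays off the origin because the limit is taken along `Im z ≠ 0`;
  -- that line is null and the closed form of the rows does not cover it.
  have t4 : Tendsto (fun z : ℂ => (⟨z.re, min |z.im| 1⟩ : ℂ)) (𝓝[{z | z.im ≠ 0}] 0) (𝓝[≠] 0) := by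
    refine tendsto_nhdsWithin_iff.2 ⟨?_, ?_⟩
    · have := h4.tendsto 0
      have e : (⟨(0 : ℂ).re, min |(0 : ℂ).im| 1⟩ : ℂ) = 0 := by apply Complex.ext <;> simp
      rw [e] at this
      exact this.mono_left nhdsWithin_le_nhds
    · filter_upwards [self_mem_nhdsWithin] with z hz h
      have him : min |z.im| 1 = 0 := congrArg Complex.im h
      exact (lt_min (abs_pos.2 hz) one_pos).ne' him
  have t5 := tendsto_log_norm_one_sub_nome_sub_log.comp t4
  have tot := ((((h2.tendsto 0).mono_left nhdsWithin_le_nhds).add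
    ((h1.tendsto 0).mono_left nhdsWithin_le_nhds)).sub
    ((t3.mono_left nhdsWithin_le_nhds).const_mul (2 * Real.pi))).sub (t5.const_mul (2 * Real.pi))
  -- The value `π²/3` of the polynomial matches the factor `e^{-π/12}` of `η(i)`, and the remaining
  -- terms match the product through `corr_zero`.
  have hlim : 2 * Real.pi ^ 2 * ((min |(0 : ℂ).im| 1) ^ 2 - min |(0 : ℂ).im| 1 + 1 / 6)
      + corr (0 : ℂ).re (min |(0 : ℂ).im| 1) - 2 * Real.pi * Real.log (1 - nomeI)
      - 2 * Real.pi * Real.log (2 * Real.pi)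
      = -(2 * Real.pi * Real.log (2 * Real.pi * (ModularForm.eta Complex.I).re ^ 2)) := by
    rw [log_two_pi_mul_eta_sq]
    simp only [Complex.zero_im, Complex.zero_re, abs_zero, min_eq_left zero_le_one]
    linear_combination corr_zero
  rw [hlim] at tot
  refine tot.congr' ?_
  have hlt : ∀ᶠ z in 𝓝[{z : ℂ | z.im ≠ 0}] (0 : ℂ), |z.im| < 1 := by
    refine Filter.Eventually.filter_mono nhdsWithin_le_nhds ?_
    have hcont : Continuous fun z : ℂ => |z.im| := by fun_prop
    exact (hcont.tendsto 0).eventually (gt_mem_nhds (by simp))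
  filter_upwards [hlt] with z hz
  have hn : ‖(⟨z.re, min |z.im| 1⟩ : ℂ)‖ = ‖z‖ := by
    refine (sq_eq_sq₀ (norm_nonneg _) (norm_nonneg _)).1 ?_
    rw [← Complex.normSq_eq_norm_sq, ← Complex.normSq_eq_norm_sq, Complex.normSq_apply,
      Complex.normSq_apply, min_eq_left hz.le]
    simp
  simp only [Function.comp, hn]
  rw [kronDiff, kron]
  ring

/-! ## The Eisenstein series has mean zero -/

lemma integral_tentR_mul_abs (f : ℝ → ℝ) :
    ∫ x, tentR x * f |x| = 2 * ∫ r in (0 : ℝ)..1, (1 - r) * f r := by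
  have h := integral_comp_abs (f := fun r => max (1 - r) 0 * f r)
  change ∫ x, tentR x * f |x| = _ at h
  rw [h, intervalIntegral.integral_of_le zero_le_one, setIntegral_eq_of_subset_of_forall_sdiff_eq_zero
    measurableSet_Ioi Set.Ioc_subset_Ioi_self (f := fun r => max (1 - r) 0 * f r)]
  · congr 1
    refine setIntegral_congr_fun measurableSet_Ioc fun r hr => ?_
    rw [max_eq_left (by linarith [hr.2])]
  · rintro r ⟨h0, h1⟩
    have hr : 1 < r := by
      by_contra hle
      exact h1 ⟨h0, not_lt.1 hle⟩
    rw [max_eq_right (by linarith), zero_mul]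

lemma integrable_tentR : Integrable tentR :=
  continuous_tentR.integrable_of_hasCompactSupport
    (HasCompactSupport.intro (isCompact_Icc (a := (-1 : ℝ)) (b := 1)) fun x hx =>
      tentR_eq_zero (by
        by_contra h
        exact hx (abs_le.1 (not_le.1 h).le)))

lemma integral_tentR : ∫ x, tentR x = 1 := by
  have h := integral_tentR_mul_abs fun _ => 1
  simp only [mul_one] at h
  rw [h, intervalIntegral.integral_eq_sub_of_hasDerivAt (f := fun r => r - r ^ 2 / 2)]
  · norm_num
  · intro x _
    refine ((hasDerivAt_id x).sub (((hasDerivAt_id x).pow 2).div_const 2)).congr_deriv ?_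
    simp
  · exact Continuous.intervalIntegrable (by fun_prop) _ _

/-- The integer translates of the tent function sum to `1`, so its pairing with a function of period
`1` is the mean of that function. Here an explicit primitive shows the vanishing. -/
lemma integral_tentR_mul_cos {n : ℕ} (hn : n ≠ 0) :
    ∫ x, tentR x * Real.cos (2 * Real.pi * n * x) = 0 := by
  have h := integral_tentR_mul_abs fun x => Real.cos (2 * Real.pi * n * x)
  have e : ∀ x : ℝ, Real.cos (2 * Real.pi * n * |x|) = Real.cos (2 * Real.pi * n * x) := by
    intro x
    rcases abs_choice x with h | h
    · rw [h]
    · rw [h, mul_neg, Real.cos_neg]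
  simp only [e] at h
  set c : ℝ := 2 * Real.pi * n with hc
  have hc0 : c ≠ 0 := by
    have := Real.pi_ne_zero
    have : (n : ℝ) ≠ 0 := Nat.cast_ne_zero.2 hn
    positivity
  rw [h, intervalIntegral.integral_eq_sub_of_hasDerivAt
    (f := fun r => (1 - r) * (Real.sin (c * r) / c) - Real.cos (c * r) / c ^ 2)]
  · have : Real.cos (c * 1) = 1 := by
      rw [hc, mul_one, show 2 * Real.pi * (n : ℝ) = n * (2 * Real.pi) by ring]
      exact Real.cos_nat_mul_two_pi n
    rw [this]
    simp
  · intro x _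
    have h1 : HasDerivAt (fun r => c * r) c x := by simpa using (hasDerivAt_id x).const_mul c
    refine ((((hasDerivAt_id x).const_sub 1).mul (h1.sin.div_const c)).sub
      (h1.cos.div_const (c ^ 2))).congr_deriv ?_
    simp only [id]
    field_simp
    ring
  · exact Continuous.intervalIntegrable (by fun_prop) _ _

/-- The rows other than `m = 0` are pure cosines in `u` and integrate to zero; the uniform bound `b`
allows termwise integration. -/
lemma integral_tentR_mul_kron {a : ℝ} (ha : a ∈ Set.Ioo (0 : ℝ) 1) :
    ∫ u, tentR u * kron u a = 2 * Real.pi ^ 2 * (a ^ 2 - a + 1 / 6) := by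
  obtain ⟨b, hb, hle⟩ := summable_norm_rowTerm ha
  have hint : ∀ n, Integrable fun u => tentR u * rowTerm n u a := by
    intro n
    have hc : Continuous fun u => rowTerm n u a := by
      unfold rowTerm
      fun_prop
    exact integrable_tentR.mul_bdd (c := b n) hc.aestronglyMeasurable (ae_of_all _ fun u => hle n u)
  have hzero : ∀ n, ∫ u, tentR u * rowTerm n u a = 0 := by
    intro n
    rcases eq_or_ne n 0 with rfl | hn
    · simp [rowTerm]
    · have e : ∀ u, tentR u * rowTerm n u a = tentR u * Real.cos (2 * Real.pi * n * u)
          * (2 * (Real.pi / n * (rowFun n a / (1 - Real.exp (-(2 * Real.pi * n)))))) := fun u => by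
        rw [rowTerm]
        ring
      simp_rw [e]
      rw [integral_mul_const, integral_tentR_mul_cos hn, zero_mul]
  have hsum : Summable fun n => ∫ u, ‖tentR u * rowTerm n u a‖ := by
    refine hb.of_nonneg_of_le (fun n => integral_nonneg fun u => norm_nonneg _) fun n => ?_
    calc _ ≤ ∫ u, tentR u * b n := by
          refine integral_mono (hint n).norm (integrable_tentR.mul_const _) fun u => ?_
          simp only
          rw [norm_mul, Real.norm_eq_abs, Real.norm_eq_abs, abs_of_nonneg (tentR_nonneg u)]
          exact mul_le_mul_of_nonneg_left (hle n u) (tentR_nonneg u)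
      _ = b n := by rw [integral_mul_const, integral_tentR, one_mul]
  have h := hasSum_integral_of_summable_integral_norm hint hsum
  simp only [hzero] at h
  have h0 := h.unique hasSum_zero
  have hser : ∀ u, ∑' n, tentR u * rowTerm n u a
      = tentR u * (kron u a - 2 * Real.pi ^ 2 * (a ^ 2 - a + 1 / 6)) := by
    intro u
    rw [tsum_mul_left, (hasSum_rowTerm u ha).tsum_eq, kron]
    ring
  have hI : Integrable fun u => ∑' n, tentR u * rowTerm n u a := by
    refine (integrable_tentR.mul_const (∑' n, b n)).mono' ?_ (ae_of_all _ fun u => ?_)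
    · have hm : Measurable fun u => kron u a := by
        have : (fun u => kron u a) = fun u : ℝ => kronDiff (u + a * Complex.I) := by
          funext u
          simp [kronDiff, abs_of_pos ha.1, min_eq_left ha.2.le]
        rw [this]
        exact measurable_kronDiff.comp (by fun_prop)
      simp only [hser]
      exact (continuous_tentR.measurable.mul (hm.sub_const _)).aestronglyMeasurable
    · rw [tsum_mul_left, norm_mul, Real.norm_eq_abs, abs_of_nonneg (tentR_nonneg u)]
      refine mul_le_mul_of_nonneg_left ?_ (tentR_nonneg u)
      exact tsum_of_norm_bounded hb.hasSum fun n => hle n u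
  simp only [hser] at h0 hI
  have e : ∀ u, tentR u * kron u a
      = tentR u * (kron u a - 2 * Real.pi ^ 2 * (a ^ 2 - a + 1 / 6))
        + tentR u * (2 * Real.pi ^ 2 * (a ^ 2 - a + 1 / 6)) := fun u => by ring
  simp_rw [e]
  rw [integral_add hI (integrable_tentR.mul_const _), h0, integral_mul_const, integral_tentR, zero_add,
    one_mul]

/-- After integration in `Re z` only the second Bernoulli polynomial is left. It is symmetric under
`r ↦ 1 - r`, so the weight `1 - r` acts as `1/2`, and its mean is zero. -/
theorem integral_tent_mul_kronDiff : ∫ z, tent z * kronDiff z = 0 := by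
  have hmp := Complex.volume_preserving_equiv_real_prod.symm
  have hint := (hmp.integrable_comp_emb (MeasurableEquiv.measurableEmbedding _)).2
    integrable_tent_mul_kronDiff
  rw [← hmp.integral_comp (MeasurableEquiv.measurableEmbedding _)]
  change ∫ p : ℝ × ℝ, tentR p.1 * tentR p.2 * kron p.1 (min |p.2| 1) = 0
  change Integrable (fun p : ℝ × ℝ => tentR p.1 * tentR p.2 * kron p.1 (min |p.2| 1)) at hint
  rw [Measure.volume_eq_prod] at hint ⊢
  rw [integral_prod_symm _ hint]
  have h : ∀ᵐ v : ℝ, ∫ u, tentR u * tentR v * kron u (min |v| 1)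
      = tentR v * (2 * Real.pi ^ 2 * (|v| ^ 2 - |v| + 1 / 6)) := by
    filter_upwards [Measure.ae_ne volume (0 : ℝ)] with v hv
    rcases le_or_gt 1 |v| with h1 | h1
    · simp [tentR_eq_zero h1]
    · rw [← integral_tentR_mul_kron ⟨abs_pos.2 hv, h1⟩, ← integral_const_mul, min_eq_left h1.le]
      congr 1
      funext u
      ring
  rw [integral_congr_ae h, integral_tentR_mul_abs fun r => 2 * Real.pi ^ 2 * (r ^ 2 - r + 1 / 6),
    intervalIntegral.integral_eq_sub_of_hasDerivAt
      (f := fun r => 2 * Real.pi ^ 2 * (r ^ 3 / 3 - r ^ 2 / 2 + r / 6 - (r ^ 4 / 4 - r ^ 3 / 3 + r ^ 2 / 12)))]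
  · norm_num
  · intro x _
    have h1 := hasDerivAt_id x
    refine ((((((h1.pow 3).div_const 3).sub ((h1.pow 2).div_const 2)).add (h1.div_const 6)).sub
      ((((h1.pow 4).div_const 4).sub ((h1.pow 3).div_const 3)).add
        ((h1.pow 2).div_const 12))).const_mul (2 * Real.pi ^ 2)).congr_deriv ?_
    simp only [id]
    push_cast
    ring
  · exact Continuous.intervalIntegrable (by fun_prop) _ _

/-! ## The expectation of the renormalized energy -/

lemma measurableSet_squareWindow (N : ℝ) : MeasurableSet (squareWindow N) :=
  (Complex.measurable_re measurableSet_Icc).inter (Complex.measurable_im measurableSet_Icc)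

lemma isCompact_squareWindow (N : ℝ) : IsCompact (squareWindow N) :=
  isCompact_Icc.reProdIm isCompact_Icc

lemma volume_Icc_inter_sub {N : ℝ} (hN : 0 < N) (x : ℝ) :
    volume {t : ℝ | t ∈ Set.Icc 0 N ∧ t - x ∈ Set.Icc 0 N} = ENNReal.ofReal (N * tentR (x / N)) := by
  have hs : {t : ℝ | t ∈ Set.Icc 0 N ∧ t - x ∈ Set.Icc 0 N} = Set.Icc (max 0 x) (min N (N + x)) := by
    ext t
    simp only [Set.mem_ofPred_eq, Set.mem_Icc, max_le_iff, le_min_iff, sub_nonneg, sub_le_iff_le_add]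
    tauto
  rw [hs, Real.volume_Icc, tentR, abs_div, abs_of_pos hN]
  have e : N * max (1 - |x| / N) 0 = max (N - |x|) 0 := by
    rw [mul_max_of_nonneg _ _ hN.le, mul_zero, mul_sub, mul_one, mul_div_cancel₀ _ hN.ne']
  rw [e, ENNReal.ofReal_max, ENNReal.ofReal_zero, max_zero]
  congr 1
  rcases le_total 0 x with h | h
  · rw [abs_of_nonneg h, max_eq_right h, min_eq_left (by linarith)]
  · rw [abs_of_nonpos h, max_eq_left h, min_eq_right (by linarith)]
    ring

lemma volume_squareWindow_inter_sub {N : ℝ} (hN : 0 < N) (w : ℂ) :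
    volume {z : ℂ | z ∈ squareWindow N ∧ z - w ∈ squareWindow N}
      = ENNReal.ofReal (N ^ 2 * tent (w / N)) := by
  have hs : {z : ℂ | z ∈ squareWindow N ∧ z - w ∈ squareWindow N}
      = Complex.measurableEquivRealProd ⁻¹' ({t : ℝ | t ∈ Set.Icc 0 N ∧ t - w.re ∈ Set.Icc 0 N}
        ×ˢ {t : ℝ | t ∈ Set.Icc 0 N ∧ t - w.im ∈ Set.Icc 0 N}) := by
    ext z
    simp only [squareWindow, Set.mem_ofPred_eq, Complex.mem_reProdIm, Set.mem_preimage,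
      Complex.measurableEquivRealProd_apply, Set.mem_prod, Complex.sub_re, Complex.sub_im]
    tauto
  rw [hs, Complex.volume_preserving_equiv_real_prod.measure_preimage_equiv, Measure.volume_eq_prod,
    Measure.prod_prod, volume_Icc_inter_sub hN, volume_Icc_inter_sub hN,
    ← ENNReal.ofReal_mul (mul_nonneg hN.le (tentR_nonneg _)), tent, Complex.div_ofReal_re,
    Complex.div_ofReal_im]
  congr 1
  ring

/-- A function of the difference of two points of the square. -/
noncomputable def windowPair (N : ℝ) (G : ℂ → ℝ≥0∞) (a b : ℂ) : ℝ≥0∞ :=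
  (squareWindow N).indicator 1 a * (squareWindow N).indicator 1 b * G (a - b)

lemma measurable_windowPair (N : ℝ) {G : ℂ → ℝ≥0∞} (hG : Measurable G) :
    Measurable (Function.uncurry (windowPair N G)) := by
  have h1 : Measurable ((squareWindow N).indicator (1 : ℂ → ℝ≥0∞)) :=
    measurable_one.indicator (measurableSet_squareWindow N)
  exact ((h1.comp measurable_fst).mul (h1.comp measurable_snd)).mul
    (hG.comp (measurable_fst.sub measurable_snd))

/-- Put `w = z₁ - z₂`; for fixed `w` the first point ranges over the intersection of the window with
a translate, of area `N² tent(w/N)`. -/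
lemma lintegral_windowPair {N : ℝ} (hN : 0 < N) {G : ℂ → ℝ≥0∞} (hG : Measurable G) :
    ∫⁻ z₁, ∫⁻ z₂, windowPair N G z₁ z₂ = ∫⁻ w, G w * ENNReal.ofReal (N ^ 2 * tent (w / N)) := by
  have hW : Measurable ((squareWindow N).indicator (1 : ℂ → ℝ≥0∞)) :=
    measurable_one.indicator (measurableSet_squareWindow N)
  calc _ = ∫⁻ z₁, ∫⁻ w, windowPair N G z₁ (z₁ - w) := by
        refine lintegral_congr fun z => ?_
        rw [← lintegral_sub_left_eq_self _ z]
    _ = ∫⁻ w, ∫⁻ z₁, windowPair N G z₁ (z₁ - w) := by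
        refine lintegral_lintegral_swap ?_
        have h : Measurable fun p : ℂ × ℂ => (p.1, p.1 - p.2) :=
          measurable_fst.prodMk (measurable_fst.sub measurable_snd)
        exact ((measurable_windowPair N hG).comp h).aemeasurable
    _ = _ := by
        refine lintegral_congr fun w => ?_
        have hm : MeasurableSet {z : ℂ | z ∈ squareWindow N ∧ z - w ∈ squareWindow N} :=
          (measurableSet_squareWindow N).inter
            ((measurable_id.sub_const w) (measurableSet_squareWindow N))
        rw [← volume_squareWindow_inter_sub hN, ← lintegral_indicator_one hm, ← lintegral_const_mul _
          (measurable_one.indicator hm)]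
        refine lintegral_congr fun z => ?_
        rw [windowPair, sub_sub_cancel, mul_comm]
        congr 1
        by_cases h1 : z ∈ squareWindow N <;> by_cases h2 : z - w ∈ squareWindow N <;>
          simp [h1, h2]

lemma pairSum_windowPair {f : EntireFun} (hf : f.1 ≠ 0) (N : ℝ) (G : ℂ → ℝ≥0∞) :
    pairSum f (windowPair N G) = ∑' p : (zeros f ∩ squareWindow N).offDiag, G (p.1.1 - p.1.2) := by
  have hL : pairSum f (windowPair N G)
      = ∑' a : zeros f, ∑' b : zeros f, ({(a : ℂ)}ᶜ : Set ℂ).indicator (windowPair N G a) b := by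
    rw [pairSum, lintegral_zeroMeasure hf]
    exact tsum_congr fun a => lintegral_zeroMeasure hf
  rw [hL, tsum_subtype (zeros f ∩ squareWindow N).offDiag fun p : ℂ × ℂ => G (p.1 - p.2),
    ENNReal.tsum_prod', tsum_subtype (zeros f) fun a => ∑' b : zeros f,
      ({(a : ℂ)}ᶜ : Set ℂ).indicator (windowPair N G a) b]
  refine tsum_congr fun a => ?_
  by_cases ha : a ∈ zeros f
  · rw [Set.indicator_of_mem ha, tsum_subtype (zeros f) (({(a : ℂ)}ᶜ : Set ℂ).indicator
      (windowPair N G a))]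
    refine tsum_congr fun b => ?_
    by_cases hb : b ∈ zeros f <;> by_cases hab : a = b <;> by_cases haw : a ∈ squareWindow N <;>
      by_cases hbw : b ∈ squareWindow N <;>
      simp [Set.indicator, windowPair, Set.mem_offDiag, ha, hb, hab, haw, hbw, eq_comm]
  · rw [Set.indicator_of_notMem ha]
    symm
    refine ENNReal.tsum_eq_zero.2 fun b => ?_
    refine Set.indicator_of_notMem (fun h => ha h.1.1) _

/-- The closed form holds for `0 < v < 1`; evenness in `v` brings negative values there. No
condition on the real part is needed. -/
lemma eisensteinN_eq {N : ℝ} (hN : 0 < N) {x : ℂ} (h0 : x.im ≠ 0) (h1 : |x.im| < N) :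
    eisensteinN N x = kronDiff (x / N) := by
  have him : (x / N).im = x.im / N := Complex.div_ofReal_im _ _
  have ha : |(x / N).im| ∈ Set.Ioo (0 : ℝ) 1 := by
    rw [him, abs_div, abs_of_pos hN]
    exact ⟨div_pos (abs_pos.2 h0) hN, (div_lt_one hN).2 h1⟩
  have habs : eisensteinKronecker (x / N).re (x / N).im Complex.I
      = eisensteinKronecker (x / N).re |(x / N).im| Complex.I := by
    rcases abs_choice (x / N).im with h | h
    · rw [h]
    · rw [h, eisensteinKronecker_neg_right]
  rw [eisensteinN, habs, eisensteinKronecker_eq_kron _ ha, Complex.ofReal_re, kronDiff,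
    min_eq_left ha.2.le]

/-- The density of the expected energy. -/
noncomputable def energyDensity (N : ℝ) (w : ℂ) : ℝ :=
  kronDiff (w / N) * (1 - gafT w) * (N ^ 2 * tent (w / N))

lemma measurable_div_ofReal (N : ℝ) : Measurable fun w : ℂ => w / N := measurable_id.div_const _

lemma integrable_tent_mul_kronDiff_div {N : ℝ} (hN : 0 < N) :
    Integrable fun w : ℂ => tent (w / N) * kronDiff (w / N) := by
  refine (integrable_tent_mul_kronDiff.comp_smul (inv_ne_zero hN.ne')).congr (ae_of_all _ fun w => ?_)
  have e : (N⁻¹ : ℝ) • w = w / N := by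
    rw [Complex.real_smul, Complex.ofReal_inv, div_eq_inv_mul]
  simp only [e]

lemma integral_tent_mul_kronDiff_div {N : ℝ} : ∫ w : ℂ, tent (w / N) * kronDiff (w / N) = 0 := by
  have h := Measure.integral_comp_smul (volume : Measure ℂ) (fun z => tent z * kronDiff z) N⁻¹
  rw [integral_tent_mul_kronDiff, smul_zero] at h
  rw [← h]
  congr 1
  funext w
  have e : (N⁻¹ : ℝ) • w = w / N := by
    rw [Complex.real_smul, Complex.ofReal_inv, div_eq_inv_mul]
  rw [e]

lemma ae_abs_gafT_le : ∀ᵐ w : ℂ, ‖gafT w‖ ≤ 100 := by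
  filter_upwards [Measure.ae_ne volume (0 : ℂ)] with w hw
  refine (abs_gafT_le hw).trans ?_
  have : Real.exp (-(Real.pi / 2) * ‖w‖ ^ 2) ≤ 1 := by
    rw [Real.exp_le_one_iff]
    have := Real.pi_pos
    nlinarith [sq_nonneg ‖w‖, mul_nonneg this.le (sq_nonneg ‖w‖)]
  linarith

lemma integrable_gafT_mul_tent_mul_kronDiff {N : ℝ} (hN : 0 < N) :
    Integrable fun w : ℂ => gafT w * (tent (w / N) * kronDiff (w / N)) :=
  (integrable_tent_mul_kronDiff_div hN).bdd_mul measurable_gafT.aestronglyMeasurable ae_abs_gafT_le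

lemma energyDensity_eq (N : ℝ) : energyDensity N = fun w => N ^ 2 * (tent (w / N) * kronDiff (w / N))
    - N ^ 2 * (gafT w * (tent (w / N) * kronDiff (w / N))) := by
  funext w
  rw [energyDensity]
  ring

lemma integrable_energyDensity {N : ℝ} (hN : 0 < N) : Integrable (energyDensity N) := by
  rw [energyDensity_eq]
  exact ((integrable_tent_mul_kronDiff_div hN).const_mul _).sub
    ((integrable_gafT_mul_tent_mul_kronDiff hN).const_mul _)

/-- The constant part of `1 - T₂` drops out because the Eisenstein function has mean zero. This
removes a contribution of order `N²` to the normalized energy. -/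
lemma integral_energyDensity {N : ℝ} (hN : 0 < N) : ∫ w, energyDensity N w
    = -(N ^ 2 * ∫ w, gafT w * (tent (w / N) * kronDiff (w / N))) := by
  rw [energyDensity_eq, integral_sub ((integrable_tent_mul_kronDiff_div hN).const_mul _)
    ((integrable_gafT_mul_tent_mul_kronDiff hN).const_mul _), integral_const_mul, integral_const_mul,
    integral_tent_mul_kronDiff_div, mul_zero, zero_sub]

lemma lintegral_pairSum_windowPair {Ω : Type*} [MeasurableSpace Ω] {P : Measure Ω}
    [IsProbabilityMeasure P] {ξ : ℕ → Ω → ℂ} (hlaw : ∀ n, HasLaw (ξ n) stdComplexGaussian P)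
    (hind : iIndepFun ξ P) {N : ℝ} (hN : 0 < N) {G : ℂ → ℝ≥0∞} (hG : Measurable G) :
    ∫⁻ ω, pairSum (gafEntire fun n => ξ n ω) (windowPair N G) ∂P
      = ∫⁻ w, G w * ENNReal.ofReal (1 - gafT w) * ENNReal.ofReal (N ^ 2 * tent (w / N)) := by
  have hρ : ∀ z : ℂ, z ≠ 0 → 1 - gafT z = pairIntensity (Real.pi * ‖z‖ ^ 2) := fun z hz => by
    rw [gafT_eq hz, sub_sub_cancel]
  have hρm : Measurable fun w => ENNReal.ofReal (1 - gafT w) :=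
    (measurable_const.sub measurable_gafT).ennreal_ofReal
  rw [lintegral_pairSum_gafZeros hlaw hind hρ (measurable_windowPair N hG)]
  refine Eq.trans ?_ (lintegral_windowPair hN (hG.mul hρm))
  refine lintegral_congr fun z₁ => lintegral_congr fun z₂ => ?_
  simp only [windowPair, mul_assoc]

/-- Pairs of zeros in the window with equal or opposite-side imaginary parts would escape the closed
form. The pair formula, applied to the indicator of three null lines, shows that their expected
number is zero. -/
lemma ae_im_sub_notMem {Ω : Type*} [MeasurableSpace Ω] {P : Measure Ω}
    [IsProbabilityMeasure P] {ξ : ℕ → Ω → ℂ} (hlaw : ∀ n, HasLaw (ξ n) stdComplexGaussian P)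
    (hind : iIndepFun ξ P) {N : ℝ} (hN : 0 < N) :
    ∀ᵐ ω ∂P, ∀ p ∈ (zeros (gafEntire fun n => ξ n ω) ∩ squareWindow N).offDiag,
      (p.1 - p.2).im ≠ 0 ∧ |(p.1 - p.2).im| < N := by
  set Z : Set ℂ := {w | w.im = 0 ∨ w.im = N ∨ w.im = -N} with hZ
  have hc : Continuous fun w : ℂ => w.im := Complex.continuous_im
  have hZm : MeasurableSet Z :=
    ((isClosed_eq hc continuous_const).union ((isClosed_eq hc continuous_const).union
      (isClosed_eq hc continuous_const))).measurableSet
  have hG : Measurable (Z.indicator (1 : ℂ → ℝ≥0∞)) := measurable_one.indicator hZm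
  have h0 : ∫⁻ ω, pairSum (gafEntire fun n => ξ n ω) (windowPair N (Z.indicator 1)) ∂P = 0 := by
    rw [lintegral_pairSum_windowPair hlaw hind hN hG]
    rw [← lintegral_zero (μ := (volume : Measure ℂ))]
    refine lintegral_congr_ae ?_
    filter_upwards [ae_im_ne 0, ae_im_ne N, ae_im_ne (-N)] with w h1 h2 h3
    rw [Set.indicator_of_notMem (by simp [hZ, h1, h2, h3]), zero_mul, zero_mul]
  have hm : AEMeasurable (fun ω => pairSum (gafEntire fun n => ξ n ω)
      (windowPair N (Z.indicator 1))) P :=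
    (measurable_pairSum (measurable_windowPair N hG)).comp_aemeasurable
      (aemeasurable_gafEntire_seq hlaw)
  filter_upwards [(lintegral_eq_zero_iff' hm).1 h0, ae_gafZeros_eq hlaw hind] with ω h1 ⟨_, h2⟩ p hp
  rw [Pi.zero_apply, pairSum_windowPair h2, ENNReal.tsum_eq_zero] at h1
  have h3 : p.1 - p.2 ∉ Z := fun h => by
    have := h1 ⟨p, hp⟩
    rw [Set.indicator_of_mem h] at this
    exact one_ne_zero this
  have ha := hp.1.2.2
  have hb := hp.2.1.2.2
  simp only [Set.mem_preimage, Set.mem_Icc] at ha hb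
  refine ⟨fun h => h3 (Or.inl h), abs_lt.2 ⟨lt_of_le_of_ne ?_ fun h => h3 (Or.inr (Or.inr h.symm)),
    lt_of_le_of_ne ?_ fun h => h3 (Or.inr (Or.inl h))⟩⟩
  · rw [Complex.sub_im]
    linarith
  · rw [Complex.sub_im]
    linarith

/-- The pair formula is for nonnegative functions, so the Eisenstein function is split into its
positive and negative parts. Both expectations are finite because the energy density is integrable,
and this yields integrability of the energy as well. -/
theorem expectation_renormalizedEnergy {Ω : Type*} [MeasurableSpace Ω] {P : Measure Ω}
    [IsProbabilityMeasure P] {ξ : ℕ → Ω → ℂ} (hlaw : ∀ n, HasLaw (ξ n) stdComplexGaussian P)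
    (hind : iIndepFun ξ P) {N : ℝ} (hN : 0 < N) :
    Integrable (fun ω => renormalizedEnergy (gafZeros ξ ω) N) P ∧
    ∫ ω, renormalizedEnergy (gafZeros ξ ω) N ∂P
      = -(1 / (2 * Real.pi)) * (∫ w, gafT w * (tent (w / N) * kronDiff (w / N)))
        + Real.log (N / (2 * Real.pi * (ModularForm.eta Complex.I).re ^ 2)) := by
  have hk : Measurable fun w : ℂ => kronDiff (w / N) :=
    measurable_kronDiff.comp (measurable_div_ofReal N)
  set Gp : ℂ → ℝ≥0∞ := fun w => ENNReal.ofReal (kronDiff (w / N)) with hGp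
  set Gn : ℂ → ℝ≥0∞ := fun w => ENNReal.ofReal (-kronDiff (w / N)) with hGn
  have mp : Measurable Gp := hk.ennreal_ofReal
  have mn : Measurable Gn := hk.neg.ennreal_ofReal
  set Up : Ω → ℝ≥0∞ := fun ω => pairSum (gafEntire fun n => ξ n ω) (windowPair N Gp) with hUp
  set Un : Ω → ℝ≥0∞ := fun ω => pairSum (gafEntire fun n => ξ n ω) (windowPair N Gn) with hUn
  have aUp : AEMeasurable Up P := (measurable_pairSum (measurable_windowPair N mp)).comp_aemeasurable
    (aemeasurable_gafEntire_seq hlaw)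
  have aUn : AEMeasurable Un P := (measurable_pairSum (measurable_windowPair N mn)).comp_aemeasurable
    (aemeasurable_gafEntire_seq hlaw)
  have ip : ∫⁻ ω, Up ω ∂P = ∫⁻ w, ENNReal.ofReal (energyDensity N w) := by
    rw [hUp, lintegral_pairSum_windowPair hlaw hind hN mp]
    refine lintegral_congr fun w => ?_
    rw [energyDensity, ENNReal.ofReal_mul' (mul_nonneg (sq_nonneg N) (tent_nonneg _)),
      ENNReal.ofReal_mul' (one_sub_gafT_nonneg w)]
  have iN : ∫⁻ ω, Un ω ∂P = ∫⁻ w, ENNReal.ofReal (-energyDensity N w) := by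
    rw [hUn, lintegral_pairSum_windowPair hlaw hind hN mn]
    refine lintegral_congr fun w => ?_
    rw [energyDensity, ← neg_mul, ← neg_mul,
      ENNReal.ofReal_mul' (mul_nonneg (sq_nonneg N) (tent_nonneg _)),
      ENNReal.ofReal_mul' (one_sub_gafT_nonneg w)]
  have hI := integrable_energyDensity hN
  have fp : ∫⁻ ω, Up ω ∂P ≠ ∞ := ip ▸ hI.lintegral_lt_top.ne
  have fn : ∫⁻ ω, Un ω ∂P ≠ ∞ := iN ▸ hI.neg.lintegral_lt_top.ne
  have hIp := integrable_toReal_of_lintegral_ne_top aUp fp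
  have hIn := integrable_toReal_of_lintegral_ne_top aUn fn
  set c : ℝ := 1 / (2 * Real.pi * N ^ 2) with hc
  set L : ℝ := Real.log (N / (2 * Real.pi * (ModularForm.eta Complex.I).re ^ 2)) with hL
  have heq : (fun ω => renormalizedEnergy (gafZeros ξ ω) N)
      =ᵐ[P] fun ω => c * ((Up ω).toReal - (Un ω).toReal) + L := by
    filter_upwards [ae_gafZeros_eq hlaw hind, ae_im_sub_notMem hlaw hind hN] with ω ⟨h1, h2⟩ h3
    rw [renormalizedEnergy, h1]
    set S := (zeros (gafEntire fun n => ξ n ω) ∩ squareWindow N).offDiag with hS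
    -- Almost surely the window holds finitely many zeros, so the sum defining the energy is a true
    -- finite sum.
    have hfin : S.Finite := (finite_zeros_inter h2 (isCompact_squareWindow N)).offDiag
    have : Fintype S := hfin.fintype
    have hsum : ∑' p : S, eisensteinN N (p.1.1 - p.1.2) = (Up ω).toReal - (Un ω).toReal := by
      rw [hUp, hUn]
      dsimp only
      rw [pairSum_windowPair h2, pairSum_windowPair h2,
        ENNReal.tsum_toReal_eq fun _ => ENNReal.ofReal_ne_top,
        ENNReal.tsum_toReal_eq fun _ => ENNReal.ofReal_ne_top, tsum_fintype, tsum_fintype,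
        tsum_fintype, ← Finset.sum_sub_distrib]
      refine Finset.sum_congr rfl fun p _ => ?_
      obtain ⟨h4, h5⟩ := h3 p.1 p.2
      rw [eisensteinN_eq hN h4 h5, ENNReal.toReal_ofReal', ENNReal.toReal_ofReal']
      exact (max_zero_sub_max_neg_zero_eq_self _).symm
    rw [hsum]
  have hdiff : Integrable (fun ω => c * ((Up ω).toReal - (Un ω).toReal)) P :=
    (hIp.sub hIn).const_mul c
  have hint : Integrable (fun ω => c * ((Up ω).toReal - (Un ω).toReal) + L) P :=
    hdiff.add (integrable_const L)
  refine ⟨hint.congr heq.symm, ?_⟩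
  rw [integral_congr_ae heq, integral_add hdiff (integrable_const L),
    integral_const_mul, integral_sub hIp hIn, integral_toReal aUp (ae_lt_top' aUp fp),
    integral_toReal aUn (ae_lt_top' aUn fn), ip, iN,
    ← integral_eq_lintegral_pos_part_sub_lintegral_neg_part hI, integral_energyDensity hN,
    integral_const, probReal_univ, one_smul, hc]
  congr 1
  have := Real.pi_ne_zero
  field_simp

/-! ## The limit of the expected energy -/

/-- The constant `2πη(i)²`. -/
noncomputable def etaConst : ℝ := 2 * Real.pi * (ModularForm.eta Complex.I).re ^ 2

lemma etaConst_pos : 0 < etaConst := by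
  have := Real.pi_pos
  rw [etaConst, eta_I, Complex.ofReal_re]
  positivity

lemma tendsto_div_atTop (w : ℂ) : Tendsto (fun N : ℝ => w / N) atTop (𝓝 0) := by
  have h := (Complex.continuous_ofReal.tendsto 0).comp (tendsto_inv_atTop_zero (𝕜 := ℝ))
  have h2 := h.const_mul w
  rw [Complex.ofReal_zero, mul_zero] at h2
  refine h2.congr fun N => ?_
  simp [div_eq_mul_inv]

/-- The integrand of the expected energy with the logarithmic singularity split off. -/
lemma energy_integrand_eq {N : ℝ} (hN : 0 < N) {w : ℂ} (hw : w ≠ 0) :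
    -(1 / (2 * Real.pi)) * (tent (w / N) * kronDiff (w / N)) + Real.log (N / etaConst)
      = -(1 / (2 * Real.pi)) * (tent (w / N) * (kronDiff (w / N) + 2 * Real.pi * Real.log ‖w / N‖))
        + tent (w / N) * Real.log ‖w‖ + (1 - tent (w / N)) * Real.log N - Real.log etaConst := by
  have hpi := Real.pi_ne_zero
  have hn : ‖w / N‖ = ‖w‖ / N := by
    rw [norm_div, Complex.norm_real, Real.norm_eq_abs, abs_of_pos hN]
  rw [hn, Real.log_div (norm_ne_zero_iff.2 hw) hN.ne', Real.log_div hN.ne' etaConst_pos.ne']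
  field_simp
  ring

/-- The loss `1 - tent(w/N) ≤ 2|w|/N` absorbs `log N ≤ N`; the resulting `2|w|` is integrable
against `T₂` by the first moment. -/
lemma abs_one_sub_tent_mul_log_le {N : ℝ} (hN : 1 ≤ N) (w : ℂ) :
    |(1 - tent (w / N)) * Real.log N| ≤ 2 * ‖w‖ := by
  have h0 : 0 < N := by linarith
  have h1 := one_sub_tent_le (w / N)
  have h2 := Real.log_le_self h0.le
  have h3 := Real.log_nonneg hN
  have h4 := sub_nonneg.2 (tent_le_one (w / N))
  rw [norm_div, Complex.norm_real, Real.norm_eq_abs, abs_of_pos h0] at h1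
  rw [abs_of_nonneg (mul_nonneg h4 h3)]
  calc _ ≤ 2 * (‖w‖ / N) * N := by gcongr
    _ = 2 * ‖w‖ := by field_simp

lemma tendsto_tent_div (w : ℂ) : Tendsto (fun N : ℝ => tent (w / N)) atTop (𝓝 1) := by
  have h := (continuous_tent.tendsto 0).comp (tendsto_div_atTop w)
  have h0 : tent 0 = 1 := by simp [tent, tentR]
  rwa [h0] at h

lemma tendsto_one_sub_tent_mul_log (w : ℂ) :
    Tendsto (fun N : ℝ => (1 - tent (w / N)) * Real.log N) atTop (𝓝 0) := by
  have h : Tendsto (fun N : ℝ => 2 * ‖w‖ * (Real.log N / N)) atTop (𝓝 0) := by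
    have h1 := Real.isLittleO_log_id_atTop.tendsto_div_nhds_zero
    simpa using h1.const_mul (2 * ‖w‖)
  refine squeeze_zero' ?_ ?_ h
  · filter_upwards [eventually_ge_atTop 1] with N hN
    exact mul_nonneg (sub_nonneg.2 (tent_le_one _)) (Real.log_nonneg hN)
  · filter_upwards [eventually_ge_atTop 1] with N hN
    have h0 : 0 < N := by linarith
    have h1 := one_sub_tent_le (w / N)
    rw [norm_div, Complex.norm_real, Real.norm_eq_abs, abs_of_pos h0] at h1
    calc _ ≤ 2 * (‖w‖ / N) * Real.log N := by
          have := Real.log_nonneg hN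
          gcongr
      _ = _ := by ring

lemma tendsto_kronDiff_div {w : ℂ} (hw : w.im ≠ 0) :
    Tendsto (fun N : ℝ => kronDiff (w / N) + 2 * Real.pi * Real.log ‖w / N‖) atTop
      (𝓝 (-(2 * Real.pi * Real.log etaConst))) := by
  refine tendsto_kronDiff_add_log.comp (tendsto_nhdsWithin_iff.2 ⟨tendsto_div_atTop w, ?_⟩)
  filter_upwards [eventually_gt_atTop 0] with N hN
  have : (w / N).im ≠ 0 := by
    rw [Complex.div_ofReal_im]
    exact div_ne_zero hw hN.ne'
  exact this

lemma tendsto_energy_integrand {w : ℂ} (hw : w.im ≠ 0) :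
    Tendsto (fun N : ℝ => -(1 / (2 * Real.pi)) * (tent (w / N) * kronDiff (w / N))
      + Real.log (N / etaConst)) atTop (𝓝 (Real.log ‖w‖)) := by
  have hpi := Real.pi_ne_zero
  have hw0 : w ≠ 0 := fun h => hw (by rw [h, Complex.zero_im])
  have h := (((((tendsto_tent_div w).mul (tendsto_kronDiff_div hw)).const_mul
    (-(1 / (2 * Real.pi)))).add ((tendsto_tent_div w).mul_const (Real.log ‖w‖))).add
    (tendsto_one_sub_tent_mul_log w)).sub_const (Real.log etaConst)
  have e : -(1 / (2 * Real.pi)) * (1 * -(2 * Real.pi * Real.log etaConst)) + 1 * Real.log ‖w‖ + 0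
      - Real.log etaConst = Real.log ‖w‖ := by
    field_simp
    ring
  rw [e] at h
  refine h.congr' ?_
  filter_upwards [eventually_gt_atTop 0] with N hN
  exact (energy_integrand_eq hN hw0).symm

/-- Since `∫ T₂ = 1`, the logarithm becomes part of the integrand, where it cancels the divergence
pointwise; dominated convergence applies. -/
theorem tendsto_expectation_formula :
    Tendsto (fun N : ℝ => -(1 / (2 * Real.pi)) * (∫ w, gafT w * (tent (w / N) * kronDiff (w / N)))
        + Real.log (N / etaConst)) atTop (𝓝 (-(1 / 2) * (1 + Real.log Real.pi))) := by
  have hpi := Real.pi_pos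
  rw [← integral_log_mul_gafT]
  -- One summand for each term of `energy_integrand_eq`: the bounded regular part, `log|w|`, the
  -- boundary effect of the window, and the constant.
  have hbound : Integrable fun w : ℂ => kronBound / (2 * Real.pi) * |gafT w|
      + |Real.log ‖w‖ * gafT w| + 2 * (‖w‖ ^ 1 * |gafT w|) + |Real.log etaConst| * |gafT w| :=
    (((integrable_gafT.abs.const_mul _).add integrable_log_mul_gafT.abs).add
      ((integrable_norm_pow_mul_abs_gafT 1).const_mul 2)).add (integrable_gafT.abs.const_mul _)
  have key : Tendsto (fun N : ℝ => ∫ w, (-(1 / (2 * Real.pi)) * (tent (w / N) * kronDiff (w / N))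
      + Real.log (N / etaConst)) * gafT w) atTop (𝓝 (∫ w : ℂ, Real.log ‖w‖ * gafT w)) := by
    refine tendsto_integral_filter_of_dominated_convergence _ ?_ ?_ hbound ?_
    · refine Eventually.of_forall fun N => ?_
      have h1 : Measurable fun w : ℂ => tent (w / N) * kronDiff (w / N) :=
        (continuous_tent.measurable.mul measurable_kronDiff).comp (measurable_div_ofReal N)
      exact (((h1.const_mul _).add_const _).mul measurable_gafT).aestronglyMeasurable
    · filter_upwards [eventually_ge_atTop 1] with N hN
      have hN0 : 0 < N := by linarith
      filter_upwards [ae_im_ne 0] with w hw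
      have hw0 : w ≠ 0 := fun h => hw (by rw [h, Complex.zero_im])
      have him : (w / N).im ≠ 0 := by
        rw [Complex.div_ofReal_im]
        exact div_ne_zero hw hN0.ne'
      rw [energy_integrand_eq hN0 hw0, norm_mul, Real.norm_eq_abs, Real.norm_eq_abs]
      set A := tent (w / N) * (kronDiff (w / N) + 2 * Real.pi * Real.log ‖w / N‖)
      have b1 : |-(1 / (2 * Real.pi)) * A| ≤ kronBound / (2 * Real.pi) := by
        rw [abs_mul, abs_neg, abs_of_pos (by positivity : 0 < 1 / (2 * Real.pi)), div_mul_eq_mul_div,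
          one_mul]
        gcongr
        exact abs_tent_mul_kronDiff_add_log_le him
      have b2 : |tent (w / N) * Real.log ‖w‖| ≤ |Real.log ‖w‖| := by
        rw [abs_mul, abs_of_nonneg (tent_nonneg _)]
        exact mul_le_of_le_one_left (abs_nonneg _) (tent_le_one _)
      have b3 := abs_one_sub_tent_mul_log_le hN w
      have b4 := abs_sub (-(1 / (2 * Real.pi)) * A + tent (w / N) * Real.log ‖w‖
        + (1 - tent (w / N)) * Real.log N) (Real.log etaConst)
      have b5 := abs_add_three (-(1 / (2 * Real.pi)) * A) (tent (w / N) * Real.log ‖w‖)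
        ((1 - tent (w / N)) * Real.log N)
      calc _ ≤ (kronBound / (2 * Real.pi) + |Real.log ‖w‖| + 2 * ‖w‖ + |Real.log etaConst|)
            * |gafT w| := by
            gcongr
            linarith
        _ = _ := by
            rw [abs_mul, pow_one]
            ring
    · filter_upwards [ae_im_ne 0] with w hw
      exact (tendsto_energy_integrand hw).mul_const _
  refine key.congr' ?_
  filter_upwards [eventually_gt_atTop 0] with N hN
  have hI := integrable_gafT_mul_tent_mul_kronDiff hN
  have e : ∀ w : ℂ, (-(1 / (2 * Real.pi)) * (tent (w / N) * kronDiff (w / N))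
      + Real.log (N / etaConst)) * gafT w
      = -(1 / (2 * Real.pi)) * (gafT w * (tent (w / N) * kronDiff (w / N)))
        + Real.log (N / etaConst) * gafT w := fun w => by ring
  simp_rw [e]
  rw [integral_add (hI.const_mul _) (integrable_gafT.const_mul _), integral_const_mul,
    integral_const_mul, integral_gafT, mul_one]

theorem mainTheorem8 {Ω : Type*} [MeasurableSpace Ω] (P : Measure Ω) [IsProbabilityMeasure P]
    (ξ : ℕ → Ω → ℂ) (hlaw : ∀ n, HasLaw (ξ n) stdComplexGaussian P) (hind : iIndepFun ξ P) :
    -- the series converges everywhere and has only simple zeros, almost surely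
    (∀ᵐ ω ∂P, (∀ z : ℂ, Summable fun n : ℕ => ξ n ω / (Real.sqrt (n ! : ℝ) : ℂ) * z ^ n) ∧
      ∀ z : ℂ, gaf ξ ω z = 0 → deriv (gaf ξ ω) z ≠ 0) ∧
    -- the zeros form a translation invariant point process with `ρ₁ = 1`, `ρ₂ = 1 - T₂(x - y)`
    IsPointProcess P (gafZeros ξ) ∧
    IsTranslationInvariant P (gafZeros ξ) ∧
    HasCorrelationFunction P (gafZeros ξ) 1 (fun _ => 1) ∧
    HasCorrelationFunction P (gafZeros ξ) 2 (fun x => 1 - gafT (x 0 - x 1)) ∧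
    -- the conditions on the cluster function
    (∀ k ∈ ({1, 2, 3} : Set ℕ), Integrable (fun v : ℂ => ‖v‖ ^ k * |gafT v|)) ∧
    Integrable gafT ∧
    ∫ v : ℂ, gafT v = 1 ∧
    (fun N : ℝ => 1 - ∫ v in centeredSquare N, gafT v) =o[atTop] (fun N : ℝ => (Real.log N)⁻¹) ∧
    Integrable (fun v : ℂ => Real.log ‖v‖ * gafT v) ∧
    -- the limit of the expected renormalized energy
    (∀ N : ℝ, 0 < N → Integrable (fun ω => renormalizedEnergy (gafZeros ξ ω) N) P) ∧
    Tendsto (fun N : ℝ => ∫ ω, renormalizedEnergy (gafZeros ξ ω) N ∂P) atTop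
      (𝓝 (-(1 / 2) * (1 + Real.log Real.pi))) := by
  have hρ : ∀ z : ℂ, z ≠ 0 → 1 - gafT z = pairIntensity (Real.pi * ‖z‖ ^ 2) := fun z hz => by
    rw [gafT_eq hz, sub_sub_cancel]
  refine ⟨ae_summable_and_simple hlaw hind, isPointProcess_gafZeros hlaw hind,
    isTranslationInvariant_gafZeros hlaw hind, hasCorrelationFunction_one hlaw hind,
    hasCorrelationFunction_two hlaw hind (ρ := fun z => 1 - gafT z)
      (measurable_const.sub measurable_gafT) one_sub_gafT_nonneg hρ,
    fun k _ => integrable_norm_pow_mul_abs_gafT k, integrable_gafT, integral_gafT,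
    one_sub_integral_gafT_isLittleO, integrable_log_mul_gafT,
    fun N hN => (expectation_renormalizedEnergy hlaw hind hN).1, ?_⟩
  refine tendsto_expectation_formula.congr' ?_
  filter_upwards [eventually_gt_atTop 0] with N hN
  exact (expectation_renormalizedEnergy hlaw hind hN).2.symm
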